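/- **Setting.** Let $\pi_{XY}:Y\to X$ be a fibration of smooth manifolds (possibly with boundary, $\partial Y=\pi_{XY}^{-1}(\partial X)$), $\dim X=n+1\ge 1$, $\dim Y=n+1+m$, and let $\eta$ be a volume form on $X$. A form is *semibasic* if it is annihilated by every $\pi_{XY}$-vertical vector. Let $Z=J^1\pi$ be the first jet bundle, whose points over $y\in Y$ are the linear sections $A:T_{\pi_{XY}(y)}X\to T_yY$ of $T_y\pi_{XY}$, with coordinates $(x^\mu,y^i,v^i_\mu)$. Let $\Lambda^{n+1}_rY$ be the bundle of $(n+1)$-forms on $Y$ annihilated by any $r$ vertical vectors, let $Z^*=(J^1\pi)^*=\Lambda^{n+1}_2Y/\Lambda^{n+1}_1Y$ with projection $\mu:\Lambda^{n+1}_2Y\to Z^*$, and let $\Theta$ be the Liouville $(n+1)$-form of $\Lambda^{n+1}_2Y$. Let $L:Z\to\mathbb R$ be a smooth Lagrangian, with Poincaré–Cartan form $$\Theta_L=L\,\eta+\frac{\partial L}{\partial v^i_\mu}\,(dy^i-v^i_\nu dx^\nu)\wedge d^nx_\mu,\qquad d^nx_\mu=\iota_{\partial/\partial x^\mu}\eta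 .$$ Let $Leg_L:Z\to\Lambda^{n+1}_2Y$ be the Legendre transformation, $Leg_L(z)(T\pi_{YZ}v_0,\dots,T\pi_{YZ}v_n)=(\Theta_L)_z(v_0,\dots,v_n)$, and $leg_L=\mu\circ Leg_L:Z\to Z^*$ the Legendre map. Assume that $L$ is hyperregular, i.e. $leg_L$ is a diffeomorphism; put $h=Leg_L\circ leg_L^{-1}$ and $\Theta_h=h^*\Theta$. Let $B$ be an embedded submanifold of $Z$ contained in $\partial Z=\pi_{XZ}^{-1}(\partial X)$, and $\Pi$ an $n$-form on $B$ with $i_B^*\Theta_L=d\Pi$; let $B^*=leg_L(B)$ and let $\Pi^*$ be the $n$-form on $B^*$ with $(leg_L|_B)^*\Pi^*=\Pi$. (For $n=0$, an exact $0$-form is a form that vanishes.) **Definitions.** * A vector field $\xi$ on $Z$ is a *Cartan symmetry for the De Donder equations* if $\pounds_\xi\Theta_L=d\alpha$ for some $n$-form $\alpha$ on $Z$ that is exact on $B$, $\xi$ is tangent to $B$ and $\pounds_{\xi|_B}\Pi=0$. A vector field on $Z^*$ is a *Cartan symmetry for the Hamilton equations* if the same holds with $(Z^*,\Theta_h,B^*,\Pi^*)$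 in place of $(Z,\Theta_L,B,\Pi)$. * For a vector field $\xi_Y$ on $Y$, its *prolongation* $\xi_Y^{(1)}$ is the vector field on $Z$ that projects onto $\xi_Y$ and preserves the contact forms. For a semibasic $n$-form $\alpha$ on $Y$, an *$\alpha$-lift* of $\xi_Y$ is a vector field on $\Lambda^{n+1}_2Y$ that projects onto $\xi_Y$ and along which the Lie derivative of $\Theta$ is $d\alpha$ (pulled back). * $\xi_Y$ is a *Noether symmetry for the De Donder equations with form $\alpha$*, where $\alpha$ is a semibasic $n$-form on $Y$, if the pullback of $\alpha$ to $B$ is exact, $\pounds_{\xi_Y^{(1)}}\Theta_L=d\alpha$ (with $\alpha$ pulled back to $Z$), $\xi_Y^{(1)}$ is tangent to $B$ and $\pounds_{\xi_Y^{(1)}|_B}\Pi=0$. * $\xi_Y$ is a *Noether symmetry for the Hamilton equations with form $\alpha$*, where $\alpha$ is a semibasic $n$-form on $Y$, if the pullback of $\alpha$ to $B^*$ is exact, $\xi_Y$ has an $\alpha$-lift and it is $\mu$-projectable onto a vector field $\xi_Y^{(1*)}$ on $Z^*$, $\pounds_{\xi_Y^{(1*)}}\Theta_h=d\alpha$ (pulled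 back to $Z^*$), $\xi_Y^{(1*)}$ is tangent to $B^*$ and $\pounds_{\xi_Y^{(1*)}|_{B^*}}\Pi^*=0$. **Statement.** 1. A vector field $\xi_Z$ on $Z$ is a Cartan symmetry for the De Donder equations if and only if $T leg_L(\xi_Z)$ is a Cartan symmetry for the Hamilton equations; hence $\xi_Z\mapsto Tleg_L(\xi_Z)$ is a bijection between the two sets of Cartan symmetries. 2. If $\xi_Y$ is a Noether symmetry for the De Donder equations with form $\alpha$, then $\xi_Y$ has exactly one $\alpha$-lift; along $Leg_L$ it is $TLeg_L(\xi_Y^{(1)})$, and it projects by $\mu$ onto $Tleg_L(\xi_Y^{(1)})$. 3. A vector field $\xi_Y$ on $Y$ is a Noether symmetry for the De Donder equations with form $\alpha$ if and only if it is a Noether symmetry for the Hamilton equations with form $\alpha$. In particular the Noether symmetries of the two kinds are the same vector fields on $Y$. -/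

import Mathlib

open Set Filter Topology Manifold ContDiff

noncomputable section

namespace FieldTheory

/-- Local trivialisations, over charts of `Y`, of a family of sets `fib y`, with values in a normed
space `V`, whose transition functions are smooth. They make the total space a manifold. -/
structure FibreAtlas {E H : Type*} [NormedAddCommGroup E] [NormedSpace ℝ E] [TopologicalSpace H]
    (I : ModelWithCorners ℝ E H) {Y : Type*} [TopologicalSpace Y] [ChartedSpace H Y]
    (V : Type*) [NormedAddCommGroup V] [NormedSpace ℝ V] (fib : Y → Type*) (ι : Type*) where
  chart : ι → OpenPartialHomeomorph Y H
  chart_mem : ∀ i, chart i ∈ IsManifold.maximalAtlas I ∞ Y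
  index : Y → ι
  mem_index : ∀ y, y ∈ (chart (index y)).source
  triv : ι → ∀ y, fib y → V
  trivSymm : ι → ∀ y, V → fib y
  left_inv : ∀ i y, y ∈ (chart i).source → ∀ a, trivSymm i y (triv i y a) = a
  right_inv : ∀ i y, y ∈ (chart i).source → ∀ v, triv i y (trivSymm i y v) = v
  smooth : ∀ i j, ContDiffOn ℝ ∞
    (fun p : E × V => triv j ((chart i).symm (I.symm p.1))
      (trivSymm i ((chart i).symm (I.symm p.1)) p.2))
    ((I.extendCoordChange (chart i) (chart j)).source ×ˢ univ)

namespace FibreAtlas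

variable {E H : Type*} [NormedAddCommGroup E] [NormedSpace ℝ E] [TopologicalSpace H]
    {I : ModelWithCorners ℝ E H} {Y : Type*} [TopologicalSpace Y] [ChartedSpace H Y]
    {V : Type*} [NormedAddCommGroup V] [NormedSpace ℝ V] {fib : Y → Type*} {ι : Type*}
    (A : FibreAtlas I V fib ι)

/-- The chart of the total space induced by a chart of the base and the trivialisation over it. -/
def totalChart (i : ι) : PartialEquiv (Bundle.TotalSpace V fib) (ModelProd H V) where
  toFun z := (A.chart i z.proj, A.triv i z.proj z.snd)
  invFun p := ⟨(A.chart i).symm p.1, A.trivSymm i _ p.2⟩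
  source := {z | z.proj ∈ (A.chart i).source}
  target := {p | p.1 ∈ (A.chart i).target}
  map_source' z hz := (A.chart i).map_source hz
  map_target' p hp := (A.chart i).map_target hp
  left_inv' := by
    rintro ⟨y, a⟩ hz
    have hz' : y ∈ (A.chart i).source := hz
    have h1 := (A.chart i).left_inv hz'
    have h2 : ∀ y', y' = y → (⟨y', A.trivSymm i y' (A.triv i y a)⟩ : Bundle.TotalSpace V fib)
        = ⟨y, a⟩ := by
      rintro y' rfl
      rw [A.left_inv i _ hz']
    exact h2 _ h1
  right_inv' := by
    rintro ⟨h, v⟩ hp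
    have hp' : h ∈ (A.chart i).target := hp
    exact Prod.ext ((A.chart i).right_inv hp') (A.right_inv i _ ((A.chart i).map_target hp') v)

lemma trans_source (i j : ι) : ((A.totalChart i).symm.trans (A.totalChart j)).source =
    {p | p.1 ∈ ((A.chart i).symm.trans (A.chart j)).source} := by
  ext p
  simp [totalChart, PartialEquiv.trans_source]

lemma contDiffOn_trans (i j : ι) :
    ContDiffOn ℝ ∞ ((I.prod 𝓘(ℝ, V)) ∘ ((A.totalChart i).symm.trans (A.totalChart j)) ∘
      (I.prod 𝓘(ℝ, V)).symm)
      ((I.prod 𝓘(ℝ, V)).symm ⁻¹' ((A.totalChart i).symm.trans (A.totalChart j)).source ∩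
        range (I.prod 𝓘(ℝ, V))) := by
  have hs : ((I.prod 𝓘(ℝ, V)).symm ⁻¹' ((A.totalChart i).symm.trans (A.totalChart j)).source ∩
        range (I.prod 𝓘(ℝ, V))) =
      ((I.extendCoordChange (A.chart i) (A.chart j)).source ×ˢ univ) := by
    rw [trans_source, I.extendCoordChange_source, I.image_eq]
    ext ⟨e, v⟩
    have hr : (e, v) ∈ range (I.prod 𝓘(ℝ, V)) ↔ e ∈ range I := by
      rw [modelWithCorners_prod_coe, range_prodMap]
      simp
    simp only [mem_inter_iff, hr, mem_prod, mem_univ, and_true]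
    rfl
  rw [hs]
  have h1 := I.contDiffOn_extendCoordChange (A.chart_mem i) (A.chart_mem j)
  exact (h1.comp contDiff_fst.contDiffOn (fun p hp => hp.1)).prodMk (A.smooth i j)

def core : ChartedSpaceCore (ModelProd H V) (Bundle.TotalSpace V fib) where
  atlas := range A.totalChart
  chartAt z := A.totalChart (A.index z.proj)
  mem_chart_source z := A.mem_index z.proj
  chart_mem_atlas z := mem_range_self _
  open_source := by
    rintro _ _ ⟨i, rfl⟩ ⟨j, rfl⟩
    rw [trans_source]
    exact ((A.chart i).symm.trans (A.chart j)).open_source.preimage continuous_fst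
  continuousOn_toFun := by
    rintro _ _ ⟨i, rfl⟩ ⟨j, rfl⟩
    have h := (A.contDiffOn_trans i j).continuousOn
    have h2 : ContinuousOn ((I.prod 𝓘(ℝ, V)).symm ∘ (((I.prod 𝓘(ℝ, V)) ∘
        ((A.totalChart i).symm.trans (A.totalChart j)) ∘
        (I.prod 𝓘(ℝ, V)).symm) ∘ (I.prod 𝓘(ℝ, V))))
        ((A.totalChart i).symm.trans (A.totalChart j)).source := by
      refine (I.prod 𝓘(ℝ, V)).continuous_symm.comp_continuousOn
        (h.comp (I.prod 𝓘(ℝ, V)).continuous.continuousOn ?_)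
      intro p hp
      refine ⟨?_, mem_range_self _⟩
      simpa only [mem_preimage, ModelWithCorners.left_inv] using hp
    refine h2.congr ?_
    intro p hp
    simp only [Function.comp_apply, ModelWithCorners.left_inv]

@[reducible] def topology : TopologicalSpace (Bundle.TotalSpace V fib) :=
  A.core.toTopologicalSpace

@[reducible] def charted : @ChartedSpace (ModelProd H V) _ (Bundle.TotalSpace V fib) A.topology :=
  A.core.toChartedSpace

lemma isManifold : @IsManifold ℝ _ _ _ _ _ _ (I.prod 𝓘(ℝ, V)) ∞ (Bundle.TotalSpace V fib)
    A.topology A.charted := by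
  let _ := A.topology
  let _ := A.charted
  refine isManifold_of_contDiffOn _ _ _ ?_
  rintro e e' he he'
  obtain ⟨_, ⟨_, rfl⟩, _, ⟨⟨i, rfl⟩, rfl⟩, rfl⟩ := he
  obtain ⟨_, ⟨_, rfl⟩, _, ⟨⟨j, rfl⟩, rfl⟩, rfl⟩ := he'
  exact A.contDiffOn_trans i j

end FibreAtlas

section Fibred

variable {EX HX F : Type*} [NormedAddCommGroup EX] [NormedSpace ℝ EX] [TopologicalSpace HX]
  [NormedAddCommGroup F] [NormedSpace ℝ F] (IX : ModelWithCorners ℝ EX HX)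
  {X Y : Type*} [TopologicalSpace X] [ChartedSpace HX X]
  [TopologicalSpace Y] [ChartedSpace (ModelProd HX F) Y] (p : Y → X)

/-- A pair of charts of `Y` and `X` in which `p` is the projection onto the first factor. -/
structure FibredChart where
  chart : OpenPartialHomeomorph Y (ModelProd HX F)
  base : OpenPartialHomeomorph X HX
  chart_mem : chart ∈ IsManifold.maximalAtlas (IX.prod 𝓘(ℝ, F)) ∞ Y
  base_mem : base ∈ IsManifold.maximalAtlas IX ∞ X
  maps : ∀ y ∈ chart.source, p y ∈ base.source
  fibred : ∀ y ∈ chart.source, (chart y).1 = base (p y)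

variable (F) in
/-- `p` is a fibration: a smooth surjective map which has a fibred chart around every point
(so it is a submersion, and the boundary of `Y` lies over the boundary of `X`). -/
class IsFibred : Prop where
  contMDiff : ContMDiff (IX.prod 𝓘(ℝ, F)) IX ∞ p
  surjective : Function.Surjective p
  exists_chart : ∀ y : Y, ∃ c : FibredChart (F := F) IX p, y ∈ c.chart.source


end Fibred

section ChartDerivative

variable {E H M : Type*} [NormedAddCommGroup E] [NormedSpace ℝ E] [TopologicalSpace H]
  {I : ModelWithCorners ℝ E H} [TopologicalSpace M] [ChartedSpace H M]
  {e e' : OpenPartialHomeomorph M H}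

variable (I e) in
/-- The derivative of a chart, as a linear map from the tangent space to the model space. -/
def dChart (x : M) : TangentSpace I x →L[ℝ] E := mfderiv I 𝓘(ℝ, E) (e.extend I) x

lemma hasMFDerivAt_extend (he : e ∈ IsManifold.maximalAtlas I ∞ M) {x : M} (hx : x ∈ e.source) :
    HasMFDerivAt I 𝓘(ℝ, E) (e.extend I) x (mfderiv I I e x : TangentSpace I x →L[ℝ] E) := by
  have h1 : MDifferentiableAt I I e x :=
    (contMDiffAt_of_mem_maximalAtlas he hx).mdifferentiableAt (by simp)
  exact I.hasMFDerivAt.comp x h1.hasMFDerivAt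

lemma isInvertible_dChart (he : e ∈ IsManifold.maximalAtlas I ∞ M) {x : M} (hx : x ∈ e.source) :
    (dChart I e x).IsInvertible := by
  have h : e.MDifferentiable I I :=
    ⟨fun y hy => ((contMDiffAt_of_mem_maximalAtlas he hy).mdifferentiableAt
        (by simp)).mdifferentiableWithinAt,
      fun y hy => ((contMDiffAt_symm_of_mem_maximalAtlas he hy).mdifferentiableAt
        (by simp)).mdifferentiableWithinAt⟩
  refine ⟨h.mfderiv hx, ?_⟩
  rw [dChart, (hasMFDerivAt_extend he hx).mfderiv]
  rfl

lemma dChart_comp_inverse (he : e ∈ IsManifold.maximalAtlas I ∞ M)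
    (he' : e' ∈ IsManifold.maximalAtlas I ∞ M) {x : M} (hx : x ∈ e.source) (hx' : x ∈ e'.source) :
    dChart I e' x ∘L (dChart I e x).inverse =
      fderivWithin ℝ (I.extendCoordChange e e') (I.extendCoordChange e e').source
        (e.extend I x) := by
  set g := I.extendCoordChange e e' with hg
  have hmem : ∀ y, y ∈ e.source → y ∈ e'.source → e.extend I y ∈ g.source := by
    intro y hy hy'
    rw [hg, I.extendCoordChange_source]
    refine ⟨e y, ?_, rfl⟩
    simp [hy, hy']
  have hgd : HasFDerivWithinAt g (fderivWithin ℝ g g.source (e.extend I x)) g.source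
      (e.extend I x) :=
    (((I.contDiffOn_extendCoordChange he he') _ (hmem x hx hx')).differentiableWithinAt
      (by simp)).hasFDerivWithinAt
  have h1 := (hasMFDerivAt_extend he hx).mdifferentiableAt.hasMFDerivAt
  have h2 := (hasMFDerivAt_extend he' hx').mdifferentiableAt.hasMFDerivAt
  have hs : e.source ∩ e'.source ∈ 𝓝 x :=
    (e.open_source.inter e'.open_source).mem_nhds ⟨hx, hx'⟩
  have h3 : HasMFDerivWithinAt I 𝓘(ℝ, E) (g ∘ e.extend I) (e.source ∩ e'.source) x
      ((fderivWithin ℝ g g.source (e.extend I x)).comp (dChart I e x)) :=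
    (hgd.hasMFDerivWithinAt).comp x h1.hasMFDerivWithinAt (fun y hy => hmem y hy.1 hy.2)
  have h4 := h3.hasMFDerivAt hs
  have h5 : (g ∘ e.extend I) =ᶠ[𝓝 x] e'.extend I := by
    filter_upwards [hs] with y hy
    simp [hg, ModelWithCorners.extendCoordChange, hy.1]
  have h6 := hasMFDerivAt_unique (h4.congr_of_eventuallyEq h5.symm) h2
  change mfderiv I 𝓘(ℝ, E) (e'.extend I) x ∘L _ = _
  rw [← h6]
  obtain ⟨D, hD⟩ := isInvertible_dChart he hx
  rw [← hD, ContinuousLinearMap.inverse_equiv]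
  ext v
  change _ = (fderivWithin ℝ g g.source (e.extend I x)) v
  change (fderivWithin ℝ g g.source (e.extend I x)) (D (D.symm v)) = _
  rw [D.apply_symm_apply]

lemma contDiffOn_fderivWithin_coordChange (he : e ∈ IsManifold.maximalAtlas I ∞ M)
    (he' : e' ∈ IsManifold.maximalAtlas I ∞ M) :
    ContDiffOn ℝ ∞ (fderivWithin ℝ (I.extendCoordChange e e') (I.extendCoordChange e e').source)
      (I.extendCoordChange e e').source :=
  (I.contDiffOn_extendCoordChange he he').fderivWithin
    (I.uniqueDiffOn_extendCoordChange_source) (by simp)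

end ChartDerivative

section Horizontal

variable {E E' B B' : Type*} [AddCommGroup E] [Module ℝ E] [TopologicalSpace E]
  [IsTopologicalAddGroup E] [ContinuousConstSMul ℝ E] [AddCommGroup E'] [Module ℝ E'] [TopologicalSpace E']
  [IsTopologicalAddGroup E'] [ContinuousConstSMul ℝ E'] [AddCommGroup B] [Module ℝ B]
  [TopologicalSpace B] [AddCommGroup B'] [Module ℝ B'] [TopologicalSpace B']
  {N : Type*} [NormedAddCommGroup N] [NormedSpace ℝ N]

variable (N) in
/-- The alternating `k`-forms which vanish if `r` of their arguments are in the kernel of `q`. -/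
def horizForms (q : E →L[ℝ] B) (k r : ℕ) : Submodule ℝ (E [⋀^Fin k]→L[ℝ] N) where
  carrier := {w | ∀ (u : Fin k → E) (s : Finset (Fin k)), s.card = r → (∀ i ∈ s, q (u i) = 0) →
    w u = 0}
  add_mem' := by
    intro a b ha hb u s hs hu
    simp [ha u s hs hu, hb u s hs hu]
  zero_mem' := by
    intro u s _ _
    rfl
  smul_mem' := by
    intro c a ha u s hs hu
    simp [ha u s hs hu]

/-- Pullback by a linear map that maps vertical vectors to vertical vectors. -/
def pullHoriz {q : E →L[ℝ] B} {q' : E' →L[ℝ] B'} (T : E →L[ℝ] E')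
    (hT : ∀ v, q v = 0 → q' (T v) = 0) (k r : ℕ) :
    horizForms N q' k r →ₗ[ℝ] horizForms N q k r where
  toFun w := ⟨w.1.compContinuousLinearMap T, fun u s hs hu =>
    w.2 (T ∘ u) s hs (fun i hi => hT _ (hu i hi))⟩
  map_add' _ _ := rfl
  map_smul' _ _ := rfl

variable (N) in
/-- The forms annihilated by two vertical vectors modulo those annihilated by one. -/
abbrev horizQuot (q : E →L[ℝ] B) (k : ℕ) : Type _ :=
  horizForms N q k 2 ⧸ (horizForms N q k 1).submoduleOf (horizForms N q k 2)

/-- The map induced on the quotients by `pullHoriz`. -/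
def pullQuot {q : E →L[ℝ] B} {q' : E' →L[ℝ] B'} (T : E →L[ℝ] E')
    (hT : ∀ v, q v = 0 → q' (T v) = 0) (k : ℕ) :
    horizQuot N q' k →ₗ[ℝ] horizQuot N q k :=
  Submodule.mapQ _ _ (pullHoriz T hT k 2) (fun w hw => (pullHoriz T hT k 1 ⟨w.1, hw⟩).2)

end Horizontal

section HorizontalSmooth

variable {E B : Type*} [NormedAddCommGroup E] [NormedSpace ℝ E] [FiniteDimensional ℝ E]
  [NormedAddCommGroup B] [NormedSpace ℝ B]
  (N : Type*) [NormedAddCommGroup N] [NormedSpace ℝ N] [FiniteDimensional ℝ N] (q : E →L[ℝ] B) (k : ℕ)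

instance finiteDimensional_forms : FiniteDimensional ℝ (E [⋀^Fin k]→L[ℝ] N) := by
  let f : (E [⋀^Fin k]→L[ℝ] N) →ₗ[ℝ] MultilinearMap ℝ (fun _ : Fin k => E) N :=
    { toFun := fun w => w.toMultilinearMap
      map_add' := fun _ _ => rfl
      map_smul' := fun _ _ => rfl }
  refine FiniteDimensional.of_injective f ?_
  intro a b h
  ext v
  exact congrArg (fun g : MultilinearMap ℝ (fun _ : Fin k => E) N => g v) h

lemma contDiff_compContinuousLinearMap : ContDiff ℝ ∞
    (fun x : (E →L[ℝ] E) × (E [⋀^Fin k]→L[ℝ] N) => x.2.compContinuousLinearMap x.1) := by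
  have h1 : ContDiff ℝ ∞ (fun x : (E →L[ℝ] E) × (E [⋀^Fin k]→L[ℝ] N) =>
      (ContinuousMultilinearMap.compContinuousLinearMapContinuousMultilinear ℝ
        (fun _ : Fin k => E) (fun _ : Fin k => E) N (fun _ => x.1))
        x.2.toContinuousMultilinearMap) := by
    refine ContDiff.clm_apply ?_ ?_
    · exact (ContinuousMultilinearMap.contDiff _).comp
        (contDiff_pi.2 fun _ => contDiff_fst)
    · exact (ContinuousAlternatingMap.toContinuousMultilinearMapLI
        (𝕜 := ℝ) (E := E) (F := N) (ι := Fin k)).contDiff.comp contDiff_snd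
  let L := (ContinuousAlternatingMap.toContinuousMultilinearMapLI
        (𝕜 := ℝ) (E := E) (F := N) (ι := Fin k))
  obtain ⟨P, hP⟩ := Submodule.ClosedComplemented.of_finiteDimensional
    (LinearMap.range L.toLinearMap)
  let g := L.equivRange.symm.toContinuousLinearEquiv.toContinuousLinearMap ∘L P
  have hg : ∀ w, g (L w) = w := by
    intro w
    have h3 : P (L w) = L.equivRange w := hP (L.equivRange w)
    change L.equivRange.symm (P (L w)) = w
    rw [h3, LinearIsometryEquiv.symm_apply_apply]
  have h4 := g.contDiff.comp h1
  have h5 : (fun x : (E →L[ℝ] E) × (E [⋀^Fin k]→L[ℝ] N) => x.2.compContinuousLinearMap x.1) =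
      g ∘ (fun x : (E →L[ℝ] E) × (E [⋀^Fin k]→L[ℝ] N) =>
      (ContinuousMultilinearMap.compContinuousLinearMapContinuousMultilinear ℝ
        (fun _ : Fin k => E) (fun _ : Fin k => E) N (fun _ => x.1))
        x.2.toContinuousMultilinearMap) := funext fun x => (hg _).symm
  rw [h5]
  exact h4

lemma contDiff_subtype_val {W : Type*} [NormedAddCommGroup W] [NormedSpace ℝ W]
    (S : Submodule ℝ W) : ContDiff ℝ ∞ (Subtype.val : S → W) :=
  S.subtypeL.contDiff

lemma exists_contDiff_proj {W : Type*} [NormedAddCommGroup W] [NormedSpace ℝ W]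
    [FiniteDimensional ℝ W] (S : Submodule ℝ W) :
    ∃ P : W → S, ContDiff ℝ ∞ P ∧ ∀ w : S, P w = w := by
  obtain ⟨P, hP⟩ := Submodule.ClosedComplemented.of_finiteDimensional S
  exact ⟨P, P.contDiff, hP⟩

section QuotSpace

variable {W : Type*} [NormedAddCommGroup W] [NormedSpace ℝ W]

/-- The quotient of a normed space by a linear subspace. -/
def QuotSpace (S : Submodule ℝ W) : Type _ := W ⧸ S

variable (S : Submodule ℝ W)

def QuotSpace.mk (w : W) : QuotSpace S := Submodule.Quotient.mk w

variable [FiniteDimensional ℝ W]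

instance : NormedAddCommGroup (QuotSpace S) :=
  haveI : IsClosed (S : Set W) := S.closed_of_finiteDimensional
  inferInstanceAs (NormedAddCommGroup (W ⧸ S))

instance : NormedSpace ℝ (QuotSpace S) :=
  haveI : IsClosed (S : Set W) := S.closed_of_finiteDimensional
  inferInstanceAs (NormedSpace ℝ (W ⧸ S))

lemma QuotSpace.contDiff_mk : ContDiff ℝ ∞ (QuotSpace.mk S) := by
  have : IsClosed (S : Set W) := S.closed_of_finiteDimensional
  exact (S.mkQ.toContinuousLinearMap.contDiff :
    ContDiff ℝ ∞ (Submodule.Quotient.mk : W → W ⧸ S))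

lemma QuotSpace.exists_section :
    ∃ s : QuotSpace S → W, ContDiff ℝ ∞ s ∧ ∀ w, QuotSpace.mk S (s w) = w := by
  have : IsClosed (S : Set W) := S.closed_of_finiteDimensional
  obtain ⟨s, hs⟩ := S.mkQ.exists_rightInverse_of_surjective
    (LinearMap.range_eq_top.2 S.mkQ_surjective)
  exact ⟨s.toContinuousLinearMap, (s.toContinuousLinearMap.contDiff :
    ContDiff ℝ ∞ (s.toContinuousLinearMap : W ⧸ S → W)), fun w => LinearMap.congr_fun hs w⟩

end QuotSpace

def LamSpace : Type _ := horizForms N q k 2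

instance : NormedAddCommGroup (LamSpace N q k) :=
  inferInstanceAs (NormedAddCommGroup (horizForms N q k 2))

instance : NormedSpace ℝ (LamSpace N q k) :=
  inferInstanceAs (NormedSpace ℝ (horizForms N q k 2))

instance : FiniteDimensional ℝ (LamSpace N q k) :=
  inferInstanceAs (FiniteDimensional ℝ (horizForms N q k 2))

instance : Inhabited (LamSpace N q k) := ⟨(0 : horizForms N q k 2)⟩

lemma exists_pull : ∃ f : (E →L[ℝ] E) × LamSpace N q k → LamSpace N q k, ContDiff ℝ ∞ f ∧
    ∀ T : E →L[ℝ] E, ∀ w w' : LamSpace N q k, w'.1 = w.1.compContinuousLinearMap T →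
      f (T, w) = w' := by
  obtain ⟨P, h1, hP⟩ := exists_contDiff_proj (horizForms N q k 2)
  refine ⟨fun x => P (x.2.1.compContinuousLinearMap x.1), ?_, ?_⟩
  · exact h1.comp ((contDiff_compContinuousLinearMap N k).comp
      (contDiff_fst.prodMk ((contDiff_subtype_val (horizForms N q k 2)).comp contDiff_snd)))
  · intro T w w' h
    change P (w.1.compContinuousLinearMap T) = w'
    rw [← h]
    exact hP w'

/-- The forms annihilated by one vertical vector, inside those annihilated by two. -/
def lamSubspace : Submodule ℝ (LamSpace N q k) where
  carrier := {w | w.1 ∈ horizForms N q k 1}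
  add_mem' := fun {_ _} ha hb => (horizForms N q k 1).add_mem ha hb
  zero_mem' := (horizForms N q k 1).zero_mem
  smul_mem' := fun c _ ha => (horizForms N q k 1).smul_mem c ha

def DualSpace : Type _ := QuotSpace (lamSubspace N q k)

instance : NormedAddCommGroup (DualSpace N q k) :=
  inferInstanceAs (NormedAddCommGroup (QuotSpace (lamSubspace N q k)))

instance : NormedSpace ℝ (DualSpace N q k) :=
  inferInstanceAs (NormedSpace ℝ (QuotSpace (lamSubspace N q k)))

/-- The canonical projection onto the quotient. -/
def LamSpace.mk (w : LamSpace N q k) : DualSpace N q k := QuotSpace.mk (lamSubspace N q k) w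

lemma contDiff_mk : ContDiff ℝ ∞ (LamSpace.mk N q k) :=
  QuotSpace.contDiff_mk (lamSubspace N q k)

lemma exists_section : ∃ s : DualSpace N q k → LamSpace N q k, ContDiff ℝ ∞ s ∧
    ∀ w, LamSpace.mk N q k (s w) = w :=
  QuotSpace.exists_section (lamSubspace N q k)

instance : Inhabited (DualSpace N q k) := ⟨LamSpace.mk N q k default⟩

end HorizontalSmooth

section JetAlgebra

variable {T S EX F : Type*} [AddCommGroup T] [Module ℝ T] [TopologicalSpace T]
  [AddCommGroup S] [Module ℝ S] [TopologicalSpace S]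
  [NormedAddCommGroup EX] [NormedSpace ℝ EX] [NormedAddCommGroup F] [NormedSpace ℝ F]

/-- If the image of `B` is the graph of a linear map from `EX` to `F`, this is that linear map. -/
def slope (B : S →L[ℝ] EX × F) : EX →L[ℝ] F :=
  (ContinuousLinearMap.snd ℝ EX F ∘L B) ∘L (ContinuousLinearMap.fst ℝ EX F ∘L B).inverse

variable {D D' : T →L[ℝ] EX × F} {d d' : S →L[ℝ] EX} {q : T →L[ℝ] S}

lemma jet_section (hD : D.IsInvertible) (hd : d.IsInvertible)
    (h : ContinuousLinearMap.fst ℝ EX F ∘L D = d ∘L q) (a : EX →L[ℝ] F) :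
    q ∘L (D.inverse ∘L (((ContinuousLinearMap.id ℝ EX).prod a) ∘L d)) =
      ContinuousLinearMap.id ℝ S := by
  obtain ⟨D, rfl⟩ := hD
  obtain ⟨d, rfl⟩ := hd
  ext v
  apply d.injective
  have h1 := DFunLike.congr_fun h (D.symm (d v, a (d v)))
  simp only [ContinuousLinearMap.comp_apply, ContinuousLinearEquiv.coe_coe,
    ContinuousLinearEquiv.apply_symm_apply, ContinuousLinearMap.coe_fst'] at h1
  simp [← h1]

lemma jet_left_inv (hD : D.IsInvertible) (hd : d.IsInvertible)
    (h : ContinuousLinearMap.fst ℝ EX F ∘L D = d ∘L q) {A : S →L[ℝ] T}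
    (hA : q ∘L A = ContinuousLinearMap.id ℝ S) :
    D.inverse ∘L (((ContinuousLinearMap.id ℝ EX).prod (slope (D ∘L A))) ∘L d) = A := by
  have h2 : ContinuousLinearMap.fst ℝ EX F ∘L (D ∘L A) = d := by
    rw [← ContinuousLinearMap.comp_assoc, h, ContinuousLinearMap.comp_assoc, hA,
      ContinuousLinearMap.comp_id]
  unfold slope
  rw [h2]
  obtain ⟨D, rfl⟩ := hD
  obtain ⟨d, rfl⟩ := hd
  ext v
  apply D.injective
  have h3 := DFunLike.congr_fun h2 v
  simp only [ContinuousLinearMap.comp_apply, ContinuousLinearEquiv.coe_coe,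
    ContinuousLinearMap.coe_fst'] at h3
  simp only [ContinuousLinearMap.inverse_equiv, ContinuousLinearMap.comp_apply,
    ContinuousLinearEquiv.coe_coe, ContinuousLinearEquiv.apply_symm_apply,
    ContinuousLinearMap.prod_apply, ContinuousLinearMap.coe_id', id_eq,
    ContinuousLinearEquiv.symm_apply_apply, ContinuousLinearMap.coe_snd']
  exact Prod.ext h3.symm rfl

lemma jet_transition (hD : D.IsInvertible) (hd : d.IsInvertible) (hd' : d'.IsInvertible)
    (h : ContinuousLinearMap.fst ℝ EX F ∘L D = d ∘L q)
    (h' : ContinuousLinearMap.fst ℝ EX F ∘L D' = d' ∘L q) (a : EX →L[ℝ] F) :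
    (ContinuousLinearMap.fst ℝ EX F ∘L ((D' ∘L D.inverse) ∘L
      ((ContinuousLinearMap.id ℝ EX).prod a))).IsInvertible ∧
    slope (D' ∘L (D.inverse ∘L (((ContinuousLinearMap.id ℝ EX).prod a) ∘L d))) =
      slope ((D' ∘L D.inverse) ∘L ((ContinuousLinearMap.id ℝ EX).prod a)) := by
  have hs := jet_section hD hd h a
  obtain ⟨d, rfl⟩ := hd
  obtain ⟨d', rfl⟩ := hd'
  set G := (D' ∘L D.inverse) ∘L ((ContinuousLinearMap.id ℝ EX).prod a) with hG
  have h1 : ContinuousLinearMap.fst ℝ EX F ∘L (G ∘L (d : S →L[ℝ] EX)) = (d' : S →L[ℝ] EX) := by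
    have : G ∘L (d : S →L[ℝ] EX) =
      D' ∘L (D.inverse ∘L (((ContinuousLinearMap.id ℝ EX).prod a) ∘L d)) := rfl
    rw [this, ← ContinuousLinearMap.comp_assoc, h', ContinuousLinearMap.comp_assoc, hs,
      ContinuousLinearMap.comp_id]
  have h2 : ContinuousLinearMap.fst ℝ EX F ∘L G =
      ((d.symm.trans d' : EX ≃L[ℝ] EX) : EX →L[ℝ] EX) := by
    ext v
    have := DFunLike.congr_fun h1 (d.symm v)
    simpa using this
  refine ⟨⟨_, h2.symm⟩, ?_⟩
  change slope (G ∘L (d : S →L[ℝ] EX)) = slope G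
  unfold slope
  rw [h1, h2, ContinuousLinearMap.inverse_equiv, ContinuousLinearMap.inverse_equiv]
  ext v
  simp

end JetAlgebra

section FibredCharts

variable {EX HX F : Type*} [NormedAddCommGroup EX] [NormedSpace ℝ EX] [TopologicalSpace HX]
  [NormedAddCommGroup F] [NormedSpace ℝ F] {IX : ModelWithCorners ℝ EX HX}
  {X Y : Type*} [TopologicalSpace X] [ChartedSpace HX X] 
  [TopologicalSpace Y] [ChartedSpace (ModelProd HX F) Y]
  {p : Y → X} [hp : IsFibred F IX p]

variable (F IX p) in
/-- The tangent map of the projection. -/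
def tangentProj (y : Y) : TangentSpace (IX.prod 𝓘(ℝ, F)) y →L[ℝ] TangentSpace IX (p y) :=
  mfderiv (IX.prod 𝓘(ℝ, F)) IX p y

variable (c : FibredChart (F := F) IX p)

lemma fst_dChart {y : Y} (hy : y ∈ c.chart.source) :
    ContinuousLinearMap.fst ℝ EX F ∘L dChart (IX.prod 𝓘(ℝ, F)) c.chart y =
      dChart IX c.base (p y) ∘L tangentProj F IX p y := by
  have h1 := (hasMFDerivAt_extend c.chart_mem hy).mdifferentiableAt.hasMFDerivAt
  have h2 := (hasMFDerivAt_extend c.base_mem (c.maps y hy)).mdifferentiableAt.hasMFDerivAt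
  have h3 : HasMFDerivAt (IX.prod 𝓘(ℝ, F)) IX p y (tangentProj F IX p y) :=
    ((hp.contMDiff y).mdifferentiableAt (by simp)).hasMFDerivAt
  have h4 := h2.comp y h3
  have h5 : HasMFDerivAt 𝓘(ℝ, EX × F) 𝓘(ℝ, EX) (Prod.fst : EX × F → EX)
      (c.chart.extend (IX.prod 𝓘(ℝ, F)) y) (ContinuousLinearMap.fst ℝ EX F) :=
    (ContinuousLinearMap.fst ℝ EX F).hasFDerivAt.hasMFDerivAt
  have h6 := h5.comp y h1
  have h7 : (Prod.fst ∘ c.chart.extend (IX.prod 𝓘(ℝ, F))) =ᶠ[𝓝 y] (c.base.extend IX ∘ p) := by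
    filter_upwards [c.chart.open_source.mem_nhds hy] with z hz
    exact congrArg IX (c.fibred z hz)
  exact hasMFDerivAt_unique h6 (h4.congr_of_eventuallyEq h7)

lemma fst_dChart_apply {y : Y} (hy : y ∈ c.chart.source)
    (v : TangentSpace (IX.prod 𝓘(ℝ, F)) y) :
    (dChart (IX.prod 𝓘(ℝ, F)) c.chart y v).1 =
      dChart IX c.base (p y) (tangentProj F IX p y v) :=
  DFunLike.congr_fun (fst_dChart c hy) v

lemma fst_dChart_eq_zero {y : Y} (hy : y ∈ c.chart.source)
    (v : TangentSpace (IX.prod 𝓘(ℝ, F)) y) (hv : tangentProj F IX p y v = 0) :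
    ContinuousLinearMap.fst ℝ EX F (dChart (IX.prod 𝓘(ℝ, F)) c.chart y v) = 0 := by
  have h := fst_dChart_apply c hy v
  rw [hv, map_zero] at h
  exact h

lemma tangentProj_inverse_eq_zero {y : Y} (hy : y ∈ c.chart.source) (v : EX × F)
    (hv : ContinuousLinearMap.fst ℝ EX F v = 0) :
    tangentProj F IX p y ((dChart (IX.prod 𝓘(ℝ, F)) c.chart y).inverse v) = 0 := by
  obtain ⟨d, hd⟩ := isInvertible_dChart c.base_mem (c.maps y hy)
  obtain ⟨D, hD⟩ := isInvertible_dChart c.chart_mem hy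
  have h := fst_dChart_apply c hy ((dChart (IX.prod 𝓘(ℝ, F)) c.chart y).inverse v)
  rw [← hd, ← hD, ContinuousLinearMap.inverse_equiv] at h
  rw [← hD, ContinuousLinearMap.inverse_equiv]
  apply d.injective
  have h2 : ((D : TangentSpace (IX.prod 𝓘(ℝ, F)) y →L[ℝ] EX × F) (D.symm v)) = v :=
    D.apply_symm_apply v
  refine h.symm.trans ?_
  rw [map_zero]
  have h3 := congrArg Prod.fst h2
  exact h3.trans hv

variable (F IX p) in
def fibredIndex (y : Y) : FibredChart (F := F) IX p := (hp.exists_chart y).choose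

lemma mem_fibredIndex (y : Y) : y ∈ (fibredIndex F IX p y).chart.source :=
  (hp.exists_chart y).choose_spec

end FibredCharts

section JetBundle

variable {EX HX F : Type*} [NormedAddCommGroup EX] [NormedSpace ℝ EX] [TopologicalSpace HX]
  [NormedAddCommGroup F] [NormedSpace ℝ F] (IX : ModelWithCorners ℝ EX HX)
  {X Y : Type*} [TopologicalSpace X] [ChartedSpace HX X] 
  [TopologicalSpace Y] [ChartedSpace (ModelProd HX F) Y]
  (p : Y → X)

variable (F) in
/-- The fibre of the first jet bundle over `y`: the linear sections of the tangent map of the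
projection. -/
structure JetFibre (y : Y) where
  toMap : TangentSpace IX (p y) →L[ℝ] TangentSpace (IX.prod 𝓘(ℝ, F)) y
  isSection : tangentProj F IX p y ∘L toMap = ContinuousLinearMap.id ℝ (TangentSpace IX (p y))

variable {IX p} in
lemma jet_mem [hp : IsFibred F IX p] (c : FibredChart (F := F) IX p) {y : Y}
    (hy : y ∈ c.chart.source) (a : EX →L[ℝ] F) :
    tangentProj F IX p y ∘L ((dChart (IX.prod 𝓘(ℝ, F)) c.chart y).inverse ∘L
      (((ContinuousLinearMap.id ℝ EX).prod a) ∘L dChart IX c.base (p y))) =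
      ContinuousLinearMap.id ℝ (TangentSpace IX (p y)) :=
  jet_section (isInvertible_dChart c.chart_mem hy)
    (isInvertible_dChart c.base_mem (c.maps y hy)) (fst_dChart c hy) a

instance [hp : IsFibred F IX p] (y : Y) : Nonempty (JetFibre F IX p y) :=
  ⟨⟨_, jet_mem (fibredIndex F IX p y) (mem_fibredIndex y) 0⟩⟩

lemma contDiffAt_slope [FiniteDimensional ℝ EX] {B : EX →L[ℝ] EX × F}
    (hB : (ContinuousLinearMap.fst ℝ EX F ∘L B).IsInvertible) :
    ContDiffAt ℝ ∞ (slope : (EX →L[ℝ] EX × F) → (EX →L[ℝ] F)) B := by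
  have : CompleteSpace EX := FiniteDimensional.complete ℝ EX
  obtain ⟨e, he⟩ := hB
  have h1 : ContDiff ℝ ∞ (fun B : EX →L[ℝ] EX × F => ContinuousLinearMap.fst ℝ EX F ∘L B) :=
    contDiff_const.clm_comp contDiff_id
  have h2 : ContDiff ℝ ∞ (fun B : EX →L[ℝ] EX × F => ContinuousLinearMap.snd ℝ EX F ∘L B) :=
    contDiff_const.clm_comp contDiff_id
  have h3 : ContDiffAt ℝ ∞ (ContinuousLinearMap.inverse : (EX →L[ℝ] EX) → (EX →L[ℝ] EX))
      (ContinuousLinearMap.fst ℝ EX F ∘L B) := by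
    rw [← he]
    exact contDiffAt_map_inverse e
  exact h2.contDiffAt.clm_comp (h3.comp B h1.contDiffAt)

variable {IX p}

/-- The coordinates `v^i_μ` of a jet in a fibred chart. -/
def jetTriv (c : FibredChart (F := F) IX p) (y : Y) (A : JetFibre F IX p y) : EX →L[ℝ] F :=
  slope (dChart (IX.prod 𝓘(ℝ, F)) c.chart y ∘L A.toMap)

open Classical in
def jetTrivSymm [hp : IsFibred F IX p] (c : FibredChart (F := F) IX p) (y : Y)
    (a : EX →L[ℝ] F) : JetFibre F IX p y :=
  if hy : y ∈ c.chart.source then ⟨_, jet_mem c hy a⟩ else Classical.arbitrary _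

variable [hp : IsFibred F IX p] (c c' : FibredChart (F := F) IX p)

lemma jetTrivSymm_toMap {y : Y} (hy : y ∈ c.chart.source) (a : EX →L[ℝ] F) :
    (jetTrivSymm c y a).toMap = (dChart (IX.prod 𝓘(ℝ, F)) c.chart y).inverse ∘L
      (((ContinuousLinearMap.id ℝ EX).prod a) ∘L dChart IX c.base (p y)) := by
  rw [jetTrivSymm, dif_pos hy]

lemma jetTriv_jetTrivSymm {y : Y} (hy : y ∈ c.chart.source) (hy' : y ∈ c'.chart.source)
    (a : EX →L[ℝ] F) :
    (ContinuousLinearMap.fst ℝ EX F ∘L ((dChart (IX.prod 𝓘(ℝ, F)) c'.chart y ∘L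
      (dChart (IX.prod 𝓘(ℝ, F)) c.chart y).inverse) ∘L
      ((ContinuousLinearMap.id ℝ EX).prod a))).IsInvertible ∧
    jetTriv c' y (jetTrivSymm c y a) = slope ((dChart (IX.prod 𝓘(ℝ, F)) c'.chart y ∘L
      (dChart (IX.prod 𝓘(ℝ, F)) c.chart y).inverse) ∘L
      ((ContinuousLinearMap.id ℝ EX).prod a)) := by
  rw [jetTriv, jetTrivSymm_toMap c hy]
  exact jet_transition (isInvertible_dChart c.chart_mem hy)
      (isInvertible_dChart c.base_mem (c.maps y hy)) (isInvertible_dChart c'.base_mem (c'.maps y hy'))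
      (fst_dChart c hy) (fst_dChart c' hy') a

lemma mem_extendCoordChange {E H M : Type*} [NormedAddCommGroup E] [NormedSpace ℝ E]
    [TopologicalSpace H] {I : ModelWithCorners ℝ E H} [TopologicalSpace M] [ChartedSpace H M]
    {e e' : OpenPartialHomeomorph M H} {v : E} (hv : v ∈ (I.extendCoordChange e e').source) :
    e.symm (I.symm v) ∈ e.source ∧ e.symm (I.symm v) ∈ e'.source ∧
      e.extend I (e.symm (I.symm v)) = v := by
  rw [I.extendCoordChange_source] at hv
  obtain ⟨x, hx, rfl⟩ := hv
  rw [ModelWithCorners.left_inv]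
  rw [OpenPartialHomeomorph.trans_source] at hx
  refine ⟨e.map_target hx.1, hx.2, ?_⟩
  rw [OpenPartialHomeomorph.extend_coe, Function.comp_apply, e.right_inv hx.1]

def jetAtlas [FiniteDimensional ℝ EX] :
    FibreAtlas (IX.prod 𝓘(ℝ, F)) (EX →L[ℝ] F) (JetFibre F IX p) (FibredChart (F := F) IX p) where
  chart c := c.chart
  chart_mem c := c.chart_mem
  index := fibredIndex F IX p
  mem_index := mem_fibredIndex
  triv := jetTriv
  trivSymm := jetTrivSymm
  left_inv c y hy A := by
    have h : (jetTrivSymm c y (jetTriv c y A)).toMap = A.toMap := by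
      rw [jetTrivSymm_toMap c hy]
      exact jet_left_inv (isInvertible_dChart c.chart_mem hy)
        (isInvertible_dChart c.base_mem (c.maps y hy)) (fst_dChart c hy) A.isSection
    cases hA : jetTrivSymm c y (jetTriv c y A)
    rw [hA] at h
    cases A
    cases h
    rfl
  right_inv c y hy a := by
    rw [(jetTriv_jetTrivSymm c c hy hy a).2]
    obtain ⟨D, hD⟩ := isInvertible_dChart c.chart_mem hy
    rw [← hD, ContinuousLinearMap.inverse_equiv]
    have h2 : ((D : TangentSpace (IX.prod 𝓘(ℝ, F)) y →L[ℝ] EX × F) ∘L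
        (D.symm : (EX × F) →L[ℝ] TangentSpace (IX.prod 𝓘(ℝ, F)) y)) ∘L
        ((ContinuousLinearMap.id ℝ EX).prod a) = (ContinuousLinearMap.id ℝ EX).prod a := by
      ext v
      · exact congrArg Prod.fst (D.apply_symm_apply _)
      · exact congrArg Prod.snd (D.apply_symm_apply _)
    rw [h2]
    unfold slope
    have h3 : ContinuousLinearMap.fst ℝ EX F ∘L ((ContinuousLinearMap.id ℝ EX).prod a) =
      ((ContinuousLinearEquiv.refl ℝ EX : EX ≃L[ℝ] EX) : EX →L[ℝ] EX) := rfl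
    rw [h3, ContinuousLinearMap.inverse_equiv]
    rfl
  smooth c c' := by
    have hT := contDiffOn_fderivWithin_coordChange c.chart_mem c'.chart_mem
    set g := (IX.prod 𝓘(ℝ, F)).extendCoordChange c.chart c'.chart with hg
    have key : ∀ e ∈ g.source, ∀ a : EX →L[ℝ] F,
        (ContinuousLinearMap.fst ℝ EX F ∘L (fderivWithin ℝ g g.source e ∘L
          ((ContinuousLinearMap.id ℝ EX).prod a))).IsInvertible ∧
        jetTriv c' (c.chart.symm ((IX.prod 𝓘(ℝ, F)).symm e))
          (jetTrivSymm c (c.chart.symm ((IX.prod 𝓘(ℝ, F)).symm e)) a) =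
          slope (fderivWithin ℝ g g.source e ∘L ((ContinuousLinearMap.id ℝ EX).prod a)) := by
      intro e he a
      obtain ⟨hx1, hx2, h2⟩ := mem_extendCoordChange he
      have h1 := dChart_comp_inverse c.chart_mem c'.chart_mem hx1 hx2
      rw [h2] at h1
      rw [hg, ← h1]
      exact jetTriv_jetTrivSymm c c' hx1 hx2 a
    have hs : ContDiffOn ℝ ∞ (fun q : (EX × F) × (EX →L[ℝ] F) =>
        slope (fderivWithin ℝ g g.source q.1 ∘L ((ContinuousLinearMap.id ℝ EX).prod q.2)))
        (g.source ×ˢ univ) := by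
      intro q hq
      refine ContDiffAt.comp_contDiffWithinAt (f := fun q : (EX × F) × (EX →L[ℝ] F) =>
        fderivWithin ℝ g g.source q.1 ∘L ((ContinuousLinearMap.id ℝ EX).prod q.2)) q
        (contDiffAt_slope (key q.1 hq.1 q.2).1) ?_
      refine ContDiffWithinAt.clm_comp ?_ ?_
      · exact (hT q.1 hq.1).comp q contDiff_fst.contDiffWithinAt (fun q hq => hq.1)
      · have : ContDiff ℝ ∞ (fun a : EX →L[ℝ] F => (ContinuousLinearMap.id ℝ EX).prod a) :=
          ((ContinuousLinearMap.prodₗᵢ ℝ (E := EX) (F := EX) (G := F) (𝕜 := ℝ)).contDiff).comp (contDiff_const.prodMk contDiff_id)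
        exact (this.comp contDiff_snd).contDiffWithinAt
    exact hs.congr fun q hq => (key q.1 hq.1 q.2).2

end JetBundle

section FormBundle

variable {EX HX F : Type*} [NormedAddCommGroup EX] [NormedSpace ℝ EX] [TopologicalSpace HX]
  [NormedAddCommGroup F] [NormedSpace ℝ F] (IX : ModelWithCorners ℝ EX HX)
  {X Y : Type*} [TopologicalSpace X] [ChartedSpace HX X]
  [TopologicalSpace Y] [ChartedSpace (ModelProd HX F) Y]
  (p : Y → X) (N : Type*) [NormedAddCommGroup N] [NormedSpace ℝ N] (k : ℕ)

variable (F) in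
abbrev LamFibre (y : Y) : Type _ := horizForms N (tangentProj F IX p y) k 2

variable (F) in
abbrev DualFibre (y : Y) : Type _ := horizQuot N (tangentProj F IX p y) k

abbrev LamModel (EX F : Type*) [NormedAddCommGroup EX] [NormedSpace ℝ EX]
    [NormedAddCommGroup F] [NormedSpace ℝ F] (N : Type*) [NormedAddCommGroup N] [NormedSpace ℝ N]
    (k : ℕ) : Type _ :=
  LamSpace N (ContinuousLinearMap.fst ℝ EX F) k

abbrev DualModel (EX F : Type*) [NormedAddCommGroup EX] [NormedSpace ℝ EX]
    [NormedAddCommGroup F] [NormedSpace ℝ F] (N : Type*) [NormedAddCommGroup N] [NormedSpace ℝ N]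
    (k : ℕ) : Type _ :=
  DualSpace N (ContinuousLinearMap.fst ℝ EX F) k

section

variable {IX p} (c : FibredChart (F := F) IX p)

lemma dChart_inverse_comp {y : Y} (hy : y ∈ c.chart.source) :
    (dChart (IX.prod 𝓘(ℝ, F)) c.chart y).inverse ∘L dChart (IX.prod 𝓘(ℝ, F)) c.chart y =
      ContinuousLinearMap.id ℝ _ := by
  obtain ⟨D, hD⟩ := isInvertible_dChart c.chart_mem hy
  rw [← hD, ContinuousLinearMap.inverse_equiv]
  ext v
  exact D.symm_apply_apply v

lemma dChart_comp_inverse_self {y : Y} (hy : y ∈ c.chart.source) :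
    dChart (IX.prod 𝓘(ℝ, F)) c.chart y ∘L (dChart (IX.prod 𝓘(ℝ, F)) c.chart y).inverse =
      ContinuousLinearMap.id ℝ _ := by
  obtain ⟨D, hD⟩ := isInvertible_dChart c.chart_mem hy
  rw [← hD, ContinuousLinearMap.inverse_equiv]
  exact ContinuousLinearMap.ext fun v => D.apply_symm_apply v

end

variable {IX p} [hp : IsFibred F IX p] (c c' : FibredChart (F := F) IX p)

variable {N k} in
open Classical in
def lamTriv (y : Y) : LamFibre F IX p N k y → LamModel EX F N k :=
  if hy : y ∈ c.chart.source then
    pullHoriz (dChart (IX.prod 𝓘(ℝ, F)) c.chart y).inverse (tangentProj_inverse_eq_zero c hy) k 2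
  else default

variable {N k} in
open Classical in
def lamTrivSymm (y : Y) : LamModel EX F N k → LamFibre F IX p N k y :=
  if hy : y ∈ c.chart.source then
    pullHoriz (dChart (IX.prod 𝓘(ℝ, F)) c.chart y) (fst_dChart_eq_zero c hy) k 2
  else fun _ => 0

variable {N k} in
open Classical in
def dualTriv (y : Y) : DualFibre F IX p N k y → DualModel EX F N k :=
  if hy : y ∈ c.chart.source then
    pullQuot (dChart (IX.prod 𝓘(ℝ, F)) c.chart y).inverse (tangentProj_inverse_eq_zero c hy) k
  else default

variable {N k} in
open Classical in
def dualTrivSymm (y : Y) : DualModel EX F N k → DualFibre F IX p N k y :=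
  if hy : y ∈ c.chart.source then
    pullQuot (dChart (IX.prod 𝓘(ℝ, F)) c.chart y) (fst_dChart_eq_zero c hy) k
  else fun _ => 0

lemma lamTriv_apply {y : Y} (hy : y ∈ c.chart.source) (w : LamFibre F IX p N k y) :
    (lamTriv c y w).1 =
      w.1.compContinuousLinearMap (dChart (IX.prod 𝓘(ℝ, F)) c.chart y).inverse := by
  have h : lamTriv c y = (pullHoriz (dChart (IX.prod 𝓘(ℝ, F)) c.chart y).inverse
      (tangentProj_inverse_eq_zero c hy) k 2 : LamFibre F IX p N k y → _) := dif_pos hy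
  rw [h]
  rfl

lemma lamTrivSymm_apply {y : Y} (hy : y ∈ c.chart.source) (w : LamModel EX F N k) :
    (lamTrivSymm c y w).1 =
      w.1.compContinuousLinearMap (dChart (IX.prod 𝓘(ℝ, F)) c.chart y) := by
  have h : lamTrivSymm c y = ((pullHoriz (dChart (IX.prod 𝓘(ℝ, F)) c.chart y)
      (fst_dChart_eq_zero c hy) k 2 : _ → LamFibre F IX p N k y)) := dif_pos hy
  rw [h]
  rfl

lemma lamTrivSymm_lamTriv {y : Y} (hy : y ∈ c.chart.source) (w : LamFibre F IX p N k y) :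
    lamTrivSymm c y (lamTriv c y w) = w := by
  apply Subtype.ext
  rw [lamTrivSymm_apply N k c hy, lamTriv_apply N k c hy]
  change w.1.compContinuousLinearMap ((dChart (IX.prod 𝓘(ℝ, F)) c.chart y).inverse ∘L
    dChart (IX.prod 𝓘(ℝ, F)) c.chart y) = w.1
  rw [dChart_inverse_comp c hy]
  rfl

lemma lamTriv_lamTrivSymm {y : Y} (hy : y ∈ c.chart.source) (w : LamModel EX F N k) :
    lamTriv c y (lamTrivSymm c y w) = w := by
  apply Subtype.ext
  rw [lamTriv_apply N k c hy, lamTrivSymm_apply N k c hy]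
  change w.1.compContinuousLinearMap (dChart (IX.prod 𝓘(ℝ, F)) c.chart y ∘L
    (dChart (IX.prod 𝓘(ℝ, F)) c.chart y).inverse) = w.1
  rw [dChart_comp_inverse_self c hy]
  rfl

lemma dualTriv_mk {y : Y} (hy : y ∈ c.chart.source) (w : LamFibre F IX p N k y) :
    dualTriv c y (Submodule.Quotient.mk w) = LamSpace.mk N _ k (lamTriv c y w) := by
  have h : dualTriv c y = (pullQuot (dChart (IX.prod 𝓘(ℝ, F)) c.chart y).inverse
      (tangentProj_inverse_eq_zero c hy) k : DualFibre F IX p N k y → _) := dif_pos hy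
  have h' : lamTriv c y = (pullHoriz (dChart (IX.prod 𝓘(ℝ, F)) c.chart y).inverse
      (tangentProj_inverse_eq_zero c hy) k 2 : LamFibre F IX p N k y → _) := dif_pos hy
  rw [h, h']
  rfl

lemma dualTrivSymm_mk {y : Y} (hy : y ∈ c.chart.source) (w : LamModel EX F N k) :
    dualTrivSymm c y (LamSpace.mk N _ k w) =
      (Submodule.Quotient.mk (lamTrivSymm c y w) : DualFibre F IX p N k y) := by
  have h : dualTrivSymm c y = ((pullQuot (dChart (IX.prod 𝓘(ℝ, F)) c.chart y)
      (fst_dChart_eq_zero c hy) k : _ → DualFibre F IX p N k y)) := dif_pos hy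
  have h' : lamTrivSymm c y = ((pullHoriz (dChart (IX.prod 𝓘(ℝ, F)) c.chart y)
      (fst_dChart_eq_zero c hy) k 2 : _ → LamFibre F IX p N k y)) := dif_pos hy
  rw [h, h']
  rfl

section smooth

variable [FiniteDimensional ℝ EX] [FiniteDimensional ℝ F] [FiniteDimensional ℝ N]

lemma contDiffOn_lamTransition :
    ContDiffOn ℝ ∞ (fun q : (EX × F) × LamModel EX F N k =>
      lamTriv c' (c.chart.symm ((IX.prod 𝓘(ℝ, F)).symm q.1))
        (lamTrivSymm c (c.chart.symm ((IX.prod 𝓘(ℝ, F)).symm q.1)) q.2))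
      (((IX.prod 𝓘(ℝ, F)).extendCoordChange c.chart c'.chart).source ×ˢ univ) := by
  have hcomplete : CompleteSpace (EX × F) := FiniteDimensional.complete ℝ _
  have hT := contDiffOn_fderivWithin_coordChange c.chart_mem c'.chart_mem
  set g := (IX.prod 𝓘(ℝ, F)).extendCoordChange c.chart c'.chart with hg
  have key : ∀ e ∈ g.source, (fderivWithin ℝ g g.source e).IsInvertible ∧
      ∀ w : LamModel EX F N k, (lamTriv c' (c.chart.symm ((IX.prod 𝓘(ℝ, F)).symm e))
        (lamTrivSymm c (c.chart.symm ((IX.prod 𝓘(ℝ, F)).symm e)) w)).1 =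
        w.1.compContinuousLinearMap (fderivWithin ℝ g g.source e).inverse := by
    intro e he
    obtain ⟨hx1, hx2, h2⟩ := mem_extendCoordChange he
    have h1 := dChart_comp_inverse c.chart_mem c'.chart_mem hx1 hx2
    rw [h2] at h1
    rw [hg, ← h1]
    set y := c.chart.symm ((IX.prod 𝓘(ℝ, F)).symm e)
    obtain ⟨D, hD⟩ := isInvertible_dChart c.chart_mem hx1
    obtain ⟨D', hD'⟩ := isInvertible_dChart c'.chart_mem hx2
    have h3 : dChart (IX.prod 𝓘(ℝ, F)) c'.chart y ∘L
        (dChart (IX.prod 𝓘(ℝ, F)) c.chart y).inverse =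
        ((D.symm.trans D' : (EX × F) ≃L[ℝ] (EX × F)) : (EX × F) →L[ℝ] (EX × F)) := by
      rw [← hD, ← hD', ContinuousLinearMap.inverse_equiv]
      rfl
    refine ⟨⟨_, h3.symm⟩, fun w => ?_⟩
    rw [lamTriv_apply N k c' hx2, lamTrivSymm_apply N k c hx1, h3,
      ContinuousLinearMap.inverse_equiv, ← hD, ← hD', ContinuousLinearMap.inverse_equiv]
    rfl
  obtain ⟨f, hf, hf'⟩ := exists_pull N (ContinuousLinearMap.fst ℝ EX F) k
  have hs : ContDiffOn ℝ ∞ (fun q : (EX × F) × LamModel EX F N k =>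
      f ((fderivWithin ℝ g g.source q.1).inverse, q.2)) (g.source ×ˢ univ) := by
    refine hf.comp_contDiffOn (f := fun q : (EX × F) × LamModel EX F N k =>
      ((fderivWithin ℝ g g.source q.1).inverse, q.2)) (ContDiffOn.prodMk ?_ ?_)
    · intro q hq
      obtain ⟨G, hG⟩ := (key q.1 hq.1).1
      have h4 : ContDiffAt ℝ ∞ (ContinuousLinearMap.inverse :
          ((EX × F) →L[ℝ] (EX × F)) → ((EX × F) →L[ℝ] (EX × F)))
          (fderivWithin ℝ g g.source q.1) := by
        rw [← hG]
        exact contDiffAt_map_inverse G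
      refine ContDiffAt.comp_contDiffWithinAt (f := fun q : (EX × F) × LamModel EX F N k =>
        fderivWithin ℝ g g.source q.1) q h4 ?_
      exact (hT q.1 hq.1).comp q contDiff_fst.contDiffWithinAt (fun q hq => hq.1)
    · exact contDiff_snd.contDiffOn
  refine hs.congr fun q hq => ?_
  exact (hf' _ _ _ ((key q.1 hq.1).2 q.2)).symm

variable (F IX p) in
def lamAtlas : FibreAtlas (IX.prod 𝓘(ℝ, F)) (LamModel EX F N k) (LamFibre F IX p N k)
    (FibredChart (F := F) IX p) where
  chart c := c.chart
  chart_mem c := c.chart_mem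
  index := fibredIndex F IX p
  mem_index := mem_fibredIndex
  triv c y := lamTriv c y
  trivSymm c y := lamTrivSymm c y
  left_inv c _ hy w := lamTrivSymm_lamTriv N k c hy w
  right_inv c _ hy w := lamTriv_lamTrivSymm N k c hy w
  smooth c c' := contDiffOn_lamTransition N k c c'

variable (F IX p) in
def dualAtlas : FibreAtlas (IX.prod 𝓘(ℝ, F)) (DualModel EX F N k) (DualFibre F IX p N k)
    (FibredChart (F := F) IX p) where
  chart c := c.chart
  chart_mem c := c.chart_mem
  index := fibredIndex F IX p
  mem_index := mem_fibredIndex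
  triv c y := dualTriv c y
  trivSymm c y := dualTrivSymm c y
  left_inv c y hy w := by
    obtain ⟨w, rfl⟩ := Submodule.Quotient.mk_surjective _ w
    rw [dualTriv_mk N k c hy, dualTrivSymm_mk N k c hy, lamTrivSymm_lamTriv N k c hy]
  right_inv c y hy w := by
    obtain ⟨w, rfl⟩ : ∃ w', LamSpace.mk N (ContinuousLinearMap.fst ℝ EX F) k w' = w :=
      Submodule.Quotient.mk_surjective _ w
    have h := dualTrivSymm_mk N k c hy w
    refine (congrArg (dualTriv c y) h).trans ?_
    rw [dualTriv_mk N k c hy, lamTriv_lamTrivSymm N k c hy]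
  smooth c c' := by
    obtain ⟨s, hs, hs'⟩ := exists_section N (ContinuousLinearMap.fst ℝ EX F) k
    have h2 := contDiff_mk N (ContinuousLinearMap.fst ℝ EX F) k
    have h3 := h2.comp_contDiffOn ((contDiffOn_lamTransition N k c c').comp
      (contDiff_fst.prodMk (hs.comp contDiff_snd)).contDiffOn
      (s := (((IX.prod 𝓘(ℝ, F)).extendCoordChange c.chart c'.chart).source ×ˢ univ))
      (fun q hq => ⟨hq.1, mem_univ _⟩))
    refine h3.congr fun q hq => ?_
    obtain ⟨hx1, hx2, -⟩ := mem_extendCoordChange hq.1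
    have h4 : dualTrivSymm c (c.chart.symm ((IX.prod 𝓘(ℝ, F)).symm q.1)) q.2 =
        (Submodule.Quotient.mk (lamTrivSymm c (c.chart.symm ((IX.prod 𝓘(ℝ, F)).symm q.1))
          (s q.2)) : DualFibre F IX p N k _) := by
      conv_lhs => rw [← hs' q.2]
      exact dualTrivSymm_mk N k c hx1 _
    rw [h4]
    exact dualTriv_mk N k c' hx2 _

end smooth

end FormBundle

section DifferentialForms

variable {E H : Type*} [NormedAddCommGroup E] [NormedSpace ℝ E] [TopologicalSpace H]
  (I : ModelWithCorners ℝ E H) (M : Type*) [TopologicalSpace M] [ChartedSpace H M]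

/-- Differential forms of degree `k` (not necessarily smooth). -/
abbrev DForm (k : ℕ) : Type _ := (x : M) → TangentSpace I x [⋀^Fin k]→L[ℝ] ℝ

/-- Vector fields (not necessarily smooth). -/
abbrev VField : Type _ := (x : M) → TangentSpace I x

variable {I M} {k : ℕ}

/-- A vector field is smooth if it is a smooth section of the tangent bundle. -/
def IsSmoothVF [IsManifold I 1 M] (ξ : VField I M) : Prop :=
  ContMDiff I I.tangent ∞ (fun x => (⟨x, ξ x⟩ : TangentBundle I M))

namespace DForm

/-- The local representative of a form in the preferred chart around `x₀`. -/
def inChart (w : DForm I M k) (x₀ : M) (e : E) : E [⋀^Fin k]→L[ℝ] ℝ :=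
  (w ((extChartAt I x₀).symm e)).compContinuousLinearMap
    (mfderivWithin 𝓘(ℝ, E) I (extChartAt I x₀).symm (range I) e)

/-- The local representative is smooth at the point. -/
def SmoothAt (w : DForm I M k) (x : M) : Prop :=
  ContDiffWithinAt ℝ ∞ (w.inChart x) (range I) (extChartAt I x x)

def Smooth (w : DForm I M k) : Prop := ∀ x, w.SmoothAt x

/-- The exterior derivative, computed in the preferred chart around each point. -/
def d (w : DForm I M k) : DForm I M (k + 1) := fun x =>
  (extDerivWithin (w.inChart x) (range I) (extChartAt I x x)).compContinuousLinearMap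
    (mfderiv I 𝓘(ℝ, E) (extChartAt I x) x : TangentSpace I x →L[ℝ] E)

/-- The interior product. -/
def interior (ξ : VField I M) (w : DForm I M (k + 1)) : DForm I M k := fun x =>
  ContinuousAlternatingMap.curryLeft (E := E) (w x) (ξ x)

/-- The Lie derivative, by Cartan's formula. -/
def lie (ξ : VField I M) : {k : ℕ} → DForm I M k → DForm I M k
  | 0, w => interior ξ w.d
  | _ + 1, w => (interior ξ w).d + interior ξ w.d

variable {E' H' : Type*} [NormedAddCommGroup E'] [NormedSpace ℝ E'] [TopologicalSpace H']
  {I' : ModelWithCorners ℝ E' H'} {M' : Type*} [TopologicalSpace M'] [ChartedSpace H' M']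

/-- The pullback of a form. -/
def pullback (f : M → M') (w : DForm I' M' k) : DForm I M k := fun x =>
  (w (f x)).compContinuousLinearMap (mfderiv I I' f x)

/-- Exactness; a form of degree `0` is exact only if it vanishes. -/
def IsExact : {k : ℕ} → DForm I M k → Prop
  | 0, w => w = 0
  | _ + 1, w => ∃ b : DForm I M _, b.Smooth ∧ w = b.d

end DForm

variable {E' H' : Type*} [NormedAddCommGroup E'] [NormedSpace ℝ E'] [TopologicalSpace H']
  {I' : ModelWithCorners ℝ E' H'} {M' : Type*} [TopologicalSpace M'] [ChartedSpace H' M']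

/-- The vector field `ξ` projects onto `ξ'` along `f`, that is, `Tf ∘ ξ = ξ' ∘ f`. -/
def IsRelated (f : M → M') (ξ : VField I M) (ξ' : VField I' M') : Prop :=
  ∀ x, mfderiv I I' f x (ξ x) = ξ' (f x)

end DifferentialForms

section BoundaryConditions

variable {E H : Type*} [NormedAddCommGroup E] [NormedSpace ℝ E] [TopologicalSpace H]
  {I : ModelWithCorners ℝ E H} {M : Type*} [TopologicalSpace M] [ChartedSpace H M]
  {b n : ℕ} {B : Type*} [TopologicalSpace B] [ChartedSpace (EuclideanSpace ℝ (Fin b)) B]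
  [IsManifold (𝓡 b) ∞ B]

variable (I) in
/-- `j` is an embedding of the manifold `B` as a submanifold. -/
structure IsEmbeddedSubmanifold (j : B → M) : Prop where
  contMDiff : ContMDiff (𝓡 b) I ∞ j
  injective_mfderiv : ∀ x, Function.Injective (mfderiv (𝓡 b) I j x)
  isEmbedding : IsEmbedding j

/-- The vector field `ξ` is tangent to the submanifold `j : B → M`, and its restriction to `B`
leaves the form `Π` invariant. -/
def PreservesBoundary (j : B → M) (P : DForm (𝓡 b) B n) (ξ : VField I M) : Prop :=
  ∃ ξB : VField (𝓡 b) B, IsSmoothVF ξB ∧ IsRelated j ξB ξ ∧ DForm.lie ξB P = 0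

/-- Cartan symmetries of a manifold with a form `Θ`, a submanifold `j : B → M` and a form `P` on
`B`. -/
def IsCartanSymmetry [IsManifold I 1 M] (Θ : DForm I M (n + 1)) (j : B → M) (P : DForm (𝓡 b) B n)
    (ξ : VField I M) : Prop :=
  IsSmoothVF ξ ∧
  (∃ α : DForm I M n, α.Smooth ∧ DForm.lie ξ Θ = α.d ∧
    DForm.IsExact (DForm.pullback j α : DForm (𝓡 b) B n)) ∧
  PreservesBoundary j P ξ

end BoundaryConditions

section Spaces

variable {EX HX F : Type*} [NormedAddCommGroup EX] [NormedSpace ℝ EX] [TopologicalSpace HX]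
  [NormedAddCommGroup F] [NormedSpace ℝ F] (IX : ModelWithCorners ℝ EX HX)
  {X Y : Type*} [TopologicalSpace X] [ChartedSpace HX X]
  [TopologicalSpace Y] [ChartedSpace (ModelProd HX F) Y]
  (p : Y → X) (k : ℕ)

variable (F) in
/-- The first jet bundle. -/
def Jet : Type _ := Bundle.TotalSpace (EX →L[ℝ] F) (JetFibre F IX p)

variable (F) in
/-- The bundle of `k`-forms on `Y` which are annihilated by any two vertical vectors. -/
def Lam : Type _ := Bundle.TotalSpace (LamModel EX F ℝ k) (LamFibre F IX p ℝ k)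

variable (F) in
/-- The quotient of the bundle of `k`-forms annihilated by two vertical vectors by the bundle
of the forms annihilated by one. -/
def DualJet : Type _ := Bundle.TotalSpace (DualModel EX F ℝ k) (DualFibre F IX p ℝ k)

variable {IX p k}

/-- The projection of the jet bundle onto `Y`. -/
def Jet.proj (z : Jet F IX p) : Y := Bundle.TotalSpace.proj z

/-- A jet, as a linear section of the tangent map of the projection. -/
def Jet.fib (z : Jet F IX p) : JetFibre F IX p z.proj := Bundle.TotalSpace.snd z

/-- The projection onto `Y`. -/
def Lam.proj (w : Lam F IX p k) : Y := Bundle.TotalSpace.proj w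

/-- The form on the tangent space of `Y` given by a point of the bundle. -/
def Lam.form (w : Lam F IX p k) : TangentSpace (IX.prod 𝓘(ℝ, F)) w.proj [⋀^Fin k]→L[ℝ] ℝ :=
  (Bundle.TotalSpace.snd w).1

/-- The projection onto `Y`. -/
def DualJet.proj (w : DualJet F IX p k) : Y := Bundle.TotalSpace.proj w

/-- The canonical projection onto the quotient. -/
def Lam.toDual (w : Lam F IX p k) : DualJet F IX p k :=
  ⟨w.proj, Submodule.Quotient.mk (Bundle.TotalSpace.snd w)⟩

variable [IsFibred F IX p] [FiniteDimensional ℝ EX]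

instance : TopologicalSpace (Jet F IX p) := (jetAtlas (F := F) (IX := IX) (p := p)).topology

instance : ChartedSpace (ModelProd (ModelProd HX F) (EX →L[ℝ] F)) (Jet F IX p) :=
  (jetAtlas (F := F) (IX := IX) (p := p)).charted

instance : IsManifold ((IX.prod 𝓘(ℝ, F)).prod 𝓘(ℝ, EX →L[ℝ] F)) ∞ (Jet F IX p) :=
  (jetAtlas (F := F) (IX := IX) (p := p)).isManifold

variable [FiniteDimensional ℝ F]

instance : TopologicalSpace (Lam F IX p k) := (lamAtlas F IX p ℝ k).topology

instance : ChartedSpace (ModelProd (ModelProd HX F) (LamModel EX F ℝ k)) (Lam F IX p k) :=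
  (lamAtlas F IX p ℝ k).charted

instance : IsManifold ((IX.prod 𝓘(ℝ, F)).prod 𝓘(ℝ, LamModel EX F ℝ k)) ∞ (Lam F IX p k) :=
  (lamAtlas F IX p ℝ k).isManifold

instance : TopologicalSpace (DualJet F IX p k) := (dualAtlas F IX p ℝ k).topology

instance : ChartedSpace (ModelProd (ModelProd HX F) (DualModel EX F ℝ k)) (DualJet F IX p k) :=
  (dualAtlas F IX p ℝ k).charted

instance : IsManifold ((IX.prod 𝓘(ℝ, F)).prod 𝓘(ℝ, DualModel EX F ℝ k)) ∞ (DualJet F IX p k) :=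
  (dualAtlas F IX p ℝ k).isManifold

end Spaces

section LegendreAlgebra

variable {n : ℕ} {E : Type*} [NormedAddCommGroup E] [NormedSpace ℝ E]

/-- The projection of `E` onto the kernel of `q` along the image of the section `A`. -/
def verticalPart (q : E →L[ℝ] EuclideanSpace ℝ (Fin (n + 1)))
    (A : EuclideanSpace ℝ (Fin (n + 1)) →L[ℝ] E) (hA : q ∘L A = ContinuousLinearMap.id ℝ _) :
    E →L[ℝ] LinearMap.ker q.toLinearMap :=
  (ContinuousLinearMap.id ℝ E - A ∘L q).codRestrict _ fun v => by
    have h := DFunLike.congr_fun hA (q v)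
    simp only [ContinuousLinearMap.comp_apply, ContinuousLinearMap.id_apply] at h
    simp [h]

/-- Given a linear form `l` on the space of linear maps from the base into the vertical vectors,
this is the map `u ↦ ∑ μ, l (dx^μ ⊗ u) ∂_μ` on vertical vectors `u`. -/
def momentum {V : Type*} [NormedAddCommGroup V] [NormedSpace ℝ V]
    (l : (EuclideanSpace ℝ (Fin (n + 1)) →L[ℝ] V) →L[ℝ] ℝ) :
    V →L[ℝ] EuclideanSpace ℝ (Fin (n + 1)) :=
  ∑ μ : Fin (n + 1),
    (l ∘L ContinuousLinearMap.smulRightL ℝ (EuclideanSpace ℝ (Fin (n + 1))) V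
      (EuclideanSpace.proj μ)).smulRight (EuclideanSpace.single μ (1 : ℝ))

/-- The form `a η + p^μ_i θ^i ∧ dⁿx_μ`, where `a` is a number, `η` is a volume form on the base
(pulled back by `q`), `p^μ_i` are the coefficients of the linear form `l`, `θ^i` are the components
of the vertical part of a vector, and `dⁿx_μ` is the interior product of `∂_μ` with `η`. -/
def legendreForm (q : E →L[ℝ] EuclideanSpace ℝ (Fin (n + 1)))
    (A : EuclideanSpace ℝ (Fin (n + 1)) →L[ℝ] E) (hA : q ∘L A = ContinuousLinearMap.id ℝ _)
    (a : ℝ) (l : (EuclideanSpace ℝ (Fin (n + 1)) →L[ℝ] LinearMap.ker q.toLinearMap) →L[ℝ] ℝ)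
    (η : EuclideanSpace ℝ (Fin (n + 1)) [⋀^Fin (n + 1)]→L[ℝ] ℝ) :
    E [⋀^Fin (n + 1)]→L[ℝ] ℝ :=
  a • η.compContinuousLinearMap q +
    ContinuousAlternatingMap.alternatizeUncurryFin
      (ContinuousAlternatingMap.compContinuousLinearMapCLM q ∘L η.curryLeft ∘L
        momentum l ∘L verticalPart q A hA)

lemma legendreForm_mem (q : E →L[ℝ] EuclideanSpace ℝ (Fin (n + 1)))
    (A : EuclideanSpace ℝ (Fin (n + 1)) →L[ℝ] E) (hA : q ∘L A = ContinuousLinearMap.id ℝ _)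
    (a : ℝ) (l : (EuclideanSpace ℝ (Fin (n + 1)) →L[ℝ] LinearMap.ker q.toLinearMap) →L[ℝ] ℝ)
    (η : EuclideanSpace ℝ (Fin (n + 1)) [⋀^Fin (n + 1)]→L[ℝ] ℝ) :
    legendreForm q A hA a l η ∈ horizForms ℝ q (n + 1) 2 := by
  intro u s hs hu
  obtain ⟨i, j, hij, rfl⟩ := Finset.card_eq_two.1 hs
  have hi : q (u i) = 0 := hu i (by simp)
  have hj : q (u j) = 0 := hu j (by simp)
  have h1 : η.compContinuousLinearMap q u = 0 := by
    rw [ContinuousAlternatingMap.compContinuousLinearMap_apply]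
    exact η.map_coord_zero i hi
  have h2 : ∀ r : Fin (n + 1), ∃ t, t ≠ r ∧ q (u t) = 0 := by
    intro r
    by_cases h : i = r
    · exact ⟨j, fun h' => hij (h.trans h'.symm), hj⟩
    · exact ⟨i, h, hi⟩
  rw [legendreForm, ContinuousAlternatingMap.add_apply, ContinuousAlternatingMap.smul_apply, h1,
    smul_zero, zero_add, ContinuousAlternatingMap.alternatizeUncurryFin_apply]
  refine Finset.sum_eq_zero fun r _ => ?_
  obtain ⟨t, ht, hq⟩ := h2 r
  obtain ⟨t', rfl⟩ := Fin.exists_succAbove_eq ht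
  have h3 : (ContinuousAlternatingMap.compContinuousLinearMapCLM q ∘L η.curryLeft ∘L
        momentum l ∘L verticalPart q A hA) (u r) (r.removeNth u) = 0 := by
    refine ContinuousAlternatingMap.map_coord_zero (η.curryLeft
      (momentum l (verticalPart q A hA (u r)))) t' ?_
    exact hq
  rw [h3, smul_zero]

end LegendreAlgebra

section Legendre

variable {n m : ℕ} {HX : Type*} [TopologicalSpace HX]
  {IX : ModelWithCorners ℝ (EuclideanSpace ℝ (Fin (n + 1))) HX}
  {X Y : Type*} [TopologicalSpace X] [ChartedSpace HX X]
  [TopologicalSpace Y] [ChartedSpace (ModelProd HX (EuclideanSpace ℝ (Fin m))) Y]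
  {p : Y → X}

/-- The space of vertical vectors at `y`. -/
abbrev VerticalSpace (IX : ModelWithCorners ℝ (EuclideanSpace ℝ (Fin (n + 1))) HX) (p : Y → X)
    (y : Y) : Submodule ℝ (EuclideanSpace ℝ (Fin (n + 1)) × EuclideanSpace ℝ (Fin m)) :=
  LinearMap.ker (tangentProj (EuclideanSpace ℝ (Fin m)) IX p y).toLinearMap

/-- The jet obtained from `A` by adding a linear map with values in the vertical vectors. -/
def JetFibre.translate {y : Y} (A : JetFibre (EuclideanSpace ℝ (Fin m)) IX p y)
    (f : EuclideanSpace ℝ (Fin (n + 1)) →L[ℝ] VerticalSpace (m := m) IX p y) :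
    JetFibre (EuclideanSpace ℝ (Fin m)) IX p y where
  toMap := (show EuclideanSpace ℝ (Fin (n + 1)) →L[ℝ]
      EuclideanSpace ℝ (Fin (n + 1)) × EuclideanSpace ℝ (Fin m) from A.toMap) +
    (VerticalSpace (m := m) IX p y).subtypeL ∘L f
  isSection := by
    refine ContinuousLinearMap.ext fun v => ?_
    have h : tangentProj (EuclideanSpace ℝ (Fin m)) IX p y (f v).1 = 0 := (f v).2
    have h1 : tangentProj (EuclideanSpace ℝ (Fin m)) IX p y (A.toMap v) = v :=
      DFunLike.congr_fun A.isSection v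
    refine (map_add (tangentProj (EuclideanSpace ℝ (Fin m)) IX p y) (A.toMap v) (f v).1).trans ?_
    rw [h, h1, add_zero]
    rfl

/-- The derivative of `L` at `z` along the fibre of the jet bundle. -/
def fibreDerivative (L : Jet (EuclideanSpace ℝ (Fin m)) IX p → ℝ)
    (z : Jet (EuclideanSpace ℝ (Fin m)) IX p) :
    (EuclideanSpace ℝ (Fin (n + 1)) →L[ℝ] VerticalSpace (m := m) IX p z.proj) →L[ℝ] ℝ :=
  fderiv ℝ (fun f => L ⟨z.proj, z.fib.translate f⟩) 0

/-- The Legendre transformation into the bundle of `(n+1)`-forms annihilated by two vertical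
vectors. -/
def Leg (η : DForm IX X (n + 1)) (L : Jet (EuclideanSpace ℝ (Fin m)) IX p → ℝ)
    (z : Jet (EuclideanSpace ℝ (Fin m)) IX p) : Lam (EuclideanSpace ℝ (Fin m)) IX p (n + 1) :=
  ⟨z.proj, legendreForm (E := EuclideanSpace ℝ (Fin (n + 1)) × EuclideanSpace ℝ (Fin m))
      (tangentProj (EuclideanSpace ℝ (Fin m)) IX p z.proj) z.fib.toMap z.fib.isSection (L z)
      (fibreDerivative L z) (η (p z.proj)),
    legendreForm_mem (E := EuclideanSpace ℝ (Fin (n + 1)) × EuclideanSpace ℝ (Fin m))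
      (tangentProj (EuclideanSpace ℝ (Fin m)) IX p z.proj) z.fib.toMap z.fib.isSection (L z)
      (fibreDerivative L z) (η (p z.proj))⟩

/-- The Legendre map into the dual jet bundle. -/
def leg (η : DForm IX X (n + 1)) (L : Jet (EuclideanSpace ℝ (Fin m)) IX p → ℝ)
    (z : Jet (EuclideanSpace ℝ (Fin m)) IX p) : DualJet (EuclideanSpace ℝ (Fin m)) IX p (n + 1) :=
  (Leg η L z).toDual

end Legendre

section FieldTheory

variable {n m : ℕ} {HX : Type*} [TopologicalSpace HX]

abbrev modelY (IX : ModelWithCorners ℝ (EuclideanSpace ℝ (Fin (n + 1))) HX) (m : ℕ) :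
    ModelWithCorners ℝ (EuclideanSpace ℝ (Fin (n + 1)) × EuclideanSpace ℝ (Fin m))
      (ModelProd HX (EuclideanSpace ℝ (Fin m))) :=
  IX.prod 𝓘(ℝ, EuclideanSpace ℝ (Fin m))

abbrev modelJet (IX : ModelWithCorners ℝ (EuclideanSpace ℝ (Fin (n + 1))) HX) (m : ℕ) :=
  (modelY IX m).prod 𝓘(ℝ, EuclideanSpace ℝ (Fin (n + 1)) →L[ℝ] EuclideanSpace ℝ (Fin m))

abbrev modelLam (IX : ModelWithCorners ℝ (EuclideanSpace ℝ (Fin (n + 1))) HX) (m : ℕ) :=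
  (modelY IX m).prod
    𝓘(ℝ, LamModel (EuclideanSpace ℝ (Fin (n + 1))) (EuclideanSpace ℝ (Fin m)) ℝ (n + 1))

abbrev modelDual (IX : ModelWithCorners ℝ (EuclideanSpace ℝ (Fin (n + 1))) HX) (m : ℕ) :=
  (modelY IX m).prod
    𝓘(ℝ, DualModel (EuclideanSpace ℝ (Fin (n + 1))) (EuclideanSpace ℝ (Fin m)) ℝ (n + 1))

variable (IX : ModelWithCorners ℝ (EuclideanSpace ℝ (Fin (n + 1))) HX)
  {X Y : Type*} [TopologicalSpace X] [ChartedSpace HX X]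
  [TopologicalSpace Y] [ChartedSpace (ModelProd HX (EuclideanSpace ℝ (Fin m))) Y]
  (p : Y → X)

/-- The first jet bundle `J¹π`. -/
abbrev JetBundle (m : ℕ) [ChartedSpace (ModelProd HX (EuclideanSpace ℝ (Fin m))) Y] : Type _ :=
  Jet (EuclideanSpace ℝ (Fin m)) IX p

/-- The bundle of `(n+1)`-forms on `Y` annihilated by any two vertical vectors. -/
abbrev LamBundle (m : ℕ) [ChartedSpace (ModelProd HX (EuclideanSpace ℝ (Fin m))) Y] : Type _ :=
  Lam (EuclideanSpace ℝ (Fin m)) IX p (n + 1)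

/-- The dual jet bundle `(J¹π)^*`. -/
abbrev DualJetBundle (m : ℕ) [ChartedSpace (ModelProd HX (EuclideanSpace ℝ (Fin m))) Y] : Type _ :=
  DualJet (EuclideanSpace ℝ (Fin m)) IX p (n + 1)

variable [IsFibred (EuclideanSpace ℝ (Fin m)) IX p]

/-- The Liouville form: `Θ_w (v₀, …, vₙ) = w (Tν v₀, …, Tν vₙ)`, where `ν` is the projection
onto `Y`. -/
def liouville : DForm (modelLam IX m) (LamBundle IX p m) (n + 1) := fun w =>
  w.form.compContinuousLinearMap (mfderiv (modelLam IX m) (modelY IX m) Lam.proj w)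

variable {IX p}

/-- The Poincaré–Cartan form: `(Θ_L)_z (v₀, …, vₙ) = Leg_L(z) (Tπ v₀, …, Tπ vₙ)`, where `π` is the
projection onto `Y`. In coordinates, `Θ_L = L η + (∂L/∂v^i_μ) θ^i ∧ dⁿx_μ`, with
`θ^i = dy^i - v^i_μ dx^μ`. -/
def poincareCartan (η : DForm IX X (n + 1)) (L : JetBundle IX p m → ℝ) :
    DForm (modelJet IX m) (JetBundle IX p m) (n + 1) := fun z =>
  (Leg η L z).form.compContinuousLinearMap (mfderiv (modelJet IX m) (modelY IX m) Jet.proj z)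

/-- A form on `Y` is semibasic if it is annihilated by any vertical vector. -/
def IsSemibasic {k : ℕ} (α : DForm (modelY IX m) Y k) : Prop :=
  ∀ y, α y ∈ horizForms ℝ (tangentProj (EuclideanSpace ℝ (Fin m)) IX p y) k 1

/-- The contact distribution on the jet bundle: the tangent vectors `V` at `z` for which
`Tπ_YZ V = z (Tπ_XZ V)`. -/
def contactSpace (z : JetBundle IX p m) : Set (TangentSpace (modelJet IX m) z) :=
  {V | mfderiv (modelJet IX m) (modelY IX m) Jet.proj z V =
    z.fib.toMap (tangentProj (EuclideanSpace ℝ (Fin m)) IX p z.proj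
      (mfderiv (modelJet IX m) (modelY IX m) Jet.proj z V))}

/-- The form `θ` is a contact form on `U`, that is, it is smooth on `U` and annihilates the contact
distribution at the points of `U`. -/
def IsContactForm (U : Set (JetBundle IX p m)) (θ : DForm (modelJet IX m) (JetBundle IX p m) 1) :
    Prop :=
  ∀ z ∈ U, θ.SmoothAt z ∧ ∀ V ∈ contactSpace z, θ z (fun _ => V) = 0

variable [IsManifold (modelY IX m) ∞ Y]

/-- The first jet prolongation `ξ^(1)` of a vector field `ξ` on `Y`: the vector field on the jet
bundle which projects onto `ξ` and preserves the contact forms. -/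
structure IsProlongation (ξ : VField (modelY IX m) Y)
    (ξ₁ : VField (modelJet IX m) (JetBundle IX p m)) : Prop where
  smooth : IsSmoothVF ξ₁
  related : IsRelated Jet.proj ξ₁ ξ
  contact : ∀ (U : Set (JetBundle IX p m)) (θ : DForm (modelJet IX m) (JetBundle IX p m) 1),
    IsOpen U → IsContactForm U θ → ∀ z ∈ U, ∀ V ∈ contactSpace z, DForm.lie ξ₁ θ z (fun _ => V) = 0

/-- The `α`-lift of a vector field `ξ` on `Y` to the bundle of `(n+1)`-forms annihilated by two
vertical vectors, for an `n`-form `α` on `Y`. -/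
structure IsAlphaLift (ξ : VField (modelY IX m) Y) (α : DForm (modelY IX m) Y n)
    (Ξ : VField (modelLam IX m) (LamBundle IX p m)) : Prop where
  smooth : IsSmoothVF Ξ
  related : IsRelated Lam.proj Ξ ξ
  lie : DForm.lie Ξ (liouville IX p) = (DForm.pullback Lam.proj α).d

variable {b : ℕ} {B : Type*} [TopologicalSpace B] [ChartedSpace (EuclideanSpace ℝ (Fin b)) B]
  [IsManifold (𝓡 b) ∞ B]

/-- A boundary condition for the Lagrangian problem: an embedded submanifold `j : B → J¹π` of the
boundary of `J¹π` (the jets over boundary points of `X`), and an `n`-form `Π` on `B` such that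
`j^* Θ_L = dΠ`. -/
structure IsBoundaryCondition (η : DForm IX X (n + 1)) (L : JetBundle IX p m → ℝ)
    (j : B → JetBundle IX p m) (P : DForm (𝓡 b) B n) : Prop where
  embedded : IsEmbeddedSubmanifold (b := b) (modelJet IX m) j
  boundary : ∀ x, p (j x).proj ∈ IX.boundary X
  smooth : P.Smooth
  primitive : (DForm.pullback j (poincareCartan η L) : DForm (𝓡 b) B (n + 1)) = P.d

/-- Noether symmetries for the De Donder equations, with respect to the semibasic `n`-form `α`
on `Y`. -/
structure IsNoetherDeDonder (η : DForm IX X (n + 1)) (L : JetBundle IX p m → ℝ)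
    (j : B → JetBundle IX p m) (P : DForm (𝓡 b) B n) (ξ : VField (modelY IX m) Y)
    (α : DForm (modelY IX m) Y n) : Prop where
  smooth_field : IsSmoothVF ξ
  smooth_form : α.Smooth
  semibasic : IsSemibasic (p := p) α
  exact : DForm.IsExact (DForm.pullback j (DForm.pullback Jet.proj α :
    DForm (modelJet IX m) (JetBundle IX p m) n) : DForm (𝓡 b) B n)
  symmetry : ∃ ξ₁ : VField (modelJet IX m) (JetBundle IX p m), IsProlongation ξ ξ₁ ∧
    DForm.lie ξ₁ (poincareCartan η L) = (DForm.pullback Jet.proj α).d ∧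
    PreservesBoundary j P ξ₁

/-- Noether symmetries for the Hamilton equations, with respect to the semibasic `n`-form `α`
on `Y`. Here `Θ` is the form on the dual jet bundle induced by a Hamiltonian. -/
structure IsNoetherHamilton (Θ : DForm (modelDual IX m) (DualJetBundle IX p m) (n + 1))
    (j : B → DualJetBundle IX p m) (P : DForm (𝓡 b) B n) (ξ : VField (modelY IX m) Y)
    (α : DForm (modelY IX m) Y n) : Prop where
  smooth_field : IsSmoothVF ξ
  smooth_form : α.Smooth
  semibasic : IsSemibasic (p := p) α
  exact : DForm.IsExact (DForm.pullback j (DForm.pullback DualJet.proj α :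
    DForm (modelDual IX m) (DualJetBundle IX p m) n) : DForm (𝓡 b) B n)
  symmetry : ∃ (Ξ : VField (modelLam IX m) (LamBundle IX p m))
    (ξ₁ : VField (modelDual IX m) (DualJetBundle IX p m)),
    IsAlphaLift ξ α Ξ ∧ IsSmoothVF ξ₁ ∧ IsRelated Lam.toDual Ξ ξ₁ ∧
    DForm.lie ξ₁ Θ = (DForm.pullback DualJet.proj α).d ∧
    PreservesBoundary j P ξ₁

/-- The form `Θ_h = h^* Θ` on the dual jet bundle induced by a Hamiltonian `h`, where `Θ` is the
Liouville form. -/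
def hamiltonForm (h : DualJetBundle IX p m → LamBundle IX p m) :
    DForm (modelDual IX m) (DualJetBundle IX p m) (n + 1) :=
  DForm.pullback h (liouville IX p)

/-- The image of a vector field under a diffeomorphism. -/
def pushforward {E E' H H' M M' : Type*} [NormedAddCommGroup E] [NormedSpace ℝ E]
    [NormedAddCommGroup E'] [NormedSpace ℝ E'] [TopologicalSpace H] [TopologicalSpace H']
    {I : ModelWithCorners ℝ E H} {I' : ModelWithCorners ℝ E' H'} [TopologicalSpace M]
    [ChartedSpace H M] [TopologicalSpace M'] [ChartedSpace H' M'] (f : M ≃ₘ^∞⟮I, I'⟯ M')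
    (ξ : VField I M) : VField I' M' :=
  fun w => mfderiv I I' f (f.symm w) (ξ (f.symm w))

end FieldTheory

end FieldTheory

end

open FieldTheory

set_option linter.unusedSectionVars false

noncomputable section

namespace FieldTheory

/-! Apart from the comparison of prolongations with lifts, the theorem is transport of structure.
The Legendre transformation covers the identity of Y, so it pulls the Liouville form Θ back to Θ_L
(`pullback_Leg_liouville`), and h = Leg_L ∘ leg_L⁻¹ turns this into Θ_h = (leg_L⁻¹)^*Θ_L
(`hamiltonForm_eq`). Exterior derivative, contraction and Lie derivative are natural for related
vector fields (`DForm.pullback_lie`), so leg_L and the induced diffeomorphism of the boundary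
submanifolds carry every clause in the definition of a Cartan symmetry
(`IsCartanSymmetry.transport`).

For Noether symmetries, Θ and Θ_L are treated together as forms ℓ along a projection to Y.
Contracting such a form with a field Ξ over ξ only sees ξ, so the equation £_Ξ Θ = dα is a condition
on each single vector Ξ(z), called `LiftsAt`. In coordinates it says that the derivative of ℓ along
Ξ(z) is dα minus the derivation of ℓ by Dξ (`liftsAt_iff`). For the Liouville form, ℓ is the fibre
coordinate itself, so the equation prescribes the fibre velocity of Ξ: an α-lift is unique, and it
exists at w exactly when the prescribed velocity is annihilated by any two vertical vectors. This
holds on the image of Leg_L, where TLeg_L(ξ^(1)) solves the equation. It propagates along the fibres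
of μ, because two points of a fibre differ by a semibasic form, whose derivation by Dξ is
annihilated by two vertical vectors (`liftRep_sub_mem`). As leg_L is onto, the lift exists
everywhere.

For the lift to be μ-projectable, Dξ must preserve vertical vectors, that is, ξ must be projectable
to X. Hyperregularity forces this (`fst_fieldDeriv_eq_zero`). Suppose that Dξ sends a vertical
vector f to a non-vertical one, and move an (n+1)-plane containing f by the linearised flow of ξ.
For small s > 0 it is the graph of a slope v(s); these slopes follow the prolonged field and are
unbounded as s → 0. Their images under Leg_L solve an affine differential equation, so they stay
bounded by Gronwall's inequality. But leg_L⁻¹ is continuous on the whole dual bundle and recovers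
v(s) from them, a contradiction (`fst_apply_eq_zero_of_affine`).

Conversely, a symmetry of the Hamilton equations, pulled back to Z, gives a field over ξ along which
the Lie derivative of Θ_L is dα. It must be shown to be ξ^(1). Evaluating the equation on a plane of
fixed slope and differentiating along the fibre shows that the Hessian of L in the velocities
annihilates the difference between the velocity of the field and that of the prolongation
(`velocity_eq`). Since leg_L is an immersion, the difference is zero (`isProlongation_of_liftsAt`).
-/

lemma minSmoothness_two_le_infty : minSmoothness ℝ 2 ≤ (∞ : WithTop ℕ∞) := by
  rw [minSmoothness_of_isRCLikeNormedField]
  exact WithTop.coe_le_coe.2 (le_top : (2 : ℕ∞) ≤ ⊤)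

/-! ### Smoothness of the pullback of alternating forms. -/

section Pullback

variable {E E' : Type*} [NormedAddCommGroup E] [NormedSpace ℝ E] [FiniteDimensional ℝ E]
  [NormedAddCommGroup E'] [NormedSpace ℝ E'] [FiniteDimensional ℝ E'] {k : ℕ}

/-- In finite dimension the alternating maps are complemented in the multilinear ones, so smoothness
can be checked for multilinear maps and projected back. -/
lemma contDiff_alternating_pullback : ContDiff ℝ ∞
    (fun x : (E' [⋀^Fin k]→L[ℝ] ℝ) × (E →L[ℝ] E') => x.1.compContinuousLinearMap x.2) := by
  have h1 : ContDiff ℝ ∞ (fun x : (E' [⋀^Fin k]→L[ℝ] ℝ) × (E →L[ℝ] E') =>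
      (ContinuousMultilinearMap.compContinuousLinearMapContinuousMultilinear ℝ
        (fun _ : Fin k => E) (fun _ : Fin k => E') ℝ (fun _ => x.2))
        x.1.toContinuousMultilinearMap) := by
    refine ContDiff.clm_apply ?_ ?_
    · exact (ContinuousMultilinearMap.contDiff _).comp
        (contDiff_pi.2 fun _ => contDiff_snd)
    · exact (ContinuousAlternatingMap.toContinuousMultilinearMapLI
        (𝕜 := ℝ) (E := E') (F := ℝ) (ι := Fin k)).contDiff.comp contDiff_fst
  let L := (ContinuousAlternatingMap.toContinuousMultilinearMapLI
        (𝕜 := ℝ) (E := E) (F := ℝ) (ι := Fin k))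
  obtain ⟨P, hP⟩ := Submodule.ClosedComplemented.of_finiteDimensional
    (LinearMap.range L.toLinearMap)
  let g := L.equivRange.symm.toContinuousLinearEquiv.toContinuousLinearMap ∘L P
  have hg : ∀ w, g (L w) = w := by
    intro w
    have h3 : P (L w) = L.equivRange w := hP (L.equivRange w)
    change L.equivRange.symm (P (L w)) = w
    rw [h3, LinearIsometryEquiv.symm_apply_apply]
  have h4 := g.contDiff.comp h1
  have h5 : (fun x : (E' [⋀^Fin k]→L[ℝ] ℝ) × (E →L[ℝ] E') => x.1.compContinuousLinearMap x.2) =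
      g ∘ (fun x : (E' [⋀^Fin k]→L[ℝ] ℝ) × (E →L[ℝ] E') =>
      (ContinuousMultilinearMap.compContinuousLinearMapContinuousMultilinear ℝ
        (fun _ : Fin k => E) (fun _ : Fin k => E') ℝ (fun _ => x.2))
        x.1.toContinuousMultilinearMap) := funext fun x => (hg _).symm
  rw [h5]
  exact h4

variable {V : Type*} [NormedAddCommGroup V] [NormedSpace ℝ V]

lemma _root_.ContDiffWithinAt.alternating_pullback {w : V → E' [⋀^Fin k]→L[ℝ] ℝ}
    {A : V → E →L[ℝ] E'} {s : Set V} {x : V} (hw : ContDiffWithinAt ℝ ∞ w s x)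
    (hA : ContDiffWithinAt ℝ ∞ A s x) :
    ContDiffWithinAt ℝ ∞ (fun v => (w v).compContinuousLinearMap (A v)) s x :=
  contDiff_alternating_pullback.contDiffAt.comp_contDiffWithinAt x (hw.prodMk hA)

end Pullback

/-! ### Maps and forms in charts of manifolds with boundary. -/

section Charts

variable {E H M : Type*} [NormedAddCommGroup E] [NormedSpace ℝ E] [TopologicalSpace H]
  {I : ModelWithCorners ℝ E H} [TopologicalSpace M] [ChartedSpace H M]
  {e : OpenPartialHomeomorph M H}
  {E' H' M' : Type*} [NormedAddCommGroup E'] [NormedSpace ℝ E'] [TopologicalSpace H']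
  {I' : ModelWithCorners ℝ E' H'} [TopologicalSpace M'] [ChartedSpace H' M']
  {e' : OpenPartialHomeomorph M' H'}

lemma dChart_inverse_apply (he : e ∈ IsManifold.maximalAtlas I ∞ M) {x : M} (hx : x ∈ e.source)
    (v : TangentSpace I x) : (dChart I e x).inverse (dChart I e x v) = v := by
  obtain ⟨D, hD⟩ := isInvertible_dChart he hx
  rw [← hD, ContinuousLinearMap.inverse_equiv]
  exact D.symm_apply_apply v

lemma dChart_apply_inverse (he : e ∈ IsManifold.maximalAtlas I ∞ M) {x : M} (hx : x ∈ e.source)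
    (v : E) : dChart I e x ((dChart I e x).inverse v) = v := by
  obtain ⟨D, hD⟩ := isInvertible_dChart he hx
  rw [← hD, ContinuousLinearMap.inverse_equiv]
  exact D.apply_symm_apply v

lemma dChart_injective (he : e ∈ IsManifold.maximalAtlas I ∞ M) {x : M} (hx : x ∈ e.source) :
    Function.Injective (dChart I e x) := fun v w h => by
  rw [← dChart_inverse_apply he hx v, h, dChart_inverse_apply he hx]

lemma hasMFDerivAt_dChart (he : e ∈ IsManifold.maximalAtlas I ∞ M) {x : M} (hx : x ∈ e.source) :
    HasMFDerivAt I 𝓘(ℝ, E) (e.extend I) x (dChart I e x) :=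
  (hasMFDerivAt_extend he hx).mdifferentiableAt.hasMFDerivAt

lemma uniqueDiffWithinAt_extend (x : M) : UniqueDiffWithinAt ℝ (range I) (e.extend I x) :=
  I.uniqueDiffOn _ (mem_range_self _)

lemma hasMFDerivWithinAt_extend_symm (he : e ∈ IsManifold.maximalAtlas I ∞ M) {x : M}
    (hx : x ∈ e.source) :
    HasMFDerivWithinAt 𝓘(ℝ, E) I (e.extend I).symm (range I) (e.extend I x)
      ((dChart I e x).inverse : E →L[ℝ] TangentSpace I x) := by
  have ht : e.extend I x ∈ (e.extend I).target :=
    (e.extend I).map_source (by rwa [e.extend_source])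
  have h0 : (e.extend I).symm (e.extend I x) = x := e.extend_left_inv hx
  have hs : (e.extend I).target ∈ 𝓝[range I] (e.extend I x) := e.extend_target_mem_nhdsWithin hx
  have h1 : MDifferentiableWithinAt 𝓘(ℝ, E) I (e.extend I).symm (range I) (e.extend I x) := by
    have h2 := (contMDiffOn_extend_symm he).mdifferentiableOn (by simp)
    rw [← e.extend_target'] at h2
    exact (h2 _ ht).mono_of_mem_nhdsWithin hs
  obtain ⟨D, h3⟩ : ∃ D : E →L[ℝ] E,
      HasMFDerivWithinAt 𝓘(ℝ, E) I (e.extend I).symm (range I) (e.extend I x) D :=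
    ⟨_, h1.hasMFDerivWithinAt⟩
  -- The point reached by chart and inverse chart equals x only propositionally, and the tangent
  -- space depends on it. Stating the fact for every y = x and substituting transports it; the same
  -- device recurs below.
  have h4' : ∀ y, y = x → HasMFDerivAt I 𝓘(ℝ, E) (e.extend I) y (dChart I e x) := by
    rintro _ rfl
    exact hasMFDerivAt_dChart he hx
  have h5 := (h4' _ h0).comp_hasMFDerivWithinAt _ h3
  have h6 : HasMFDerivWithinAt 𝓘(ℝ, E) 𝓘(ℝ, E) (e.extend I ∘ (e.extend I).symm) (range I)
      (e.extend I x) (ContinuousLinearMap.id ℝ E) := by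
    refine (hasMFDerivWithinAt_id _ _).congr_of_eventuallyEq ?_ ?_
    · filter_upwards [hs] with v hv
      exact (e.extend I).right_inv hv
    · exact (e.extend I).right_inv ht
  have h7 : (dChart I e x : E →L[ℝ] E) ∘L D = ContinuousLinearMap.id ℝ E :=
    (uniqueDiffWithinAt_extend (I := I) (e := e) x).eq h5.hasFDerivWithinAt
      h6.hasFDerivWithinAt
  have h8 : D = (dChart I e x).inverse := by
    refine ContinuousLinearMap.ext fun v => ?_
    apply dChart_injective he hx
    refine Eq.trans ?_ (dChart_apply_inverse he hx v).symm
    exact DFunLike.congr_fun h7 v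
  rw [← h8]
  exact h3

variable (I I' e e') in
/-- The coordinate representative of a map in two charts. -/
def mapRep (f : M → M') : E → E' := e'.extend I' ∘ f ∘ (e.extend I).symm

lemma mapRep_extend {f : M → M'} {x : M} (hx : x ∈ e.source) :
    mapRep I e I' e' f (e.extend I x) = e'.extend I' (f x) := by
  exact congrArg (fun y => e'.extend I' (f y)) (e.extend_left_inv hx)

lemma mapsTo_mapRep (f : M → M') : MapsTo (mapRep I e I' e' f) (range I) (range I') :=
  fun _ _ => mem_range_self _

lemma hasFDerivWithinAt_mapRep (he : e ∈ IsManifold.maximalAtlas I ∞ M)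
    (he' : e' ∈ IsManifold.maximalAtlas I' ∞ M') {f : M → M'} {x : M} (hx : x ∈ e.source)
    (hx' : f x ∈ e'.source) (hf : MDifferentiableAt I I' f x) :
    HasFDerivWithinAt (mapRep I e I' e' f)
      ((dChart I' e' (f x) ∘L mfderiv I I' f x) ∘L (dChart I e x).inverse) (range I)
      (e.extend I x) := by
  have h0 : (e.extend I).symm (e.extend I x) = x := e.extend_left_inv hx
  have h1 := (hasMFDerivAt_dChart he' hx').comp x hf.hasMFDerivAt
  have h2 : ∀ y, y = x → HasMFDerivAt I 𝓘(ℝ, E') (e'.extend I' ∘ f) y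
      (dChart I' e' (f x) ∘L mfderiv I I' f x) := by
    rintro _ rfl
    exact h1
  exact ((h2 _ h0).comp_hasMFDerivWithinAt _
    (hasMFDerivWithinAt_extend_symm he hx)).hasFDerivWithinAt

lemma fderivWithin_mapRep (he : e ∈ IsManifold.maximalAtlas I ∞ M)
    (he' : e' ∈ IsManifold.maximalAtlas I' ∞ M') {f : M → M'} {x : M} (hx : x ∈ e.source)
    (hx' : f x ∈ e'.source) (hf : MDifferentiableAt I I' f x) :
    fderivWithin ℝ (mapRep I e I' e' f) (range I) (e.extend I x) =
      (dChart I' e' (f x) ∘L mfderiv I I' f x) ∘L (dChart I e x).inverse :=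
  (hasFDerivWithinAt_mapRep he he' hx hx' hf).fderivWithin (uniqueDiffWithinAt_extend x)

lemma dChart_mfderiv (he : e ∈ IsManifold.maximalAtlas I ∞ M)
    (he' : e' ∈ IsManifold.maximalAtlas I' ∞ M') {f : M → M'} {x : M} (hx : x ∈ e.source)
    (hx' : f x ∈ e'.source) (hf : MDifferentiableAt I I' f x) (v : TangentSpace I x) :
    dChart I' e' (f x) (mfderiv I I' f x v) =
      fderivWithin ℝ (mapRep I e I' e' f) (range I) (e.extend I x) (dChart I e x v) := by
  rw [fderivWithin_mapRep he he' hx hx' hf]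
  change _ = dChart I' e' (f x) (mfderiv I I' f x ((dChart I e x).inverse (dChart I e x v)))
  rw [dChart_inverse_apply he hx]

lemma contDiffWithinAt_mapRep (he : e ∈ IsManifold.maximalAtlas I ∞ M)
    (he' : e' ∈ IsManifold.maximalAtlas I' ∞ M') {f : M → M'} {x : M} (hx : x ∈ e.source)
    (hx' : f x ∈ e'.source) (hf : ContMDiffAt I I' ∞ f x) :
    ContDiffWithinAt ℝ ∞ (mapRep I e I' e' f) (range I) (e.extend I x) :=
  ((contMDiffAt_iff_of_mem_maximalAtlas he he' hx hx').1 hf).2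

/-- Symmetry of second derivatives, and with it the naturality of d, holds at boundary points
because they are limits of interior points of the model. -/
lemma mem_closure_interior_range (x : M) : e.extend I x ∈ closure (interior (range I)) :=
  I.range_subset_closure_interior (mem_range_self _)

/-- A chart maps the neighbourhoods of a point onto the neighbourhoods of its image relative to
`range I`. All germ identities between coordinate representatives are obtained through this. -/
lemma eventually_extend {P : E → Prop} {x : M} (hx : x ∈ e.source)
    (h : ∀ᶠ y in 𝓝 x, P (e.extend I y)) : ∀ᶠ v in 𝓝[range I] (e.extend I x), P v := by
  rw [← e.map_extend_nhds hx]
  exact h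

lemma contDiffWithinAt_fderivWithin_range {G : Type*} [NormedAddCommGroup G] [NormedSpace ℝ G]
    {F : E → G} {v : E} (hv : v ∈ range I) (hF : ContDiffWithinAt ℝ ∞ F (range I) v) :
    ContDiffWithinAt ℝ ∞ (fderivWithin ℝ F (range I)) (range I) v :=
  hF.fderivWithin_right I.uniqueDiffOn (by simp) hv

namespace DForm

variable {k : ℕ}

/-- The coordinate representative of a form in a chart. -/
def rep (w : DForm I M k) (e : OpenPartialHomeomorph M H) (v : E) : E [⋀^Fin k]→L[ℝ] ℝ :=
  (w ((e.extend I).symm v)).compContinuousLinearMap (dChart I e ((e.extend I).symm v)).inverse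

lemma rep_extend (w : DForm I M k) {x : M} (hx : x ∈ e.source) :
    w.rep e (e.extend I x) = (w x).compContinuousLinearMap (dChart I e x).inverse := by
  have h : ∀ y, y = x → ((w y).compContinuousLinearMap (dChart I e y).inverse :
      E [⋀^Fin k]→L[ℝ] ℝ) = (w x).compContinuousLinearMap (dChart I e x).inverse := by
    rintro y rfl; rfl
  exact h _ (e.extend_left_inv hx)

lemma rep_comp_dChart (he : e ∈ IsManifold.maximalAtlas I ∞ M) (w : DForm I M k) {x : M}
    (hx : x ∈ e.source) :
    (w.rep e (e.extend I x)).compContinuousLinearMap (dChart I e x) = w x := by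
  rw [rep_extend w hx]
  ext v
  change w x (fun i => (dChart I e x).inverse (dChart I e x (v i))) = w x v
  congr 1
  ext1 i
  exact dChart_inverse_apply he hx _

lemma rep_pullback (he : e ∈ IsManifold.maximalAtlas I ∞ M)
    (he' : e' ∈ IsManifold.maximalAtlas I' ∞ M') {f : M → M'} {x : M} (hx : x ∈ e.source)
    (hx' : f x ∈ e'.source) (hf : MDifferentiableAt I I' f x) (w : DForm I' M' k) :
    (pullback (I := I) f w).rep e (e.extend I x) =
      (w.rep e' (mapRep I e I' e' f (e.extend I x))).compContinuousLinearMap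
        (fderivWithin ℝ (mapRep I e I' e' f) (range I) (e.extend I x)) := by
  rw [rep_extend _ hx, mapRep_extend hx, rep_extend _ hx', fderivWithin_mapRep he he' hx hx' hf]
  ext v
  change w (f x) (fun i => mfderiv I I' f x ((dChart I e x).inverse (v i))) =
    w (f x) (fun i => (dChart I' e' (f x)).inverse (dChart I' e' (f x)
      (mfderiv I I' f x ((dChart I e x).inverse (v i)))))
  congr 1
  ext1 i
  exact (dChart_inverse_apply he' hx' _).symm

lemma pullback_id (w : DForm I M k) : pullback (I := I) (fun x : M => x) w = w := by
  funext x
  have h : mfderiv I I (fun x : M => x) x = ContinuousLinearMap.id ℝ _ := mfderiv_id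
  rw [pullback, h]
  rfl

lemma eventually_rep_pullback (he : e ∈ IsManifold.maximalAtlas I ∞ M)
    (he' : e' ∈ IsManifold.maximalAtlas I' ∞ M') {f : M → M'} {x : M} (hx : x ∈ e.source)
    (hx' : f x ∈ e'.source) (hf : ∀ᶠ y in 𝓝 x, MDifferentiableAt I I' f y) (w : DForm I' M' k) :
    (pullback (I := I) f w).rep e =ᶠ[𝓝[range I] (e.extend I x)]
      fun v => (w.rep e' (mapRep I e I' e' f v)).compContinuousLinearMap
        (fderivWithin ℝ (mapRep I e I' e' f) (range I) v) := by
  refine eventually_extend hx ?_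
  filter_upwards [hf, e.open_source.mem_nhds hx,
    hf.self_of_nhds.continuousAt.preimage_mem_nhds (e'.open_source.mem_nhds hx')] with y h1 h2 h3
  exact rep_pullback he he' h2 h3 h1 w

variable [FiniteDimensional ℝ E] [FiniteDimensional ℝ E']

lemma _root_.ContMDiffAt.eventually_mdifferentiableAt [IsManifold I 1 M] [IsManifold I' 1 M']
    {f : M → M'} {x : M} (hf : ContMDiffAt I I' ∞ f x) :
    ∀ᶠ y in 𝓝 x, MDifferentiableAt I I' f y := by
  have h1 : ContMDiffAt I I' 1 f x := hf.of_le (by simp)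
  filter_upwards [(contMDiffAt_iff_contMDiffAt_nhds (by simp)).1 h1] with y hy
  exact hy.mdifferentiableAt (by simp)

lemma contDiffWithinAt_rep_pullback [IsManifold I 1 M] [IsManifold I' 1 M']
    (he : e ∈ IsManifold.maximalAtlas I ∞ M)
    (he' : e' ∈ IsManifold.maximalAtlas I' ∞ M') {f : M → M'} {x : M} (hx : x ∈ e.source)
    (hx' : f x ∈ e'.source) (hf : ContMDiffAt I I' ∞ f x) {w : DForm I' M' k}
    (hw : ContDiffWithinAt ℝ ∞ (w.rep e') (range I') (e'.extend I' (f x))) :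
    ContDiffWithinAt ℝ ∞ ((pullback (I := I) f w).rep e) (range I) (e.extend I x) := by
  have h1 := eventually_rep_pullback he he' hx hx' hf.eventually_mdifferentiableAt w
  refine ContDiffWithinAt.congr_of_eventuallyEq ?_ h1 (h1.self_of_nhdsWithin (mem_range_self _))
  have h2 := contDiffWithinAt_mapRep he he' hx hx' hf
  refine ContDiffWithinAt.alternating_pullback ?_
    (contDiffWithinAt_fderivWithin_range (mem_range_self _) h2)
  rw [← mapRep_extend (e := e) (I := I) (e' := e') (I' := I') (f := f) hx] at hw
  exact hw.comp _ h2 (mapsTo_mapRep f)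

/-- The representative of a pullback is the pullback of the representative near the point, which is
all that the exterior derivative sees; naturality of d then holds on the model spaces. -/
lemma extDerivWithin_rep_pullback [IsManifold I 1 M] [IsManifold I' 1 M']
    (he : e ∈ IsManifold.maximalAtlas I ∞ M)
    (he' : e' ∈ IsManifold.maximalAtlas I' ∞ M') {f : M → M'} {x : M} (hx : x ∈ e.source)
    (hx' : f x ∈ e'.source) (hf : ContMDiffAt I I' ∞ f x) {w : DForm I' M' k}
    (hw : ContDiffWithinAt ℝ ∞ (w.rep e') (range I') (e'.extend I' (f x))) :
    extDerivWithin ((pullback (I := I) f w).rep e) (range I) (e.extend I x) =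
      (extDerivWithin (w.rep e') (range I') (e'.extend I' (f x))).compContinuousLinearMap
        (fderivWithin ℝ (mapRep I e I' e' f) (range I) (e.extend I x)) := by
  have h1 := eventually_rep_pullback he he' hx hx' hf.eventually_mdifferentiableAt w
  rw [h1.extDerivWithin_eq_of_mem (mem_range_self _)]
  have h2 := contDiffWithinAt_mapRep he he' hx hx' hf
  rw [← mapRep_extend (e := e) (I := I) (e' := e') (I' := I') (f := f) hx] at hw ⊢
  exact extDerivWithin_pullback (r := ∞) (hw.differentiableWithinAt (by simp)) h2 minSmoothness_two_le_infty
    I.uniqueDiffOn (mem_closure_interior_range x) (mem_range_self _) (mapsTo_mapRep f)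

/-- Connects the definitions of `SmoothAt` and `d`, which are tied to the preferred chart at x, with
`rep`, which makes sense in any chart of the maximal atlas. -/
lemma eventually_inChart_eq_rep [IsManifold I ∞ M] (w : DForm I M k) (x : M) :
    w.inChart x =ᶠ[𝓝[range I] (extChartAt I x x)] w.rep (chartAt H x) := by
  have he : chartAt H x ∈ IsManifold.maximalAtlas I ∞ M := IsManifold.chart_mem_maximalAtlas x
  refine eventually_extend (e := chartAt H x) (mem_chart_source H x) ?_
  filter_upwards [(chartAt H x).open_source.mem_nhds (mem_chart_source H x)] with y hy
  rw [inChart, rep]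
  have h1 := (hasMFDerivWithinAt_extend_symm he hy).mfderivWithin
    (uniqueDiffWithinAt_extend (I := I) y).uniqueMDiffWithinAt
  have h0 : ((chartAt H x).extend I).symm ((chartAt H x).extend I y) = y :=
    (chartAt H x).extend_left_inv hy
  change (w (((chartAt H x).extend I).symm ((chartAt H x).extend I y))).compContinuousLinearMap
    (mfderivWithin 𝓘(ℝ, E) I ((chartAt H x).extend I).symm (range I)
      ((chartAt H x).extend I y)) = _
  rw [h1, h0]
  rfl

end DForm

end Charts

/-- Currying of the first argument of an alternating map, as a continuous linear map. -/
def curryLeftL (E : Type*) [NormedAddCommGroup E] [NormedSpace ℝ E] (k : ℕ) :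
    (E [⋀^Fin (k + 1)]→L[ℝ] ℝ) →L[ℝ] (E →L[ℝ] E [⋀^Fin k]→L[ℝ] ℝ) :=
  ContinuousAlternatingMap.curryLeftLI.toContinuousLinearMap

lemma contDiff_curryLeft {E : Type*} [NormedAddCommGroup E] [NormedSpace ℝ E] {k : ℕ} :
    ContDiff ℝ ∞ (fun w : E [⋀^Fin (k + 1)]→L[ℝ] ℝ => w.curryLeft) := by
  have h : ContDiff ℝ ∞ (curryLeftL E k) := ContinuousLinearMap.contDiff _
  exact h

/-! ### Vector fields in charts, and naturality of d, contraction and Lie derivative. -/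

section Charts2

variable {E H M : Type*} [NormedAddCommGroup E] [NormedSpace ℝ E] [TopologicalSpace H]
  {I : ModelWithCorners ℝ E H} [TopologicalSpace M] [ChartedSpace H M]
  {e : OpenPartialHomeomorph M H}
  {E' H' M' : Type*} [NormedAddCommGroup E'] [NormedSpace ℝ E'] [TopologicalSpace H']
  {I' : ModelWithCorners ℝ E' H'} [TopologicalSpace M'] [ChartedSpace H' M']
  {e' : OpenPartialHomeomorph M' H'}

namespace VField

/-- The coordinate representative of a vector field in a chart. -/
def rep (ξ : VField I M) (e : OpenPartialHomeomorph M H) (v : E) : E :=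
  dChart I e ((e.extend I).symm v) (ξ ((e.extend I).symm v))

lemma rep_extend (ξ : VField I M) {x : M} (hx : x ∈ e.source) :
    rep ξ e (e.extend I x) = dChart I e x (ξ x) := by
  have h : ∀ y, y = x → (dChart I e y (ξ y) : E) = dChart I e x (ξ x) := by
    rintro y rfl; rfl
  exact h _ (e.extend_left_inv hx)

/-- The tangent map of the chart turns the smooth section into a smooth map to E × E, whose second
component is the representative. -/
lemma contDiffWithinAt_rep [IsManifold I 1 M] (he : e ∈ IsManifold.maximalAtlas I ∞ M) {x : M}
    (hx : x ∈ e.source) {ξ : VField I M} (hξ : IsSmoothVF ξ) :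
    ContDiffWithinAt ℝ ∞ (rep ξ e) (range I) (e.extend I x) := by
  have h1 : ContMDiffOn I.tangent 𝓘(ℝ, E).tangent ∞
      (tangentMapWithin I 𝓘(ℝ, E) (e.extend I) e.source)
      (Bundle.TotalSpace.proj ⁻¹' e.source) :=
    (e.contMDiffOn_extend he).contMDiffOn_tangentMapWithin (by simp) e.open_source.uniqueMDiffOn
  have h2 : ContMDiffOn I 𝓘(ℝ, E).tangent ∞
      (fun y => tangentMapWithin I 𝓘(ℝ, E) (e.extend I) e.source ⟨y, ξ y⟩) e.source :=
    h1.comp hξ.contMDiffOn (fun y hy => hy)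
  have h3 : ContMDiffOn I 𝓘(ℝ, E) ∞ (fun y => (dChart I e y (ξ y) : E)) e.source := by
    refine ((contMDiff_snd_tangentBundle_modelSpace E 𝓘(ℝ, E)).comp_contMDiffOn h2).congr ?_
    intro y hy
    change dChart I e y (ξ y) = mfderivWithin I 𝓘(ℝ, E) (e.extend I) e.source y (ξ y)
    rw [mfderivWithin_of_isOpen e.open_source hy]
    rfl
  have h4 := (contMDiffWithinAt_iff_source_of_mem_maximalAtlas he hx).1 (h3 x hx)
  refine (h4.contDiffWithinAt).mono_of_mem_nhdsWithin ?_
  refine Filter.inter_mem ?_ self_mem_nhdsWithin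
  filter_upwards [e.extend_target_mem_nhdsWithin (I := I) hx] with v hv
  have := (e.extend I).map_target hv
  rwa [e.extend_source] at this

/-- Here the tangent map of the inverse chart takes the graph of the representative back to the
section; one chart around each point is enough. -/
lemma isSmoothVF_of_rep [IsManifold I 1 M] {ξ : VField I M}
    (h : ∀ x, ∃ e ∈ IsManifold.maximalAtlas I ∞ M, x ∈ e.source ∧
      ContDiffWithinAt ℝ ∞ (rep ξ e) (range I) (e.extend I x)) : IsSmoothVF ξ := by
  intro x
  obtain ⟨e, he, hx, hξ⟩ := h x
  have ht : e.extend I x ∈ (e.extend I).target :=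
    (e.extend I).map_source (by rwa [e.extend_source])
  have hsm := contMDiffOn_extend_symm he
  rw [← e.extend_target'] at hsm
  have hU : UniqueDiffOn ℝ (e.extend I).target := by
    rw [e.extend_target]
    exact I.uniqueDiffOn_preimage e.open_target
  have h1 := hsm.contMDiffOn_tangentMapWithin (m := ∞) (by simp) hU.uniqueMDiffOn
  let g : E → E := rep ξ e
  have h2 : ContMDiffWithinAt 𝓘(ℝ, E) 𝓘(ℝ, E).tangent ∞
      (fun v => (⟨v, g v⟩ : TangentBundle 𝓘(ℝ, E) E)) (e.extend I).target (e.extend I x) :=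
    contMDiffWithinAt_vectorSpace_iff_contDiffWithinAt.2
      (hξ.mono (e.extend_target_subset_range))
  have h3 := (h1 ⟨e.extend I x, g (e.extend I x)⟩ ht).comp (e.extend I x) h2
    (fun v hv => hv)
  have h4 := h3.comp_of_eq (f := e.extend I) (x := x) (s := e.source)
    ((e.contMDiffOn_extend he) x hx)
    (fun y hy => (e.extend I).map_source (by rwa [e.extend_source])) rfl
  have h5 := h4.contMDiffAt (e.open_source.mem_nhds hx)
  refine h5.congr_of_eventuallyEq ?_
  filter_upwards [e.open_source.mem_nhds hx] with y hy
  have ht' : e.extend I y ∈ (e.extend I).target :=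
    (e.extend I).map_source (by rwa [e.extend_source])
  have h6 := ((hasMFDerivWithinAt_extend_symm he hy).mono
    (e.extend_target_subset_range)).mfderivWithin (hU _ ht').uniqueMDiffWithinAt
  have h0 : (e.extend I).symm (e.extend I y) = y := e.extend_left_inv hy
  have h7 : ∀ z (u : E), z = y → u = ξ y → (⟨y, ξ y⟩ : TangentBundle I M) = ⟨z, u⟩ := by
    rintro _ _ rfl rfl; rfl
  refine h7 _ _ h0 ?_
  change mfderivWithin 𝓘(ℝ, E) I (e.extend I).symm (e.extend I).target (e.extend I y)
    (g (e.extend I y)) = ξ y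
  rw [h6, show g (e.extend I y) = dChart I e y (ξ y) from rep_extend ξ hy]
  exact dChart_inverse_apply he hy _

end VField

namespace DForm

variable {k : ℕ}

variable [FiniteDimensional ℝ E] [FiniteDimensional ℝ E']

/-- A change of chart is the pullback by the identity, read in two different charts. -/
lemma contDiffWithinAt_rep_iff [IsManifold I 1 M] {e₁ : OpenPartialHomeomorph M H}
    (he : e ∈ IsManifold.maximalAtlas I ∞ M) (he₁ : e₁ ∈ IsManifold.maximalAtlas I ∞ M) {x : M}
    (hx : x ∈ e.source) (hx₁ : x ∈ e₁.source) {w : DForm I M k} :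
    ContDiffWithinAt ℝ ∞ (w.rep e) (range I) (e.extend I x) ↔
      ContDiffWithinAt ℝ ∞ (w.rep e₁) (range I) (e₁.extend I x) := by
  constructor <;> intro h
  · have := contDiffWithinAt_rep_pullback (f := fun x : M => x) he₁ he hx₁ hx contMDiffAt_id h
    rwa [pullback_id] at this
  · have := contDiffWithinAt_rep_pullback (f := fun x : M => x) he he₁ hx hx₁ contMDiffAt_id h
    rwa [pullback_id] at this

lemma smoothAt_iff [IsManifold I ∞ M] (he : e ∈ IsManifold.maximalAtlas I ∞ M) {x : M}
    (hx : x ∈ e.source) {w : DForm I M k} :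
    w.SmoothAt x ↔ ContDiffWithinAt ℝ ∞ (w.rep e) (range I) (e.extend I x) := by
  have : IsManifold I 1 M := IsManifold.of_le (n := ∞) (by simp)
  rw [contDiffWithinAt_rep_iff he (IsManifold.chart_mem_maximalAtlas x) hx (mem_chart_source H x)]
  have h := eventually_inChart_eq_rep w x
  exact ⟨fun h1 => h1.congr_of_eventuallyEq h.symm (h.self_of_nhdsWithin (mem_range_self _)).symm,
    fun h1 => h1.congr_of_eventuallyEq h (h.self_of_nhdsWithin (mem_range_self _))⟩

/-- Independence of d from the chart is again naturality under the identity, with the preferred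
chart on one side and e on the other. -/
lemma d_eq_rep [IsManifold I ∞ M] (he : e ∈ IsManifold.maximalAtlas I ∞ M) {x : M}
    (hx : x ∈ e.source) {w : DForm I M k} (hw : w.SmoothAt x) :
    w.d x = (extDerivWithin (w.rep e) (range I) (e.extend I x)).compContinuousLinearMap
      (dChart I e x) := by
  have : IsManifold I 1 M := IsManifold.of_le (n := ∞) (by simp)
  have hc : chartAt H x ∈ IsManifold.maximalAtlas I ∞ M := IsManifold.chart_mem_maximalAtlas x
  have h := eventually_inChart_eq_rep w x
  have h1 := extDerivWithin_rep_pullback (f := fun x : M => x) hc he (mem_chart_source H x) hx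
    contMDiffAt_id ((smoothAt_iff he hx).1 hw)
  rw [pullback_id, fderivWithin_mapRep (f := fun x : M => x) hc he (mem_chart_source H x) hx
    mdifferentiableAt_id] at h1
  have h2 : w.d x = (extDerivWithin (w.rep (chartAt H x)) (range I)
      ((chartAt H x).extend I x)).compContinuousLinearMap (dChart I (chartAt H x) x) := by
    rw [d, h.extDerivWithin_eq_of_mem (mem_range_self _)]
    rfl
  rw [h2, h1]
  ext v
  refine congrArg (extDerivWithin (w.rep e) (range I) (e.extend I x)) ?_
  funext i
  have h3 : mfderiv I I (fun x : M => x) x = ContinuousLinearMap.id ℝ _ := mfderiv_id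
  rw [h3]
  exact congrArg (dChart I e x) (dChart_inverse_apply hc (mem_chart_source H x) (v i))

lemma SmoothAt.pullback [IsManifold I ∞ M] [IsManifold I' ∞ M'] {f : M → M'} {x : M}
    (hf : ContMDiffAt I I' ∞ f x) {w : DForm I' M' k} (hw : w.SmoothAt (f x)) :
    (DForm.pullback (I := I) f w).SmoothAt x := by
  have : IsManifold I 1 M := IsManifold.of_le (n := ∞) (by simp)
  have : IsManifold I' 1 M' := IsManifold.of_le (n := ∞) (by simp)
  have hc : chartAt H x ∈ IsManifold.maximalAtlas I ∞ M := IsManifold.chart_mem_maximalAtlas x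
  have hc' : chartAt H' (f x) ∈ IsManifold.maximalAtlas I' ∞ M' :=
    IsManifold.chart_mem_maximalAtlas _
  rw [smoothAt_iff hc (mem_chart_source H x)]
  rw [smoothAt_iff hc' (mem_chart_source H' _)] at hw
  exact contDiffWithinAt_rep_pullback hc hc' (mem_chart_source H x) (mem_chart_source H' _) hf hw

lemma d_pullback [IsManifold I ∞ M] [IsManifold I' ∞ M'] {f : M → M'} {x : M}
    (hf : ContMDiffAt I I' ∞ f x) {w : DForm I' M' k} (hw : w.SmoothAt (f x)) :
    (DForm.pullback (I := I) f w).d x = DForm.pullback (I := I) f w.d x := by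
  have : IsManifold I 1 M := IsManifold.of_le (n := ∞) (by simp)
  have : IsManifold I' 1 M' := IsManifold.of_le (n := ∞) (by simp)
  have hc : chartAt H x ∈ IsManifold.maximalAtlas I ∞ M := IsManifold.chart_mem_maximalAtlas x
  have hc' : chartAt H' (f x) ∈ IsManifold.maximalAtlas I' ∞ M' :=
    IsManifold.chart_mem_maximalAtlas _
  rw [d_eq_rep hc (mem_chart_source H x) (hw.pullback hf),
    extDerivWithin_rep_pullback hc hc' (mem_chart_source H x) (mem_chart_source H' _) hf
      ((smoothAt_iff hc' (mem_chart_source H' _)).1 hw), DForm.pullback,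
    d_eq_rep hc' (mem_chart_source H' _) hw]
  ext v
  refine congrArg (extDerivWithin (w.rep (chartAt H' (f x))) (range I') _) ?_
  funext i
  exact (dChart_mfderiv hc hc' (mem_chart_source H x) (mem_chart_source H' _)
    (hf.mdifferentiableAt (by simp)) (v i)).symm

lemma rep_interior (he : e ∈ IsManifold.maximalAtlas I ∞ M) {x : M}
    (hx : x ∈ e.source) (ξ : VField I M) (w : DForm I M (k + 1)) :
    (interior ξ w).rep e (e.extend I x) =
      (w.rep e (e.extend I x)).curryLeft (VField.rep ξ e (e.extend I x)) := by
  rw [rep_extend _ hx, rep_extend _ hx, VField.rep_extend _ hx]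
  ext v
  change w x (Matrix.vecCons (ξ x) fun i => (dChart I e x).inverse (v i)) =
    w x fun i => (dChart I e x).inverse ((Matrix.vecCons (dChart I e x (ξ x)) v : Fin (k + 1) → E) i)
  congr 1
  funext i
  refine Fin.cases ?_ (fun i => rfl) i
  exact (dChart_inverse_apply he hx _).symm

lemma SmoothAt.interior [IsManifold I ∞ M] {ξ : VField I M} (hξ : IsSmoothVF ξ)
    {w : DForm I M (k + 1)} {x : M} (hw : w.SmoothAt x) : (interior ξ w).SmoothAt x := by
  have hc : chartAt H x ∈ IsManifold.maximalAtlas I ∞ M := IsManifold.chart_mem_maximalAtlas x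
  have hx := mem_chart_source H x
  rw [smoothAt_iff hc hx] at hw ⊢
  have h1 : (DForm.interior ξ w).rep (chartAt H x) =ᶠ[𝓝[range I] ((chartAt H x).extend I x)]
      fun v => (w.rep (chartAt H x) v).curryLeft (VField.rep ξ (chartAt H x) v) := by
    refine eventually_extend hx ?_
    filter_upwards [(chartAt H x).open_source.mem_nhds hx] with y hy
    exact rep_interior hc hy ξ w
  refine ContDiffWithinAt.congr_of_eventuallyEq ?_ h1 (h1.self_of_nhdsWithin (mem_range_self _))
  refine ContDiffWithinAt.clm_apply ?_ (VField.contDiffWithinAt_rep hc hx hξ)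
  exact contDiff_curryLeft.contDiffAt.comp_contDiffWithinAt _ hw

lemma pullback_interior {f : M → M'} {ξ : VField I M} {ξ' : VField I' M'}
    (h : IsRelated f ξ ξ') (w : DForm I' M' (k + 1)) :
    pullback f (interior ξ' w) = interior ξ (pullback f w) := by
  funext x
  ext v
  change w (f x) (Matrix.vecCons (ξ' (f x)) fun i => mfderiv I I' f x (v i)) =
    w (f x) fun i => mfderiv I I' f x
      ((Matrix.vecCons (ξ x) v : Fin (k + 1) → TangentSpace I x) i)
  congr 1
  funext i
  refine Fin.cases ?_ (fun i => rfl) i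
  exact (h x).symm

lemma pullback_add (f : M → M') (w w' : DForm I' M' k) :
    (pullback f (w + w') : DForm I M k) = pullback f w + pullback f w' := rfl

lemma Smooth.d_pullback [IsManifold I ∞ M] [IsManifold I' ∞ M'] {f : M → M'}
    (hf : ContMDiff I I' ∞ f) {w : DForm I' M' k} (hw : w.Smooth) :
    (DForm.pullback f w : DForm I M k).d = DForm.pullback f w.d :=
  funext fun x => DForm.d_pullback (hf x) (hw (f x))

/-- Each ingredient of Cartan's formula is natural: d under smooth maps, contraction under related
fields. -/
lemma pullback_lie [IsManifold I ∞ M] [IsManifold I' ∞ M'] {f : M → M'}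
    (hf : ContMDiff I I' ∞ f) {ξ : VField I M} {ξ' : VField I' M'} (hξ' : IsSmoothVF ξ')
    (h : IsRelated f ξ ξ') {w : DForm I' M' k} (hw : w.Smooth) :
    pullback f (lie ξ' w) = lie ξ (pullback f w : DForm I M k) := by
  cases k with
  | zero =>
    change pullback f (interior ξ' w.d) = interior ξ (DForm.d _)
    rw [hw.d_pullback hf, pullback_interior h]
  | succ k =>
    change pullback f ((interior ξ' w).d + interior ξ' w.d) =
      (interior ξ _).d + interior ξ (DForm.d _)
    rw [hw.d_pullback hf, ← pullback_interior h w, ← pullback_interior h,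
      Smooth.d_pullback hf (fun x => (hw x).interior hξ'), pullback_add]

lemma pullback_comp {E₂ H₂ M₂ : Type*} [NormedAddCommGroup E₂] [NormedSpace ℝ E₂]
    [TopologicalSpace H₂] {I₂ : ModelWithCorners ℝ E₂ H₂} [TopologicalSpace M₂]
    [ChartedSpace H₂ M₂] {f : M → M'} {g : M' → M₂} (hf : MDifferentiable I I' f)
    (hg : MDifferentiable I' I₂ g) (w : DForm I₂ M₂ k) :
    (pullback f (pullback g w : DForm I' M' k) : DForm I M k) = pullback (g ∘ f) w := by
  funext x
  have h := mfderiv_comp x (hg (f x)) (hf x)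
  ext v
  change w (g (f x)) (fun i => mfderiv I' I₂ g (f x) (mfderiv I I' f x (v i))) =
    w (g (f x)) (fun i => mfderiv I I₂ (g ∘ f) x (v i))
  rw [h]
  rfl

end DForm

end Charts2

/-! ### Transport of Cartan symmetries by a diffeomorphism. -/

section Transport

variable {E H M : Type*} [NormedAddCommGroup E] [NormedSpace ℝ E] [TopologicalSpace H]
  {I : ModelWithCorners ℝ E H} [TopologicalSpace M] [ChartedSpace H M] [IsManifold I ∞ M]
  {E' H' M' : Type*} [NormedAddCommGroup E'] [NormedSpace ℝ E'] [TopologicalSpace H']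
  {I' : ModelWithCorners ℝ E' H'} [TopologicalSpace M'] [ChartedSpace H' M'] [IsManifold I' ∞ M']
  [FiniteDimensional ℝ E] [FiniteDimensional ℝ E']

lemma _root_.Diffeomorph.mfderiv_symm_apply (Φ : M ≃ₘ^∞⟮I, I'⟯ M') (x : M) (v : TangentSpace I x) :
    mfderiv I' I Φ.symm (Φ x) (mfderiv I I' Φ x v) = v := by
  have h1 : MDifferentiableAt I I' Φ x := Φ.contMDiff.mdifferentiableAt (by simp)
  have h2 : MDifferentiableAt I' I Φ.symm (Φ x) := Φ.symm.contMDiff.mdifferentiableAt (by simp)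
  have h3 := mfderiv_comp x h2 h1
  have h4 : (Φ.symm : M' → M) ∘ Φ = id := by
    funext y
    exact Φ.symm_apply_apply y
  rw [h4, mfderiv_id] at h3
  exact (DFunLike.congr_fun h3 v).symm

lemma isRelated_pushforward (Φ : M ≃ₘ^∞⟮I, I'⟯ M') (ξ : VField I M) :
    IsRelated Φ ξ (pushforward Φ ξ) := by
  intro x
  have h : ∀ y, y = x → (mfderiv I I' Φ x (ξ x) : E') = mfderiv I I' Φ y (ξ y) := by
    rintro _ rfl; rfl
  exact h _ (Φ.symm_apply_apply x)

lemma isRelated_symm_pushforward (Φ : M ≃ₘ^∞⟮I, I'⟯ M') (ξ : VField I M) :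
    IsRelated Φ.symm (pushforward Φ ξ) ξ := by
  intro y
  have h : ∀ z, z = y → (mfderiv I' I Φ.symm y
      (show TangentSpace I' y from mfderiv I I' Φ (Φ.symm y) (ξ (Φ.symm y))) : E) =
      mfderiv I' I Φ.symm z
        (show TangentSpace I' z from mfderiv I I' Φ (Φ.symm y) (ξ (Φ.symm y))) := by
    rintro _ rfl; rfl
  exact (h _ (Φ.apply_symm_apply y)).trans (Φ.mfderiv_symm_apply (Φ.symm y) (ξ (Φ.symm y)))

lemma pushforward_symm_pushforward (Φ : M ≃ₘ^∞⟮I, I'⟯ M') (ξ : VField I M) :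
    pushforward Φ.symm (pushforward Φ ξ) = ξ := by
  funext x
  have h : ∀ z, z = x → (mfderiv I' I Φ.symm (Φ x)
      (show TangentSpace I' (Φ x) from mfderiv I I' Φ z (ξ z)) : E) = ξ x := by
    rintro _ rfl
    exact Φ.mfderiv_symm_apply _ _
  exact h _ (Φ.symm_apply_apply x)

lemma isSmoothVF_pushforward (Φ : M ≃ₘ^∞⟮I, I'⟯ M') {ξ : VField I M} (hξ : IsSmoothVF ξ) :
    IsSmoothVF (pushforward Φ ξ) := by
  have h1 : ContMDiff I.tangent I'.tangent ∞ (tangentMap I I' Φ) :=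
    Φ.contMDiff.contMDiff_tangentMap (by simp)
  have h2 := (h1.comp hξ).comp Φ.symm.contMDiff
  intro y
  refine (h2 y).congr_of_eventuallyEq (Eventually.of_forall fun z => ?_)
  have h : ∀ a b : M', a = b → ∀ v : E', (⟨a, v⟩ : TangentBundle I' M') = ⟨b, v⟩ := by
    rintro _ _ rfl _; rfl
  exact h _ _ (Φ.apply_symm_apply z).symm _

lemma DForm.pullback_symm_pullback (Φ : M ≃ₘ^∞⟮I, I'⟯ M') {k : ℕ} (w : DForm I' M' k) :
    DForm.pullback Φ.symm (DForm.pullback Φ w : DForm I M k) = w := by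
  rw [DForm.pullback_comp (Φ.symm.contMDiff.mdifferentiable (by simp))
    (Φ.contMDiff.mdifferentiable (by simp))]
  have h4 : (Φ : M → M') ∘ Φ.symm = fun x => x := by
    funext y
    exact Φ.apply_symm_apply y
  rw [h4, DForm.pullback_id]

lemma DForm.IsExact.pullback {f : M → M'} (hf : ContMDiff I I' ∞ f) :
    ∀ {k : ℕ} {w : DForm I' M' k}, w.IsExact → (DForm.pullback f w : DForm I M k).IsExact
  | 0, w, h => by
    change w = 0 at h
    subst h
    rfl
  | _ + 1, _, ⟨b, hb, h⟩ => by
    subst h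
    exact ⟨DForm.pullback f b, fun x => (hb (f x)).pullback (hf x), (hb.d_pullback hf).symm⟩

variable {b n : ℕ} {B : Type*} [TopologicalSpace B] [ChartedSpace (EuclideanSpace ℝ (Fin b)) B]
  [IsManifold (𝓡 b) ∞ B] {B' : Type*} [TopologicalSpace B']
  [ChartedSpace (EuclideanSpace ℝ (Fin b)) B'] [IsManifold (𝓡 b) ∞ B']

lemma PreservesBoundary.transport (Φ : M ≃ₘ^∞⟮I, I'⟯ M') (β : B ≃ₘ^∞⟮𝓡 b, 𝓡 b⟯ B')
    {j : B → M} {j' : B' → M'} (hj : ContMDiff (𝓡 b) I ∞ j) (hβ : ∀ x, j' (β x) = Φ (j x))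
    {P : DForm (𝓡 b) B n} (hP : P.Smooth) {P' : DForm (𝓡 b) B' n}
    (hP' : P' = DForm.pullback β.symm P) {ξ : VField I M} (h : PreservesBoundary j P ξ) :
    PreservesBoundary j' P' (pushforward Φ ξ) := by
  obtain ⟨ξB, h1, h2, h3⟩ := h
  refine ⟨pushforward β ξB, isSmoothVF_pushforward β h1, ?_, ?_⟩
  · intro y
    obtain ⟨x, rfl⟩ : ∃ x, β x = y := ⟨β.symm y, β.apply_symm_apply y⟩
    -- The relation `hβ` determines j', so its smoothness follows from that of j.
    have hj' : j' = Φ ∘ j ∘ β.symm := by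
      funext y
      obtain ⟨x, rfl⟩ : ∃ x, β x = y := ⟨β.symm y, β.apply_symm_apply y⟩
      simp only [Function.comp_apply, β.symm_apply_apply]
      exact hβ x
    have hjm : MDifferentiableAt (𝓡 b) I' j' (β x) := by
      rw [hj']
      exact ((Φ.contMDiff.comp (hj.comp β.symm.contMDiff)) _).mdifferentiableAt (by simp)
    have h4 := mfderiv_comp x hjm (β.contMDiff.mdifferentiableAt (by simp))
    have h5 := mfderiv_comp x (Φ.contMDiff.mdifferentiableAt (by simp) (x := j x))
      (hj.mdifferentiableAt (by simp) (x := x))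
    have h6 : j' ∘ β = Φ ∘ j := funext hβ
    rw [h6, h5] at h4
    have h7 := DFunLike.congr_fun h4 (ξB x)
    have h8 : mfderiv (𝓡 b) I' j' (β x) (mfderiv (𝓡 b) (𝓡 b) β x (ξB x)) =
        mfderiv I I' Φ (j x) (mfderiv (𝓡 b) I j x (ξB x)) := h7.symm
    rw [h2 x, isRelated_pushforward β ξB x] at h8
    rw [h8]
    have h9 := isRelated_pushforward Φ ξ (j x)
    have h10 : ∀ a c : M', a = c → (pushforward Φ ξ a : E') = pushforward Φ ξ c := by
      rintro _ _ rfl; rfl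
    exact h9.trans (h10 _ _ (hβ x).symm)
  · subst hP'
    rw [← DForm.pullback_lie β.symm.contMDiff h1 (isRelated_symm_pushforward β ξB) hP, h3]
    rfl

/-- The form α is carried along as its pullback by Φ⁻¹. Exactness on the boundary survives because
Φ⁻¹ ∘ j' = j ∘ β⁻¹: the restriction of the new form is the pullback by β⁻¹ of the restriction of the
old one. -/
lemma IsCartanSymmetry.transport (Φ : M ≃ₘ^∞⟮I, I'⟯ M') (β : B ≃ₘ^∞⟮𝓡 b, 𝓡 b⟯ B')
    {j : B → M} {j' : B' → M'} (hj : ContMDiff (𝓡 b) I ∞ j) (hβ : ∀ x, j' (β x) = Φ (j x))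
    {P : DForm (𝓡 b) B n} (hP : P.Smooth) {P' : DForm (𝓡 b) B' n}
    (hP' : P' = DForm.pullback β.symm P) {Θ : DForm I M (n + 1)} (hΘ : Θ.Smooth)
    {Θ' : DForm I' M' (n + 1)} (hΘ' : Θ' = DForm.pullback Φ.symm Θ)
    {ξ : VField I M} (h : IsCartanSymmetry Θ j P ξ) :
    IsCartanSymmetry Θ' j' P' (pushforward Φ ξ) := by
  obtain ⟨h1, ⟨α, h2, h3, h4⟩, h5⟩ := h
  have hj' : Φ.symm ∘ j' = j ∘ β.symm := by
    funext y
    obtain ⟨x, rfl⟩ : ∃ x, β x = y := ⟨β.symm y, β.apply_symm_apply y⟩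
    simp only [Function.comp_apply, β.symm_apply_apply, hβ, Φ.symm_apply_apply]
  have hjm : ContMDiff (𝓡 b) I' ∞ j' := by
    have : j' = Φ ∘ (j ∘ β.symm) := by
      rw [← hj']
      funext y
      exact (Φ.apply_symm_apply _).symm
    rw [this]
    exact Φ.contMDiff.comp (hj.comp β.symm.contMDiff)
  refine ⟨isSmoothVF_pushforward Φ h1, ⟨DForm.pullback Φ.symm α,
    fun x => (h2 _).pullback (Φ.symm.contMDiff x), ?_, ?_⟩, h5.transport Φ β hj hβ hP hP'⟩
  · rw [hΘ', ← DForm.pullback_lie Φ.symm.contMDiff h1 (isRelated_symm_pushforward Φ ξ) hΘ, h3,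
      h2.d_pullback Φ.symm.contMDiff]
  · rw [DForm.pullback_comp (hjm.mdifferentiable (by simp))
      (Φ.symm.contMDiff.mdifferentiable (by simp)), hj', ← DForm.pullback_comp
      (β.symm.contMDiff.mdifferentiable (by simp)) (hj.mdifferentiable (by simp))]
    exact h4.pullback β.symm.contMDiff

end Transport

/-! ### Cartan's formula on a vector space. -/

section LinearAlgebra

variable {E E' G : Type*} [NormedAddCommGroup E] [NormedSpace ℝ E]
  [NormedAddCommGroup E'] [NormedSpace ℝ E'] [NormedAddCommGroup G] [NormedSpace ℝ G] {k : ℕ}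

open ContinuousAlternatingMap

/-- The algebra behind Cartan's formula, with D the derivative of a form w and T that of a vector
field with value u. In the contraction of dw with u the first term is D u, and the other terms
cancel those of d(ι_u w) in which w is differentiated. What remains is T inserted into w, slot by
slot. -/
lemma alternatizeUncurryFin_curryLeft_add (D : E →L[ℝ] E [⋀^Fin (k + 1)]→L[ℝ] ℝ)
    (w : E [⋀^Fin (k + 1)]→L[ℝ] ℝ) (T : E →L[ℝ] E) (u : E) :
    alternatizeUncurryFin ((ContinuousLinearMap.apply ℝ _ u) ∘L (curryLeftL E k ∘L D) +
        w.curryLeft ∘L T) + (alternatizeUncurryFin D).curryLeft u =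
      D u + w.fderivCompContinuousLinearMap (ContinuousLinearMap.id ℝ E) T := by
  rw [fderivCompContinuousLinearMap_eq_alternatizeUncurryFin]
  ext v
  simp only [ContinuousAlternatingMap.add_apply, alternatizeUncurryFin_apply,
    curryLeft_apply_apply, Fin.sum_univ_succ (n := k + 1), _root_.add_apply,
    alternatizeUncurryFinCLM_apply, ContinuousLinearMap.comp_apply, Matrix.vecCons]
  simp only [smul_add, Finset.sum_add_distrib, Fin.cons_zero, Fin.cons_succ, Fin.val_zero, pow_zero,
    one_smul, Fin.val_succ, pow_succ]
  -- With u in front, position i of v becomes position i + 1. This shift gives the opposite sign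
  -- that makes the two sums cancel.
  have h1 : ∀ i : Fin (k + 1), Fin.removeNth i.succ (Fin.cons u v : Fin (k + 2) → E) =
      Matrix.vecCons u (Fin.removeNth i v) := fun i => by
    funext t
    refine Fin.cases rfl (fun t => ?_) t
    simp [Fin.removeNth, Matrix.vecCons]
  have h2 : Fin.removeNth 0 (Fin.cons u v : Fin (k + 2) → E) = v := by
    funext t
    simp [Fin.removeNth]
  simp only [h1, h2]
  have h3 : ∀ i : Fin (k + 1), ((ContinuousLinearMap.apply ℝ (E [⋀^Fin k]→L[ℝ] ℝ) u)
      ((curryLeftL E k) (D (v i)))) (Fin.removeNth i v) =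
      D (v i) (Matrix.vecCons u (Fin.removeNth i v)) := fun i => rfl
  simp only [h3]
  have h4 : ∀ i : Fin (k + 1), ((((compContinuousLinearMapCLM (ContinuousLinearMap.id ℝ E) ∘L
      w.curryLeft).postcomp E) T) (v i)) (Fin.removeNth i v) =
      w (Fin.cons (T (v i)) (Fin.removeNth i v)) := fun i => rfl
  simp only [h4]
  simp only [mul_neg, mul_one, neg_smul, Finset.sum_neg_distrib]
  abel

lemma hasFDerivWithinAt_clm_comp {W W' : Type*} [NormedAddCommGroup W] [NormedSpace ℝ W]
    [NormedAddCommGroup W'] [NormedSpace ℝ W'] (A : W →L[ℝ] W') {f : E → W} {f' : E →L[ℝ] W}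
    {s : Set E} {x : E} (hf : HasFDerivWithinAt f f' s x) :
    HasFDerivWithinAt (fun y => A (f y)) (A ∘L f') s x :=
  A.hasFDerivAt.comp_hasFDerivWithinAt x hf

/-- Cartan's expression becomes a directional derivative plus a derivation by DX, in which X is
differentiated only through the explicit last term. -/
lemma extDerivWithin_curryLeft_add {w : E → E [⋀^Fin (k + 1)]→L[ℝ] ℝ} {X : E → E} {s : Set E}
    {x : E} (hw : DifferentiableWithinAt ℝ w s x) (hX : DifferentiableWithinAt ℝ X s x)
    (hs : UniqueDiffWithinAt ℝ s x) :
    extDerivWithin (fun v => (w v).curryLeft (X v)) s x + (extDerivWithin w s x).curryLeft (X x) =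
      fderivWithin ℝ w s x (X x) +
        (w x).fderivCompContinuousLinearMap (ContinuousLinearMap.id ℝ E)
          (fderivWithin ℝ X s x) := by
  have h1 : HasFDerivWithinAt (fun v => (w v).curryLeft) (curryLeftL E k ∘L fderivWithin ℝ w s x)
      s x := by
    exact hasFDerivWithinAt_clm_comp (W := E [⋀^Fin (k + 1)]→L[ℝ] ℝ)
      (W' := E →L[ℝ] E [⋀^Fin k]→L[ℝ] ℝ) (curryLeftL E k) hw.hasFDerivWithinAt
  have h2 := (h1.clm_apply hX.hasFDerivWithinAt).fderivWithin hs
  rw [extDerivWithin, h2, extDerivWithin, ← alternatizeUncurryFin_curryLeft_add]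
  congr 2
  rw [add_comm]
  rfl

lemma fderivComp_comp (w : G [⋀^Fin k]→L[ℝ] ℝ) (A f : E' →L[ℝ] G) (C : E →L[ℝ] E') :
    (w.fderivCompContinuousLinearMap A f).compContinuousLinearMap C =
      w.fderivCompContinuousLinearMap (A ∘L C) (f ∘L C) := by
  ext v
  simp only [compContinuousLinearMap_apply, fderivCompContinuousLinearMap_apply]
  refine Finset.sum_congr rfl fun i _ => ?_
  congr 1
  funext t
  by_cases h : t = i
  · subst h; simp
  · simp [h]

lemma compContinuousLinearMap_fderivComp (w : G [⋀^Fin k]→L[ℝ] ℝ) (C : E' →L[ℝ] G)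
    (A f : E →L[ℝ] E') :
    (w.compContinuousLinearMap C).fderivCompContinuousLinearMap A f =
      w.fderivCompContinuousLinearMap (C ∘L A) (C ∘L f) := by
  ext v
  simp only [compContinuousLinearMap_apply, fderivCompContinuousLinearMap_apply]
  refine Finset.sum_congr rfl fun i _ => ?_
  congr 1
  funext t
  by_cases h : t = i
  · subst h; simp
  · simp [h]

end LinearAlgebra

/-! ### Forms along a projection, and the pointwise lifting equation. -/

section BasicForms

variable {E H V Y M : Type*} [NormedAddCommGroup E] [NormedSpace ℝ E] [TopologicalSpace H]
  {I : ModelWithCorners ℝ E H} [TopologicalSpace Y] [ChartedSpace H Y]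
  [NormedAddCommGroup V] [NormedSpace ℝ V] [TopologicalSpace M] [ChartedSpace (ModelProd H V) M]
  {π : M → Y} {k : ℕ}

variable (I V π) in
/-- Forms along `π`: sections of the pullback of the bundle of alternating forms on `Y`. -/
abbrev FormAlong (k : ℕ) : Type _ := (z : M) → TangentSpace I (π z) [⋀^Fin k]→L[ℝ] ℝ

variable (V) in
/-- The form on the total space defined by a form along the projection. -/
def basicForm (ℓ : FormAlong I π k) : DForm (I.prod 𝓘(ℝ, V)) M k := fun z =>
  (ℓ z).compContinuousLinearMap (tangentProj V I π z)

/-- The coordinate representative of a form along the projection. -/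
def FormAlong.rep (ℓ : FormAlong I π k) (C : FibredChart (F := V) I π) (v : E × V) :
    E [⋀^Fin k]→L[ℝ] ℝ :=
  (ℓ ((C.chart.extend (I.prod 𝓘(ℝ, V))).symm v)).compContinuousLinearMap
    (dChart I C.base (π ((C.chart.extend (I.prod 𝓘(ℝ, V))).symm v))).inverse

variable (C : FibredChart (F := V) I π) {z : M}

lemma FormAlong.rep_extend (ℓ : FormAlong I π k) (hz : z ∈ C.chart.source) :
    ℓ.rep C (C.chart.extend (I.prod 𝓘(ℝ, V)) z) =
      (ℓ z).compContinuousLinearMap (dChart I C.base (π z)).inverse := by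
  have h : ∀ y, y = z → ((ℓ y).compContinuousLinearMap (dChart I C.base (π y)).inverse :
      E [⋀^Fin k]→L[ℝ] ℝ) = (ℓ z).compContinuousLinearMap (dChart I C.base (π z)).inverse := by
    rintro y rfl; rfl
  exact h _ (C.chart.extend_left_inv hz)

lemma extend_base (hz : z ∈ C.chart.source) :
    C.base.extend I (π z) = (C.chart.extend (I.prod 𝓘(ℝ, V)) z).1 :=
  (congrArg I (C.fibred z hz)).symm

variable [hπ : IsFibred V I π]

lemma rep_basicForm (ℓ : FormAlong I π k) (hz : z ∈ C.chart.source) :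
    (basicForm V ℓ).rep C.chart (C.chart.extend (I.prod 𝓘(ℝ, V)) z) =
      (ℓ.rep C (C.chart.extend (I.prod 𝓘(ℝ, V)) z)).compContinuousLinearMap
        (ContinuousLinearMap.fst ℝ E V) := by
  rw [DForm.rep_extend _ hz, FormAlong.rep_extend C _ hz]
  ext v
  change ℓ z (fun i => tangentProj V I π z ((dChart (I.prod 𝓘(ℝ, V)) C.chart z).inverse (v i))) =
    ℓ z (fun i => (dChart I C.base (π z)).inverse (v i).1)
  congr 1
  funext i
  apply dChart_injective C.base_mem (C.maps z hz)
  rw [← fst_dChart_apply C hz, dChart_apply_inverse C.chart_mem hz,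
    dChart_apply_inverse C.base_mem (C.maps z hz)]

lemma eventually_rep_basicForm (ℓ : FormAlong I π k) (hz : z ∈ C.chart.source) :
    (basicForm V ℓ).rep C.chart =ᶠ[𝓝[range (I.prod 𝓘(ℝ, V))] (C.chart.extend (I.prod 𝓘(ℝ, V)) z)]
      fun v => (ℓ.rep C v).compContinuousLinearMap (ContinuousLinearMap.fst ℝ E V) := by
  refine eventually_extend hz ?_
  filter_upwards [C.chart.open_source.mem_nhds hz] with y hy
  exact rep_basicForm C ℓ hy

variable [FiniteDimensional ℝ E] [FiniteDimensional ℝ V] [IsManifold I ∞ Y]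
  [IsManifold (I.prod 𝓘(ℝ, V)) ∞ M]

lemma smoothAt_basicForm {ℓ : FormAlong I π k} (hz : z ∈ C.chart.source)
    (hℓ : ContDiffWithinAt ℝ ∞ (ℓ.rep C) (range (I.prod 𝓘(ℝ, V)))
      (C.chart.extend (I.prod 𝓘(ℝ, V)) z)) : (basicForm V ℓ).SmoothAt z := by
  rw [DForm.smoothAt_iff C.chart_mem hz]
  have h := eventually_rep_basicForm C ℓ hz
  exact (hℓ.alternating_pullback contDiffWithinAt_const).congr_of_eventuallyEq h
    (h.self_of_nhdsWithin (mem_range_self _))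

/-- The tangent vector `u` at `z` projects onto `ξ`, and satisfies the pointwise version of the
equation that says that the Lie derivative of `basicForm ℓ` is the pullback of `dα`. -/
def LiftsAt (ℓ : FormAlong I π (k + 1)) (ξ : VField I Y) (α : DForm I Y k) (z : M)
    (u : TangentSpace (I.prod 𝓘(ℝ, V)) z) : Prop :=
  tangentProj V I π z u = ξ (π z) ∧
    (basicForm V (π := π) (fun z => ((ℓ z).curryLeft (E := E) (ξ (π z)) :
      TangentSpace I (π z) [⋀^Fin k]→L[ℝ] ℝ))).d z +
      (show TangentSpace (I.prod 𝓘(ℝ, V)) z [⋀^Fin (k + 1)]→L[ℝ] ℝ from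
        ((basicForm V ℓ).d z).curryLeft (E := E × V) u) =
      (DForm.pullback π α : DForm (I.prod 𝓘(ℝ, V)) M k).d z

/-- Contracting `basicForm ℓ` with Ξ uses only the projection of Ξ, which is ξ. Hence Ξ is never
differentiated in Cartan's formula, and the equation for the field splits into independent
conditions on the vectors Ξ z. -/
lemma lie_basicForm_iff {π : M → Y} {ℓ : FormAlong I π (k + 1)} {ξ : VField I Y} {α : DForm I Y k}
    {Ξ : VField (I.prod 𝓘(ℝ, V)) M} :
    (IsRelated π Ξ ξ ∧ DForm.lie Ξ (basicForm V ℓ) = (DForm.pullback π α).d) ↔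
      ∀ z, LiftsAt (V := V) (M := M) ℓ ξ α z (Ξ z) := by
  have key : IsRelated π Ξ ξ → DForm.interior Ξ (basicForm V ℓ) =
      basicForm V (π := π) (fun z => ((ℓ z).curryLeft (E := E) (ξ (π z)) :
      TangentSpace I (π z) [⋀^Fin k]→L[ℝ] ℝ)) := by
    intro h
    funext z
    ext v
    change ℓ z (fun i => tangentProj V I π z ((Matrix.vecCons (Ξ z) v :
      Fin (k + 1) → TangentSpace (I.prod 𝓘(ℝ, V)) z) i)) =
      ℓ z (Matrix.vecCons (ξ (π z)) fun i => tangentProj V I π z (v i))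
    congr 1
    funext i
    refine Fin.cases ?_ (fun i => rfl) i
    exact h z
  constructor
  · rintro ⟨h1, h2⟩ z
    refine ⟨h1 z, ?_⟩
    rw [← h2, ← key h1]
    rfl
  · intro h
    have h1 : IsRelated π Ξ ξ := fun z => (h z).1
    refine ⟨h1, funext fun z => ?_⟩
    rw [← (h z).2, ← key h1]
    rfl

end BasicForms

section Lift

variable {E H V Y M : Type*} [NormedAddCommGroup E] [NormedSpace ℝ E] [TopologicalSpace H]
  {I : ModelWithCorners ℝ E H} [TopologicalSpace Y] [ChartedSpace H Y]
  [NormedAddCommGroup V] [NormedSpace ℝ V] [TopologicalSpace M] [ChartedSpace (ModelProd H V) M]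
  {π : M → Y} {k : ℕ} (C : FibredChart (F := V) I π) {z : M}

lemma mapsTo_fst_range : MapsTo (Prod.fst : E × V → E) (range (I.prod 𝓘(ℝ, V))) (range I) := by
  rw [ModelWithCorners.range_prod]
  exact fun v hv => hv.1

variable [hπ : IsFibred V I π]

/-- The field in the contraction has the constant fibre component c. Since the form is pulled back
through the first factor, this choice does not affect the contraction, and only the base part X
contributes a derivative. -/
lemma extDerivWithin_rep_fst {w : E × V → E [⋀^Fin (k + 1)]→L[ℝ] ℝ} {X : E → E} {c : V}
    {x : E × V} (hx : x ∈ range (I.prod 𝓘(ℝ, V)))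
    (hw : DifferentiableWithinAt ℝ w (range (I.prod 𝓘(ℝ, V))) x)
    (hX : DifferentiableWithinAt ℝ X (range I) x.1) :
    extDerivWithin (fun v => ((w v).compContinuousLinearMap
        (ContinuousLinearMap.fst ℝ E V)).curryLeft (X v.1, c)) (range (I.prod 𝓘(ℝ, V))) x +
      (extDerivWithin (fun v => (w v).compContinuousLinearMap (ContinuousLinearMap.fst ℝ E V))
        (range (I.prod 𝓘(ℝ, V))) x).curryLeft (X x.1, c) =
      (fderivWithin ℝ w (range (I.prod 𝓘(ℝ, V))) x (X x.1, c) +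
        (w x).fderivCompContinuousLinearMap (ContinuousLinearMap.id ℝ E)
          (fderivWithin ℝ X (range I) x.1)).compContinuousLinearMap
        (ContinuousLinearMap.fst ℝ E V) := by
  have hu := (I.prod 𝓘(ℝ, V)).uniqueDiffOn x hx
  have h1 : HasFDerivWithinAt (fun v => (w v).compContinuousLinearMap
      (ContinuousLinearMap.fst ℝ E V))
      ((ContinuousAlternatingMap.compContinuousLinearMapCLM (ContinuousLinearMap.fst ℝ E V)) ∘L
        fderivWithin ℝ w (range (I.prod 𝓘(ℝ, V))) x) (range (I.prod 𝓘(ℝ, V))) x :=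
    hasFDerivWithinAt_clm_comp (W := E [⋀^Fin (k + 1)]→L[ℝ] ℝ)
      (W' := (E × V) [⋀^Fin (k + 1)]→L[ℝ] ℝ)
      (ContinuousAlternatingMap.compContinuousLinearMapCLM (ContinuousLinearMap.fst ℝ E V))
      hw.hasFDerivWithinAt
  have h2 : HasFDerivWithinAt (fun v : E × V => ((X v.1, c) : E × V))
      ((fderivWithin ℝ X (range I) x.1 ∘L ContinuousLinearMap.fst ℝ E V).prod 0)
      (range (I.prod 𝓘(ℝ, V))) x := by
    refine HasFDerivWithinAt.prodMk ?_ (hasFDerivWithinAt_const _ _ _)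
    exact hX.hasFDerivWithinAt.comp x hasFDerivWithinAt_fst mapsTo_fst_range
  rw [extDerivWithin_curryLeft_add (X := fun v : E × V => ((X v.1, c) : E × V))
    h1.differentiableWithinAt h2.differentiableWithinAt hu, h1.fderivWithin hu,
    h2.fderivWithin hu, compContinuousLinearMap_fderivComp]
  have h3 : ∀ a b : E [⋀^Fin (k + 1)]→L[ℝ] ℝ,
      (a + b).compContinuousLinearMap (ContinuousLinearMap.fst ℝ E V) =
      a.compContinuousLinearMap (ContinuousLinearMap.fst ℝ E V) +
      b.compContinuousLinearMap (ContinuousLinearMap.fst ℝ E V) := fun _ _ => rfl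
  rw [h3, fderivComp_comp]
  rfl

variable [FiniteDimensional ℝ E] [FiniteDimensional ℝ V] [IsManifold I ∞ Y] [IsManifold I 1 Y]
  [IsManifold (I.prod 𝓘(ℝ, V)) ∞ M]

lemma curryLeft_add_comp {T T' : Type*} [NormedAddCommGroup T] [NormedSpace ℝ T]
    [NormedAddCommGroup T'] [NormedSpace ℝ T'] (D : T →L[ℝ] T') (a : T' [⋀^Fin (k + 1)]→L[ℝ] ℝ)
    (b : T' [⋀^Fin (k + 2)]→L[ℝ] ℝ) {u : T} {y : T'} (hy : D u = y) :
    a.compContinuousLinearMap D + (b.compContinuousLinearMap D).curryLeft u =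
      (a + b.curryLeft y).compContinuousLinearMap D := by
  subst hy
  ext v
  change _ + b (fun i => D ((Matrix.vecCons u v : Fin (k + 2) → T) i)) =
    _ + b (Matrix.vecCons (D u) fun i => D (v i))
  congr 2
  funext i
  exact Fin.cases rfl (fun i => rfl) i

/-- Each side of the lifting equation is pulled back, by the differential of the projection, from a
form on the model of the base. That differential is onto, so the pullback can be cancelled. The
vector u then enters only as the direction in which ℓ is differentiated. -/
lemma liftsAt_iff {ℓ : FormAlong I π (k + 1)} {ξ : VField I Y} {α : DForm I Y k}
    (hz : z ∈ C.chart.source)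
    (hℓ : ContDiffWithinAt ℝ ∞ (ℓ.rep C) (range (I.prod 𝓘(ℝ, V)))
      (C.chart.extend (I.prod 𝓘(ℝ, V)) z))
    (hξ : IsSmoothVF ξ) (hα : α.Smooth) {u : TangentSpace (I.prod 𝓘(ℝ, V)) z}
    (hu : tangentProj V I π z u = ξ (π z)) :
    LiftsAt (V := V) (M := M) ℓ ξ α z u ↔
      fderivWithin ℝ (ℓ.rep C) (range (I.prod 𝓘(ℝ, V))) (C.chart.extend (I.prod 𝓘(ℝ, V)) z)
          (dChart (I.prod 𝓘(ℝ, V)) C.chart z u) +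
        (ℓ.rep C (C.chart.extend (I.prod 𝓘(ℝ, V)) z)).fderivCompContinuousLinearMap
          (ContinuousLinearMap.id ℝ E)
          (fderivWithin ℝ (VField.rep ξ C.base) (range I) (C.base.extend I (π z))) =
      extDerivWithin (α.rep C.base) (range I) (C.base.extend I (π z)) := by
  set κ : FormAlong I π k := fun z => ((ℓ z).curryLeft (E := E) (ξ (π z)) :
      TangentSpace I (π z) [⋀^Fin k]→L[ℝ] ℝ) with hκ
  set x := C.chart.extend (I.prod 𝓘(ℝ, V)) z with hx
  -- Only the vector u at z is given; freezing its fibre component yields a field near z, in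
  -- coordinates, with value u at z.
  set c : V := (dChart (I.prod 𝓘(ℝ, V)) C.chart z u).2 with hc
  have hxr : x ∈ range (I.prod 𝓘(ℝ, V)) := mem_range_self _
  have hbase : C.base.extend I (π z) = x.1 := extend_base C hz
  have hX : ContDiffWithinAt ℝ ∞ (VField.rep ξ C.base) (range I) x.1 := by
    rw [← hbase]
    exact VField.contDiffWithinAt_rep C.base_mem (C.maps z hz) hξ
  have hu' : dChart (I.prod 𝓘(ℝ, V)) C.chart z u = (VField.rep ξ C.base x.1, c) := by
    refine Prod.ext ?_ rfl
    rw [← hbase, VField.rep_extend ξ (C.maps z hz), ← hu]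
    exact fst_dChart_apply C hz u
  have hX2 : ContDiffWithinAt ℝ ∞ (fun v : E × V => ((VField.rep ξ C.base v.1, c) : E × V))
      (range (I.prod 𝓘(ℝ, V))) x :=
    (hX.comp x contDiffWithinAt_fst mapsTo_fst_range).prodMk contDiffWithinAt_const
  have hrep : (basicForm V ℓ).rep C.chart =ᶠ[𝓝[range (I.prod 𝓘(ℝ, V))] x]
      fun v => (ℓ.rep C v).compContinuousLinearMap (ContinuousLinearMap.fst ℝ E V) :=
    eventually_rep_basicForm C ℓ hz
  have hκr : (basicForm V κ).rep C.chart =ᶠ[𝓝[range (I.prod 𝓘(ℝ, V))] x]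
      fun v => ((ℓ.rep C v).compContinuousLinearMap
        (ContinuousLinearMap.fst ℝ E V)).curryLeft (VField.rep ξ C.base v.1, c) := by
    refine eventually_extend hz ?_
    filter_upwards [C.chart.open_source.mem_nhds hz] with y hy
    rw [rep_basicForm C κ hy, FormAlong.rep_extend C _ hy, FormAlong.rep_extend C _ hy,
      ← extend_base C hy, VField.rep_extend ξ (C.maps y hy)]
    ext v
    change ℓ y (Matrix.vecCons (ξ (π y)) fun i => (dChart I C.base (π y)).inverse (v i).1) =
      ℓ y (fun i => (dChart I C.base (π y)).inverse
        ((Matrix.vecCons ((dChart I C.base (π y) (ξ (π y)), c) : E × V) v : Fin (k + 1) → E × V)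
          i).1)
    congr 1
    funext i
    refine Fin.cases ?_ (fun i => rfl) i
    exact (dChart_inverse_apply C.base_mem (C.maps y hy) _).symm
  have hθ : ContDiffWithinAt ℝ ∞ (fun v => (ℓ.rep C v).compContinuousLinearMap
      (ContinuousLinearMap.fst ℝ E V)) (range (I.prod 𝓘(ℝ, V))) x :=
    hℓ.alternating_pullback contDiffWithinAt_const
  have hsθ : (basicForm V ℓ).SmoothAt z := smoothAt_basicForm C hz hℓ
  have hsκ : (basicForm V κ).SmoothAt z := by
    rw [DForm.smoothAt_iff C.chart_mem hz]
    refine ContDiffWithinAt.congr_of_eventuallyEq ?_ hκr (hκr.self_of_nhdsWithin hxr)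
    exact (contDiff_curryLeft.contDiffAt.comp_contDiffWithinAt x hθ).clm_apply hX2
  have hdθ : (basicForm V ℓ).d z = (extDerivWithin (fun v => (ℓ.rep C v).compContinuousLinearMap
      (ContinuousLinearMap.fst ℝ E V)) (range (I.prod 𝓘(ℝ, V))) x).compContinuousLinearMap
        (dChart (I.prod 𝓘(ℝ, V)) C.chart z) := by
    rw [DForm.d_eq_rep C.chart_mem hz hsθ, hrep.extDerivWithin_eq_of_mem hxr]
  have hdκ := DForm.d_eq_rep C.chart_mem hz hsκ
  rw [hκr.extDerivWithin_eq_of_mem hxr] at hdκ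
  have hsum := extDerivWithin_rep_fst (I := I) (c := c) hxr (hℓ.differentiableWithinAt (by simp))
    (hX.differentiableWithinAt (by simp))
  have hright : (DForm.pullback π α : DForm (I.prod 𝓘(ℝ, V)) M k).d z =
      ((extDerivWithin (α.rep C.base) (range I) x.1).compContinuousLinearMap
        (ContinuousLinearMap.fst ℝ E V)).compContinuousLinearMap (dChart (I.prod 𝓘(ℝ, V)) C.chart z) := by
    rw [DForm.d_pullback (hπ.contMDiff z) (hα (π z)), DForm.pullback,
      DForm.d_eq_rep C.base_mem (C.maps z hz) (hα (π z)), ← hbase]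
    ext v
    change extDerivWithin _ _ _ (fun i => dChart I C.base (π z) (tangentProj V I π z (v i))) =
      extDerivWithin _ _ _ (fun i => (dChart (I.prod 𝓘(ℝ, V)) C.chart z (v i)).1)
    congr 1
    funext i
    exact (fst_dChart_apply C hz (v i)).symm
  have hleft : (basicForm V κ).d z +
      (show TangentSpace (I.prod 𝓘(ℝ, V)) z [⋀^Fin (k + 1)]→L[ℝ] ℝ from
        ((basicForm V ℓ).d z).curryLeft (E := E × V) u) =
      ((fderivWithin ℝ (ℓ.rep C) (range (I.prod 𝓘(ℝ, V))) x (dChart (I.prod 𝓘(ℝ, V)) C.chart z u) +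
        (ℓ.rep C x).fderivCompContinuousLinearMap (ContinuousLinearMap.id ℝ E)
          (fderivWithin ℝ (VField.rep ξ C.base) (range I) x.1)).compContinuousLinearMap
        (ContinuousLinearMap.fst ℝ E V)).compContinuousLinearMap (dChart (I.prod 𝓘(ℝ, V)) C.chart z) := by
    rw [hu', ← hsum, hdκ, hdθ]
    exact curryLeft_add_comp (T := E × V) (dChart (I.prod 𝓘(ℝ, V)) C.chart z) _ _ hu'
  -- A form on E is recovered from its pullback by lifting its arguments with zero fibre component.
  have hinj : ∀ a b : E [⋀^Fin (k + 1)]→L[ℝ] ℝ,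
      (a.compContinuousLinearMap (ContinuousLinearMap.fst ℝ E V)).compContinuousLinearMap
        (dChart (I.prod 𝓘(ℝ, V)) C.chart z) =
      (b.compContinuousLinearMap (ContinuousLinearMap.fst ℝ E V)).compContinuousLinearMap
        (dChart (I.prod 𝓘(ℝ, V)) C.chart z) → a = b := by
    intro a b h
    ext v
    have h1 := DFunLike.congr_fun h
      (fun i => (dChart (I.prod 𝓘(ℝ, V)) C.chart z).inverse ((v i, 0) : E × V))
    have h2 : ∀ a : E [⋀^Fin (k + 1)]→L[ℝ] ℝ,
        (a.compContinuousLinearMap (ContinuousLinearMap.fst ℝ E V)).compContinuousLinearMap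
        (dChart (I.prod 𝓘(ℝ, V)) C.chart z) (fun i => (dChart (I.prod 𝓘(ℝ, V)) C.chart z).inverse ((v i, 0) : E × V)) = a v := by
      intro a
      change a (fun i => (dChart (I.prod 𝓘(ℝ, V)) C.chart z ((dChart (I.prod 𝓘(ℝ, V)) C.chart z).inverse (v i, 0))).1) = a v
      congr 1
      funext i
      rw [dChart_apply_inverse C.chart_mem hz]
    rwa [h2, h2] at h1
  rw [hbase]
  unfold LiftsAt
  refine ⟨fun h => hinj _ _ (hleft.symm.trans (h.2.trans hright)), fun h => ⟨hu, ?_⟩⟩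
  exact hleft.trans ((congrArg (fun a : E [⋀^Fin (k + 1)]→L[ℝ] ℝ =>
    (a.compContinuousLinearMap (ContinuousLinearMap.fst ℝ E V)).compContinuousLinearMap
        (dChart (I.prod 𝓘(ℝ, V)) C.chart z)) h).trans hright.symm)

end Lift

/-! ### Fibred charts of the jet bundle, the bundle of forms and the dual bundle. -/

section Fibred

variable {E H V Y M : Type*} [NormedAddCommGroup E] [NormedSpace ℝ E] [TopologicalSpace H]
  {I : ModelWithCorners ℝ E H} [TopologicalSpace Y] [ChartedSpace H Y]
  [NormedAddCommGroup V] [NormedSpace ℝ V] [TopologicalSpace M] [ChartedSpace (ModelProd H V) M]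
  {π : M → Y}

lemma contMDiff_of_fibredChart (h : ∀ z, ∃ C : FibredChart (F := V) I π, z ∈ C.chart.source) :
    ContMDiff (I.prod 𝓘(ℝ, V)) I ∞ π := by
  intro z
  obtain ⟨C, hz⟩ := h z
  have h1 := C.chart.contMDiffOn_extend C.chart_mem
  have h2 : ContMDiff 𝓘(ℝ, E × V) 𝓘(ℝ, E) ∞ (Prod.fst : E × V → E) := contDiff_fst.contMDiff
  have h3 := contMDiffOn_extend_symm C.base_mem
  have h4 : ∀ y ∈ C.chart.source, (C.base.extend I).symm
      (Prod.fst (C.chart.extend (I.prod 𝓘(ℝ, V)) y)) = π y := by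
    intro y hy
    rw [← extend_base C hy, C.base.extend_left_inv (C.maps y hy)]
  have h5 : ContMDiffOn (I.prod 𝓘(ℝ, V)) I ∞ ((C.base.extend I).symm ∘
      (Prod.fst ∘ C.chart.extend (I.prod 𝓘(ℝ, V)))) C.chart.source := by
    refine h3.comp (h2.comp_contMDiffOn h1) fun y hy => ?_
    refine ⟨C.base (π y), C.base.map_source (C.maps y hy), ?_⟩
    exact extend_base C hy
  exact (h5.congr fun y hy => (h4 y hy).symm).contMDiffAt (C.chart.open_source.mem_nhds hz)

end Fibred

namespace FibreAtlas

variable {E H : Type*} [NormedAddCommGroup E] [NormedSpace ℝ E] [TopologicalSpace H]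
    {I : ModelWithCorners ℝ E H} {Y : Type*} [TopologicalSpace Y] [ChartedSpace H Y]
    {V : Type*} [NormedAddCommGroup V] [NormedSpace ℝ V] {fib : Y → Type*} {ι : Type*}
    (A : FibreAtlas I V fib ι)

/-- The chart of the total space over a chart of the base, as a fibred chart. -/
def fibredChart (i : ι) : @FibredChart E H V _ _ _ _ _ I Y (Bundle.TotalSpace V fib) _ _
    A.topology A.charted Bundle.TotalSpace.proj :=
  letI := A.topology
  letI := A.charted
  haveI := A.isManifold
  { chart := A.core.openPartialHomeomorph (A.totalChart i) (mem_range_self i)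
    base := A.chart i
    chart_mem := IsManifold.subset_maximalAtlas (by
      refine mem_iUnion.2 ⟨A.totalChart i, mem_iUnion.2 ⟨mem_range_self i, rfl⟩⟩)
    base_mem := A.chart_mem i
    maps := fun _ hz => hz
    fibred := fun _ _ => rfl }

lemma isFibred (h : ∀ y, Nonempty (fib y)) :
    @IsFibred E H V _ _ _ _ _ I Y (Bundle.TotalSpace V fib) _ _
      A.topology A.charted Bundle.TotalSpace.proj := by
  letI := A.topology
  letI := A.charted
  have h1 : ∀ z : Bundle.TotalSpace V fib, ∃ C : FibredChart (F := V) I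
      (Bundle.TotalSpace.proj : Bundle.TotalSpace V fib → Y), z ∈ C.chart.source :=
    fun z => ⟨A.fibredChart (A.index z.proj), A.mem_index z.proj⟩
  exact ⟨contMDiff_of_fibredChart h1, fun y => ⟨⟨y, (h y).some⟩, rfl⟩, h1⟩

end FibreAtlas

section Spaces

variable {EX HX F : Type*} [NormedAddCommGroup EX] [NormedSpace ℝ EX] [TopologicalSpace HX]
  [NormedAddCommGroup F] [NormedSpace ℝ F] {IX : ModelWithCorners ℝ EX HX}
  {X Y : Type*} [TopologicalSpace X] [ChartedSpace HX X]
  [TopologicalSpace Y] [ChartedSpace (ModelProd HX F) Y]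
  {p : Y → X} {k : ℕ} [IsFibred F IX p] [FiniteDimensional ℝ EX]

instance isFibred_jet : IsFibred (EX →L[ℝ] F) (IX.prod 𝓘(ℝ, F)) (Jet.proj : Jet F IX p → Y) :=
  (jetAtlas (F := F) (IX := IX) (p := p)).isFibred fun _ => inferInstance

/-- The fibred chart of the jet bundle over a fibred chart. -/
def jetChart (c : FibredChart (F := F) IX p) :
    FibredChart (F := EX →L[ℝ] F) (IX.prod 𝓘(ℝ, F)) (Jet.proj : Jet F IX p → Y) :=
  (jetAtlas (F := F) (IX := IX) (p := p)).fibredChart c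

lemma jetChart_extend (c : FibredChart (F := F) IX p) (z : Jet F IX p) :
    (jetChart c).chart.extend ((IX.prod 𝓘(ℝ, F)).prod 𝓘(ℝ, EX →L[ℝ] F)) z =
      (c.chart.extend (IX.prod 𝓘(ℝ, F)) z.proj, jetTriv c z.proj z.fib) := rfl

variable [FiniteDimensional ℝ F]

instance isFibred_lam :
    IsFibred (LamModel EX F ℝ k) (IX.prod 𝓘(ℝ, F)) (Lam.proj : Lam F IX p k → Y) :=
  (lamAtlas F IX p ℝ k).isFibred fun _ => ⟨0⟩

/-- The fibred chart of the bundle of horizontal forms over a fibred chart. -/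
def lamChart (c : FibredChart (F := F) IX p) :
    FibredChart (F := LamModel EX F ℝ k) (IX.prod 𝓘(ℝ, F)) (Lam.proj : Lam F IX p k → Y) :=
  (lamAtlas F IX p ℝ k).fibredChart c

instance isFibred_dual :
    IsFibred (DualModel EX F ℝ k) (IX.prod 𝓘(ℝ, F)) (DualJet.proj : DualJet F IX p k → Y) :=
  (dualAtlas F IX p ℝ k).isFibred fun _ => ⟨0⟩

/-- The fibred chart of the dual jet bundle over a fibred chart. -/
def dualChart (c : FibredChart (F := F) IX p) :
    FibredChart (F := DualModel EX F ℝ k) (IX.prod 𝓘(ℝ, F)) (DualJet.proj : DualJet F IX p k → Y) :=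
  (dualAtlas F IX p ℝ k).fibredChart c

instance finiteDimensional_dualModel : FiniteDimensional ℝ (DualModel EX F ℝ k) := by
  obtain ⟨s, hs, hs'⟩ := exists_section ℝ (ContinuousLinearMap.fst ℝ EX F) k
  exact Module.Finite.of_surjective (Submodule.mkQ (lamSubspace ℝ (ContinuousLinearMap.fst ℝ EX F) k))
    (Submodule.mkQ_surjective _)

/-- The quotient map from the model of the bundle of horizontal forms, as a continuous linear map. -/
def mkL (EX F : Type*) [NormedAddCommGroup EX] [NormedSpace ℝ EX] [NormedAddCommGroup F]
    [NormedSpace ℝ F] [FiniteDimensional ℝ EX] [FiniteDimensional ℝ F] (k : ℕ) :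
    LamModel EX F ℝ k →L[ℝ] DualModel EX F ℝ k :=
  LinearMap.toContinuousLinearMap
    (Submodule.mkQ (lamSubspace ℝ (ContinuousLinearMap.fst ℝ EX F) k))

lemma mkL_eq_zero {w : LamModel EX F ℝ k} :
    mkL EX F k w = 0 ↔ w.1 ∈ horizForms ℝ (ContinuousLinearMap.fst ℝ EX F) k 1 :=
  Submodule.Quotient.mk_eq_zero (lamSubspace ℝ (ContinuousLinearMap.fst ℝ EX F) k)

lemma dualChart_extend_toDual (c : FibredChart (F := F) IX p) {w : Lam F IX p k}
    (hw : w.proj ∈ c.chart.source) :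
    (dualChart c).chart.extend ((IX.prod 𝓘(ℝ, F)).prod 𝓘(ℝ, DualModel EX F ℝ k)) w.toDual =
      (((lamChart c).chart.extend ((IX.prod 𝓘(ℝ, F)).prod 𝓘(ℝ, LamModel EX F ℝ k)) w).1,
        mkL EX F k ((lamChart c).chart.extend
          ((IX.prod 𝓘(ℝ, F)).prod 𝓘(ℝ, LamModel EX F ℝ k)) w).2) :=
  Prod.ext rfl (dualTriv_mk ℝ k c hw _)

end Spaces

/-! ### Multilinear algebra of the Legendre form. -/

section LinearAlgebra

open ContinuousAlternatingMap (alternatizeUncurryFin alternatizeUncurryFinCLM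
  fderivCompContinuousLinearMap_eq_alternatizeUncurryFin fderivCompContinuousLinearMap_apply
  compContinuousLinearMapCLM)

variable {n : ℕ} {E F : Type*} [NormedAddCommGroup E] [NormedSpace ℝ E]
  [NormedAddCommGroup F] [NormedSpace ℝ F]

/-- Duality with all covectors, instead of the coordinate ones only, frees `momentum` from the basis
in its definition. Together with `momentum_unique` it replaces computations with indices. -/
lemma proj_momentum (l : (EuclideanSpace ℝ (Fin (n + 1)) →L[ℝ] F) →L[ℝ] ℝ)
    (φ : EuclideanSpace ℝ (Fin (n + 1)) →L[ℝ] ℝ) (u : F) :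
    φ (momentum l u) = l (φ.smulRight u) := by
  have h : φ = ∑ μ : Fin (n + 1), φ (EuclideanSpace.single μ (1 : ℝ)) •
      (EuclideanSpace.proj μ : EuclideanSpace ℝ (Fin (n + 1)) →L[ℝ] ℝ) := by
    ext x
    have hx : x = ∑ μ : Fin (n + 1), x μ • EuclideanSpace.single μ (1 : ℝ) := by
      ext i
      simp [Finset.sum_apply, Pi.single_apply]
    conv_lhs => rw [hx]
    simp [mul_comm]
  have h1 : φ.smulRight u = ∑ μ : Fin (n + 1), φ (EuclideanSpace.single μ (1 : ℝ)) •
      (EuclideanSpace.proj μ : EuclideanSpace ℝ (Fin (n + 1)) →L[ℝ] ℝ).smulRight u := by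
    conv_lhs => rw [h]
    ext x
    simp [Finset.sum_smul, mul_smul]
  rw [h1, momentum]
  simp only [_root_.sum_apply, map_sum, map_smul, smul_eq_mul,
    ContinuousLinearMap.smulRight_apply, ContinuousLinearMap.comp_apply]
  refine Finset.sum_congr rfl fun μ _ => ?_
  rw [mul_comm]
  rfl

lemma momentum_unique {l : (EuclideanSpace ℝ (Fin (n + 1)) →L[ℝ] F) →L[ℝ] ℝ} {u : F}
    {w : EuclideanSpace ℝ (Fin (n + 1))}
    (h : ∀ φ : EuclideanSpace ℝ (Fin (n + 1)) →L[ℝ] ℝ, φ w = l (φ.smulRight u)) :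
    w = momentum l u := by
  ext μ
  exact (h (EuclideanSpace.proj μ)).trans (proj_momentum l (EuclideanSpace.proj μ) u).symm

lemma contDiff_momentum : ContDiff ℝ ∞
    (momentum : ((EuclideanSpace ℝ (Fin (n + 1)) →L[ℝ] F) →L[ℝ] ℝ) →
      F →L[ℝ] EuclideanSpace ℝ (Fin (n + 1))) := by
  unfold momentum
  refine ContDiff.sum fun μ _ => ?_
  exact (contDiff_id.clm_comp contDiff_const).smulRight contDiff_const

lemma momentum_add (l l' : (EuclideanSpace ℝ (Fin (n + 1)) →L[ℝ] F) →L[ℝ] ℝ) :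
    momentum (l + l') = momentum l + momentum l' := by
  ext u : 1
  refine (momentum_unique fun φ => ?_).symm
  simp [proj_momentum]

lemma fderivComp_eq_alternatize {k : ℕ} {G : Type*} [NormedAddCommGroup G] [NormedSpace ℝ G]
    (w : G [⋀^Fin (k + 1)]→L[ℝ] ℝ) (A f : E →L[ℝ] G) :
    w.fderivCompContinuousLinearMap A f =
      alternatizeUncurryFin (compContinuousLinearMapCLM A ∘L w.curryLeft ∘L f) := by
  rw [fderivCompContinuousLinearMap_eq_alternatizeUncurryFin]
  rfl

lemma fderivComp_add_left {k : ℕ} {G : Type*} [NormedAddCommGroup G] [NormedSpace ℝ G]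
    (w w' : G [⋀^Fin k]→L[ℝ] ℝ) (A f : E →L[ℝ] G) :
    (w + w').fderivCompContinuousLinearMap A f =
      w.fderivCompContinuousLinearMap A f + w'.fderivCompContinuousLinearMap A f := by
  ext v
  simp [fderivCompContinuousLinearMap_apply, Finset.sum_add_distrib]

lemma contDiff_clm_comp {G W W' : Type*} [NormedAddCommGroup G] [NormedSpace ℝ G]
    [NormedAddCommGroup W] [NormedSpace ℝ W] [NormedAddCommGroup W'] [NormedSpace ℝ W']
    (A : W →L[ℝ] W') {f : G → W} (hf : ContDiff ℝ ∞ f) : ContDiff ℝ ∞ (fun y => A (f y)) :=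
  A.contDiff.comp hf

lemma contDiff_fderivComp {k : ℕ} {G : Type*} [NormedAddCommGroup G] [NormedSpace ℝ G]
    (A : E →L[ℝ] G) :
    ContDiff ℝ ∞ (fun x : (G [⋀^Fin (k + 1)]→L[ℝ] ℝ) × (E →L[ℝ] G) =>
      x.1.fderivCompContinuousLinearMap A x.2) := by
  have h : (fun x : (G [⋀^Fin (k + 1)]→L[ℝ] ℝ) × (E →L[ℝ] G) =>
      x.1.fderivCompContinuousLinearMap A x.2) = fun x =>
      alternatizeUncurryFinCLM ℝ E ℝ (compContinuousLinearMapCLM A ∘L x.1.curryLeft ∘L x.2) :=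
    funext fun x => fderivComp_eq_alternatize _ _ _
  rw [h]
  refine contDiff_clm_comp (G := (G [⋀^Fin (k + 1)]→L[ℝ] ℝ) × (E →L[ℝ] G)) (W := E →L[ℝ] E [⋀^Fin k]→L[ℝ] ℝ) (W' := E [⋀^Fin (k + 1)]→L[ℝ] ℝ)
    (alternatizeUncurryFinCLM ℝ E ℝ) ?_
  exact contDiff_const.clm_comp ((contDiff_curryLeft.comp contDiff_fst).clm_comp contDiff_snd)

/-- The form φ ∧ η has degree n + 2 on a space of dimension n + 1, so it vanishes. Contracting it
with u gives φ(u) η = φ ∧ ι_u η, and the right-hand side is the derivation of η by φ ⊗ u. -/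
lemma fderivComp_smulRight [FiniteDimensional ℝ E] (hE : Module.finrank ℝ E = n + 1)
    (η : E [⋀^Fin (n + 1)]→L[ℝ] ℝ) (φ : E →L[ℝ] ℝ) (u : E) :
    η.fderivCompContinuousLinearMap (ContinuousLinearMap.id ℝ E) (φ.smulRight u) = φ u • η := by
  have h := alternatizeUncurryFin_curryLeft_add (φ.smulRight η) η (φ.smulRight u) u
  have h0 : alternatizeUncurryFin (φ.smulRight η) = 0 := by
    ext v
    have hv : ¬ LinearIndependent ℝ v := by
      intro hv
      have := hv.fintype_card_le_finrank
      simp [hE] at this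
    exact (alternatizeUncurryFin (φ.smulRight η)).toAlternatingMap.map_linearDependent v hv
  have h1 : η.fderivCompContinuousLinearMap (ContinuousLinearMap.id ℝ E) (φ.smulRight u) =
      alternatizeUncurryFin (η.curryLeft ∘L φ.smulRight u) := by
    rw [fderivComp_eq_alternatize]
    rfl
  have h2 : (ContinuousLinearMap.apply ℝ _ u) ∘L (curryLeftL E n ∘L φ.smulRight η) =
      η.curryLeft ∘L φ.smulRight u := by
    ext x : 1
    change (φ x • η).curryLeft u = η.curryLeft (φ x • u)
    rw [map_smul]
    rfl
  -- With T = 0 the identity is the rule for contracting φ ∧ η with u.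
  have h3 := alternatizeUncurryFin_curryLeft_add (φ.smulRight η) η 0 u
  rw [h0, h2, map_zero, add_zero, ContinuousLinearMap.comp_zero, add_zero] at h3
  have h4 : (0 : E [⋀^Fin (n + 2)]→L[ℝ] ℝ).curryLeft u = 0 := rfl
  rw [h4, add_zero] at h3
  exact h1.trans h3

/-- An endomorphism acts on a top form, as a derivation, by its trace, and the trace of `momentum l
∘L g` is l g. A decomposition into rank one maps reduces this to `fderivComp_smulRight`. -/
lemma fderivComp_momentum (η : EuclideanSpace ℝ (Fin (n + 1)) [⋀^Fin (n + 1)]→L[ℝ] ℝ)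
    (l : (EuclideanSpace ℝ (Fin (n + 1)) →L[ℝ] F) →L[ℝ] ℝ)
    (g : EuclideanSpace ℝ (Fin (n + 1)) →L[ℝ] F) :
    η.fderivCompContinuousLinearMap (ContinuousLinearMap.id ℝ _) (momentum l ∘L g) = l g • η := by
  have hg : g = ∑ μ : Fin (n + 1), (EuclideanSpace.proj μ :
      EuclideanSpace ℝ (Fin (n + 1)) →L[ℝ] ℝ).smulRight (g (EuclideanSpace.single μ (1 : ℝ))) := by
    ext x : 1
    have hx : x = ∑ μ : Fin (n + 1), x μ • EuclideanSpace.single μ (1 : ℝ) := by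
      ext i
      simp [Finset.sum_apply, Pi.single_apply]
    conv_lhs => rw [hx]
    simp
  have h1 : momentum l ∘L g = ∑ μ : Fin (n + 1), (l ∘L
      ContinuousLinearMap.smulRightL ℝ (EuclideanSpace ℝ (Fin (n + 1))) F
      (EuclideanSpace.proj μ) ∘L g).smulRight (EuclideanSpace.single μ (1 : ℝ)) := by
    ext x : 1
    simp [momentum]
  rw [h1, map_sum]
  rw [Finset.sum_congr rfl fun μ _ => fderivComp_smulRight (n := n) (by simp) η _ _,
    ← Finset.sum_smul]
  congr 1
  conv_rhs => rw [hg]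
  rw [map_sum]
  rfl

/-- The coordinate expression of the Legendre transformation. -/
def legRep (a : ℝ) (l : (EuclideanSpace ℝ (Fin (n + 1)) →L[ℝ] F) →L[ℝ] ℝ)
    (η : EuclideanSpace ℝ (Fin (n + 1)) [⋀^Fin (n + 1)]→L[ℝ] ℝ)
    (v : EuclideanSpace ℝ (Fin (n + 1)) →L[ℝ] F) :
    (EuclideanSpace ℝ (Fin (n + 1)) × F) [⋀^Fin (n + 1)]→L[ℝ] ℝ :=
  a • η.compContinuousLinearMap (ContinuousLinearMap.fst ℝ _ F) +
    η.fderivCompContinuousLinearMap (ContinuousLinearMap.fst ℝ _ F)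
      (momentum l ∘L (ContinuousLinearMap.snd ℝ _ F - v ∘L ContinuousLinearMap.fst ℝ _ F))

/-- On the graph of v' the contact form dy - v dx restricts to v' - v. When a and l are the value
and the derivative of a Lagrangian at v, the coefficient of η is its first order Taylor polynomial
at v, evaluated at v'. -/
lemma legRep_comp_graph (a : ℝ) (l : (EuclideanSpace ℝ (Fin (n + 1)) →L[ℝ] F) →L[ℝ] ℝ)
    (η : EuclideanSpace ℝ (Fin (n + 1)) [⋀^Fin (n + 1)]→L[ℝ] ℝ)
    (v v' : EuclideanSpace ℝ (Fin (n + 1)) →L[ℝ] F) :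
    (legRep a l η v).compContinuousLinearMap ((ContinuousLinearMap.id ℝ _).prod v') =
      (a + l (v' - v)) • η := by
  have h : (legRep a l η v).compContinuousLinearMap ((ContinuousLinearMap.id ℝ _).prod v') =
      a • η + (η.fderivCompContinuousLinearMap (ContinuousLinearMap.fst ℝ _ F)
      (momentum l ∘L (ContinuousLinearMap.snd ℝ _ F -
        v ∘L ContinuousLinearMap.fst ℝ _ F))).compContinuousLinearMap
        ((ContinuousLinearMap.id ℝ _).prod v') := rfl
  rw [h, fderivComp_comp, add_smul]
  congr 1
  exact fderivComp_momentum η l (v' - v)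

lemma contDiff_legRep [FiniteDimensional ℝ F] : ContDiff ℝ ∞
    (fun x : ((EuclideanSpace ℝ (Fin (n + 1)) [⋀^Fin (n + 1)]→L[ℝ] ℝ) × ℝ) ×
      ((EuclideanSpace ℝ (Fin (n + 1)) →L[ℝ] F) →L[ℝ] ℝ) ×
      (EuclideanSpace ℝ (Fin (n + 1)) →L[ℝ] F) => legRep x.1.2 x.2.1 x.1.1 x.2.2) := by
  have h1 : ContDiff ℝ ∞ (fun x : ((EuclideanSpace ℝ (Fin (n + 1)) [⋀^Fin (n + 1)]→L[ℝ] ℝ) × ℝ) ×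
      ((EuclideanSpace ℝ (Fin (n + 1)) →L[ℝ] F) →L[ℝ] ℝ) ×
      (EuclideanSpace ℝ (Fin (n + 1)) →L[ℝ] F) => ContinuousLinearMap.snd ℝ _ F -
      x.2.2 ∘L ContinuousLinearMap.fst ℝ _ F) :=
    contDiff_const.sub (contDiff_snd.snd.clm_comp contDiff_const)
  have h2 : ContDiff ℝ ∞ (fun x : ((EuclideanSpace ℝ (Fin (n + 1)) [⋀^Fin (n + 1)]→L[ℝ] ℝ) × ℝ) ×
      ((EuclideanSpace ℝ (Fin (n + 1)) →L[ℝ] F) →L[ℝ] ℝ) ×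
      (EuclideanSpace ℝ (Fin (n + 1)) →L[ℝ] F) => momentum x.2.1) :=
    contDiff_momentum.comp contDiff_snd.fst
  have h3 := (contDiff_fderivComp (k := n) (ContinuousLinearMap.fst ℝ
    (EuclideanSpace ℝ (Fin (n + 1))) F)).comp (contDiff_fst.fst.prodMk (h2.clm_comp h1))
  refine ContDiff.add (contDiff_fst.snd.smul ?_) h3
  exact contDiff_alternating_pullback.comp (contDiff_fst.fst.prodMk contDiff_const)

/-- All ingredients transform under a change of coordinates: D takes the vertical part of a vector
to dy - v dx, and d takes `momentum l` to `momentum l'` because both are characterised by duality.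
-/
lemma legendreForm_comp_inverse {q : E →L[ℝ] EuclideanSpace ℝ (Fin (n + 1))}
    {A : EuclideanSpace ℝ (Fin (n + 1)) →L[ℝ] E} (hA : q ∘L A = ContinuousLinearMap.id ℝ _)
    (a : ℝ) (l : (EuclideanSpace ℝ (Fin (n + 1)) →L[ℝ] LinearMap.ker q.toLinearMap) →L[ℝ] ℝ)
    (η : EuclideanSpace ℝ (Fin (n + 1)) [⋀^Fin (n + 1)]→L[ℝ] ℝ)
    {D : E →L[ℝ] EuclideanSpace ℝ (Fin (n + 1)) × F} (hD : D.IsInvertible)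
    {d : EuclideanSpace ℝ (Fin (n + 1)) →L[ℝ] EuclideanSpace ℝ (Fin (n + 1))}
    (hd : d.IsInvertible) (hq : ContinuousLinearMap.fst ℝ _ F ∘L D = d ∘L q)
    {v : EuclideanSpace ℝ (Fin (n + 1)) →L[ℝ] F}
    (hv : D ∘L A = (ContinuousLinearMap.id ℝ _).prod v ∘L d)
    (l' : (EuclideanSpace ℝ (Fin (n + 1)) →L[ℝ] F) →L[ℝ] ℝ)
    (hl : ∀ f, l f = l' ((ContinuousLinearMap.snd ℝ _ F ∘L D ∘L
      (LinearMap.ker q.toLinearMap).subtypeL) ∘L f ∘L d.inverse)) :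
    (legendreForm q A hA a l η).compContinuousLinearMap D.inverse =
      legRep a l' (η.compContinuousLinearMap d.inverse) v := by
  have h1 : legendreForm q A hA a l η = a • η.compContinuousLinearMap q +
      η.fderivCompContinuousLinearMap q (momentum l ∘L verticalPart q A hA) := by
    rw [fderivComp_eq_alternatize]
    rfl
  have h2 : (legendreForm q A hA a l η).compContinuousLinearMap D.inverse =
      a • η.compContinuousLinearMap (q ∘L D.inverse) +
      (η.fderivCompContinuousLinearMap q
        (momentum l ∘L verticalPart q A hA)).compContinuousLinearMap D.inverse := by
    rw [h1]
    rfl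
  have hm : ∀ x, d (momentum l x) = momentum l' (D x.1).2 := by
    intro x
    refine momentum_unique fun φ => ?_
    refine (proj_momentum l (φ ∘L d) x).trans ?_
    rw [hl]
    congr 1
    ext y : 1
    obtain ⟨d, rfl⟩ := hd
    simp
  obtain ⟨D, rfl⟩ := hD
  obtain ⟨d, rfl⟩ := hd
  have h3 : q ∘L (D : E →L[ℝ] EuclideanSpace ℝ (Fin (n + 1)) × F).inverse =
      (d : EuclideanSpace ℝ (Fin (n + 1)) →L[ℝ] EuclideanSpace ℝ (Fin (n + 1))).inverse ∘L ContinuousLinearMap.fst ℝ _ F := by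
    refine ContinuousLinearMap.ext fun x => ?_
    apply d.injective
    have := DFunLike.congr_fun hq (D.symm x)
    simpa using this.symm
  rw [h2, fderivComp_comp, h3, legRep, compContinuousLinearMap_fderivComp]
  congr 2
  refine ContinuousLinearMap.ext fun x => ?_
  apply d.injective
  have h4 := hm (verticalPart q A hA (D.symm x))
  have h5 : (D (verticalPart q A hA (D.symm x)).1).2 = x.2 - v x.1 := by
    have h6 : (verticalPart q A hA (D.symm x)).1 = D.symm x - A (q (D.symm x)) := rfl
    have h7 := DFunLike.congr_fun hv (q (D.symm x))
    have h8 := DFunLike.congr_fun hq (D.symm x)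
    simp at h7 h8
    rw [h6, map_sub, h7]
    simp [← h8]
  have h9 := h4.trans (congrArg (momentum l') h5)
  simpa using h9

end LinearAlgebra

/-! ### Smooth maps and fibre derivatives in charts. -/

section Charts

variable {E H M : Type*} [NormedAddCommGroup E] [NormedSpace ℝ E] [TopologicalSpace H]
  {I : ModelWithCorners ℝ E H} [TopologicalSpace M] [ChartedSpace H M]
  {e : OpenPartialHomeomorph M H}
  {E' H' M' : Type*} [NormedAddCommGroup E'] [NormedSpace ℝ E'] [TopologicalSpace H']
  {I' : ModelWithCorners ℝ E' H'} [TopologicalSpace M'] [ChartedSpace H' M']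
  {e' : OpenPartialHomeomorph M' H'}

/-- Continuity of f is not presupposed. Near x the map is its representative followed by the inverse
chart, which gives continuity as well. -/
lemma contMDiffAt_of_mapRep [IsManifold I ∞ M] [IsManifold I' ∞ M']
    (he : e ∈ IsManifold.maximalAtlas I ∞ M)
    (he' : e' ∈ IsManifold.maximalAtlas I' ∞ M') {f : M → M'} {x : M} (hx : x ∈ e.source)
    (hx' : ∀ᶠ y in 𝓝 x, f y ∈ e'.source)
    (h : ContDiffWithinAt ℝ ∞ (mapRep I e I' e' f) (range I) (e.extend I x)) :
    ContMDiffAt I I' ∞ f x := by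
  rw [contMDiffAt_iff_of_mem_maximalAtlas he he' hx hx'.self_of_nhds]
  refine ⟨?_, h⟩
  have h1 : Tendsto (e.extend I) (𝓝 x) (𝓝[range I] (e.extend I x)) := by
    rw [← e.map_extend_nhds hx]
    exact tendsto_map
  have h2 := h.continuousWithinAt.tendsto.comp h1
  rw [mapRep_extend hx] at h2
  have h3 : ContinuousAt (e'.extend I').symm (e'.extend I' (f x)) :=
    e'.continuousAt_extend_symm hx'.self_of_nhds
  have h4 := h3.tendsto.comp h2
  rw [e'.extend_left_inv hx'.self_of_nhds] at h4
  refine h4.congr' ?_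
  filter_upwards [e.open_source.mem_nhds hx, hx'] with y hy hy'
  simp only [Function.comp_apply, mapRep_extend hy, e'.extend_left_inv hy']

end Charts

section Vertical

variable {E H V W : Type*} [NormedAddCommGroup E] [NormedSpace ℝ E] [TopologicalSpace H]
  {I : ModelWithCorners ℝ E H} [NormedAddCommGroup V] [NormedSpace ℝ V]
  [NormedAddCommGroup W] [NormedSpace ℝ W]

/-- The fibre V has no boundary, so fibre derivatives are two-sided even over boundary points of the
base. -/
lemma hasFDerivAt_vertical {G : E × V → W} {x : E × V} (hx : x ∈ range (I.prod 𝓘(ℝ, V)))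
    (hG : DifferentiableWithinAt ℝ G (range (I.prod 𝓘(ℝ, V))) x) :
    HasFDerivAt (fun v => G (x.1, v))
      (fderivWithin ℝ G (range (I.prod 𝓘(ℝ, V))) x ∘L ContinuousLinearMap.inr ℝ E V) x.2 := by
  rw [← hasFDerivWithinAt_univ]
  refine HasFDerivWithinAt.comp (f := fun v : V => (x.1, v)) x.2 hG.hasFDerivWithinAt
    (hasFDerivAt_prodMk_right x.1 x.2).hasFDerivWithinAt fun v _ => ?_
  rw [ModelWithCorners.range_prod] at hx ⊢
  exact ⟨hx.1, by simp⟩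

end Vertical

/-! ### Coordinates of jets, and the projection μ in coordinates. -/

section JetCoordinates

variable {EX HX F : Type*} [NormedAddCommGroup EX] [NormedSpace ℝ EX] [TopologicalSpace HX]
  [NormedAddCommGroup F] [NormedSpace ℝ F] {IX : ModelWithCorners ℝ EX HX}
  {X Y : Type*} [TopologicalSpace X] [ChartedSpace HX X]
  [TopologicalSpace Y] [ChartedSpace (ModelProd HX F) Y]
  {p : Y → X} {k : ℕ} [IsFibred F IX p] [FiniteDimensional ℝ EX] (c : FibredChart (F := F) IX p)

lemma dChart_comp_jet {y : Y} (hy : y ∈ c.chart.source) (A : JetFibre F IX p y) :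
    dChart (IX.prod 𝓘(ℝ, F)) c.chart y ∘L A.toMap =
      (ContinuousLinearMap.id ℝ EX).prod (jetTriv c y A) ∘L dChart IX c.base (p y) := by
  have h := jet_left_inv (isInvertible_dChart c.chart_mem hy)
    (isInvertible_dChart c.base_mem (c.maps y hy)) (fst_dChart c hy) A.isSection
  conv_lhs => rw [← h]
  ext v : 1
  exact dChart_apply_inverse c.chart_mem hy _

lemma jetTriv_unique {y : Y} (hy : y ∈ c.chart.source) {A : JetFibre F IX p y} {a : EX →L[ℝ] F}
    (h : dChart (IX.prod 𝓘(ℝ, F)) c.chart y ∘L A.toMap =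
      (ContinuousLinearMap.id ℝ EX).prod a ∘L dChart IX c.base (p y)) : jetTriv c y A = a := by
  ext v : 1
  have h1 := DFunLike.congr_fun (h.symm.trans (dChart_comp_jet c hy A))
    ((dChart IX c.base (p y)).inverse v)
  have h2 : dChart IX c.base (p y) ((dChart IX c.base (p y)).inverse v) = v :=
    dChart_apply_inverse c.base_mem (c.maps y hy) v
  have h3 := congrArg Prod.snd h1
  change a (dChart IX c.base (p y) ((dChart IX c.base (p y)).inverse v)) =
    jetTriv c y A (dChart IX c.base (p y) ((dChart IX c.base (p y)).inverse v)) at h3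
  rw [h2] at h3
  exact h3.symm

variable [FiniteDimensional ℝ F] [IsManifold (IX.prod 𝓘(ℝ, F)) ∞ Y]

/-- In charts induced by one chart of Y, μ is the identity times a linear quotient map. Its
smoothness and its tangent map are read off from this. -/
lemma eventually_mapRep_toDual {w : Lam F IX p k} (hw : w.proj ∈ c.chart.source) :
    mapRep ((IX.prod 𝓘(ℝ, F)).prod 𝓘(ℝ, LamModel EX F ℝ k)) (lamChart c).chart
        ((IX.prod 𝓘(ℝ, F)).prod 𝓘(ℝ, DualModel EX F ℝ k)) (dualChart c).chart Lam.toDual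
      =ᶠ[𝓝[range ((IX.prod 𝓘(ℝ, F)).prod 𝓘(ℝ, LamModel EX F ℝ k))]
        ((lamChart c).chart.extend ((IX.prod 𝓘(ℝ, F)).prod 𝓘(ℝ, LamModel EX F ℝ k)) w)]
      (ContinuousLinearMap.id ℝ (EX × F)).prodMap (mkL EX F k) := by
  refine eventually_extend (e := (lamChart (k := k) c).chart) hw ?_
  filter_upwards [(lamChart (k := k) c).chart.open_source.mem_nhds hw] with y hy
  rw [mapRep_extend hy]
  exact dualChart_extend_toDual c hy

lemma contMDiff_toDual : ContMDiff ((IX.prod 𝓘(ℝ, F)).prod 𝓘(ℝ, LamModel EX F ℝ k))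
    ((IX.prod 𝓘(ℝ, F)).prod 𝓘(ℝ, DualModel EX F ℝ k)) ∞ (Lam.toDual : Lam F IX p k → _) := by
  intro w
  set c := fibredIndex F IX p w.proj
  have hw : w.proj ∈ c.chart.source := mem_fibredIndex w.proj
  refine contMDiffAt_of_mapRep (lamChart (k := k) c).chart_mem (dualChart (k := k) c).chart_mem hw
    ?_ ?_
  · exact (lamChart (k := k) c).chart.open_source.mem_nhds hw
  · have h := eventually_mapRep_toDual (k := k) c hw
    exact (ContinuousLinearMap.contDiff _).contDiffWithinAt.congr_of_eventuallyEq h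
      (h.self_of_nhdsWithin (mem_range_self _))

lemma dChart_mfderiv_toDual {w : Lam F IX p k} (hw : w.proj ∈ c.chart.source)
    (u : TangentSpace ((IX.prod 𝓘(ℝ, F)).prod 𝓘(ℝ, LamModel EX F ℝ k)) w) :
    dChart ((IX.prod 𝓘(ℝ, F)).prod 𝓘(ℝ, DualModel EX F ℝ k)) (dualChart c).chart w.toDual
      (mfderiv ((IX.prod 𝓘(ℝ, F)).prod 𝓘(ℝ, LamModel EX F ℝ k))
        ((IX.prod 𝓘(ℝ, F)).prod 𝓘(ℝ, DualModel EX F ℝ k)) Lam.toDual w u) =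
      ((dChart ((IX.prod 𝓘(ℝ, F)).prod 𝓘(ℝ, LamModel EX F ℝ k)) (lamChart c).chart w u).1,
        mkL EX F k (dChart ((IX.prod 𝓘(ℝ, F)).prod 𝓘(ℝ, LamModel EX F ℝ k))
          (lamChart c).chart w u).2) := by
  have h := eventually_mapRep_toDual (k := k) c hw
  rw [dChart_mfderiv (lamChart (k := k) c).chart_mem (dualChart (k := k) c).chart_mem hw hw
    ((contMDiff_toDual w).mdifferentiableAt (by simp)),
    h.fderivWithin_eq (h.self_of_nhdsWithin (mem_range_self _)),
    ContinuousLinearMap.fderivWithin _ (uniqueDiffWithinAt_extend w)]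
  rfl

end JetCoordinates

/-- The model space of the base. -/
abbrev BaseModel (n : ℕ) : Type := EuclideanSpace ℝ (Fin (n + 1))

/-- The model space of the fibre. -/
abbrev FibreModel (m : ℕ) : Type := EuclideanSpace ℝ (Fin m)

section Vertical

variable {B B' E F : Type*} [NormedAddCommGroup B] [NormedSpace ℝ B] [NormedAddCommGroup B']
  [NormedSpace ℝ B'] [NormedAddCommGroup E] [NormedSpace ℝ E] [NormedAddCommGroup F]
  [NormedSpace ℝ F]

/-- The coordinates, with respect to `D` and `d`, of a linear map with values in the kernel of
`q`. -/
def coordVertical (q : E →L[ℝ] B') (D : E →L[ℝ] B × F) (d : B →L[ℝ] B) :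
    (B →L[ℝ] LinearMap.ker q.toLinearMap) →L[ℝ] (B →L[ℝ] F) :=
  (ContinuousLinearMap.compL ℝ B (LinearMap.ker q.toLinearMap) F (ContinuousLinearMap.snd ℝ B F ∘L
    D ∘L (LinearMap.ker q.toLinearMap).subtypeL)) ∘L
    ((ContinuousLinearMap.compL ℝ B B (LinearMap.ker q.toLinearMap)).flip d.inverse)

lemma hasFDerivAt_comp_add {f : E → F} {f' : E →L[ℝ] F} {x : E} (h : HasFDerivAt f f' x)
    (A : B →L[ℝ] E) : HasFDerivAt (fun y => f (x + A y)) (f' ∘L A) 0 := by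
  have h1 : HasFDerivAt (fun y => x + A y) A 0 := A.hasFDerivAt.const_add _
  refine HasFDerivAt.comp 0 ?_ h1
  rwa [map_zero, add_zero]

end Vertical

/-- The jet given by a linear section of the tangent map. -/
def Jet.mk {EX HX F : Type*} [NormedAddCommGroup EX] [NormedSpace ℝ EX] [TopologicalSpace HX]
    [NormedAddCommGroup F] [NormedSpace ℝ F] {IX : ModelWithCorners ℝ EX HX}
    {X Y : Type*} [TopologicalSpace X] [ChartedSpace HX X]
    [TopologicalSpace Y] [ChartedSpace (ModelProd HX F) Y]
    {p : Y → X} (y : Y) (A : JetFibre F IX p y) : Jet F IX p := ⟨y, A⟩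

/-! ### The Lagrangian and the Legendre form in coordinates. -/

section Legendre

variable {n m : ℕ} {HX : Type*} [TopologicalSpace HX]
  {IX : ModelWithCorners ℝ (BaseModel n) HX}
  {X Y : Type*} [TopologicalSpace X] [ChartedSpace HX X]
  [TopologicalSpace Y] [ChartedSpace (ModelProd HX (FibreModel m)) Y]
  {p : Y → X} [IsFibred (FibreModel m) IX p]
  (c : FibredChart (F := FibreModel m) IX p)
  (η : DForm IX X (n + 1)) (L : JetBundle IX p m → ℝ)

/-- The Legendre transformation as a form along the projection of the jet bundle. -/
def legAlong : FormAlong (modelY IX m) (Jet.proj : JetBundle IX p m → Y) (n + 1) :=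
  fun z => (Leg η L z).form

/-- The Lagrangian in the coordinates of a chart. -/
def lagRep (w : (BaseModel n × FibreModel m) × (BaseModel n →L[ℝ] FibreModel m)) : ℝ :=
  L (((jetChart c).chart.extend (modelJet IX m)).symm w)

/-- The derivatives of the Lagrangian with respect to the velocities. -/
def momRep (w : (BaseModel n × FibreModel m) × (BaseModel n →L[ℝ] FibreModel m)) :
    (BaseModel n →L[ℝ] FibreModel m) →L[ℝ] ℝ :=
  fderivWithin ℝ (lagRep c L) (range (modelJet IX m)) w ∘L ContinuousLinearMap.inr ℝ _ _

variable {c L}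

lemma lagRep_extend {z : JetBundle IX p m} (hz : z.proj ∈ c.chart.source) :
    lagRep c L ((jetChart c).chart.extend (modelJet IX m) z) = L z :=
  congrArg L ((jetChart c).chart.extend_left_inv hz)

lemma lagRep_mk {y : Y} (hy : y ∈ c.chart.source) (A : JetFibre (FibreModel m) IX p y) :
    L (Jet.mk y A) = lagRep c L (c.chart.extend (modelY IX m) y, jetTriv c y A) := by
  have hz : (Jet.mk y A).proj ∈ c.chart.source := hy
  have h := jetChart_extend c (Jet.mk y A)
  rw [← lagRep_extend (L := L) hz, h]
  rfl

variable [IsManifold (modelY IX m) ∞ Y]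

lemma contDiffWithinAt_lagRep (hL : ContMDiff (modelJet IX m) 𝓘(ℝ, ℝ) ∞ L)
    {z : JetBundle IX p m} (hz : z.proj ∈ c.chart.source) :
    ContDiffWithinAt ℝ ∞ (lagRep c L) (range (modelJet IX m))
      ((jetChart c).chart.extend (modelJet IX m) z) := by
  have h := contDiffWithinAt_mapRep (jetChart c).chart_mem
    (IsManifold.chart_mem_maximalAtlas (I := 𝓘(ℝ, ℝ)) (n := ∞) (L z)) hz
    (mem_chart_source ℝ (L z)) (hL z)
  exact h

lemma contDiffWithinAt_momRep (hL : ContMDiff (modelJet IX m) 𝓘(ℝ, ℝ) ∞ L)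
    {z : JetBundle IX p m} (hz : z.proj ∈ c.chart.source) :
    ContDiffWithinAt ℝ ∞ (momRep c L) (range (modelJet IX m))
      ((jetChart c).chart.extend (modelJet IX m) z) :=
  (contDiffWithinAt_fderivWithin_range (mem_range_self _)
    (contDiffWithinAt_lagRep hL hz)).clm_comp contDiffWithinAt_const

lemma hasFDerivAt_lagRep (hL : ContMDiff (modelJet IX m) 𝓘(ℝ, ℝ) ∞ L)
    {z : JetBundle IX p m} (hz : z.proj ∈ c.chart.source) :
    HasFDerivAt (fun v => lagRep c L (((jetChart c).chart.extend (modelJet IX m) z).1, v))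
      (momRep c L ((jetChart c).chart.extend (modelJet IX m) z))
      ((jetChart c).chart.extend (modelJet IX m) z).2 :=
  hasFDerivAt_vertical (mem_range_self _)
    ((contDiffWithinAt_lagRep hL hz).differentiableWithinAt (by simp))

variable (c) in
/-- The coordinates of a linear map with values in the vertical vectors. -/
def verticalRep (y : Y) : (BaseModel n →L[ℝ] VerticalSpace (m := m) IX p y) →L[ℝ]
    (BaseModel n →L[ℝ] FibreModel m) :=
  coordVertical (E := BaseModel n × FibreModel m) (B := BaseModel n) (B' := BaseModel n)
    (tangentProj (FibreModel m) IX p y) (dChart (modelY IX m) c.chart y) (dChart IX c.base (p y))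

lemma jetTriv_translate {y : Y} (hy : y ∈ c.chart.source)
    (A : JetFibre (FibreModel m) IX p y)
    (f : BaseModel n →L[ℝ] VerticalSpace (m := m) IX p y) :
    jetTriv c y (A.translate f) = jetTriv c y A + verticalRep c y f := by
  refine jetTriv_unique c hy ?_
  have hA := dChart_comp_jet c hy A
  ext v : 1
  have h1 : dChart (modelY IX m) c.chart y (A.toMap v) =
      (dChart IX c.base (p y) v, jetTriv c y A (dChart IX c.base (p y) v)) :=
    DFunLike.congr_fun hA v
  have h2 : (dChart (modelY IX m) c.chart y (f v).1).1 = 0 :=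
    fst_dChart_eq_zero c hy _ (f v).2
  have h3 : (dChart IX c.base (p y)).inverse (dChart IX c.base (p y) v) = v :=
    dChart_inverse_apply c.base_mem (c.maps y hy) v
  have h4 : verticalRep c y f (dChart IX c.base (p y) v) =
      (dChart (modelY IX m) c.chart y (f v).1).2 :=
    congrArg (fun t => (dChart (modelY IX m) c.chart y (f t).1).2) h3
  refine (map_add (dChart (modelY IX m) c.chart y) (A.toMap v) (f v).1).trans ?_
  rw [h1]
  refine Prod.ext ?_ ?_
  · exact (congrArg (fun t => dChart IX c.base (p y) v + t) h2).trans (add_zero _)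
  · exact congrArg (fun t => jetTriv c y A (dChart IX c.base (p y) v) + t) h4.symm

lemma lagRep_translate {y : Y} (hy : y ∈ c.chart.source) (A : JetFibre (FibreModel m) IX p y)
    (f : BaseModel n →L[ℝ] VerticalSpace (m := m) IX p y) :
    L (Jet.mk y (A.translate f)) =
      lagRep c L (c.chart.extend (modelY IX m) y, jetTriv c y A + verticalRep c y f) := by
  rw [lagRep_mk (c := c) (L := L) hy (A.translate f), jetTriv_translate hy A f]

lemma hasFDerivAt_lagRep_translate (hL : ContMDiff (modelJet IX m) 𝓘(ℝ, ℝ) ∞ L)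
    {z : JetBundle IX p m} (hz : z.proj ∈ c.chart.source)
    {G : Type*} [NormedAddCommGroup G] [NormedSpace ℝ G]
    (Ψ : G →L[ℝ] (BaseModel n →L[ℝ] FibreModel m)) :
    HasFDerivAt (fun f => lagRep c L (c.chart.extend (modelY IX m) z.proj,
        jetTriv c z.proj z.fib + Ψ f))
      (momRep c L ((jetChart c).chart.extend (modelJet IX m) z) ∘L Ψ) 0 := by
  have h3 : HasFDerivAt (fun v => lagRep c L (c.chart.extend (modelY IX m) z.proj, v))
      (momRep c L ((jetChart c).chart.extend (modelJet IX m) z)) (jetTriv c z.proj z.fib) :=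
    hasFDerivAt_lagRep hL hz
  exact hasFDerivAt_comp_add h3 Ψ

/-- Translating a jet by a vertical-valued map adds `verticalRep` to its slope, so the intrinsic
fibre derivative is ∂L/∂v composed with this linear map. -/
lemma fibreDerivative_apply (hL : ContMDiff (modelJet IX m) 𝓘(ℝ, ℝ) ∞ L)
    {z : JetBundle IX p m} (hz : z.proj ∈ c.chart.source)
    (f : BaseModel n →L[ℝ] VerticalSpace (m := m) IX p z.proj) :
    fibreDerivative L z f =
      momRep c L ((jetChart c).chart.extend (modelJet IX m) z) (verticalRep c z.proj f) := by
  have h0 : fibreDerivative L z = fderiv ℝ (fun f => L (Jet.mk z.proj (z.fib.translate f))) 0 := rfl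
  have h1 := (hasFDerivAt_lagRep_translate
    (G := BaseModel n →L[ℝ] VerticalSpace (m := m) IX p z.proj) hL hz (verticalRep c z.proj)).fderiv
  rw [h0, funext fun f => lagRep_translate hz z.fib f, h1]
  rfl

lemma rep_legAlong (hL : ContMDiff (modelJet IX m) 𝓘(ℝ, ℝ) ∞ L)
    {z : JetBundle IX p m} (hz : z.proj ∈ c.chart.source) :
    (legAlong η L).rep (jetChart c) ((jetChart c).chart.extend (modelJet IX m) z) =
      legRep (lagRep c L ((jetChart c).chart.extend (modelJet IX m) z))
        (momRep c L ((jetChart c).chart.extend (modelJet IX m) z))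
        (η.rep c.base ((jetChart c).chart.extend (modelJet IX m) z).1.1)
        ((jetChart c).chart.extend (modelJet IX m) z).2 := by
  have hb : ((jetChart c).chart.extend (modelJet IX m) z).1.1 = c.base.extend IX (p z.proj) :=
    (extend_base c hz).symm
  rw [FormAlong.rep_extend (jetChart c) _ hz, hb, DForm.rep_extend η (c.maps _ hz),
    lagRep_extend hz]
  exact legendreForm_comp_inverse (E := BaseModel n × FibreModel m) (F := FibreModel m)
    (q := tangentProj (FibreModel m) IX p z.proj) (A := z.fib.toMap)
    (D := dChart (modelY IX m) c.chart z.proj) (d := dChart IX c.base (p z.proj))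
    (v := jetTriv c z.proj z.fib)
    z.fib.isSection (L z) (fibreDerivative L z) (η (p z.proj))
    (isInvertible_dChart c.chart_mem hz) (isInvertible_dChart c.base_mem (c.maps _ hz))
    (fst_dChart c hz) (dChart_comp_jet c hz z.fib)
    (momRep c L ((jetChart c).chart.extend (modelJet IX m) z)) (fibreDerivative_apply hL hz)

end Legendre

/-! ### The tautological form and the smoothness of the Legendre transformation. -/

section Liouville

variable {EX HX F : Type*} [NormedAddCommGroup EX] [NormedSpace ℝ EX] [TopologicalSpace HX]
  [NormedAddCommGroup F] [NormedSpace ℝ F] {IX : ModelWithCorners ℝ EX HX}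
  {X Y : Type*} [TopologicalSpace X] [ChartedSpace HX X]
  [TopologicalSpace Y] [ChartedSpace (ModelProd HX F) Y]
  {p : Y → X} {k : ℕ} [IsFibred F IX p] [FiniteDimensional ℝ EX] [FiniteDimensional ℝ F]
  (c : FibredChart (F := F) IX p)

/-- The inclusion of the model of the bundle of horizontal forms, as a continuous linear map. -/
def valL (EX F : Type*) [NormedAddCommGroup EX] [NormedSpace ℝ EX] [NormedAddCommGroup F]
    [NormedSpace ℝ F] [FiniteDimensional ℝ EX] [FiniteDimensional ℝ F] (k : ℕ) :
    LamModel EX F ℝ k →L[ℝ] (EX × F) [⋀^Fin k]→L[ℝ] ℝ :=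
  (horizForms ℝ (ContinuousLinearMap.fst ℝ EX F) k 2).subtypeL

lemma valL_injective : Function.Injective (valL EX F k) := Subtype.val_injective

lemma valL_mem (w : LamModel EX F ℝ k) :
    valL EX F k w ∈ horizForms ℝ (ContinuousLinearMap.fst ℝ EX F) k 2 := w.2

lemma mkL_eq_zero_iff {w : LamModel EX F ℝ k} :
    mkL EX F k w = 0 ↔ valL EX F k w ∈ horizForms ℝ (ContinuousLinearMap.fst ℝ EX F) k 1 :=
  mkL_eq_zero

/-- A continuous projection onto the model of the bundle of horizontal forms. -/
lemma exists_projL (EX F : Type*) [NormedAddCommGroup EX] [NormedSpace ℝ EX] [NormedAddCommGroup F]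
    [NormedSpace ℝ F] [FiniteDimensional ℝ EX] [FiniteDimensional ℝ F] (k : ℕ) :
    ∃ P : (EX × F) [⋀^Fin k]→L[ℝ] ℝ →L[ℝ] LamModel EX F ℝ k, ∀ w, P (valL EX F k w) = w :=
  Submodule.ClosedComplemented.of_finiteDimensional
    (horizForms ℝ (ContinuousLinearMap.fst ℝ EX F) k 2)

/-- The tautological form along the projection of the bundle of horizontal forms. -/
def formAlong : FormAlong (IX.prod 𝓘(ℝ, F)) (Lam.proj : Lam F IX p k → Y) k := fun w => w.form

lemma valL_lamChart (w : Lam F IX p k) (hw : w.proj ∈ c.chart.source) :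
    valL EX F k ((lamChart c).chart.extend
      ((IX.prod 𝓘(ℝ, F)).prod 𝓘(ℝ, LamModel EX F ℝ k)) w).2 =
      w.form.compContinuousLinearMap (dChart (IX.prod 𝓘(ℝ, F)) c.chart w.proj).inverse :=
  lamTriv_apply ℝ k c hw w.snd

/-- The tautological form at w is w, so its representative is the fibre coordinate, which is linear.
For this reason the lifting equation over the bundle of forms is an explicit formula for the fibre
velocity. -/
lemma eventually_rep_formAlong {w : Lam F IX p k} (hw : w.proj ∈ c.chart.source) :
    (formAlong : FormAlong (IX.prod 𝓘(ℝ, F)) (Lam.proj : Lam F IX p k → Y) k).rep (lamChart c)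
      =ᶠ[𝓝[range ((IX.prod 𝓘(ℝ, F)).prod 𝓘(ℝ, LamModel EX F ℝ k))]
        ((lamChart c).chart.extend ((IX.prod 𝓘(ℝ, F)).prod 𝓘(ℝ, LamModel EX F ℝ k)) w)]
      (valL EX F k ∘L ContinuousLinearMap.snd ℝ (EX × F) (LamModel EX F ℝ k)) := by
  refine eventually_extend (e := (lamChart (k := k) c).chart) hw ?_
  filter_upwards [(lamChart (k := k) c).chart.open_source.mem_nhds hw] with y hy
  rw [FormAlong.rep_extend (lamChart c) _ hy]
  exact (valL_lamChart c y hy).symm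

lemma contDiffWithinAt_rep_formAlong {w : Lam F IX p k} (hw : w.proj ∈ c.chart.source) :
    ContDiffWithinAt ℝ ∞
      ((formAlong : FormAlong (IX.prod 𝓘(ℝ, F)) (Lam.proj : Lam F IX p k → Y) k).rep (lamChart c))
      (range ((IX.prod 𝓘(ℝ, F)).prod 𝓘(ℝ, LamModel EX F ℝ k)))
      ((lamChart c).chart.extend ((IX.prod 𝓘(ℝ, F)).prod 𝓘(ℝ, LamModel EX F ℝ k)) w) := by
  have h := eventually_rep_formAlong c hw
  exact (ContinuousLinearMap.contDiff _).contDiffWithinAt.congr_of_eventuallyEq h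
    (h.self_of_nhdsWithin (mem_range_self _))

end Liouville

section Legendre

variable {n m : ℕ} {HX : Type*} [TopologicalSpace HX]
  {IX : ModelWithCorners ℝ (BaseModel n) HX}
  {X Y : Type*} [TopologicalSpace X] [ChartedSpace HX X] [IsManifold IX ∞ X]
  [TopologicalSpace Y] [ChartedSpace (ModelProd HX (FibreModel m)) Y]
  [IsManifold (modelY IX m) ∞ Y]
  {p : Y → X} [IsFibred (FibreModel m) IX p]
  (c : FibredChart (F := FibreModel m) IX p)
  {η : DForm IX X (n + 1)} {L : JetBundle IX p m → ℝ}

lemma eventually_rep_legAlong (hL : ContMDiff (modelJet IX m) 𝓘(ℝ, ℝ) ∞ L)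
    {z : JetBundle IX p m} (hz : z.proj ∈ c.chart.source) :
    (legAlong η L).rep (jetChart c) =ᶠ[𝓝[range (modelJet IX m)]
      ((jetChart c).chart.extend (modelJet IX m) z)]
      fun w => legRep (lagRep c L w) (momRep c L w) (η.rep c.base w.1.1) w.2 := by
  refine eventually_extend (e := (jetChart c).chart) hz ?_
  filter_upwards [(jetChart c).chart.open_source.mem_nhds hz] with y hy
  exact rep_legAlong η hL hy

lemma contDiffWithinAt_volRep (hη : η.Smooth) {z : JetBundle IX p m}
    (hz : z.proj ∈ c.chart.source) :
    ContDiffWithinAt ℝ ∞ (fun w : (BaseModel n × FibreModel m) ×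
        (BaseModel n →L[ℝ] FibreModel m) => η.rep c.base w.1.1) (range (modelJet IX m))
      ((jetChart c).chart.extend (modelJet IX m) z) := by
  have h := (DForm.smoothAt_iff c.base_mem (c.maps _ hz)).1 (hη (p z.proj))
  have hb : c.base.extend IX (p z.proj) = ((jetChart c).chart.extend (modelJet IX m) z).1.1 :=
    extend_base c hz
  rw [hb] at h
  refine h.comp (f := fun w : (BaseModel n × FibreModel m) ×
    (BaseModel n →L[ℝ] FibreModel m) => w.1.1) _ contDiff_fst.fst.contDiffWithinAt fun w hw => ?_
  exact mapsTo_fst_range (mapsTo_fst_range hw)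

lemma contDiffWithinAt_rep_legAlong (hη : η.Smooth)
    (hL : ContMDiff (modelJet IX m) 𝓘(ℝ, ℝ) ∞ L)
    {z : JetBundle IX p m} (hz : z.proj ∈ c.chart.source) :
    ContDiffWithinAt ℝ ∞ ((legAlong η L).rep (jetChart c)) (range (modelJet IX m))
      ((jetChart c).chart.extend (modelJet IX m) z) := by
  have h := eventually_rep_legAlong (η := η) c hL hz
  refine ContDiffWithinAt.congr_of_eventuallyEq ?_ h (h.self_of_nhdsWithin (mem_range_self _))
  exact (contDiff_legRep (n := n) (F := FibreModel m)).contDiffAt.comp_contDiffWithinAt _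
    (((contDiffWithinAt_volRep c hη hz).prodMk (contDiffWithinAt_lagRep hL hz)).prodMk
      ((contDiffWithinAt_momRep hL hz).prodMk contDiff_snd.contDiffWithinAt))

lemma smooth_poincareCartan (hη : η.Smooth) (hL : ContMDiff (modelJet IX m) 𝓘(ℝ, ℝ) ∞ L) :
    (poincareCartan η L).Smooth :=
  fun z => smoothAt_basicForm (ℓ := legAlong η L)
    (jetChart (fibredIndex (FibreModel m) IX p z.proj))
    (mem_fibredIndex z.proj) (contDiffWithinAt_rep_legAlong _ hη hL (mem_fibredIndex z.proj))

lemma valL_lamChart_Leg {z : JetBundle IX p m} (hz : z.proj ∈ c.chart.source) :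
    valL (BaseModel n) (FibreModel m) (n + 1)
      ((lamChart c).chart.extend (modelLam IX m) (Leg η L z)).2 =
      (legAlong η L).rep (jetChart c) ((jetChart c).chart.extend (modelJet IX m) z) := by
  rw [FormAlong.rep_extend (jetChart c) _ hz]
  exact valL_lamChart c (Leg η L z) hz

lemma eventually_mapRep_Leg {z : JetBundle IX p m} (hz : z.proj ∈ c.chart.source) :
    ∀ᶠ w in 𝓝[range (modelJet IX m)] ((jetChart c).chart.extend (modelJet IX m) z),
      (mapRep (modelJet IX m) (jetChart c).chart (modelLam IX m) (lamChart c).chart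
        (Leg η L) w).1 = w.1 ∧
      valL (BaseModel n) (FibreModel m) (n + 1) (mapRep (modelJet IX m) (jetChart c).chart
        (modelLam IX m) (lamChart c).chart (Leg η L) w).2 = (legAlong η L).rep (jetChart c) w := by
  refine eventually_extend (e := (jetChart c).chart) hz ?_
  filter_upwards [(jetChart c).chart.open_source.mem_nhds hz] with y hy
  rw [mapRep_extend hy]
  exact ⟨rfl, valL_lamChart_Leg c hy⟩

lemma contMDiff_Leg (hη : η.Smooth) (hL : ContMDiff (modelJet IX m) 𝓘(ℝ, ℝ) ∞ L) :
    ContMDiff (modelJet IX m) (modelLam IX m) ∞ (Leg η L) := by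
  intro z
  set c := fibredIndex (FibreModel m) IX p z.proj
  have hz : z.proj ∈ c.chart.source := mem_fibredIndex z.proj
  -- The representative of `legAlong` is the fibre coordinate of Leg_L seen in the space of all
  -- forms; the linear retraction P brings it back to the model fibre.
  obtain ⟨P, hP⟩ := exists_projL (BaseModel n) (FibreModel m) (n + 1)
  refine contMDiffAt_of_mapRep (jetChart c).chart_mem (lamChart c).chart_mem hz
    ((jetChart c).chart.open_source.mem_nhds hz) ?_
  have h1 := contDiffWithinAt_rep_legAlong c hη hL hz
  have h2 : mapRep (modelJet IX m) (jetChart c).chart (modelLam IX m) (lamChart c).chart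
      (Leg η L) =ᶠ[𝓝[range (modelJet IX m)] ((jetChart c).chart.extend (modelJet IX m) z)]
      fun w => (w.1, P ((legAlong η L).rep (jetChart c) w)) := by
    filter_upwards [eventually_mapRep_Leg (η := η) (L := L) c hz] with w hw
    rw [← hw.2, hP, ← hw.1]
  refine ContDiffWithinAt.congr_of_eventuallyEq ?_ h2 (h2.self_of_nhdsWithin (mem_range_self _))
  exact contDiffWithinAt_fst.prodMk (P.contDiff.contDiffAt.comp_contDiffWithinAt _ h1)

lemma dChart_mfderiv_Leg (hη : η.Smooth) (hL : ContMDiff (modelJet IX m) 𝓘(ℝ, ℝ) ∞ L)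
    {z : JetBundle IX p m} (hz : z.proj ∈ c.chart.source) (u : TangentSpace (modelJet IX m) z) :
    (dChart (modelLam IX m) (lamChart c).chart (Leg η L z)
      (mfderiv (modelJet IX m) (modelLam IX m) (Leg η L) z u)).1 =
      (dChart (modelJet IX m) (jetChart c).chart z u).1 ∧
    valL (BaseModel n) (FibreModel m) (n + 1)
      (dChart (modelLam IX m) (lamChart c).chart (Leg η L z)
      (mfderiv (modelJet IX m) (modelLam IX m) (Leg η L) z u)).2 =
      fderivWithin ℝ ((legAlong η L).rep (jetChart c)) (range (modelJet IX m))
        ((jetChart c).chart.extend (modelJet IX m) z)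
        (dChart (modelJet IX m) (jetChart c).chart z u) := by
  have hd := contMDiff_Leg hη hL z
  have hm := ((contDiffWithinAt_mapRep (jetChart c).chart_mem (lamChart c).chart_mem hz hz
    hd).differentiableWithinAt (by simp)).hasFDerivWithinAt
  have hu := uniqueDiffWithinAt_extend (I := modelJet IX m) (e := (jetChart c).chart) z
  have hev := eventually_mapRep_Leg (η := η) (L := L) c hz
  have h0 := hev.self_of_nhdsWithin (mem_range_self _)
  rw [dChart_mfderiv (jetChart c).chart_mem (lamChart c).chart_mem hz hz
    (hd.mdifferentiableAt (by simp))]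
  constructor
  · have h1 := hm.fst.congr_of_eventuallyEq (hev.mono fun w hw => hw.1.symm) h0.1.symm
    exact DFunLike.congr_fun (hu.eq h1 hasFDerivWithinAt_fst) _
  · have h1 := (hasFDerivWithinAt_clm_comp (valL (BaseModel n) (FibreModel m) (n + 1))
      hm.snd).congr_of_eventuallyEq (hev.mono fun w hw => hw.2.symm) h0.2.symm
    rw [h1.fderivWithin hu]
    rfl

end Legendre

/-! ### Lifts to the bundle of forms, and their behaviour along the fibres of μ. -/

section LinearAlgebra

variable {E G : Type*} [NormedAddCommGroup E] [NormedSpace ℝ E] [NormedAddCommGroup G]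
  [NormedSpace ℝ G] {q : E →L[ℝ] G} {k : ℕ}

/-- Each summand changes one argument only, so of two vertical arguments at least one survives, and
one is enough to annihilate w. -/
lemma fderivComp_mem_two {w : E [⋀^Fin k]→L[ℝ] ℝ} (hw : w ∈ horizForms ℝ q k 1) (T : E →L[ℝ] E) :
    w.fderivCompContinuousLinearMap (ContinuousLinearMap.id ℝ E) T ∈ horizForms ℝ q k 2 := by
  intro u s hs hu
  obtain ⟨i, j, hij, rfl⟩ := Finset.card_eq_two.1 hs
  rw [ContinuousAlternatingMap.fderivCompContinuousLinearMap_apply]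
  refine Finset.sum_eq_zero fun r _ => ?_
  obtain ⟨t, ht, hut⟩ : ∃ t, t ≠ r ∧ q (u t) = 0 := by
    by_cases h : i = r
    · exact ⟨j, fun h' => hij (h.trans h'.symm), hu j (by simp)⟩
    · exact ⟨i, h, hu i (by simp)⟩
  refine hw _ {t} (by simp) fun t' ht' => ?_
  rw [Finset.mem_singleton.1 ht']
  simpa [ht] using hut

/-- The single vertical argument is either kept or replaced by its image under T, which is again
vertical. -/
lemma fderivComp_mem_one {w : E [⋀^Fin k]→L[ℝ] ℝ} (hw : w ∈ horizForms ℝ q k 1) {T : E →L[ℝ] E}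
    (hT : ∀ u, q u = 0 → q (T u) = 0) :
    w.fderivCompContinuousLinearMap (ContinuousLinearMap.id ℝ E) T ∈ horizForms ℝ q k 1 := by
  intro u s hs hu
  obtain ⟨i, rfl⟩ := Finset.card_eq_one.1 hs
  rw [ContinuousAlternatingMap.fderivCompContinuousLinearMap_apply]
  refine Finset.sum_eq_zero fun r _ => ?_
  refine hw _ {i} (by simp) fun t' ht' => ?_
  rw [Finset.mem_singleton.1 ht']
  have hi : q (u i) = 0 := hu i (by simp)
  by_cases h : i = r
  · subst h
    simpa using hT _ hi
  · simpa [h] using hi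

lemma _root_.ContDiffWithinAt.fderivComp {V : Type*} [NormedAddCommGroup V] [NormedSpace ℝ V]
    {w : V → G [⋀^Fin (k + 1)]→L[ℝ] ℝ} {T : V → E →L[ℝ] G} {s : Set V} {x : V}
    (hw : ContDiffWithinAt ℝ ∞ w s x) (A : E →L[ℝ] G) (hT : ContDiffWithinAt ℝ ∞ T s x) :
    ContDiffWithinAt ℝ ∞ (fun v => (w v).fderivCompContinuousLinearMap A (T v)) s x := by
  have h1 := hw.prodMk hT
  have h2 := (contDiff_fderivComp (k := k) A).contDiffAt (x := (w x, T x))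
  exact ContDiffAt.comp_contDiffWithinAt x h2 h1

end LinearAlgebra

section AlphaLift

variable {EX HX F : Type*} [NormedAddCommGroup EX] [NormedSpace ℝ EX] [TopologicalSpace HX]
  [NormedAddCommGroup F] [NormedSpace ℝ F] {IX : ModelWithCorners ℝ EX HX}
  {X Y : Type*} [TopologicalSpace X] [ChartedSpace HX X]
  [TopologicalSpace Y] [ChartedSpace (ModelProd HX F) Y]
  {p : Y → X} {k : ℕ} (c : FibredChart (F := F) IX p)
  (ξ : VField (IX.prod 𝓘(ℝ, F)) Y) (α : DForm (IX.prod 𝓘(ℝ, F)) Y k)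

/-- The derivative of the coordinate representative of a vector field. -/
def fieldDeriv (v : EX × F) : EX × F →L[ℝ] EX × F :=
  fderivWithin ℝ (VField.rep ξ c.chart) (range (IX.prod 𝓘(ℝ, F))) v

/-- The coordinate representative of the exterior derivative of a form. -/
def extRep (v : EX × F) : (EX × F) [⋀^Fin (k + 1)]→L[ℝ] ℝ :=
  extDerivWithin (α.rep c.chart) (range (IX.prod 𝓘(ℝ, F))) v

/-- The rate of change, in coordinates, of the forms `w` which are transported along `ξ` in such
a way that the Lie derivative of the tautological form is `dα`. -/
def liftRep (v : EX × F) (w : (EX × F) [⋀^Fin (k + 1)]→L[ℝ] ℝ) :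
    (EX × F) [⋀^Fin (k + 1)]→L[ℝ] ℝ :=
  extRep c α v - w.fderivCompContinuousLinearMap (ContinuousLinearMap.id ℝ (EX × F))
    (fieldDeriv c ξ v)

variable {ξ α}

lemma contDiffWithinAt_extDerivWithin {E H : Type*} [NormedAddCommGroup E] [NormedSpace ℝ E]
    [TopologicalSpace H] {I : ModelWithCorners ℝ E H} {w : E → E [⋀^Fin k]→L[ℝ] ℝ} {v : E}
    (hv : v ∈ range I) (hw : ContDiffWithinAt ℝ ∞ w (range I) v) :
    ContDiffWithinAt ℝ ∞ (extDerivWithin w (range I)) (range I) v := by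
  have h : ContDiff ℝ ∞ (fun A : E →L[ℝ] E [⋀^Fin k]→L[ℝ] ℝ =>
      ContinuousAlternatingMap.alternatizeUncurryFinCLM ℝ E ℝ A) :=
    contDiff_clm_comp (W := E →L[ℝ] E [⋀^Fin k]→L[ℝ] ℝ) (W' := E [⋀^Fin (k + 1)]→L[ℝ] ℝ)
      (ContinuousAlternatingMap.alternatizeUncurryFinCLM ℝ E ℝ) contDiff_id
  exact h.contDiffAt.comp_contDiffWithinAt v (contDiffWithinAt_fderivWithin_range hv hw)

variable [FiniteDimensional ℝ EX] [FiniteDimensional ℝ F] [IsManifold (IX.prod 𝓘(ℝ, F)) ∞ Y]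
  [IsManifold (IX.prod 𝓘(ℝ, F)) 1 Y]

lemma contDiffWithinAt_fieldDeriv (hξ : IsSmoothVF ξ) {y : Y} (hy : y ∈ c.chart.source) :
    ContDiffWithinAt ℝ ∞ (fieldDeriv c ξ) (range (IX.prod 𝓘(ℝ, F)))
      (c.chart.extend (IX.prod 𝓘(ℝ, F)) y) :=
  contDiffWithinAt_fderivWithin_range (mem_range_self _)
    (VField.contDiffWithinAt_rep c.chart_mem hy hξ)

lemma contDiffWithinAt_extRep (hα : α.Smooth) {y : Y} (hy : y ∈ c.chart.source) :
    ContDiffWithinAt ℝ ∞ (extRep c α) (range (IX.prod 𝓘(ℝ, F)))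
      (c.chart.extend (IX.prod 𝓘(ℝ, F)) y) :=
  contDiffWithinAt_extDerivWithin (mem_range_self _)
    ((DForm.smoothAt_iff c.chart_mem hy).1 (hα y))

variable [IsFibred F IX p]

lemma liftsAt_formAlong_iff (hξ : IsSmoothVF ξ) (hα : α.Smooth) {w : Lam F IX p (k + 1)}
    (hw : w.proj ∈ c.chart.source)
    {u : TangentSpace ((IX.prod 𝓘(ℝ, F)).prod 𝓘(ℝ, LamModel EX F ℝ (k + 1))) w}
    (hu : tangentProj (LamModel EX F ℝ (k + 1)) (IX.prod 𝓘(ℝ, F)) Lam.proj w u = ξ w.proj) :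
    LiftsAt (V := LamModel EX F ℝ (k + 1)) (M := Lam F IX p (k + 1)) formAlong ξ α w u ↔
      valL EX F (k + 1) (dChart ((IX.prod 𝓘(ℝ, F)).prod 𝓘(ℝ, LamModel EX F ℝ (k + 1)))
        (lamChart c).chart w u).2 =
      liftRep c ξ α (c.chart.extend (IX.prod 𝓘(ℝ, F)) w.proj)
        (valL EX F (k + 1) ((lamChart c).chart.extend
          ((IX.prod 𝓘(ℝ, F)).prod 𝓘(ℝ, LamModel EX F ℝ (k + 1))) w).2) := by
  have h := eventually_rep_formAlong c hw
  have h0 := h.self_of_nhdsWithin (mem_range_self _)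
  rw [liftsAt_iff (lamChart c) hw (contDiffWithinAt_rep_formAlong c hw) hξ hα hu,
    h.fderivWithin_eq h0, h0, ContinuousLinearMap.fderivWithin _ (uniqueDiffWithinAt_extend w)]
  exact eq_sub_iff_add_eq.symm

lemma liftsAt_formAlong_unique (hξ : IsSmoothVF ξ) (hα : α.Smooth) {w : Lam F IX p (k + 1)}
    {u u' : TangentSpace ((IX.prod 𝓘(ℝ, F)).prod 𝓘(ℝ, LamModel EX F ℝ (k + 1))) w}
    (hu : LiftsAt (V := LamModel EX F ℝ (k + 1)) (M := Lam F IX p (k + 1)) formAlong ξ α w u)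
    (hu' : LiftsAt (V := LamModel EX F ℝ (k + 1)) (M := Lam F IX p (k + 1)) formAlong ξ α w u') :
    u = u' := by
  set c := fibredIndex F IX p w.proj
  have hw : w.proj ∈ c.chart.source := mem_fibredIndex w.proj
  apply dChart_injective (lamChart (k := k + 1) c).chart_mem hw
  refine Prod.ext ?_ (valL_injective ?_)
  · rw [fst_dChart_apply (lamChart c) hw, fst_dChart_apply (lamChart c) hw, hu.1, hu'.1]
  · rw [(liftsAt_formAlong_iff c hξ hα hw hu.1).1 hu, (liftsAt_formAlong_iff c hξ hα hw hu'.1).1 hu']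

/-- The equation leaves one candidate for the velocity. The only obstruction is that it must be
tangent to the bundle, that is, lie in the model fibre. -/
lemma exists_liftsAt_formAlong_iff (hξ : IsSmoothVF ξ) (hα : α.Smooth) {w : Lam F IX p (k + 1)}
    (hw : w.proj ∈ c.chart.source) :
    (∃ u, LiftsAt (V := LamModel EX F ℝ (k + 1)) (M := Lam F IX p (k + 1)) formAlong ξ α w u) ↔
      liftRep c ξ α (c.chart.extend (IX.prod 𝓘(ℝ, F)) w.proj)
        (valL EX F (k + 1) ((lamChart c).chart.extend
          ((IX.prod 𝓘(ℝ, F)).prod 𝓘(ℝ, LamModel EX F ℝ (k + 1))) w).2) ∈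
      horizForms ℝ (ContinuousLinearMap.fst ℝ EX F) (k + 1) 2 := by
  constructor
  · rintro ⟨u, hu⟩
    rw [← (liftsAt_formAlong_iff c hξ hα hw hu.1).1 hu]
    exact valL_mem _
  · intro h
    let a : LamModel EX F ℝ (k + 1) := ⟨_, h⟩
    have hD : dChart ((IX.prod 𝓘(ℝ, F)).prod 𝓘(ℝ, LamModel EX F ℝ (k + 1))) (lamChart c).chart w
        ((dChart ((IX.prod 𝓘(ℝ, F)).prod 𝓘(ℝ, LamModel EX F ℝ (k + 1))) (lamChart c).chart
          w).inverse (dChart (IX.prod 𝓘(ℝ, F)) c.chart w.proj (ξ w.proj), a)) = _ :=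
      dChart_apply_inverse (lamChart (k := k + 1) c).chart_mem hw _
    refine ⟨(dChart ((IX.prod 𝓘(ℝ, F)).prod 𝓘(ℝ, LamModel EX F ℝ (k + 1))) (lamChart c).chart
      w).inverse (dChart (IX.prod 𝓘(ℝ, F)) c.chart w.proj (ξ w.proj), a), ?_⟩
    have hu : tangentProj (LamModel EX F ℝ (k + 1)) (IX.prod 𝓘(ℝ, F)) Lam.proj w
        ((dChart ((IX.prod 𝓘(ℝ, F)).prod 𝓘(ℝ, LamModel EX F ℝ (k + 1))) (lamChart c).chart
          w).inverse (dChart (IX.prod 𝓘(ℝ, F)) c.chart w.proj (ξ w.proj), a)) = ξ w.proj := by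
      apply dChart_injective c.chart_mem hw
      refine (fst_dChart_apply (lamChart c) hw _).symm.trans ?_
      rw [hD]
    rw [liftsAt_formAlong_iff c hξ hα hw hu, hD]
    rfl

lemma contDiffWithinAt_liftRep (hξ : IsSmoothVF ξ) (hα : α.Smooth) {y : Y}
    (hy : y ∈ c.chart.source) {G : Type*} [NormedAddCommGroup G] [NormedSpace ℝ G]
    {x : (EX × F) × G} (hx : x.1 = c.chart.extend (IX.prod 𝓘(ℝ, F)) y)
    (A : G →L[ℝ] (EX × F) [⋀^Fin (k + 1)]→L[ℝ] ℝ) :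
    ContDiffWithinAt ℝ ∞ (fun v : (EX × F) × G => liftRep c ξ α v.1 (A v.2))
      (range ((IX.prod 𝓘(ℝ, F)).prod 𝓘(ℝ, G))) x := by
  have hD := contDiffWithinAt_fieldDeriv c hξ hy
  have hA := contDiffWithinAt_extRep c hα hy
  rw [← hx] at hD hA
  have hD' : ContDiffWithinAt ℝ ∞ (fun v : (EX × F) × G => fieldDeriv c ξ v.1)
      (range ((IX.prod 𝓘(ℝ, F)).prod 𝓘(ℝ, G))) x :=
    hD.comp x contDiffWithinAt_fst mapsTo_fst_range
  have hA' : ContDiffWithinAt ℝ ∞ (fun v : (EX × F) × G => extRep c α v.1)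
      (range ((IX.prod 𝓘(ℝ, F)).prod 𝓘(ℝ, G))) x :=
    hA.comp x contDiffWithinAt_fst mapsTo_fst_range
  have hv : ContDiff ℝ ∞ (fun v : (EX × F) × G => A v.2) := A.contDiff.comp contDiff_snd
  have hI : ContDiffWithinAt ℝ ∞ (fun v : (EX × F) × G =>
      (A v.2).fderivCompContinuousLinearMap (ContinuousLinearMap.id ℝ (EX × F))
        (fieldDeriv c ξ v.1)) (range ((IX.prod 𝓘(ℝ, F)).prod 𝓘(ℝ, G))) x :=
    hv.contDiffWithinAt.fderivComp _ hD'
  exact hA'.sub hI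

/-- Solving the equation pointwise suffices: both components of the solution are given by
expressions that are smooth in the point. -/
lemma isSmoothVF_of_liftsAt (hξ : IsSmoothVF ξ) (hα : α.Smooth)
    {Ξ : VField ((IX.prod 𝓘(ℝ, F)).prod 𝓘(ℝ, LamModel EX F ℝ (k + 1))) (Lam F IX p (k + 1))}
    (h : ∀ w, LiftsAt (V := LamModel EX F ℝ (k + 1)) (M := Lam F IX p (k + 1)) formAlong ξ α w
      (Ξ w)) : IsSmoothVF Ξ := by
  obtain ⟨P, hP⟩ := exists_projL EX F (k + 1)
  refine VField.isSmoothVF_of_rep fun w => ?_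
  set c := fibredIndex F IX p w.proj
  have hw : w.proj ∈ c.chart.source := mem_fibredIndex w.proj
  refine ⟨(lamChart c).chart, (lamChart c).chart_mem, hw, ?_⟩
  have h1 : VField.rep Ξ (lamChart c).chart
      =ᶠ[𝓝[range ((IX.prod 𝓘(ℝ, F)).prod 𝓘(ℝ, LamModel EX F ℝ (k + 1)))]
        ((lamChart c).chart.extend ((IX.prod 𝓘(ℝ, F)).prod 𝓘(ℝ, LamModel EX F ℝ (k + 1))) w)]
      fun v => (VField.rep ξ c.chart v.1, P (liftRep c ξ α v.1 (valL EX F (k + 1) v.2))) := by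
    refine eventually_extend (e := (lamChart (k := k + 1) c).chart) hw ?_
    filter_upwards [(lamChart (k := k + 1) c).chart.open_source.mem_nhds hw] with y hy
    have hb := extend_base (lamChart c) hy
    rw [VField.rep_extend Ξ hy, ← hb]
    refine Prod.ext ?_ ?_
    · refine (fst_dChart_apply (lamChart c) hy _).trans ?_
      rw [(h y).1]
      exact (VField.rep_extend ξ hy).symm
    · have h2 := congrArg P ((liftsAt_formAlong_iff c hξ hα hy (h y).1).1 (h y))
      rwa [hP] at h2
  refine ContDiffWithinAt.congr_of_eventuallyEq ?_ h1 (h1.self_of_nhdsWithin (mem_range_self _))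
  have hb : ((lamChart c).chart.extend
      ((IX.prod 𝓘(ℝ, F)).prod 𝓘(ℝ, LamModel EX F ℝ (k + 1))) w).1 =
      c.chart.extend (IX.prod 𝓘(ℝ, F)) w.proj := (extend_base (lamChart c) hw).symm
  have hX := VField.contDiffWithinAt_rep c.chart_mem hw hξ
  rw [← hb] at hX
  have hX' := hX.comp _ contDiffWithinAt_fst (mapsTo_fst_range (V := LamModel EX F ℝ (k + 1)))
  exact hX'.prodMk (P.contDiff.contDiffAt.comp_contDiffWithinAt _
    (contDiffWithinAt_liftRep c hξ hα hw hb (valL EX F (k + 1))))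

/-- The prescribed velocity is affine in w, so two velocities differ by the derivation of w' - w by
Dξ. Equal classes mean that w' - w is semibasic. Its derivation is annihilated by two vertical
vectors in any case, and by one if Dξ preserves vertical vectors. The first part gives the lift off
the image of Leg_L, the second its projectability. -/
lemma liftRep_sub_mem (v : EX × F) {w w' : LamModel EX F ℝ (k + 1)}
    (h : mkL EX F (k + 1) w = mkL EX F (k + 1) w') :
    liftRep c ξ α v (valL EX F (k + 1) w) - liftRep c ξ α v (valL EX F (k + 1) w') ∈
      horizForms ℝ (ContinuousLinearMap.fst ℝ EX F) (k + 1) 2 ∧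
    ((∀ f, (fieldDeriv c ξ v (0, f)).1 = 0) →
      liftRep c ξ α v (valL EX F (k + 1) w) - liftRep c ξ α v (valL EX F (k + 1) w') ∈
      horizForms ℝ (ContinuousLinearMap.fst ℝ EX F) (k + 1) 1) := by
  have h1 : valL EX F (k + 1) (w' - w) ∈
      horizForms ℝ (ContinuousLinearMap.fst ℝ EX F) (k + 1) 1 := by
    rw [← mkL_eq_zero_iff, map_sub, h, sub_self]
  have h2 : liftRep c ξ α v (valL EX F (k + 1) w) - liftRep c ξ α v (valL EX F (k + 1) w') =
      (valL EX F (k + 1) (w' - w)).fderivCompContinuousLinearMap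
        (ContinuousLinearMap.id ℝ (EX × F)) (fieldDeriv c ξ v) := by
    have h3 := fderivComp_add_left (valL EX F (k + 1) (w' - w)) (valL EX F (k + 1) w)
      (ContinuousLinearMap.id ℝ (EX × F)) (fieldDeriv c ξ v)
    rw [← map_add, sub_add_cancel] at h3
    rw [liftRep, liftRep, h3]
    abel
  rw [h2]
  refine ⟨fderivComp_mem_two h1 _, fun hξ => fderivComp_mem_one h1 fun u hu => ?_⟩
  have hu' : u = (0, u.2) := Prod.ext hu rfl
  rw [hu']
  exact hξ u.2

end AlphaLift

section AlphaLift

variable {EX HX F : Type*} [NormedAddCommGroup EX] [NormedSpace ℝ EX] [TopologicalSpace HX]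
  [NormedAddCommGroup F] [NormedSpace ℝ F] {IX : ModelWithCorners ℝ EX HX}
  {X Y : Type*} [TopologicalSpace X] [ChartedSpace HX X]
  [TopologicalSpace Y] [ChartedSpace (ModelProd HX F) Y]
  {p : Y → X} {k : ℕ} (c : FibredChart (F := F) IX p)
  {ξ : VField (IX.prod 𝓘(ℝ, F)) Y} {α : DForm (IX.prod 𝓘(ℝ, F)) Y k}
  [FiniteDimensional ℝ EX] [FiniteDimensional ℝ F] [IsManifold (IX.prod 𝓘(ℝ, F)) ∞ Y]
  [IsManifold (IX.prod 𝓘(ℝ, F)) 1 Y] [IsFibred F IX p]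

lemma mkL_eq_of_toDual_eq {w w' : Lam F IX p (k + 1)} (h : w.toDual = w'.toDual)
    (hw : w.proj ∈ c.chart.source) (hw' : w'.proj ∈ c.chart.source) :
    mkL EX F (k + 1) ((lamChart c).chart.extend
        ((IX.prod 𝓘(ℝ, F)).prod 𝓘(ℝ, LamModel EX F ℝ (k + 1))) w).2 =
      mkL EX F (k + 1) ((lamChart c).chart.extend
        ((IX.prod 𝓘(ℝ, F)).prod 𝓘(ℝ, LamModel EX F ℝ (k + 1))) w').2 := by
  have h1 := dualChart_extend_toDual c hw
  rw [h, dualChart_extend_toDual c hw'] at h1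
  exact (congrArg Prod.snd h1).symm

/-- Liftability is constant along the fibres of μ, since the obstruction changes there by an
admissible velocity. -/
lemma exists_liftsAt_of_toDual_eq (hξ : IsSmoothVF ξ) (hα : α.Smooth) {w w' : Lam F IX p (k + 1)}
    (h : w.toDual = w'.toDual) (h' : ∃ u, LiftsAt (V := LamModel EX F ℝ (k + 1))
      (M := Lam F IX p (k + 1)) formAlong ξ α w' u) :
    ∃ u, LiftsAt (V := LamModel EX F ℝ (k + 1)) (M := Lam F IX p (k + 1)) formAlong ξ α w u := by
  have hp : w.proj = w'.proj := congrArg DualJet.proj h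
  set c := fibredIndex F IX p w'.proj
  have hw' : w'.proj ∈ c.chart.source := mem_fibredIndex w'.proj
  have hw : w.proj ∈ c.chart.source := by rw [hp]; exact hw'
  rw [exists_liftsAt_formAlong_iff c hξ hα hw'] at h'
  rw [exists_liftsAt_formAlong_iff c hξ hα hw, hp]
  have h1 := (liftRep_sub_mem (ξ := ξ) (α := α) c (c.chart.extend (IX.prod 𝓘(ℝ, F)) w'.proj)
    (mkL_eq_of_toDual_eq c h hw hw')).1
  have h2 := (horizForms ℝ (ContinuousLinearMap.fst ℝ EX F) (k + 1) 2).add_mem h1 h'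
  rwa [sub_add_cancel] at h2

/-- When Dξ preserves vertical vectors, fibre velocities at two points over the same dual jet differ
by a semibasic form, which the quotient kills. -/
lemma dChart_toDual_eq (hξ : IsSmoothVF ξ) (hα : α.Smooth) {w w' : Lam F IX p (k + 1)}
    (h : w.toDual = w'.toDual) (hw : w.proj ∈ c.chart.source) (hw' : w'.proj ∈ c.chart.source)
    (hv : ∀ f, (fieldDeriv c ξ (c.chart.extend (IX.prod 𝓘(ℝ, F)) w'.proj) (0, f)).1 = 0)
    {u : TangentSpace ((IX.prod 𝓘(ℝ, F)).prod 𝓘(ℝ, LamModel EX F ℝ (k + 1))) w}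
    {u' : TangentSpace ((IX.prod 𝓘(ℝ, F)).prod 𝓘(ℝ, LamModel EX F ℝ (k + 1))) w'}
    (hu : LiftsAt (V := LamModel EX F ℝ (k + 1)) (M := Lam F IX p (k + 1)) formAlong ξ α w u)
    (hu' : LiftsAt (V := LamModel EX F ℝ (k + 1)) (M := Lam F IX p (k + 1)) formAlong ξ α w' u') :
    dChart ((IX.prod 𝓘(ℝ, F)).prod 𝓘(ℝ, DualModel EX F ℝ (k + 1))) (dualChart c).chart w.toDual
      (mfderiv ((IX.prod 𝓘(ℝ, F)).prod 𝓘(ℝ, LamModel EX F ℝ (k + 1)))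
        ((IX.prod 𝓘(ℝ, F)).prod 𝓘(ℝ, DualModel EX F ℝ (k + 1))) Lam.toDual w u) =
    dChart ((IX.prod 𝓘(ℝ, F)).prod 𝓘(ℝ, DualModel EX F ℝ (k + 1))) (dualChart c).chart w'.toDual
      (mfderiv ((IX.prod 𝓘(ℝ, F)).prod 𝓘(ℝ, LamModel EX F ℝ (k + 1)))
        ((IX.prod 𝓘(ℝ, F)).prod 𝓘(ℝ, DualModel EX F ℝ (k + 1))) Lam.toDual w' u') := by
  have hp : w.proj = w'.proj := congrArg DualJet.proj h
  rw [dChart_mfderiv_toDual c hw, dChart_mfderiv_toDual c hw']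
  have hξp : ∀ y, y = w'.proj → VField.rep ξ c.chart (c.chart.extend (IX.prod 𝓘(ℝ, F)) y) =
      VField.rep ξ c.chart (c.chart.extend (IX.prod 𝓘(ℝ, F)) w'.proj) := by
    rintro y rfl; rfl
  refine Prod.ext ?_ ?_
  · refine (fst_dChart_apply (lamChart c) hw u).trans
      (Eq.trans ?_ (fst_dChart_apply (lamChart c) hw' u').symm)
    rw [hu.1, hu'.1]
    have h1 := hξp _ hp
    rwa [VField.rep_extend ξ hw, VField.rep_extend ξ hw'] at h1
  · have h1 := (liftsAt_formAlong_iff c hξ hα hw hu.1).1 hu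
    have h2 := (liftsAt_formAlong_iff c hξ hα hw' hu'.1).1 hu'
    rw [hp] at h1
    have h3 := (liftRep_sub_mem (ξ := ξ) (α := α) c (c.chart.extend (IX.prod 𝓘(ℝ, F)) w'.proj)
      (mkL_eq_of_toDual_eq c h hw hw')).2 hv
    rw [← h1, ← h2, ← map_sub, ← mkL_eq_zero_iff, map_sub] at h3
    exact sub_eq_zero.1 h3

end AlphaLift

/-! ### The lift along the Legendre transformation. -/

section Legendre

variable {n m : ℕ} {HX : Type*} [TopologicalSpace HX]
  {IX : ModelWithCorners ℝ (BaseModel n) HX}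
  {X Y : Type*} [TopologicalSpace X] [ChartedSpace HX X] [IsManifold IX ∞ X]
  [TopologicalSpace Y] [ChartedSpace (ModelProd HX (FibreModel m)) Y]
  [IsManifold (modelY IX m) ∞ Y] [IsManifold (modelY IX m) 1 Y]
  {p : Y → X} [IsFibred (FibreModel m) IX p]
  (c : FibredChart (F := FibreModel m) IX p)
  {η : DForm IX X (n + 1)} {L : JetBundle IX p m → ℝ}
  {ξ : VField (modelY IX m) Y} {α : DForm (modelY IX m) Y n}

lemma liftsAt_legAlong_iff (hη : η.Smooth) (hL : ContMDiff (modelJet IX m) 𝓘(ℝ, ℝ) ∞ L)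
    (hξ : IsSmoothVF ξ) (hα : α.Smooth) {z : JetBundle IX p m} (hz : z.proj ∈ c.chart.source)
    {u : TangentSpace (modelJet IX m) z}
    (hu : tangentProj (BaseModel n →L[ℝ] FibreModel m) (modelY IX m) Jet.proj z u = ξ z.proj) :
    LiftsAt (V := BaseModel n →L[ℝ] FibreModel m) (M := JetBundle IX p m) (legAlong η L) ξ α z u ↔
      fderivWithin ℝ ((legAlong η L).rep (jetChart c)) (range (modelJet IX m))
        ((jetChart c).chart.extend (modelJet IX m) z)
        (dChart (modelJet IX m) (jetChart c).chart z u) =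
      liftRep c ξ α (c.chart.extend (modelY IX m) z.proj)
        ((legAlong η L).rep (jetChart c) ((jetChart c).chart.extend (modelJet IX m) z)) := by
  rw [liftsAt_iff (jetChart c) hz (contDiffWithinAt_rep_legAlong c hη hL hz) hξ hα hu]
  exact eq_sub_iff_add_eq.symm

lemma tangentProj_mfderiv_Leg (hη : η.Smooth) (hL : ContMDiff (modelJet IX m) 𝓘(ℝ, ℝ) ∞ L)
    (z : JetBundle IX p m) (u : TangentSpace (modelJet IX m) z) :
    tangentProj (LamModel (BaseModel n) (FibreModel m) ℝ (n + 1)) (modelY IX m) Lam.proj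
      (Leg η L z) (mfderiv (modelJet IX m) (modelLam IX m) (Leg η L) z u) =
    tangentProj (BaseModel n →L[ℝ] FibreModel m) (modelY IX m) Jet.proj z u := by
  set c := fibredIndex (FibreModel m) IX p z.proj
  have hz : z.proj ∈ c.chart.source := mem_fibredIndex z.proj
  apply dChart_injective c.chart_mem hz
  have h1 := fst_dChart_apply (lamChart c) (y := Leg η L z) hz
    (mfderiv (modelJet IX m) (modelLam IX m) (Leg η L) z u)
  have h2 := fst_dChart_apply (jetChart c) hz u
  exact h1.symm.trans ((dChart_mfderiv_Leg c hη hL hz u).1.trans h2)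

/-- If u projects onto ξ, both conditions are the same coordinate equation, because the fibre
coordinate of Leg_L is the representative of `legAlong`. Otherwise both fail, as Leg_L covers the
identity of Y. -/
lemma liftsAt_mfderiv_Leg_iff (hη : η.Smooth) (hL : ContMDiff (modelJet IX m) 𝓘(ℝ, ℝ) ∞ L)
    (hξ : IsSmoothVF ξ) (hα : α.Smooth) {z : JetBundle IX p m}
    {u : TangentSpace (modelJet IX m) z} :
    LiftsAt (V := LamModel (BaseModel n) (FibreModel m) ℝ (n + 1)) (M := LamBundle IX p m)
      formAlong ξ α (Leg η L z) (mfderiv (modelJet IX m) (modelLam IX m) (Leg η L) z u) ↔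
    LiftsAt (V := BaseModel n →L[ℝ] FibreModel m) (M := JetBundle IX p m) (legAlong η L) ξ α z u := by
  by_cases hu : tangentProj (BaseModel n →L[ℝ] FibreModel m) (modelY IX m) Jet.proj z u = ξ z.proj
  · have hu' := (tangentProj_mfderiv_Leg (η := η) hη hL z u).trans hu
    set c := fibredIndex (FibreModel m) IX p z.proj
    have hz : z.proj ∈ c.chart.source := mem_fibredIndex z.proj
    rw [liftsAt_legAlong_iff c hη hL hξ hα hz hu,
      liftsAt_formAlong_iff c hξ hα (w := Leg η L z) hz hu', (dChart_mfderiv_Leg c hη hL hz u).2,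
      valL_lamChart_Leg c hz]
    rfl
  · refine ⟨fun h => absurd ?_ hu, fun h => absurd h.1 hu⟩
    exact (tangentProj_mfderiv_Leg (η := η) hη hL z u).symm.trans h.1

lemma isAlphaLift_iff (hξ : IsSmoothVF ξ) (hα : α.Smooth)
    {Ξ : VField (modelLam IX m) (LamBundle IX p m)} :
    IsAlphaLift ξ α Ξ ↔ ∀ w, LiftsAt (V := LamModel (BaseModel n) (FibreModel m) ℝ (n + 1))
      (M := LamBundle IX p m) formAlong ξ α w (Ξ w) := by
  constructor
  · intro h
    exact lie_basicForm_iff.1 ⟨h.related, h.lie⟩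
  · intro h
    obtain ⟨h1, h2⟩ := lie_basicForm_iff.2 h
    exact ⟨isSmoothVF_of_liftsAt hξ hα h, h1, h2⟩

lemma isAlphaLift_unique (hξ : IsSmoothVF ξ) (hα : α.Smooth)
    {Ξ Ξ' : VField (modelLam IX m) (LamBundle IX p m)}
    (h : IsAlphaLift ξ α Ξ) (h' : IsAlphaLift ξ α Ξ') : Ξ' = Ξ :=
  funext fun w => liftsAt_formAlong_unique hξ hα ((isAlphaLift_iff hξ hα).1 h' w)
    ((isAlphaLift_iff hξ hα).1 h w)

/-- As leg_L is onto, every fibre of μ meets the image of Leg_L, where the image of ξ₁ is a lift;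
liftability then spreads over the fibre. Uniqueness of pointwise lifts gives both a global field and
its agreement with TLeg_L(ξ₁). -/
lemma exists_isAlphaLift (hη : η.Smooth) (hL : ContMDiff (modelJet IX m) 𝓘(ℝ, ℝ) ∞ L)
    (hξ : IsSmoothVF ξ) (hα : α.Smooth)
    (hleg : Function.Surjective (leg η L))
    {ξ₁ : VField (modelJet IX m) (JetBundle IX p m)}
    (h : ∀ z, LiftsAt (V := BaseModel n →L[ℝ] FibreModel m) (M := JetBundle IX p m)
      (legAlong η L) ξ α z (ξ₁ z)) :
    ∃ Ξ : VField (modelLam IX m) (LamBundle IX p m), IsAlphaLift ξ α Ξ ∧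
      IsRelated (Leg η L) ξ₁ Ξ := by
  have h1 : ∀ w : LamBundle IX p m, ∃ u, LiftsAt
      (V := LamModel (BaseModel n) (FibreModel m) ℝ (n + 1)) (M := LamBundle IX p m)
      formAlong ξ α w u := by
    intro w
    obtain ⟨z, hz⟩ := hleg w.toDual
    exact exists_liftsAt_of_toDual_eq hξ hα hz.symm
      ⟨_, (liftsAt_mfderiv_Leg_iff hη hL hξ hα).2 (h z)⟩
  choose Ξ hΞ using h1
  refine ⟨Ξ, (isAlphaLift_iff hξ hα).2 hΞ, fun z => ?_⟩
  exact liftsAt_formAlong_unique hξ hα ((liftsAt_mfderiv_Leg_iff hη hL hξ hα).2 (h z)) (hΞ _)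

end Legendre

/-! ### Contact forms and prolongations in coordinates. -/

namespace DForm

variable {E H M : Type*} [NormedAddCommGroup E] [NormedSpace ℝ E] [TopologicalSpace H]
  {I : ModelWithCorners ℝ E H} [TopologicalSpace M] [ChartedSpace H M] [FiniteDimensional ℝ E]
  {e : OpenPartialHomeomorph M H} {k : ℕ}

/-- The Lie derivative in a chart. -/
lemma lie_eq_rep [IsManifold I ∞ M] [IsManifold I 1 M] (he : e ∈ IsManifold.maximalAtlas I ∞ M)
    {x : M} (hx : x ∈ e.source) {ξ : VField I M} (hξ : IsSmoothVF ξ) {w : DForm I M (k + 1)}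
    (hw : w.SmoothAt x) :
    lie ξ w x = (fderivWithin ℝ (w.rep e) (range I) (e.extend I x) (dChart I e x (ξ x)) +
      (w.rep e (e.extend I x)).fderivCompContinuousLinearMap (ContinuousLinearMap.id ℝ E)
        (fderivWithin ℝ (VField.rep ξ e) (range I) (e.extend I x))).compContinuousLinearMap
      (dChart I e x) := by
  have h1 : (DForm.interior ξ w).rep e =ᶠ[𝓝[range I] (e.extend I x)]
      fun v => (w.rep e v).curryLeft (VField.rep ξ e v) := by
    refine eventually_extend hx ?_
    filter_upwards [e.open_source.mem_nhds hx] with y hy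
    exact rep_interior he hy ξ w
  have hd := d_eq_rep he hx (hw.interior hξ)
  rw [h1.extDerivWithin_eq_of_mem (mem_range_self _)] at hd
  have hX := VField.contDiffWithinAt_rep he hx hξ
  have hw' := (smoothAt_iff he hx).1 hw
  have h2 := extDerivWithin_curryLeft_add (hw'.differentiableWithinAt (by simp))
    (hX.differentiableWithinAt (by simp)) (uniqueDiffWithinAt_extend (e := e) x)
  have h3 := curryLeft_add_comp (T := E) (dChart I e x)
    (extDerivWithin (fun v => (w.rep e v).curryLeft (VField.rep ξ e v)) (range I) (e.extend I x))
    (extDerivWithin (w.rep e) (range I) (e.extend I x)) (u := ξ x)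
    (VField.rep_extend ξ hx).symm
  rw [h2] at h3
  rw [← VField.rep_extend ξ hx]
  refine Eq.trans ?_ h3
  exact congrArg₂ (fun (a : E [⋀^Fin (k + 1)]→L[ℝ] ℝ) (b : E [⋀^Fin (k + 2)]→L[ℝ] ℝ) =>
    a + b.curryLeft (E := E) (ξ x)) hd (d_eq_rep he hx hw)

end DForm

section ContactCalculus

variable {B F : Type*} [NormedAddCommGroup B] [NormedSpace ℝ B] [NormedAddCommGroup F]
  [NormedSpace ℝ F]

-- The identity θ((a, v a), f) = 0 holds at all nearby points, with v the moving slope.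
-- Differentiating it in the direction u trades the derivative of θ for a value of θ on ((0, u.2 a),
-- 0), so that on contact vectors the Lie derivative becomes algebraic in θ.
open ContinuousAlternatingMap in
lemma contact_lie_apply {s : Set ((B × F) × (B →L[ℝ] F))} {x : (B × F) × (B →L[ℝ] F)}
    (hs : UniqueDiffWithinAt ℝ s x) (hx : x ∈ s)
    {θ : (B × F) × (B →L[ℝ] F) → ((B × F) × (B →L[ℝ] F)) [⋀^Fin 1]→L[ℝ] ℝ}
    (hθ : DifferentiableWithinAt ℝ θ s x)
    (h0 : ∀ᶠ w in 𝓝[s] x, ∀ (a : B) (f : B →L[ℝ] F), θ w (fun _ => ((a, w.2 a), f)) = 0)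
    (u : (B × F) × (B →L[ℝ] F))
    (T : (B × F) × (B →L[ℝ] F) →L[ℝ] (B × F) × (B →L[ℝ] F)) (a : B) (f : B →L[ℝ] F) :
    (fderivWithin ℝ θ s x u + (θ x).fderivCompContinuousLinearMap (ContinuousLinearMap.id ℝ _) T)
        (fun _ => ((a, x.2 a), f)) =
      θ x (fun _ => T ((a, x.2 a), f) - ((0, u.2 a), 0)) := by
  let S := (ofSubsingletonLIE (𝕜 := ℝ) (E := (B × F) × (B →L[ℝ] F)) (F := ℝ) (0 : Fin 1)).symm
  have hS : ∀ (w : ((B × F) × (B →L[ℝ] F)) [⋀^Fin 1]→L[ℝ] ℝ) v, S w v = w (fun _ => v) :=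
    fun w v => rfl
  let l : (B × F) × (B →L[ℝ] F) →L[ℝ] (B × F) × (B →L[ℝ] F) :=
    (((0 : (B × F) × (B →L[ℝ] F) →L[ℝ] B).prod
      (ContinuousLinearMap.apply ℝ F a ∘L ContinuousLinearMap.snd ℝ (B × F) (B →L[ℝ] F)))).prod 0
  have h1 : HasFDerivWithinAt (fun w => S (θ w))
      ((S : _ →L[ℝ] _) ∘L fderivWithin ℝ θ s x) s x :=
    hasFDerivWithinAt_clm_comp (W := ((B × F) × (B →L[ℝ] F)) [⋀^Fin 1]→L[ℝ] ℝ)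
      (W' := (B × F) × (B →L[ℝ] F) →L[ℝ] ℝ) (S : _ →L[ℝ] _) hθ.hasFDerivWithinAt
  have h2 : HasFDerivWithinAt (fun w : (B × F) × (B →L[ℝ] F) => ((a, w.2 a), f)) l s x := by
    have h3 := (l.hasFDerivAt (x := x)).hasFDerivWithinAt (s := s) |>.add_const ((a, 0), f)
    refine h3.congr_of_eventuallyEq (Eventually.of_forall fun w => ?_) ?_ <;> simp [l]
  have h3 := h1.clm_apply h2
  have h4 : HasFDerivWithinAt (fun w : (B × F) × (B →L[ℝ] F) => S (θ w) ((a, w.2 a), f))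
      (0 : (B × F) × (B →L[ℝ] F) →L[ℝ] ℝ) s x := by
    have h5 : (fun w : (B × F) × (B →L[ℝ] F) => S (θ w) ((a, w.2 a), f)) =ᶠ[𝓝[s] x] fun _ => 0 :=
      h0.mono fun w hw => hw a f
    exact (hasFDerivWithinAt_const 0 x s).congr_of_eventuallyEq h5 (h5.self_of_nhdsWithin hx)
  have h5 := DFunLike.congr_fun (hs.eq h3 h4) u
  have h6 : θ x (fun _ => ((0, u.2 a), 0)) + fderivWithin ℝ θ s x u (fun _ => ((a, x.2 a), f)) = 0 :=
    h5
  have h7 : ∀ v v' : (B × F) × (B →L[ℝ] F), θ x (fun _ => v - v') =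
      θ x (fun _ => v) - θ x (fun _ => v') := fun v v' => map_sub (S (θ x)) v v'
  rw [h7, ContinuousAlternatingMap.add_apply, fderivCompContinuousLinearMap_apply,
    Fin.sum_univ_one, eq_neg_of_add_eq_zero_left h6, sub_neg_eq_add, add_comm]
  congr 1
  congr 1
  funext i
  rw [Subsingleton.elim i 0]
  simp

end ContactCalculus

/-- The form which has the representative `Θ` in a chart. -/
def DForm.ofModel {E H M : Type*} [NormedAddCommGroup E] [NormedSpace ℝ E] [TopologicalSpace H]
    {I : ModelWithCorners ℝ E H} [TopologicalSpace M] [ChartedSpace H M] {k : ℕ}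
    (e : OpenPartialHomeomorph M H) (Θ : E → E [⋀^Fin k]→L[ℝ] ℝ) : DForm I M k := fun z =>
  (Θ (e.extend I z)).compContinuousLinearMap (dChart I e z)

section OfModel

variable {E H M : Type*} [NormedAddCommGroup E] [NormedSpace ℝ E] [TopologicalSpace H]
  {I : ModelWithCorners ℝ E H} [TopologicalSpace M] [ChartedSpace H M] [FiniteDimensional ℝ E]
  {e : OpenPartialHomeomorph M H} {k : ℕ} {Θ : E → E [⋀^Fin k]→L[ℝ] ℝ}

lemma DForm.rep_ofModel (he : e ∈ IsManifold.maximalAtlas I ∞ M) {z : M} (hz : z ∈ e.source) :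
    (DForm.ofModel (I := I) e Θ).rep e (e.extend I z) = Θ (e.extend I z) := by
  rw [DForm.rep_extend _ hz]
  ext v
  change Θ (e.extend I z) (fun i => dChart I e z ((dChart I e z).inverse (v i))) = _
  congr 1
  funext i
  exact dChart_apply_inverse he hz _

lemma DForm.smoothAt_ofModel [IsManifold I ∞ M] (he : e ∈ IsManifold.maximalAtlas I ∞ M)
    (hΘ : ContDiff ℝ ∞ Θ) {z : M} (hz : z ∈ e.source) :
    (DForm.ofModel (I := I) e Θ).SmoothAt z := by
  rw [DForm.smoothAt_iff he hz]
  have h : (DForm.ofModel (I := I) e Θ).rep e =ᶠ[𝓝[range I] (e.extend I z)] Θ := by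
    refine eventually_extend hz ?_
    filter_upwards [e.open_source.mem_nhds hz] with y hy
    exact DForm.rep_ofModel he hy
  exact hΘ.contDiffWithinAt.congr_of_eventuallyEq h (h.self_of_nhdsWithin (mem_range_self _))

end OfModel

section ContactChart

variable {B F H M : Type*} [NormedAddCommGroup B] [NormedSpace ℝ B] [NormedAddCommGroup F]
  [NormedSpace ℝ F] [FiniteDimensional ℝ B] [FiniteDimensional ℝ F] [TopologicalSpace H]
  {I : ModelWithCorners ℝ ((B × F) × (B →L[ℝ] F)) H} [TopologicalSpace M] [ChartedSpace H M]
  [IsManifold I ∞ M] [IsManifold I 1 M] {e : OpenPartialHomeomorph M H}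

lemma lie_apply_of_contact (he : e ∈ IsManifold.maximalAtlas I ∞ M) {z : M} (hz : z ∈ e.source)
    {ξ : VField I M} (hξ : IsSmoothVF ξ) {θ : DForm I M 1} (hs : θ.SmoothAt z)
    (h : ∀ᶠ y in 𝓝 z, ∀ (a : B) (f : B →L[ℝ] F),
      θ y (fun _ => (dChart I e y).inverse ((a, (e.extend I y).2 a), f)) = 0)
    (a : B) (f : B →L[ℝ] F) :
    DForm.lie ξ θ z (fun _ => (dChart I e z).inverse ((a, (e.extend I z).2 a), f)) =
    θ z (fun _ => (dChart I e z).inverse (fderivWithin ℝ (VField.rep ξ e) (range I) (e.extend I z)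
        ((a, (e.extend I z).2 a), f) - ((0, (dChart I e z (ξ z)).2 a), 0))) := by
  have h0 : ∀ᶠ w in 𝓝[range I] (e.extend I z), ∀ (a : B) (f : B →L[ℝ] F),
        θ.rep e w (fun _ => ((a, w.2 a), f)) = 0 := by
    refine eventually_extend hz ?_
    filter_upwards [h, e.open_source.mem_nhds hz] with y hy hy' a f
    rw [DForm.rep_extend θ hy']
    exact hy a f
  have h1 := (DForm.smoothAt_iff he hz).1 hs
  have h3 := contact_lie_apply (x := e.extend I z) (s := range I) (uniqueDiffWithinAt_extend (e := e) z) (mem_range_self _)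
    (h1.differentiableWithinAt (by simp)) h0 (dChart I e z (ξ z))
    (fderivWithin ℝ (VField.rep ξ e) (range I) (e.extend I z)) a f
  rw [DForm.lie_eq_rep he hz hξ hs]
  have h4 : dChart I e z ((dChart I e z).inverse ((a, (e.extend I z).2 a), f)) =
      ((a, (e.extend I z).2 a), f) := dChart_apply_inverse he hz _
  refine Eq.trans (congrArg (fun v => (fderivWithin ℝ (θ.rep e) (range I) (e.extend I z)
    (dChart I e z (ξ z)) + (θ.rep e (e.extend I z)).fderivCompContinuousLinearMap
      (ContinuousLinearMap.id ℝ _) (fderivWithin ℝ (VField.rep ξ e) (range I) (e.extend I z)))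
    (fun _ => v)) h4) (h3.trans ?_)
  rw [DForm.rep_extend θ hz]
  rfl

end ContactChart

section Prolongation

variable {n m : ℕ} {HX : Type*} [TopologicalSpace HX]
  {IX : ModelWithCorners ℝ (BaseModel n) HX}
  {X Y : Type*} [TopologicalSpace X] [ChartedSpace HX X] [IsManifold IX ∞ X]
  [TopologicalSpace Y] [ChartedSpace (ModelProd HX (FibreModel m)) Y]
  [IsManifold (modelY IX m) ∞ Y] [IsManifold (modelY IX m) 1 Y]
  {p : Y → X} [IsFibred (FibreModel m) IX p]
  (c : FibredChart (F := FibreModel m) IX p)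

/-- The velocity components of the prolongation of a vector field with derivative `T` in a
chart. -/
def prolongRep {B F : Type*} [NormedAddCommGroup B] [NormedSpace ℝ B] [NormedAddCommGroup F]
    [NormedSpace ℝ F] (T : B × F →L[ℝ] B × F) (v : B →L[ℝ] F) : B →L[ℝ] F :=
  ContinuousLinearMap.snd ℝ _ _ ∘L T ∘L (ContinuousLinearMap.id ℝ _).prod v -
    v ∘L ContinuousLinearMap.fst ℝ _ _ ∘L T ∘L (ContinuousLinearMap.id ℝ _).prod v

lemma mem_contactSpace_iff {z : JetBundle IX p m} (hz : z.proj ∈ c.chart.source)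
    {V : TangentSpace (modelJet IX m) z} : V ∈ contactSpace z ↔
      (dChart (modelJet IX m) (jetChart c).chart z V).1.2 =
        ((jetChart c).chart.extend (modelJet IX m) z).2
          (dChart (modelJet IX m) (jetChart c).chart z V).1.1 := by
  have h1 : (dChart (modelJet IX m) (jetChart c).chart z V).1 =
      dChart (modelY IX m) c.chart z.proj
        (tangentProj (BaseModel n →L[ℝ] FibreModel m) (modelY IX m) Jet.proj z V) :=
    fst_dChart_apply (jetChart c) hz V
  rw [h1]
  have h2 := DFunLike.congr_fun (dChart_comp_jet c hz z.fib)
    (tangentProj (FibreModel m) IX p z.proj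
      (tangentProj (BaseModel n →L[ℝ] FibreModel m) (modelY IX m) Jet.proj z V))
  have h3 := fst_dChart_apply c hz
    (tangentProj (BaseModel n →L[ℝ] FibreModel m) (modelY IX m) Jet.proj z V)
  have h4 : dChart (modelY IX m) c.chart z.proj (z.fib.toMap (tangentProj (FibreModel m) IX p z.proj
      (tangentProj (BaseModel n →L[ℝ] FibreModel m) (modelY IX m) Jet.proj z V))) =
      ((dChart (modelY IX m) c.chart z.proj
        (tangentProj (BaseModel n →L[ℝ] FibreModel m) (modelY IX m) Jet.proj z V)).1,
      jetTriv c z.proj z.fib (dChart (modelY IX m) c.chart z.proj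
        (tangentProj (BaseModel n →L[ℝ] FibreModel m) (modelY IX m) Jet.proj z V)).1) := by
    rw [h3]
    exact h2
  constructor
  · intro h
    have h5 : dChart (modelY IX m) c.chart z.proj
        (tangentProj (BaseModel n →L[ℝ] FibreModel m) (modelY IX m) Jet.proj z V) =
        dChart (modelY IX m) c.chart z.proj (z.fib.toMap (tangentProj (FibreModel m) IX p z.proj
        (tangentProj (BaseModel n →L[ℝ] FibreModel m) (modelY IX m) Jet.proj z V))) :=
      congrArg (dChart (modelY IX m) c.chart z.proj) h
    have h6 := congrArg Prod.snd (Eq.trans h5 h4)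
    exact h6
  · intro h
    apply dChart_injective c.chart_mem hz
    refine Eq.trans ?_ h4.symm
    exact Prod.ext rfl h

lemma inverse_mem_contactSpace {z : JetBundle IX p m} (hz : z.proj ∈ c.chart.source)
    (a : BaseModel n) (f : BaseModel n →L[ℝ] FibreModel m) :
    (dChart (modelJet IX m) (jetChart c).chart z).inverse
      ((a, ((jetChart c).chart.extend (modelJet IX m) z).2 a), f) ∈ contactSpace z := by
  rw [mem_contactSpace_iff c hz, dChart_apply_inverse (jetChart c).chart_mem hz]

lemma lie_contactForm {ξ₁ : VField (modelJet IX m) (JetBundle IX p m)} (hξ : IsSmoothVF ξ₁)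
    {U : Set (JetBundle IX p m)} (hU : IsOpen U)
    {θ : DForm (modelJet IX m) (JetBundle IX p m) 1} (hθ : IsContactForm U θ)
    {z : JetBundle IX p m} (hzU : z ∈ U) (hz : z.proj ∈ c.chart.source)
    (a : BaseModel n) (f : BaseModel n →L[ℝ] FibreModel m) :
    DForm.lie ξ₁ θ z (fun _ => (dChart (modelJet IX m) (jetChart c).chart z).inverse
      ((a, ((jetChart c).chart.extend (modelJet IX m) z).2 a), f)) =
    θ z (fun _ => (dChart (modelJet IX m) (jetChart c).chart z).inverse
      (fderivWithin ℝ (VField.rep ξ₁ (jetChart c).chart) (range (modelJet IX m))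
        ((jetChart c).chart.extend (modelJet IX m) z)
        ((a, ((jetChart c).chart.extend (modelJet IX m) z).2 a), f) -
      ((0, (dChart (modelJet IX m) (jetChart c).chart z (ξ₁ z)).2 a), 0))) := by
  refine lie_apply_of_contact (jetChart c).chart_mem hz hξ (hθ z hzU).1 ?_ a f
  filter_upwards [hU.mem_nhds hzU, (jetChart c).chart.open_source.mem_nhds hz] with y hy hy' a f
  exact (hθ y hy).2 _ (inverse_mem_contactSpace c hy' a f)

/-- Since ξ₁ projects onto ξ, its components along Y do not depend on the velocities, and their
derivative is that of ξ. -/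
lemma fst_fderivWithin_rep {ξ : VField (modelY IX m) Y}
    {ξ₁ : VField (modelJet IX m) (JetBundle IX p m)} (hξ : IsSmoothVF ξ) (hξ₁ : IsSmoothVF ξ₁)
    (h : IsRelated Jet.proj ξ₁ ξ) {z : JetBundle IX p m} (hz : z.proj ∈ c.chart.source)
    (u : (BaseModel n × FibreModel m) × (BaseModel n →L[ℝ] FibreModel m)) :
    (fderivWithin ℝ (VField.rep ξ₁ (jetChart c).chart) (range (modelJet IX m))
        ((jetChart c).chart.extend (modelJet IX m) z) u).1 =
      fieldDeriv c ξ (c.chart.extend (modelY IX m) z.proj) u.1 := by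
  have h1 : (fun w => (VField.rep ξ₁ (jetChart c).chart w).1)
      =ᶠ[𝓝[range (modelJet IX m)] ((jetChart c).chart.extend (modelJet IX m) z)]
      fun w => VField.rep ξ c.chart w.1 := by
    refine eventually_extend hz ?_
    filter_upwards [(jetChart c).chart.open_source.mem_nhds hz] with y hy
    rw [VField.rep_extend ξ₁ hy]
    refine (fst_dChart_apply (jetChart c) hy _).trans ?_
    refine (congrArg (dChart (modelY IX m) c.chart y.proj) (h y)).trans ?_
    exact (VField.rep_extend ξ hy).symm
  have h2 := ((VField.contDiffWithinAt_rep (jetChart c).chart_mem hz hξ₁).differentiableWithinAt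
    (by simp)).hasFDerivWithinAt.fst
  have h3 := ((VField.contDiffWithinAt_rep c.chart_mem hz hξ).differentiableWithinAt
    (by simp)).hasFDerivWithinAt
  have h4 : HasFDerivWithinAt (fun w : (BaseModel n × FibreModel m) ×
      (BaseModel n →L[ℝ] FibreModel m) => VField.rep ξ c.chart w.1)
      (fieldDeriv c ξ (c.chart.extend (modelY IX m) z.proj) ∘L ContinuousLinearMap.fst ℝ _ _)
      (range (modelJet IX m)) ((jetChart c).chart.extend (modelJet IX m) z) :=
    HasFDerivWithinAt.comp (f := Prod.fst) ((jetChart c).chart.extend (modelJet IX m) z) h3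
      hasFDerivWithinAt_fst mapsTo_fst_range
  have h5 := (uniqueDiffWithinAt_extend (e := (jetChart c).chart) z).eq h2
    (h4.congr_of_eventuallyEq h1 (h1.self_of_nhdsWithin (mem_range_self _)))
  exact DFunLike.congr_fun h5 u

/-- The contact form `φ (dy - v dx)` in the coordinates of a chart. -/
def contactModel {B F : Type*} [NormedAddCommGroup B] [NormedSpace ℝ B] [NormedAddCommGroup F]
    [NormedSpace ℝ F] (φ : F →L[ℝ] ℝ) (w : (B × F) × (B →L[ℝ] F)) :
    ((B × F) × (B →L[ℝ] F)) [⋀^Fin 1]→L[ℝ] ℝ :=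
  ContinuousAlternatingMap.ofSubsingletonLIE (𝕜 := ℝ) (E := (B × F) × (B →L[ℝ] F)) (F := ℝ)
    (0 : Fin 1) (φ ∘L (ContinuousLinearMap.snd ℝ B F - w.2 ∘L ContinuousLinearMap.fst ℝ B F) ∘L
      ContinuousLinearMap.fst ℝ (B × F) (B →L[ℝ] F))

lemma contactModel_apply {B F : Type*} [NormedAddCommGroup B] [NormedSpace ℝ B]
    [NormedAddCommGroup F] [NormedSpace ℝ F] (φ : F →L[ℝ] ℝ) (w : (B × F) × (B →L[ℝ] F))
    (u : Fin 1 → (B × F) × (B →L[ℝ] F)) :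
    contactModel φ w u = φ ((u 0).1.2 - w.2 (u 0).1.1) := rfl

lemma contDiff_contactModel {B F : Type*} [NormedAddCommGroup B] [NormedSpace ℝ B]
    [NormedAddCommGroup F] [NormedSpace ℝ F] (φ : F →L[ℝ] ℝ) :
    ContDiff ℝ ∞ (contactModel (B := B) φ) := by
  have h1 : ContDiff ℝ ∞ (fun w : (B × F) × (B →L[ℝ] F) =>
      φ ∘L (ContinuousLinearMap.snd ℝ B F - w.2 ∘L ContinuousLinearMap.fst ℝ B F) ∘L
      ContinuousLinearMap.fst ℝ (B × F) (B →L[ℝ] F)) :=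
    contDiff_const.clm_comp
      ((contDiff_const.sub (contDiff_snd.clm_comp contDiff_const)).clm_comp contDiff_const)
  exact (ContinuousAlternatingMap.ofSubsingletonLIE (𝕜 := ℝ) (E := (B × F) × (B →L[ℝ] F)) (F := ℝ)
    (0 : Fin 1)).contDiff.comp h1

lemma isContactForm_ofModel (φ : FibreModel m →L[ℝ] ℝ) :
    IsContactForm (p := p) (jetChart c).chart.source
      (DForm.ofModel (I := modelJet IX m) (jetChart c).chart (contactModel φ)) := by
  intro z hz
  refine ⟨DForm.smoothAt_ofModel (jetChart c).chart_mem (contDiff_contactModel φ) hz,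
    fun V hV => ?_⟩
  have h := (mem_contactSpace_iff c hz).1 hV
  change contactModel φ ((jetChart c).chart.extend (modelJet IX m) z)
    (fun _ => dChart (modelJet IX m) (jetChart c).chart z V) = 0
  rw [contactModel_apply, h, sub_self, map_zero]

/-- The coordinate contact forms φ (dy - v dx) detect every direction transverse to the contact
distribution, so preserving them forces the velocity formula. Under this formula the vector produced
by `lie_contactForm` is itself a contact vector, hence every contact form is preserved. -/
lemma isProlongation_iff {ξ : VField (modelY IX m) Y}
    {ξ₁ : VField (modelJet IX m) (JetBundle IX p m)} (hξ : IsSmoothVF ξ) :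
    IsProlongation ξ ξ₁ ↔ IsSmoothVF ξ₁ ∧ IsRelated Jet.proj ξ₁ ξ ∧
      ∀ (c : FibredChart (F := FibreModel m) IX p) (z : JetBundle IX p m),
        z.proj ∈ c.chart.source → (dChart (modelJet IX m) (jetChart c).chart z (ξ₁ z)).2 =
          prolongRep (fieldDeriv c ξ (c.chart.extend (modelY IX m) z.proj))
            ((jetChart c).chart.extend (modelJet IX m) z).2 := by
  constructor
  · intro h
    refine ⟨h.smooth, h.related, fun c z hz => ?_⟩
    ext1 a
    rw [← sub_eq_zero]
    refine SeparatingDual.eq_zero_of_forall_dual_eq_zero (R := ℝ) fun φ => ?_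
    -- One contact vector for each a is enough, so the velocity part of the test vector is taken to
    -- be 0.
    have h1 := lie_contactForm c h.smooth (jetChart c).chart.open_source
      (isContactForm_ofModel c φ) (z := z) hz hz a 0
    rw [h.contact _ _ (jetChart c).chart.open_source (isContactForm_ofModel c φ) z hz _
      (inverse_mem_contactSpace c hz a 0)] at h1
    have h2 : ∀ u : (BaseModel n × FibreModel m) × (BaseModel n →L[ℝ] FibreModel m),
        DForm.ofModel (I := modelJet IX m) (jetChart c).chart (contactModel φ) z
          (fun _ => (dChart (modelJet IX m) (jetChart c).chart z).inverse u) =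
        φ (u.1.2 - ((jetChart c).chart.extend (modelJet IX m) z).2 u.1.1) := by
      intro u
      change φ ((dChart (modelJet IX m) (jetChart c).chart z
        ((dChart (modelJet IX m) (jetChart c).chart z).inverse u)).1.2 -
        ((jetChart c).chart.extend (modelJet IX m) z).2 (dChart (modelJet IX m) (jetChart c).chart z
        ((dChart (modelJet IX m) (jetChart c).chart z).inverse u)).1.1) = _
      have h3 : dChart (modelJet IX m) (jetChart c).chart z
        ((dChart (modelJet IX m) (jetChart c).chart z).inverse u) = u :=
        dChart_apply_inverse (jetChart c).chart_mem hz u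
      rw [h3]
    rw [h2] at h1
    rw [Prod.fst_sub, Prod.fst_sub, Prod.snd_sub,
      fst_fderivWithin_rep c hξ h.smooth h.related hz] at h1
    rw [← neg_eq_zero, ← map_neg, h1]
    congr 1
    simp only [prolongRep, _root_.sub_apply, ContinuousLinearMap.comp_apply,
      ContinuousLinearMap.prod_apply, ContinuousLinearMap.id_apply, ContinuousLinearMap.coe_fst',
      ContinuousLinearMap.coe_snd', sub_zero]
    abel
  · rintro ⟨h1, h2, h3⟩
    refine ⟨h1, h2, fun U θ hU hθ z hz V hV => ?_⟩
    set c := fibredIndex (FibreModel m) IX p z.proj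
    have hzc : z.proj ∈ c.chart.source := mem_fibredIndex z.proj
    have hV' : V = (dChart (modelJet IX m) (jetChart c).chart z).inverse
        (((dChart (modelJet IX m) (jetChart c).chart z V).1.1,
          ((jetChart c).chart.extend (modelJet IX m) z).2
            (dChart (modelJet IX m) (jetChart c).chart z V).1.1),
          (dChart (modelJet IX m) (jetChart c).chart z V).2) := by
      rw [← (mem_contactSpace_iff c hzc).1 hV]
      exact (dChart_inverse_apply (jetChart c).chart_mem hzc V).symm
    rw [hV', lie_contactForm c h1 hU hθ hz hzc]
    refine (hθ z hz).2 _ ?_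
    have h4 : ∀ u, dChart (modelJet IX m) (jetChart c).chart z
        ((dChart (modelJet IX m) (jetChart c).chart z).inverse u) = u :=
      dChart_apply_inverse (jetChart c).chart_mem hzc
    rw [mem_contactSpace_iff c hzc, h4, Prod.fst_sub, fst_fderivWithin_rep c hξ h1 h2 hzc, h3 c z hzc]
    simp only [prolongRep, _root_.sub_apply, ContinuousLinearMap.comp_apply,
      ContinuousLinearMap.prod_apply, ContinuousLinearMap.id_apply, ContinuousLinearMap.coe_fst',
      ContinuousLinearMap.coe_snd', sub_zero, Prod.snd_sub, Prod.fst_sub]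
    abel

end Prolongation

/-! ### Lifts of Hamiltonian origin are prolongations: the fibre Hessian. -/

section VerticalDerivatives

variable {E V H : Type*} [NormedAddCommGroup E] [NormedSpace ℝ E] [NormedAddCommGroup V]
  [NormedSpace ℝ V] [TopologicalSpace H] {I : ModelWithCorners ℝ E H}

lemma tendsto_vertical {x : E × V} (hx : x ∈ range (I.prod 𝓘(ℝ, V))) :
    Tendsto (fun v => (x.1, v)) (𝓝 x.2) (𝓝[range (I.prod 𝓘(ℝ, V))] x) := by
  refine tendsto_nhdsWithin_iff.2 ⟨?_, Eventually.of_forall fun v => ?_⟩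
  · exact (Continuous.prodMk_right x.1).tendsto' _ _ rfl
  · rw [ModelWithCorners.range_prod] at hx ⊢
    exact ⟨hx.1, by simp⟩

/-- If the vertical derivatives of `γ` near `x` are `q (x.2 - w.2) μ`, then the vertical
derivatives at `x` of the derivative of `γ` along a vector field only depend on the vertical
component of the vector field. -/
lemma hasFDerivAt_vertical_derivative {x : E × V} (hx : x ∈ range (I.prod 𝓘(ℝ, V)))
    (hc : x ∈ closure (interior (range (I.prod 𝓘(ℝ, V)))))
    {γ μ : E × V → ℝ} {q : E × V → V →L[ℝ] V →L[ℝ] ℝ} {U : E × V → E × V}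
    (hγ : ContDiffWithinAt ℝ ∞ γ (range (I.prod 𝓘(ℝ, V))) x)
    (hμ : DifferentiableWithinAt ℝ μ (range (I.prod 𝓘(ℝ, V))) x)
    (hq : DifferentiableWithinAt ℝ q (range (I.prod 𝓘(ℝ, V))) x)
    (hU : DifferentiableWithinAt ℝ U (range (I.prod 𝓘(ℝ, V))) x)
    (hU' : ∀ᶠ v in 𝓝 x.2, (U (x.1, v)).1 = (U x).1)
    (h : ∀ᶠ w in 𝓝[range (I.prod 𝓘(ℝ, V))] x, ∀ f,
      fderivWithin ℝ γ (range (I.prod 𝓘(ℝ, V))) w (0, f) = q w f (x.2 - w.2) * μ w) :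
    ∃ D : V →L[ℝ] ℝ, HasFDerivAt
      (fun v => fderivWithin ℝ γ (range (I.prod 𝓘(ℝ, V))) (x.1, v) (U (x.1, v))) D x.2 ∧
      ∀ f, D f = - (q x f (U x).2 * μ x) := by
  have hs := (I.prod 𝓘(ℝ, V)).uniqueDiffOn x hx
  have hγ' : DifferentiableWithinAt ℝ (fderivWithin ℝ γ (range (I.prod 𝓘(ℝ, V))))
      (range (I.prod 𝓘(ℝ, V))) x :=
    (contDiffWithinAt_fderivWithin_range hx hγ).differentiableWithinAt (by simp)
  have hsymm : IsSymmSndFDerivWithinAt ℝ γ (range (I.prod 𝓘(ℝ, V))) x :=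
    hγ.isSymmSndFDerivWithinAt minSmoothness_two_le_infty (I.prod 𝓘(ℝ, V)).uniqueDiffOn hc hx
  have h1 := hasFDerivAt_vertical hx hγ'
  have h2 := hasFDerivAt_vertical hx hU
  refine ⟨_, h1.clm_apply h2, fun f => ?_⟩
  -- By `hU'` the base component of U is constant along the fibre through x.
  have h3 : (fderivWithin ℝ U (range (I.prod 𝓘(ℝ, V))) x (0, f)).1 = 0 := by
    have h4 : HasFDerivAt (fun v => (U (x.1, v)).1) (0 : V →L[ℝ] E) x.2 :=
      (hasFDerivAt_const _ _).congr_of_eventuallyEq hU'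
    exact DFunLike.congr_fun (h2.fst.unique h4) f
  -- At x itself the factor x.2 - w.2 is zero, so γ is stationary in the fibre; no derivative of U
  -- survives in the product rule.
  have h5 : ∀ f, fderivWithin ℝ γ (range (I.prod 𝓘(ℝ, V))) x (0, f) = 0 := by
    intro f
    rw [h.self_of_nhdsWithin hx f, sub_self, map_zero, zero_mul]
  have h6 : fderivWithin ℝ γ (range (I.prod 𝓘(ℝ, V))) x
      (fderivWithin ℝ U (range (I.prod 𝓘(ℝ, V))) x (0, f)) = 0 := by
    have h7 : fderivWithin ℝ U (range (I.prod 𝓘(ℝ, V))) x (0, f) =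
        (0, (fderivWithin ℝ U (range (I.prod 𝓘(ℝ, V))) x (0, f)).2) := Prod.ext h3 rfl
    rw [h7, h5]
  have h8 : HasFDerivWithinAt (fun w => fderivWithin ℝ γ (range (I.prod 𝓘(ℝ, V))) w (0, f))
      ((fderivWithin ℝ (fderivWithin ℝ γ (range (I.prod 𝓘(ℝ, V))))
        (range (I.prod 𝓘(ℝ, V))) x).flip (0, f)) (range (I.prod 𝓘(ℝ, V))) x := by
    have h9 := hγ'.hasFDerivWithinAt.clm_apply (hasFDerivWithinAt_const ((0 : E), f) x _)
    simpa using h9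
  have h10 : HasFDerivWithinAt (fun w => q w f (x.2 - w.2) * μ w) _ (range (I.prod 𝓘(ℝ, V))) x :=
    ((hq.hasFDerivWithinAt.clm_apply (hasFDerivWithinAt_const f x _)).clm_apply
      (hasFDerivWithinAt_snd.const_sub x.2)).mul hμ.hasFDerivWithinAt
  have h11 := hs.eq h8 (h10.congr_of_eventuallyEq (h.mono fun w hw => hw f)
    (h.self_of_nhdsWithin hx f))
  -- By symmetry the vertical derivatives of γ may be differentiated along U instead. Only the
  -- factor x.2 - w.2 contributes, which leaves the vertical component of U with a minus sign.
  have h12 := DFunLike.congr_fun h11 (U x)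
  rw [ContinuousLinearMap.flip_apply, hsymm.eq] at h12
  change fderivWithin ℝ γ _ x (fderivWithin ℝ U _ x (0, f)) +
    fderivWithin ℝ (fderivWithin ℝ γ _) _ x (0, f) (U x) = _
  rw [h6, zero_add, h12]
  simp
  ring

/-- This is the Taylor polynomial at a moving v', evaluated at the fixed v. At v' = v the change of
a cancels that of v - v', and the change of l is multiplied by zero. -/
lemma hasFDerivAt_add_apply_sub {a : V → ℝ} {l : V → V →L[ℝ] ℝ} {l' : V →L[ℝ] V →L[ℝ] ℝ} {v : V}
    (ha : HasFDerivAt a (l v) v) (hl : HasFDerivAt l l' v) :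
    HasFDerivAt (fun v' => a v' + l v' (v - v')) (0 : V →L[ℝ] ℝ) v := by
  have h3 := ha.add (hl.clm_apply ((hasFDerivAt_id v).const_sub v))
  convert! h3 using 1
  ext f
  simp

lemma exists_hasFDerivAt_linear_pair {W N : Type*} [NormedAddCommGroup W] [NormedSpace ℝ W]
    [FiniteDimensional ℝ W] [NormedAddCommGroup N] [NormedSpace ℝ N] (Q : ℝ × W →ₗ[ℝ] N)
    {a : V → ℝ} {l : V → W} {l' : V →L[ℝ] W} {v : V} (ha : HasFDerivAt a (0 : V →L[ℝ] ℝ) v)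
    (hl : HasFDerivAt l l' v) :
    ∃ D : V →L[ℝ] N, HasFDerivAt (fun v' => Q (a v', l v')) D v ∧ ∀ f, D f = Q (0, l' f) :=
  ⟨_, (LinearMap.toContinuousLinearMap Q).hasFDerivAt.comp v (ha.prodMk hl), fun _ => rfl⟩

lemma hasFDerivAt_clm_comp_left {W W' : Type*} [NormedAddCommGroup W] [NormedSpace ℝ W]
    [NormedAddCommGroup W'] [NormedSpace ℝ W'] (A : W →L[ℝ] W') {w : V → W} {w' : V →L[ℝ] W} {v : V}
    (hw : HasFDerivAt w w' v) : HasFDerivAt (fun x => A (w x)) (A ∘L w') v :=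
  A.hasFDerivAt.comp v hw

lemma hasFDerivAt_apply_sum {G : Type*} [NormedAddCommGroup G] [NormedSpace ℝ G] {k : ℕ}
    {w : V → G [⋀^Fin k]→L[ℝ] ℝ} {w' : V →L[ℝ] G [⋀^Fin k]→L[ℝ] ℝ} {v : V}
    (hw : HasFDerivAt w w' v) (A T : G →L[ℝ] G) (u : Fin k → G) (b : ℝ) {D : V →L[ℝ] ℝ}
    (hD : HasFDerivAt (fun v => b - (w v).fderivCompContinuousLinearMap A T u) D v) (f : V) :
    D f = - (w' f).fderivCompContinuousLinearMap A T u := by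
  have h1 : ∀ i : Fin k, HasFDerivAt (fun v => w v fun j => Function.update (fun _ => A) i T j (u j))
      (ContinuousAlternatingMap.apply ℝ G ℝ (fun j => Function.update (fun _ => A) i T j (u j)) ∘L
        w') v := fun i => hasFDerivAt_clm_comp_left (W := G [⋀^Fin k]→L[ℝ] ℝ) (W' := ℝ)
        (ContinuousAlternatingMap.apply ℝ G ℝ (fun j => Function.update (fun _ => A) i T j (u j))) hw
  have h2 := (HasFDerivAt.fun_sum (u := Finset.univ) fun i _ => h1 i).const_sub b
  simp only [ContinuousAlternatingMap.fderivCompContinuousLinearMap_apply] at hD ⊢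
  rw [hD.unique h2]
  simp

end VerticalDerivatives

section Legendre

variable {n : ℕ} {F : Type*} [NormedAddCommGroup F] [NormedSpace ℝ F]

/-- Another slope changes dy - v dx by a horizontal part, which by the trace identity
`fderivComp_momentum` only alters the coefficient of η. This allows the contact form to be frozen
while the velocity varies. -/
lemma legRep_eq (a : ℝ) (l : (EuclideanSpace ℝ (Fin (n + 1)) →L[ℝ] F) →L[ℝ] ℝ)
    (η : EuclideanSpace ℝ (Fin (n + 1)) [⋀^Fin (n + 1)]→L[ℝ] ℝ)
    (v v' : EuclideanSpace ℝ (Fin (n + 1)) →L[ℝ] F) :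
    legRep a l η v' = legRep (a + l (v - v')) l η v := by
  have h1 : momentum l ∘L (ContinuousLinearMap.snd ℝ _ F - v' ∘L ContinuousLinearMap.fst ℝ _ F) =
      momentum l ∘L (ContinuousLinearMap.snd ℝ _ F - v ∘L ContinuousLinearMap.fst ℝ _ F) +
      (momentum l ∘L (v - v')) ∘L ContinuousLinearMap.fst ℝ _ F := by
    refine ContinuousLinearMap.ext fun x => ?_
    simp
  have h2 : η.fderivCompContinuousLinearMap (ContinuousLinearMap.fst ℝ _ F)
      ((momentum l ∘L (v - v')) ∘L ContinuousLinearMap.fst ℝ _ F) =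
      l (v - v') • η.compContinuousLinearMap (ContinuousLinearMap.fst ℝ _ F) := by
    have h3 := fderivComp_comp η (ContinuousLinearMap.id ℝ _) (momentum l ∘L (v - v'))
      (ContinuousLinearMap.fst ℝ _ F)
    rw [fderivComp_momentum] at h3
    exact h3.symm
  rw [legRep, legRep, h1, map_add, h2, add_smul]
  abel

/-- Obtained by differentiating `legRep_comp_graph` along the graphs of v + t f at t = 0. -/
lemma fderivComp_legRep_graph (l : (EuclideanSpace ℝ (Fin (n + 1)) →L[ℝ] F) →L[ℝ] ℝ)
    (η : EuclideanSpace ℝ (Fin (n + 1)) [⋀^Fin (n + 1)]→L[ℝ] ℝ)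
    (v f : EuclideanSpace ℝ (Fin (n + 1)) →L[ℝ] F) :
    (legRep 0 l η v).fderivCompContinuousLinearMap ((ContinuousLinearMap.id ℝ _).prod v)
      (ContinuousLinearMap.inr ℝ _ F ∘L f) = l f • η := by
  have h1 : HasFDerivAt (fun t : ℝ => (ContinuousLinearMap.id ℝ _).prod v +
      t • (ContinuousLinearMap.inr ℝ (EuclideanSpace ℝ (Fin (n + 1))) F ∘L f))
      (ContinuousLinearMap.toSpanSingleton ℝ (ContinuousLinearMap.inr ℝ _ F ∘L f)) 0 := by
    have h2 := (ContinuousLinearMap.toSpanSingleton ℝ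
      (ContinuousLinearMap.inr ℝ (EuclideanSpace ℝ (Fin (n + 1))) F ∘L f)).hasFDerivAt (x := 0)
    exact h2.const_add _
  have h2 := (hasFDerivAt_const (𝕜 := ℝ) (legRep 0 l η v)
    (0 : ℝ)).continuousAlternatingMapCompContinuousLinearMap h1
  have h3 : (fun t : ℝ => (legRep 0 l η v).compContinuousLinearMap
      ((ContinuousLinearMap.id ℝ _).prod v + t • (ContinuousLinearMap.inr ℝ _ F ∘L f))) =
      fun t => ContinuousLinearMap.toSpanSingleton ℝ (l f • η) t := by
    funext t
    have h4 : (ContinuousLinearMap.id ℝ _).prod v + t • (ContinuousLinearMap.inr ℝ _ F ∘L f) =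
        (ContinuousLinearMap.id ℝ (EuclideanSpace ℝ (Fin (n + 1)))).prod (v + t • f) := by
      refine ContinuousLinearMap.ext fun x => ?_
      simp
    rw [h4, legRep_comp_graph]
    simp [smul_smul]
  rw [h3] at h2
  have h5 := DFunLike.congr_fun (h2.unique (ContinuousLinearMap.hasFDerivAt _)) 1
  have h6 : (legRep 0 l η v).fderivCompContinuousLinearMap ((ContinuousLinearMap.id ℝ _).prod v +
      (0 : ℝ) • (ContinuousLinearMap.inr ℝ _ F ∘L f))
      ((1 : ℝ) • (ContinuousLinearMap.inr ℝ _ F ∘L f)) = (1 : ℝ) • l f • η :=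
    (zero_add _).symm.trans h5
  have h7 : (ContinuousLinearMap.id ℝ _).prod v + (0 : ℝ) • (ContinuousLinearMap.inr ℝ _ F ∘L f) =
      (ContinuousLinearMap.id ℝ (EuclideanSpace ℝ (Fin (n + 1)))).prod v := by
    refine ContinuousLinearMap.ext fun x => ?_
    simp
  have h8 : (1 : ℝ) • (ContinuousLinearMap.inr ℝ (EuclideanSpace ℝ (Fin (n + 1))) F ∘L f) =
      ContinuousLinearMap.inr ℝ _ F ∘L f := by
    refine ContinuousLinearMap.ext fun x => ?_
    simp
  rw [h7, h8] at h6
  exact h6.trans (one_smul ℝ (l f • η))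

/-- Along the graph of v, the map T splits into a part tangent to the graph and the vertical part
`prolongRep T v`. With zero coefficient the form vanishes on the graph, so only the vertical part
contributes. -/
lemma fderivComp_legRep (l : (EuclideanSpace ℝ (Fin (n + 1)) →L[ℝ] F) →L[ℝ] ℝ)
    (η : EuclideanSpace ℝ (Fin (n + 1)) [⋀^Fin (n + 1)]→L[ℝ] ℝ)
    (v : EuclideanSpace ℝ (Fin (n + 1)) →L[ℝ] F)
    (T : EuclideanSpace ℝ (Fin (n + 1)) × F →L[ℝ] EuclideanSpace ℝ (Fin (n + 1)) × F) :
    ((legRep 0 l η v).fderivCompContinuousLinearMap (ContinuousLinearMap.id ℝ _)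
      T).compContinuousLinearMap ((ContinuousLinearMap.id ℝ _).prod v) =
      l (prolongRep T v) • η := by
  have h1 : T ∘L (ContinuousLinearMap.id ℝ _).prod v =
      (ContinuousLinearMap.id ℝ _).prod v ∘L
        (ContinuousLinearMap.fst ℝ _ F ∘L T ∘L (ContinuousLinearMap.id ℝ _).prod v) +
      ContinuousLinearMap.inr ℝ _ F ∘L prolongRep T v := by
    refine ContinuousLinearMap.ext fun x => ?_
    refine Prod.ext ?_ ?_ <;> simp [prolongRep]
  have h2 := compContinuousLinearMap_fderivComp (legRep 0 l η v)
    ((ContinuousLinearMap.id ℝ _).prod v) (ContinuousLinearMap.id ℝ _)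
    (ContinuousLinearMap.fst ℝ _ F ∘L T ∘L (ContinuousLinearMap.id ℝ _).prod v)
  rw [legRep_comp_graph, sub_self, map_zero, add_zero, zero_smul] at h2
  have h3 : ∀ f : EuclideanSpace ℝ (Fin (n + 1)) →L[ℝ] EuclideanSpace ℝ (Fin (n + 1)),
      (0 : EuclideanSpace ℝ (Fin (n + 1)) [⋀^Fin (n + 1)]→L[ℝ] ℝ).fderivCompContinuousLinearMap
      (ContinuousLinearMap.id ℝ _) f = 0 := by
    intro f
    ext u
    simp [ContinuousAlternatingMap.fderivCompContinuousLinearMap_apply]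
  rw [h3, ContinuousLinearMap.comp_id] at h2
  rw [fderivComp_comp, ContinuousLinearMap.id_comp, h1, map_add, ← h2, zero_add,
    fderivComp_legRep_graph]

variable [FiniteDimensional ℝ F] {H : Type*} [TopologicalSpace H]
  {I : ModelWithCorners ℝ (EuclideanSpace ℝ (Fin (n + 1)) × F) H}

/-- `legRep`, as a linear map of the value and the derivative of the Lagrangian. -/
def legRepL (η : EuclideanSpace ℝ (Fin (n + 1)) [⋀^Fin (n + 1)]→L[ℝ] ℝ)
    (v : EuclideanSpace ℝ (Fin (n + 1)) →L[ℝ] F) :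
    ℝ × ((EuclideanSpace ℝ (Fin (n + 1)) →L[ℝ] F) →L[ℝ] ℝ) →ₗ[ℝ]
      (EuclideanSpace ℝ (Fin (n + 1)) × F) [⋀^Fin (n + 1)]→L[ℝ] ℝ where
  toFun x := legRep x.1 x.2 η v
  map_add' x y := by
    simp only [legRep, Prod.fst_add, Prod.snd_add, momentum_add, ContinuousLinearMap.add_comp,
      map_add, add_smul]
    abel
  map_smul' r x := by
    have h : momentum (r • x.2) = r • momentum x.2 := by
      ext u : 1
      refine (momentum_unique fun φ => ?_).symm
      simp [proj_momentum]
    simp only [legRep, Prod.smul_fst, Prod.smul_snd, h, ContinuousLinearMap.smul_comp, map_smul,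
      smul_add, smul_smul, smul_eq_mul, RingHom.id_apply]

/-- With the contact form frozen at v by `legRep_eq`, the coefficient of η is a Taylor polynomial
and stationary; only the variation of l is left. -/
lemma exists_hasFDerivAt_legRep {a : (EuclideanSpace ℝ (Fin (n + 1)) →L[ℝ] F) → ℝ}
    {l : (EuclideanSpace ℝ (Fin (n + 1)) →L[ℝ] F) →
      (EuclideanSpace ℝ (Fin (n + 1)) →L[ℝ] F) →L[ℝ] ℝ}
    {l' : (EuclideanSpace ℝ (Fin (n + 1)) →L[ℝ] F) →L[ℝ]
      (EuclideanSpace ℝ (Fin (n + 1)) →L[ℝ] F) →L[ℝ] ℝ}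
    {v : EuclideanSpace ℝ (Fin (n + 1)) →L[ℝ] F}
    (ha : HasFDerivAt a (l v) v) (hl : HasFDerivAt l l' v)
    (η : EuclideanSpace ℝ (Fin (n + 1)) [⋀^Fin (n + 1)]→L[ℝ] ℝ) :
    ∃ D : (EuclideanSpace ℝ (Fin (n + 1)) →L[ℝ] F) →L[ℝ]
      (EuclideanSpace ℝ (Fin (n + 1)) × F) [⋀^Fin (n + 1)]→L[ℝ] ℝ,
      HasFDerivAt (fun v' => legRep (a v') (l v') η v') D v ∧ ∀ f, D f = legRep 0 (l' f) η v := by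
  obtain ⟨D, hD, hD'⟩ := exists_hasFDerivAt_linear_pair
    (W := (EuclideanSpace ℝ (Fin (n + 1)) →L[ℝ] F) →L[ℝ] ℝ)
    (N := (EuclideanSpace ℝ (Fin (n + 1)) × F) [⋀^Fin (n + 1)]→L[ℝ] ℝ) (legRepL η v)
    (hasFDerivAt_add_apply_sub ha hl) hl
  exact ⟨D, hD.congr_of_eventuallyEq (Eventually.of_forall fun v' => legRep_eq _ _ _ v _), hD'⟩

variable {x : (EuclideanSpace ℝ (Fin (n + 1)) × F) × (EuclideanSpace ℝ (Fin (n + 1)) →L[ℝ] F)}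
  {G : (EuclideanSpace ℝ (Fin (n + 1)) × F) × (EuclideanSpace ℝ (Fin (n + 1)) →L[ℝ] F) →
    (EuclideanSpace ℝ (Fin (n + 1)) × F) [⋀^Fin (n + 1)]→L[ℝ] ℝ}
  {a : (EuclideanSpace ℝ (Fin (n + 1)) × F) × (EuclideanSpace ℝ (Fin (n + 1)) →L[ℝ] F) → ℝ}
  {l : (EuclideanSpace ℝ (Fin (n + 1)) × F) × (EuclideanSpace ℝ (Fin (n + 1)) →L[ℝ] F) →
    (EuclideanSpace ℝ (Fin (n + 1)) →L[ℝ] F) →L[ℝ] ℝ}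
  {η : EuclideanSpace ℝ (Fin (n + 1)) × F →
    EuclideanSpace ℝ (Fin (n + 1)) [⋀^Fin (n + 1)]→L[ℝ] ℝ}

lemma fderivWithin_legRep_vertical
    (hx : x ∈ range (I.prod 𝓘(ℝ, EuclideanSpace ℝ (Fin (n + 1)) →L[ℝ] F)))
    (hG : G =ᶠ[𝓝[range (I.prod 𝓘(ℝ, EuclideanSpace ℝ (Fin (n + 1)) →L[ℝ] F))] x]
      fun w => legRep (a w) (l w) (η w.1) w.2)
    (hG' : DifferentiableWithinAt ℝ G
      (range (I.prod 𝓘(ℝ, EuclideanSpace ℝ (Fin (n + 1)) →L[ℝ] F))) x)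
    (ha : HasFDerivAt (fun v => a (x.1, v)) (l x) x.2)
    (hl : DifferentiableWithinAt ℝ l
      (range (I.prod 𝓘(ℝ, EuclideanSpace ℝ (Fin (n + 1)) →L[ℝ] F))) x)
    (f : EuclideanSpace ℝ (Fin (n + 1)) →L[ℝ] F) :
    fderivWithin ℝ G (range (I.prod 𝓘(ℝ, EuclideanSpace ℝ (Fin (n + 1)) →L[ℝ] F))) x (0, f) =
      legRep 0 (fderivWithin ℝ l
        (range (I.prod 𝓘(ℝ, EuclideanSpace ℝ (Fin (n + 1)) →L[ℝ] F))) x (0, f)) (η x.1) x.2 := by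
  have h1 := hasFDerivAt_vertical hx hG'
  have h0 := hasFDerivAt_vertical
    (W := (EuclideanSpace ℝ (Fin (n + 1)) →L[ℝ] F) →L[ℝ] ℝ) hx hl
  obtain ⟨D, h2, hD⟩ := exists_hasFDerivAt_legRep ha h0 (η x.1)
  have h3 := h1.unique (h2.congr_of_eventuallyEq ((tendsto_vertical hx).eventually hG))
  exact (DFunLike.congr_fun h3 f).trans (hD f)

-- The lifting equation is evaluated on the plane of slope x.2, kept fixed while the point moves in
-- the fibre, and differentiated along the fibre at x. The left side gives the Hessian paired with
-- the velocity of U, the right side the Hessian paired with the prolongation; A and T depend on the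
-- base point only, so they are constant in this differentiation.
set_option maxHeartbeats 1600000 in
lemma velocity_eq
    (hx : x ∈ range (I.prod 𝓘(ℝ, EuclideanSpace ℝ (Fin (n + 1)) →L[ℝ] F)))
    (hc : x ∈ closure (interior (range (I.prod 𝓘(ℝ, EuclideanSpace ℝ (Fin (n + 1)) →L[ℝ] F)))))
    (hG : G =ᶠ[𝓝[range (I.prod 𝓘(ℝ, EuclideanSpace ℝ (Fin (n + 1)) →L[ℝ] F))] x]
      fun w => legRep (a w) (l w) (η w.1) w.2)
    (hG' : ∀ᶠ w in 𝓝[range (I.prod 𝓘(ℝ, EuclideanSpace ℝ (Fin (n + 1)) →L[ℝ] F))] x,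
      w ∈ range (I.prod 𝓘(ℝ, EuclideanSpace ℝ (Fin (n + 1)) →L[ℝ] F)) ∧ ContDiffWithinAt ℝ ∞ G
        (range (I.prod 𝓘(ℝ, EuclideanSpace ℝ (Fin (n + 1)) →L[ℝ] F))) w)
    (ha : ∀ᶠ w in 𝓝[range (I.prod 𝓘(ℝ, EuclideanSpace ℝ (Fin (n + 1)) →L[ℝ] F))] x,
      HasFDerivAt (fun v => a (w.1, v)) (l w) w.2)
    (hl : ∀ᶠ w in 𝓝[range (I.prod 𝓘(ℝ, EuclideanSpace ℝ (Fin (n + 1)) →L[ℝ] F))] x,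
      ContDiffWithinAt ℝ ∞ l
        (range (I.prod 𝓘(ℝ, EuclideanSpace ℝ (Fin (n + 1)) →L[ℝ] F))) w)
    (hη : DifferentiableWithinAt ℝ (fun w : (EuclideanSpace ℝ (Fin (n + 1)) × F) ×
      (EuclideanSpace ℝ (Fin (n + 1)) →L[ℝ] F) => η w.1)
      (range (I.prod 𝓘(ℝ, EuclideanSpace ℝ (Fin (n + 1)) →L[ℝ] F))) x)
    {U : (EuclideanSpace ℝ (Fin (n + 1)) × F) × (EuclideanSpace ℝ (Fin (n + 1)) →L[ℝ] F) →
      (EuclideanSpace ℝ (Fin (n + 1)) × F) × (EuclideanSpace ℝ (Fin (n + 1)) →L[ℝ] F)}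
    (hU : DifferentiableWithinAt ℝ U
      (range (I.prod 𝓘(ℝ, EuclideanSpace ℝ (Fin (n + 1)) →L[ℝ] F))) x)
    (hU' : ∀ᶠ v in 𝓝 x.2, (U (x.1, v)).1 = (U x).1)
    {A : EuclideanSpace ℝ (Fin (n + 1)) × F →
      (EuclideanSpace ℝ (Fin (n + 1)) × F) [⋀^Fin (n + 1)]→L[ℝ] ℝ}
    {T : EuclideanSpace ℝ (Fin (n + 1)) × F → EuclideanSpace ℝ (Fin (n + 1)) × F →L[ℝ]
      EuclideanSpace ℝ (Fin (n + 1)) × F}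
    (h : ∀ᶠ w in 𝓝[range (I.prod 𝓘(ℝ, EuclideanSpace ℝ (Fin (n + 1)) →L[ℝ] F))] x,
      fderivWithin ℝ G (range (I.prod 𝓘(ℝ, EuclideanSpace ℝ (Fin (n + 1)) →L[ℝ] F))) w (U w) =
      A w.1 - (G w).fderivCompContinuousLinearMap (ContinuousLinearMap.id ℝ _) (T w.1))
    (f : EuclideanSpace ℝ (Fin (n + 1)) →L[ℝ] F) :
    fderivWithin ℝ l (range (I.prod 𝓘(ℝ, EuclideanSpace ℝ (Fin (n + 1)) →L[ℝ] F))) x (0, f)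
      ((U x).2 - prolongRep (T x.1) x.2) • η x.1 = 0 := by
  ext ε
  -- The arguments ε are lifted to the plane of the frozen slope, on which G is a Taylor polynomial
  -- times η.
  let u : Fin (n + 1) → EuclideanSpace ℝ (Fin (n + 1)) × F :=
    fun i => (ContinuousLinearMap.id ℝ _).prod x.2 (ε i)
  let γ : (EuclideanSpace ℝ (Fin (n + 1)) × F) × (EuclideanSpace ℝ (Fin (n + 1)) →L[ℝ] F) → ℝ :=
    fun w => G w u
  have hγ : ∀ {w}, ContDiffWithinAt ℝ ∞ G
        (range (I.prod 𝓘(ℝ, EuclideanSpace ℝ (Fin (n + 1)) →L[ℝ] F))) w → ContDiffWithinAt ℝ ∞ γ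
        (range (I.prod 𝓘(ℝ, EuclideanSpace ℝ (Fin (n + 1)) →L[ℝ] F))) w := fun hw =>
    (ContinuousAlternatingMap.apply ℝ (EuclideanSpace ℝ (Fin (n + 1)) × F) ℝ
      u).contDiff.contDiffAt.comp_contDiffWithinAt _ hw
  have hγ' : ∀ {w}, w ∈ range (I.prod 𝓘(ℝ, EuclideanSpace ℝ (Fin (n + 1)) →L[ℝ] F)) →
      ContDiffWithinAt ℝ ∞ G
        (range (I.prod 𝓘(ℝ, EuclideanSpace ℝ (Fin (n + 1)) →L[ℝ] F))) w →
      ∀ v, fderivWithin ℝ γ (range (I.prod 𝓘(ℝ, EuclideanSpace ℝ (Fin (n + 1)) →L[ℝ] F))) w v =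
        fderivWithin ℝ G (range (I.prod 𝓘(ℝ, EuclideanSpace ℝ (Fin (n + 1)) →L[ℝ] F))) w v u := by
    intro w hw hGw v
    have h1 := hasFDerivWithinAt_clm_comp
      (W := (EuclideanSpace ℝ (Fin (n + 1)) × F) [⋀^Fin (n + 1)]→L[ℝ] ℝ) (W' := ℝ)
      (ContinuousAlternatingMap.apply ℝ (EuclideanSpace ℝ (Fin (n + 1)) × F) ℝ u)
      (hGw.differentiableWithinAt (by simp)).hasFDerivWithinAt
    exact DFunLike.congr_fun (h1.fderivWithin ((I.prod 𝓘(ℝ, _)).uniqueDiffOn w hw)) v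
  have hq : DifferentiableWithinAt ℝ (fun w => fderivWithin ℝ l
      (range (I.prod 𝓘(ℝ, EuclideanSpace ℝ (Fin (n + 1)) →L[ℝ] F))) w ∘L
      ContinuousLinearMap.inr ℝ _ _)
      (range (I.prod 𝓘(ℝ, EuclideanSpace ℝ (Fin (n + 1)) →L[ℝ] F))) x :=
    ((contDiffWithinAt_fderivWithin_range hx (hl.self_of_nhdsWithin hx)).clm_comp
      contDiffWithinAt_const).differentiableWithinAt (by simp)
  have hμ : DifferentiableWithinAt ℝ (fun w : (EuclideanSpace ℝ (Fin (n + 1)) × F) ×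
      (EuclideanSpace ℝ (Fin (n + 1)) →L[ℝ] F) => η w.1 ε)
      (range (I.prod 𝓘(ℝ, EuclideanSpace ℝ (Fin (n + 1)) →L[ℝ] F))) x :=
    (hasFDerivWithinAt_clm_comp (ContinuousAlternatingMap.apply ℝ (EuclideanSpace ℝ (Fin (n + 1)))
      ℝ ε) hη.hasFDerivWithinAt).differentiableWithinAt
  obtain ⟨D, hD, hD'⟩ := hasFDerivAt_vertical_derivative (γ := γ) (μ := fun w => η w.1 ε)
    (q := fun w => fderivWithin ℝ l
      (range (I.prod 𝓘(ℝ, EuclideanSpace ℝ (Fin (n + 1)) →L[ℝ] F))) w ∘L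
      ContinuousLinearMap.inr ℝ _ _) hx hc (hγ (hG'.self_of_nhdsWithin hx).2) hμ hq hU hU' (by
    -- For the Taylor polynomial a + l (x.2 - v), the derivative of a cancels that of x.2 - v; the
    -- derivative of l, applied to x.2 - v, is what `hasFDerivAt_vertical_derivative` requires.
    filter_upwards [eventually_eventually_nhdsWithin.2 hG, hG', ha, hl] with w h1 h2 h3 h4 f
    have h5 := hasFDerivAt_vertical h2.1 ((hγ h2.2).differentiableWithinAt (by simp))
    have h6 : HasFDerivAt (fun v => (a (w.1, v) + l (w.1, v) (x.2 - v)) * η w.1 ε) _ w.2 :=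
      (h3.add ((hasFDerivAt_vertical
        (W := (EuclideanSpace ℝ (Fin (n + 1)) →L[ℝ] F) →L[ℝ] ℝ) h2.1
        (h4.differentiableWithinAt (by simp))).clm_apply
        ((hasFDerivAt_id w.2).const_sub x.2))).mul_const (η w.1 ε)
    have h7 : (fun v => γ (w.1, v)) =ᶠ[𝓝 w.2]
        fun v => (a (w.1, v) + l (w.1, v) (x.2 - v)) * η w.1 ε := by
      filter_upwards [(tendsto_vertical h2.1).eventually h1] with v hv
      have h8 := DFunLike.congr_fun (legRep_comp_graph (a (w.1, v)) (l (w.1, v)) (η w.1) v x.2) ε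
      rw [← hv] at h8
      exact h8
    have h8 := DFunLike.congr_fun (h5.unique (h6.congr_of_eventuallyEq h7)) f
    refine h8.trans ?_
    simp
    ring)
  have hR : (fun v => fderivWithin ℝ γ
      (range (I.prod 𝓘(ℝ, EuclideanSpace ℝ (Fin (n + 1)) →L[ℝ] F))) (x.1, v) (U (x.1, v)))
      =ᶠ[𝓝 x.2] fun v => A x.1 u - (G (x.1, v)).fderivCompContinuousLinearMap
        (ContinuousLinearMap.id ℝ _) (T x.1) u := by
    filter_upwards [(tendsto_vertical hx).eventually (hG'.and h)] with v hv
    rw [hγ' hv.1.1 hv.1.2, hv.2]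
    rfl
  have hGx := (hG'.self_of_nhdsWithin hx).2.differentiableWithinAt (by simp)
  have h1 := hasFDerivAt_apply_sum (hasFDerivAt_vertical hx hGx) _ _ _ _
    (hD.congr_of_eventuallyEq hR.symm) f
  have h0 : (fderivWithin ℝ G (range (I.prod 𝓘(ℝ, EuclideanSpace ℝ (Fin (n + 1)) →L[ℝ] F))) x ∘L
      ContinuousLinearMap.inr ℝ _ _) f = _ :=
    fderivWithin_legRep_vertical hx hG hGx (ha.self_of_nhdsWithin hx)
      ((hl.self_of_nhdsWithin hx).differentiableWithinAt (by simp)) f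
  rw [hD', h0] at h1
  have h2 := DFunLike.congr_fun (fderivComp_legRep (fderivWithin ℝ l
    (range (I.prod 𝓘(ℝ, EuclideanSpace ℝ (Fin (n + 1)) →L[ℝ] F))) x (0, f)) (η x.1) x.2 (T x.1)) ε
  have h3 := (neg_injective h1).trans h2
  have h4 := congrArg₂ (· - ·) h3 (refl ((fderivWithin ℝ l
    (range (I.prod 𝓘(ℝ, EuclideanSpace ℝ (Fin (n + 1)) →L[ℝ] F))) x (0, f)
      (prolongRep (T x.1) x.2)) * η x.1 ε))
  rw [map_sub]
  refine (sub_mul _ _ (η x.1 ε)).trans (h4.trans (sub_self _))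

end Legendre

section Symmetry

variable {E V H : Type*} [NormedAddCommGroup E] [NormedSpace ℝ E] [NormedAddCommGroup V]
  [NormedSpace ℝ V] [TopologicalSpace H] {I : ModelWithCorners ℝ E H}

/-- The vertical Hessian of a function is symmetric. -/
lemma fderivWithin_fderivWithin_inr_symm {l : E × V → ℝ} {x : E × V}
    (hx : x ∈ range (I.prod 𝓘(ℝ, V))) (hc : x ∈ closure (interior (range (I.prod 𝓘(ℝ, V)))))
    (hl : ContDiffWithinAt ℝ ∞ l (range (I.prod 𝓘(ℝ, V))) x) (f g : V) :
    fderivWithin ℝ (fun w => fderivWithin ℝ l (range (I.prod 𝓘(ℝ, V))) w ∘L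
      ContinuousLinearMap.inr ℝ E V) (range (I.prod 𝓘(ℝ, V))) x (0, f) g =
    fderivWithin ℝ (fun w => fderivWithin ℝ l (range (I.prod 𝓘(ℝ, V))) w ∘L
      ContinuousLinearMap.inr ℝ E V) (range (I.prod 𝓘(ℝ, V))) x (0, g) f := by
  have hsymm : IsSymmSndFDerivWithinAt ℝ l (range (I.prod 𝓘(ℝ, V))) x :=
    hl.isSymmSndFDerivWithinAt minSmoothness_two_le_infty (I.prod 𝓘(ℝ, V)).uniqueDiffOn hc hx
  have h1 : DifferentiableWithinAt ℝ (fderivWithin ℝ l (range (I.prod 𝓘(ℝ, V))))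
      (range (I.prod 𝓘(ℝ, V))) x :=
    (contDiffWithinAt_fderivWithin_range hx hl).differentiableWithinAt (by simp)
  have h2 := hasFDerivWithinAt_clm_comp (ContinuousLinearMap.precomp ℝ
    (ContinuousLinearMap.inr ℝ E V)) h1.hasFDerivWithinAt
  have h3 := h2.fderivWithin ((I.prod 𝓘(ℝ, V)).uniqueDiffOn x hx)
  have h4 : ∀ f g, fderivWithin ℝ (fun w => fderivWithin ℝ l (range (I.prod 𝓘(ℝ, V))) w ∘L
      ContinuousLinearMap.inr ℝ E V) (range (I.prod 𝓘(ℝ, V))) x (0, f) g =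
      fderivWithin ℝ (fderivWithin ℝ l (range (I.prod 𝓘(ℝ, V)))) (range (I.prod 𝓘(ℝ, V))) x
        (0, f) (0, g) := fun f g => DFunLike.congr_fun (DFunLike.congr_fun h3 (0, f)) g
  rw [h4, h4, hsymm.eq]

end Symmetry

section Legendre

variable {n m : ℕ} {HX : Type*} [TopologicalSpace HX]
  {IX : ModelWithCorners ℝ (BaseModel n) HX}
  {X Y : Type*} [TopologicalSpace X] [ChartedSpace HX X] [IsManifold IX ∞ X]
  [TopologicalSpace Y] [ChartedSpace (ModelProd HX (FibreModel m)) Y]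
  [IsManifold (modelY IX m) ∞ Y] [IsManifold (modelY IX m) 1 Y]
  {p : Y → X} [IsFibred (FibreModel m) IX p]
  (c : FibredChart (F := FibreModel m) IX p)
  {η : DForm IX X (n + 1)} {L : JetBundle IX p m → ℝ}
  {ξ : VField (modelY IX m) Y} {α : DForm (modelY IX m) Y n}

lemma eventually_rep_related {ξ₁ : VField (modelJet IX m) (JetBundle IX p m)}
    (h : IsRelated Jet.proj ξ₁ ξ) {z : JetBundle IX p m} (hz : z.proj ∈ c.chart.source) :
    ∀ᶠ w in 𝓝[range (modelJet IX m)] ((jetChart c).chart.extend (modelJet IX m) z),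
      (VField.rep ξ₁ (jetChart c).chart w).1 = VField.rep ξ c.chart w.1 := by
  refine eventually_extend (e := (jetChart c).chart) hz ?_
  filter_upwards [(jetChart c).chart.open_source.mem_nhds hz] with y hy
  rw [VField.rep_extend ξ₁ hy]
  refine (fst_dChart_apply (jetChart c) hy (ξ₁ y)).trans ?_
  have h1 : tangentProj (BaseModel n →L[ℝ] FibreModel m) (modelY IX m) Jet.proj y (ξ₁ y) =
    ξ y.proj := h y
  rw [h1]
  exact (VField.rep_extend ξ (e := c.chart) hy).symm

lemma fderivWithin_momRep_apply_eq_zero (hη : η.Smooth) (hη0 : ∀ x, η x ≠ 0)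
    (hL : ContMDiff (modelJet IX m) 𝓘(ℝ, ℝ) ∞ L)
    (hξ : IsSmoothVF ξ) (hα : α.Smooth) {ξ₁ : VField (modelJet IX m) (JetBundle IX p m)}
    (hξ₁ : IsSmoothVF ξ₁) (hr : IsRelated Jet.proj ξ₁ ξ)
    (h : ∀ z, LiftsAt (V := BaseModel n →L[ℝ] FibreModel m) (M := JetBundle IX p m)
      (legAlong η L) ξ α z (ξ₁ z))
    {z : JetBundle IX p m} (hz : z.proj ∈ c.chart.source) (f : BaseModel n →L[ℝ] FibreModel m) :
    fderivWithin ℝ (momRep c L) (range (modelJet IX m))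
      ((jetChart c).chart.extend (modelJet IX m) z) (0, f)
      ((dChart (modelJet IX m) (jetChart c).chart z (ξ₁ z)).2 -
        prolongRep (fieldDeriv c ξ (c.chart.extend (modelY IX m) z.proj))
          ((jetChart c).chart.extend (modelJet IX m) z).2) = 0 := by
  have hs := (jetChart c).chart.open_source.mem_nhds hz
  have hr' := eventually_rep_related c hr hz
  have hG' : ∀ᶠ w in 𝓝[range (modelJet IX m)] ((jetChart c).chart.extend (modelJet IX m) z),
      w ∈ range (modelJet IX m) ∧
        ContDiffWithinAt ℝ ∞ ((legAlong η L).rep (jetChart c)) (range (modelJet IX m)) w := by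
    refine eventually_extend (e := (jetChart c).chart) hz ?_
    filter_upwards [hs] with y hy
    exact ⟨mem_range_self _, contDiffWithinAt_rep_legAlong c hη hL hy⟩
  have ha : ∀ᶠ w in 𝓝[range (modelJet IX m)] ((jetChart c).chart.extend (modelJet IX m) z),
      HasFDerivAt (fun v => lagRep c L (w.1, v)) (momRep c L w) w.2 := by
    refine eventually_extend (e := (jetChart c).chart) hz ?_
    filter_upwards [hs] with y hy
    exact hasFDerivAt_lagRep hL hy
  have hl : ∀ᶠ w in 𝓝[range (modelJet IX m)] ((jetChart c).chart.extend (modelJet IX m) z),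
      ContDiffWithinAt ℝ ∞ (momRep c L) (range (modelJet IX m)) w := by
    refine eventually_extend (e := (jetChart c).chart) hz ?_
    filter_upwards [hs] with y hy
    exact contDiffWithinAt_momRep hL hy
  have hU' : ∀ᶠ v in 𝓝 ((jetChart c).chart.extend (modelJet IX m) z).2,
      (VField.rep ξ₁ (jetChart c).chart (((jetChart c).chart.extend (modelJet IX m) z).1, v)).1 =
      (VField.rep ξ₁ (jetChart c).chart ((jetChart c).chart.extend (modelJet IX m) z)).1 := by
    rw [hr'.self_of_nhdsWithin (mem_range_self _)]
    exact (tendsto_vertical (mem_range_self _)).eventually hr'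
  have hE : ∀ᶠ w in 𝓝[range (modelJet IX m)] ((jetChart c).chart.extend (modelJet IX m) z),
      fderivWithin ℝ ((legAlong η L).rep (jetChart c)) (range (modelJet IX m)) w
        (VField.rep ξ₁ (jetChart c).chart w) =
      extRep c α w.1 - ((legAlong η L).rep (jetChart c) w).fderivCompContinuousLinearMap
        (ContinuousLinearMap.id ℝ _) (fieldDeriv c ξ w.1) := by
    refine eventually_extend (e := (jetChart c).chart) hz ?_
    filter_upwards [hs] with y hy
    rw [VField.rep_extend ξ₁ hy]
    exact (liftsAt_legAlong_iff c hη hL hξ hα hy (h y).1).1 (h y)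
  have hv := velocity_eq (n := n) (F := FibreModel m) (I := modelY IX m)
    (x := (jetChart c).chart.extend (modelJet IX m) z)
    (a := lagRep c L) (l := momRep c L) (η := fun y => η.rep c.base y.1)
    (mem_range_self _) (mem_closure_interior_range z) (eventually_rep_legAlong c hL hz) hG' ha hl
    ((contDiffWithinAt_volRep c hη hz).differentiableWithinAt (by simp))
    ((VField.contDiffWithinAt_rep (jetChart c).chart_mem hz hξ₁).differentiableWithinAt (by simp))
    hU' hE f
  rw [VField.rep_extend ξ₁ hz] at hv
  -- The equation carries the factor η, which is cancelled because the volume form has no zeros.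
  refine (smul_eq_zero.1 hv).resolve_right fun h0 => hη0 (p z.proj) ?_
  have hb : ((jetChart c).chart.extend (modelJet IX m) z).1.1 = c.base.extend IX (p z.proj) :=
    (extend_base c hz).symm
  have h1 : η.rep c.base (c.base.extend IX (p z.proj)) = 0 := by rw [← hb]; exact h0
  exact (DForm.rep_comp_dChart c.base_mem η (c.maps _ hz)).symm.trans
    (congrArg (fun w => ContinuousAlternatingMap.compContinuousLinearMap w
      (dChart IX c.base (p z.proj))) h1)

/-- Let g be the difference between the velocity of ξ₁ and that of the prolongation. By symmetry of
the Hessian the momenta are stationary in the direction (0, g), hence so is the whole form Leg_L,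
whose fibre derivative involves only the variation of the momenta. Then T leg_L annihilates (0, g),
and injectivity gives g = 0. -/
lemma isProlongation_of_liftsAt (hη : η.Smooth) (hη0 : ∀ x, η x ≠ 0)
    (hL : ContMDiff (modelJet IX m) 𝓘(ℝ, ℝ) ∞ L)
    (himm : ∀ z u, mfderiv (modelJet IX m) (modelDual IX m) (leg η L) z u = 0 → u = 0)
    (hξ : IsSmoothVF ξ) (hα : α.Smooth) {ξ₁ : VField (modelJet IX m) (JetBundle IX p m)}
    (hξ₁ : IsSmoothVF ξ₁) (hr : IsRelated Jet.proj ξ₁ ξ)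
    (h : ∀ z, LiftsAt (V := BaseModel n →L[ℝ] FibreModel m) (M := JetBundle IX p m)
      (legAlong η L) ξ α z (ξ₁ z)) : IsProlongation ξ ξ₁ := by
  refine (isProlongation_iff hξ).2 ⟨hξ₁, hr, fun c z hz => ?_⟩
  set g := (dChart (modelJet IX m) (jetChart c).chart z (ξ₁ z)).2 -
        prolongRep (fieldDeriv c ξ (c.chart.extend (modelY IX m) z.proj))
          ((jetChart c).chart.extend (modelJet IX m) z).2 with hg
  have h1 : fderivWithin ℝ (momRep c L) (range (modelJet IX m))
      ((jetChart c).chart.extend (modelJet IX m) z) (0, g) = 0 := by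
    ext f : 1
    exact (fderivWithin_fderivWithin_inr_symm (mem_range_self _) (mem_closure_interior_range z)
      (contDiffWithinAt_lagRep hL hz) g f).trans
      (fderivWithin_momRep_apply_eq_zero c hη hη0 hL hξ hα hξ₁ hr h hz f)
  have h2 : fderivWithin ℝ ((legAlong η L).rep (jetChart c)) (range (modelJet IX m))
      ((jetChart c).chart.extend (modelJet IX m) z) (0, g) = 0 := by
    have h3 := fderivWithin_legRep_vertical (n := n) (F := FibreModel m) (I := modelY IX m)
      (x := (jetChart c).chart.extend (modelJet IX m) z)
      (a := lagRep c L) (l := momRep c L) (η := fun y => η.rep c.base y.1)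
      (mem_range_self _) (eventually_rep_legAlong c hL hz)
      ((contDiffWithinAt_rep_legAlong c hη hL hz).differentiableWithinAt (by simp))
      (hasFDerivAt_lagRep hL hz)
      ((contDiffWithinAt_momRep hL hz).differentiableWithinAt (by simp)) g
    refine h3.trans ?_
    rw [h1]
    exact map_zero (legRepL _ _)
  have h3 : ∀ v, dChart (modelJet IX m) (jetChart c).chart z
      ((dChart (modelJet IX m) (jetChart c).chart z).inverse v) = v :=
    dChart_apply_inverse (jetChart c).chart_mem hz
  set u := (dChart (modelJet IX m) (jetChart c).chart z).inverse (0, g) with hu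
  have h4 := dChart_mfderiv_Leg (η := η) c hη hL hz u
  rw [hu, h3, h2] at h4
  have h5 : mfderiv (modelJet IX m) (modelLam IX m) (Leg η L) z u = 0 := by
    apply dChart_injective (lamChart c).chart_mem (x := Leg η L z) hz
    refine Eq.trans ?_ (map_zero _).symm
    refine Prod.ext h4.1 (valL_injective (h4.2.trans (map_zero _).symm))
  have h6 : mfderiv (modelJet IX m) (modelDual IX m) (leg η L) z u = 0 := by
    have h7 := mfderiv_comp (I := modelJet IX m) (I' := modelLam IX m) (I'' := modelDual IX m) z
      ((contMDiff_toDual (Leg η L z)).mdifferentiableAt (by simp))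
      ((contMDiff_Leg hη hL z).mdifferentiableAt (by simp))
    refine (DFunLike.congr_fun h7 u).trans ?_
    refine (congrArg (mfderiv (modelLam IX m) (modelDual IX m) Lam.toDual (Leg η L z)) h5).trans ?_
    exact map_zero _
  have h7 := h3 (0, g)
  rw [← hu, himm z u h6] at h7
  have h8 : ((0 : BaseModel n × FibreModel m), g) = 0 := h7.symm.trans (map_zero _)
  exact sub_eq_zero.1 (congrArg Prod.snd h8)

end Legendre

/-! ### Escaping slopes and affine differential equations. -/

section Gronwall

variable {W : Type*} [NormedAddCommGroup W] [NormedSpace ℝ W]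

/-- The solutions of a differential equation with affinely bounded right-hand side are bounded. -/
lemma exists_norm_le_of_norm_deriv_le {w w' : ℝ → W} {C D ε : ℝ} (hC : 0 ≤ C) (hD : 0 ≤ D)
    (hε : 0 < ε) (hw : ∀ s ∈ Ioo 0 ε, HasDerivAt w (w' s) s)
    (hw' : ∀ s ∈ Ioo 0 ε, ‖w' s‖ ≤ C * ‖w s‖ + D) :
    ∃ M, ∀ s ∈ Ioc 0 (ε / 2), ‖w s‖ ≤ M := by
  -- Gronwall's inequality runs forward, so the curve is followed backwards from ε / 2. The bound
  -- for the whole time ε / 2 is independent of s.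
  refine ⟨gronwallBound ‖w (ε / 2)‖ C D (ε / 2), fun s hs => ?_⟩
  have hmem : ∀ t ∈ Icc 0 (ε / 2 - s), ε / 2 - t ∈ Ioo 0 ε := by
    intro t ht
    constructor <;> linarith [hs.1, ht.1, ht.2]
  have hd : ∀ t ∈ Icc 0 (ε / 2 - s),
      HasDerivAt (fun t => w (ε / 2 - t)) (-w' (ε / 2 - t)) t := by
    intro t ht
    have h := (hw _ (hmem t ht)).scomp t ((hasDerivAt_id t).const_sub (ε / 2))
    rw [neg_one_smul] at h
    exact h
  have h1 := norm_le_gronwallBound_of_norm_deriv_right_le (f := fun t => w (ε / 2 - t))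
    (f' := fun t => -w' (ε / 2 - t)) (δ := ‖w (ε / 2)‖) (K := C) (ε := D) (a := 0) (b := ε / 2 - s)
    (fun t ht => (hd t ht).continuousAt.continuousWithinAt)
    (fun t ht => (hd t ⟨ht.1, ht.2.le⟩).hasDerivWithinAt) (by simp)
    (fun t ht => by
      rw [norm_neg]
      exact hw' _ (hmem t ⟨ht.1, ht.2.le⟩))
    (ε / 2 - s) ⟨by linarith [hs.2], le_rfl⟩
  rw [sub_sub_cancel, sub_zero] at h1
  exact h1.trans (gronwallBound_mono (norm_nonneg _) hD hC (by linarith [hs.1]))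

end Gronwall

section SlopeCurve

variable {B F : Type*} [NormedAddCommGroup B] [NormedSpace ℝ B] [FiniteDimensional ℝ B]
  [NormedAddCommGroup F] [NormedSpace ℝ F] [FiniteDimensional ℝ F]

/-- A trajectory and the linear maps transported along it solve one differential equation with C¹
right-hand side for the pair (y, A), so a local solution exists, for negative times as well. -/
lemma exists_linearized_curve {E : Type*} [NormedAddCommGroup E] [NormedSpace ℝ E] [CompleteSpace E]
    {ξ : E → E} {T : E → E →L[ℝ] E} {e : E} (hξ : ContDiffAt ℝ 1 ξ e) (hT : ContDiffAt ℝ 1 T e)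
    (A₀ : B →L[ℝ] E) : ∃ (y : ℝ → E) (A : ℝ → B →L[ℝ] E), y 0 = e ∧ A 0 = A₀ ∧ ∃ ε > 0,
      ∀ s ∈ Ioo (-ε) ε, HasDerivAt y (ξ (y s)) s ∧ HasDerivAt A (T (y s) ∘L A s) s := by
  have h1 : ContDiffAt ℝ 1 (fun x : E × (B →L[ℝ] E) => (ξ x.1, T x.1 ∘L x.2)) (e, A₀) :=
    (hξ.comp (e, A₀) contDiffAt_fst).prodMk ((hT.comp (e, A₀) contDiffAt_fst).clm_comp contDiffAt_snd)
  obtain ⟨γ, h0, ε, hε, h⟩ :=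
    h1.exists_forall_mem_closedBall_exists_eq_forall_mem_Ioo_hasDerivAt₀ 0
  refine ⟨fun s => (γ s).1, fun s => (γ s).2, congrArg Prod.fst h0, congrArg Prod.snd h0, ε, hε, fun s hs => ?_⟩
  have h2 := h s (by simpa using hs)
  exact ⟨(ContinuousLinearMap.fst ℝ E (B →L[ℝ] E)).hasFDerivAt.comp_hasDerivAt s h2,
    (ContinuousLinearMap.snd ℝ E (B →L[ℝ] E)).hasFDerivAt.comp_hasDerivAt s h2⟩

lemma hasDerivAt_comp_left {E G : Type*} [NormedAddCommGroup E] [NormedSpace ℝ E]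
    [NormedAddCommGroup G] [NormedSpace ℝ G] (M : E →L[ℝ] G) {A : ℝ → B →L[ℝ] E} {A' : B →L[ℝ] E}
    {s : ℝ} (hA : HasDerivAt A A' s) : HasDerivAt (fun s => M ∘L A s) (M ∘L A') s := by
  simpa using (hasDerivAt_const s M).clm_comp hA

/-- With P and N the base and fibre parts of A, the slope N P⁻¹ has derivative N' P⁻¹ - N P⁻¹ P'
P⁻¹. This Riccati equation is the velocity equation of the prolongation. -/
lemma hasDerivAt_slope {A : ℝ → B →L[ℝ] B × F} {T : B × F →L[ℝ] B × F} {s : ℝ}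
    (hA : HasDerivAt A (T ∘L A s) s) (hu : IsUnit (ContinuousLinearMap.fst ℝ B F ∘L A s)) :
    HasDerivAt (fun s => (ContinuousLinearMap.snd ℝ B F ∘L A s) ∘L
        Ring.inverse (ContinuousLinearMap.fst ℝ B F ∘L A s))
      (prolongRep T ((ContinuousLinearMap.snd ℝ B F ∘L A s) ∘L
        Ring.inverse (ContinuousLinearMap.fst ℝ B F ∘L A s))) s := by
  obtain ⟨P, hP⟩ := hu
  have h1 : HasDerivAt (fun s => ContinuousLinearMap.fst ℝ B F ∘L A s)
      (ContinuousLinearMap.fst ℝ B F ∘L T ∘L A s) s :=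
    hasDerivAt_comp_left _ hA
  have h2 : HasDerivAt (fun s => ContinuousLinearMap.snd ℝ B F ∘L A s)
      (ContinuousLinearMap.snd ℝ B F ∘L T ∘L A s) s :=
    hasDerivAt_comp_left _ hA
  have h3 := hasFDerivAt_ringInverse (𝕜 := ℝ) P
  rw [hP] at h3
  have h4 := h3.comp_hasDerivAt s h1
  have h5 := h2.clm_comp h4
  have hi : Ring.inverse (ContinuousLinearMap.fst ℝ B F ∘L A s) = ↑P⁻¹ := by
    rw [← hP, Ring.inverse_unit]
  have h6 : ∀ x, ContinuousLinearMap.fst ℝ B F (A s ((↑P⁻¹ : B →L[ℝ] B) x)) = x := by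
    intro x
    have h7 := P.mul_inv
    rw [hP] at h7
    exact DFunLike.congr_fun h7 x
  convert! h5 using 1
  ext x
  have h8 : (x, ContinuousLinearMap.snd ℝ B F (A s ((↑P⁻¹ : B →L[ℝ] B) x))) =
      A s ((↑P⁻¹ : B →L[ℝ] B) x) := Prod.ext (h6 x).symm rfl
  simp only [Function.comp_apply, hi, prolongRep, _root_.sub_apply, _root_.add_apply,
    ContinuousLinearMap.comp_apply, ContinuousLinearMap.prod_apply, ContinuousLinearMap.id_apply, h8]
  simp [sub_eq_add_neg, ContinuousLinearMap.mulLeftRight_apply]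

/-- If the linear map `P s` degenerates at `s = 0` in a single direction `b`, to first order, then
`P s` is invertible for small `s > 0`. -/
lemma eventually_isUnit {P : ℝ → B →L[ℝ] B} {P' : B →L[ℝ] B} {φ : B →L[ℝ] ℝ} {b : B}
    (hφ : φ b = 1) (hP : HasDerivAt P P' 0) (h0 : P 0 = ContinuousLinearMap.id ℝ B - φ.smulRight b)
    (h1 : P' b = b) : ∀ᶠ s in 𝓝[>] (0 : ℝ), IsUnit (P s) := by
  have hPb : HasDerivAt (fun s => P s b) b 0 := by
    have h := hP.clm_apply (hasDerivAt_const (0 : ℝ) b)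
    simpa [h1] using h
  have h0b : P 0 b = 0 := by simp [h0, hφ]
  have h2 : Tendsto (fun s : ℝ => s⁻¹ • P s b) (𝓝[>] 0) (𝓝 b) := by
    have h := (hasDerivAt_iff_tendsto_slope_zero.1 hPb).mono_left
      (nhdsWithin_mono 0 (fun s (hs : s ∈ Ioi 0) => (ne_of_gt hs : s ≠ 0)))
    simp only [zero_add, h0b, sub_zero] at h
    exact h
  have h3 : Tendsto (fun s => P s b) (𝓝[>] 0) (𝓝 0) := by
    have h := hPb.continuousAt.tendsto.mono_left (nhdsWithin_le_nhds (s := Ioi 0))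
    rwa [h0b] at h
  have h4 : Tendsto P (𝓝[>] 0) (𝓝 (ContinuousLinearMap.id ℝ B - φ.smulRight b)) := by
    have h := hP.continuousAt.tendsto.mono_left (nhdsWithin_le_nhds (s := Ioi 0))
    rwa [h0] at h
  -- This is P s composed with id + (s⁻¹ - 1) φ ⊗ b, which rescales the degenerate direction by s⁻¹;
  -- in the limit it is the identity, hence it is invertible for small s.
  have h5 : Tendsto (fun s => P s + φ.smulRight (s⁻¹ • P s b - P s b)) (𝓝[>] 0)
      (𝓝 (1 : B →L[ℝ] B)) := by
    have h6 := ((ContinuousLinearMap.smulRightL ℝ B B φ).continuous.tendsto _).comp (h2.sub h3)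
    have h7 := h4.add h6
    have h8 : ContinuousLinearMap.id ℝ B - φ.smulRight b +
        ContinuousLinearMap.smulRightL ℝ B B φ (b - 0) = 1 := by
      ext x
      simp
    rw [h8] at h7
    exact h7
  filter_upwards [h5.eventually (Units.isOpen.mem_nhds isUnit_one)] with s hs
  rw [ContinuousLinearMap.isUnit_iff_bijective]
  have hsurj : Function.Surjective (P s) := by
    intro x
    obtain ⟨x', rfl⟩ := (ContinuousLinearMap.isUnit_iff_bijective.1 hs).2 x
    -- By the factorisation through P s, surjectivity of the product gives that of P s; injectivity
    -- follows in finite dimension.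
    refine ⟨x' + (φ x' * (s⁻¹ - 1)) • b, ?_⟩
    simp only [map_add, map_smul, _root_.add_apply, ContinuousLinearMap.smulRight_apply, mul_smul,
      sub_smul, one_smul, map_sub]
  exact ⟨(LinearMap.injective_iff_surjective (f := (P s).toLinearMap)).2 hsurj, hsurj⟩

/-- The curve of slopes obtained by transporting a plane which has a vertical direction; it escapes
to infinity. -/
lemma exists_slope_curve {ξ : B × F → B × F} {T : B × F → B × F →L[ℝ] B × F} {e : B × F}
    (hξ : ContDiffAt ℝ 1 ξ e) (hT : ContDiffAt ℝ 1 T e) {f : F} (hf : (T e (0, f)).1 ≠ 0) :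
    ∃ (y : ℝ → B × F) (v : ℝ → B →L[ℝ] F) (r : ℝ → B), Tendsto y (𝓝[>] 0) (𝓝 e) ∧
      (∀ᶠ s in 𝓝[>] (0 : ℝ), HasDerivAt y (ξ (y s)) s ∧
        HasDerivAt v (prolongRep (T (y s)) (v s)) s) ∧
      Tendsto r (𝓝[>] 0) (𝓝 0) ∧ Tendsto (fun s => v s (r s)) (𝓝[>] 0) (𝓝 f) := by
  set b := (T e (0, f)).1 with hb
  obtain ⟨φ, hφ⟩ := SeparatingDual.exists_eq_one (R := ℝ) hf
  -- The initial plane contains (0, f), as the image of b, and its base part id - φ ⊗ b has kernel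
  -- spanned by b. Since b is the base component of T e (0, f), the derivative of the base part
  -- fixes b, and the degeneration is of first order.
  obtain ⟨y, A, hy, hA, ε, hε, h⟩ := exists_linearized_curve hξ hT
    ((ContinuousLinearMap.id ℝ B - φ.smulRight b).prod (φ.smulRight f))
  have h0 := h 0 ⟨by linarith, hε⟩
  have hle : 𝓝[>] (0 : ℝ) ≤ 𝓝 0 := nhdsWithin_le_nhds
  have hP : HasDerivAt (fun s => ContinuousLinearMap.fst ℝ B F ∘L A s)
      (ContinuousLinearMap.fst ℝ B F ∘L T (y 0) ∘L A 0) 0 :=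
    hasDerivAt_comp_left _ h0.2
  have hAb : A 0 b = (0, f) := by
    rw [hA]
    simp [hφ]
  have hu := eventually_isUnit hφ hP (by rw [hA]; rfl)
    (by
      rw [ContinuousLinearMap.comp_apply, ContinuousLinearMap.comp_apply, hAb, hy]
      rfl)
  have hAt : Tendsto (fun s => A s b) (𝓝[>] 0) (𝓝 (0, f)) := by
    rw [← hAb]
    exact (h0.2.clm_apply (hasDerivAt_const (0 : ℝ) b)).continuousAt.tendsto.mono_left hle
  -- Here r s is the base component of A s b, and v s sends it to the fibre component. As A s b
  -- tends to (0, f), the slope cannot stay bounded when f ≠ 0.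
  refine ⟨y, fun s => (ContinuousLinearMap.snd ℝ B F ∘L A s) ∘L
        Ring.inverse (ContinuousLinearMap.fst ℝ B F ∘L A s), fun s => (A s b).1, ?_, ?_, ?_, ?_⟩
  · rw [← hy]
    exact h0.1.continuousAt.tendsto.mono_left hle
  · filter_upwards [hu, hle (Ioo_mem_nhds (neg_lt_zero.2 hε) hε)] with s hs hs'
    exact ⟨(h s hs').1, hasDerivAt_slope (h s hs').2 hs⟩
  · exact (continuous_fst.tendsto _).comp hAt
  · refine Tendsto.congr' ?_ ((continuous_snd.tendsto _).comp hAt)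
    filter_upwards [hu] with s hs
    have h1 := DFunLike.congr_fun (Ring.inverse_mul_cancel _ hs) b
    exact (congrArg (fun t => (A s t).2) h1).symm

end SlopeCurve

section Escape

variable {B F W : Type*} [NormedAddCommGroup B] [NormedSpace ℝ B] [FiniteDimensional ℝ B]
  [NormedAddCommGroup F] [NormedSpace ℝ F] [FiniteDimensional ℝ F]
  [NormedAddCommGroup W] [NormedSpace ℝ W] [FiniteDimensional ℝ W]

/-- If the lifts of the slope curves solve an affine differential equation, from whose solutions the
slopes can be recovered continuously, then there are no escaping slope curves. -/
lemma fst_apply_eq_zero_of_affine {ξ : B × F → B × F} {T : B × F → B × F →L[ℝ] B × F} {e : B × F}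
    (hξ : ContDiffAt ℝ 1 ξ e) (hT : ContDiffAt ℝ 1 T e)
    {ℓ : (B × F) × (B →L[ℝ] F) → W} {ψ : (B × F) × W → B →L[ℝ] F} {R₀ : B × F → W}
    {R : B × F → W → W} (hR₀ : ContinuousAt R₀ e)
    (hR : ContinuousAt (fun x : (B × F) × W => R x.1 x.2) (e, 0))
    (hR' : ∀ x (t : ℝ) w, R x (t • w) = t • R x w)
    (hℓ : ∀ᶠ x in 𝓝 e, ∀ v, DifferentiableAt ℝ ℓ (x, v) ∧
      fderiv ℝ ℓ (x, v) (ξ x, prolongRep (T x) v) = R₀ x - R x (ℓ (x, v)))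
    (hψ : ∀ᶠ x in 𝓝 e, ∀ v, ψ (x, ℓ (x, v)) = v)
    (hψ' : ∀ w, ContinuousAt ψ (e, w)) (f : F) : (T e (0, f)).1 = 0 := by
  by_contra hf
  obtain ⟨y, v, r, hy, hd, hr, hv⟩ := exists_slope_curve hξ hT hf
  -- Continuity at (e, 0) bounds R by 1 on a ball of radius δ, uniformly near e, and homogeneity
  -- turns this into a linear bound. The factor 2 keeps the rescaled vector strictly inside the
  -- ball.
  obtain ⟨C, hC, hRb⟩ : ∃ C, 0 ≤ C ∧ ∀ᶠ x in 𝓝 e, ∀ w, ‖R x w‖ ≤ C * ‖w‖ := by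
    have h1 : ∀ x, R x 0 = 0 := fun x => by simpa using hR' x 0 0
    have h2 : ∀ᶠ x in 𝓝 (e, (0 : W)), ‖R x.1 x.2‖ < 1 := by
      refine hR.norm.eventually_lt continuousAt_const ?_
      simp [h1]
    rw [nhds_prod_eq, eventually_prod_iff] at h2
    obtain ⟨p, hp, q, hq, h3⟩ := h2
    obtain ⟨δ, hδ, hq⟩ := Metric.eventually_nhds_iff.1 hq
    refine ⟨2 / δ, by positivity, hp.mono fun x hx w => ?_⟩
    by_cases hw : w = 0
    · simp [hw, h1]
    · have hn : 0 < ‖w‖ := norm_pos_iff.2 hw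
      have h4 := h3 hx (hq (y := (δ / (2 * ‖w‖)) • w) (by
        rw [dist_zero_right, norm_smul, Real.norm_of_nonneg (by positivity)]
        field_simp
        linarith))
      rw [hR', norm_smul, Real.norm_of_nonneg (by positivity), div_mul_eq_mul_div,
        div_lt_one (by positivity)] at h4
      rw [div_mul_eq_mul_div, le_div_iff₀ hδ]
      linarith
  have hR₀b : ∀ᶠ x in 𝓝 e, ‖R₀ x‖ ≤ ‖R₀ e‖ + 1 :=
    (hR₀.norm.eventually_lt continuousAt_const (by simp)).mono fun x hx => hx.le
  have hw : ∀ᶠ s in 𝓝[>] (0 : ℝ), HasDerivAt (fun s => ℓ (y s, v s))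
      (R₀ (y s) - R (y s) (ℓ (y s, v s))) s ∧
      ‖R₀ (y s) - R (y s) (ℓ (y s, v s))‖ ≤ C * ‖ℓ (y s, v s)‖ + (‖R₀ e‖ + 1) ∧
      ψ (y s, ℓ (y s, v s)) = v s := by
    filter_upwards [hd, hy.eventually hℓ, hy.eventually hRb, hy.eventually hR₀b,
      hy.eventually hψ] with s h1 h2 h3 h4 h5
    refine ⟨?_, ?_, h5 _⟩
    · rw [← (h2 (v s)).2]
      exact (h2 (v s)).1.hasFDerivAt.comp_hasDerivAt s (h1.1.prodMk h1.2)
    · refine (norm_sub_le _ _).trans ?_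
      linarith [h3 (ℓ (y s, v s))]
  obtain ⟨ε, hε, hw⟩ := (mem_nhdsGT_iff_exists_Ioo_subset.1 hw)
  obtain ⟨M, hM⟩ := exists_norm_le_of_norm_deriv_le hC (by positivity) hε
    (fun s hs => (hw hs).1) (fun s hs => (hw hs).2.1)
  have hs : ∀ k : ℕ, ε / (k + 2) ∈ Ioc 0 (ε / 2) := by
    intro k
    have hε' : (0 : ℝ) < ε := hε
    refine ⟨by positivity, ?_⟩
    gcongr
    linarith [(Nat.cast_nonneg k : (0 : ℝ) ≤ k)]
  have hlim : Tendsto (fun k : ℕ => ε / (k + 2)) atTop (𝓝[>] 0) := by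
    refine tendsto_nhdsWithin_iff.2 ⟨?_, Eventually.of_forall fun k => (hs k).1⟩
    exact Tendsto.const_div_atTop (tendsto_atTop_add_const_right _ _ tendsto_natCast_atTop_atTop) ε
  -- The lifted curve is bounded, so it converges to some w along a sequence of times tending to 0;
  -- continuity of ψ at (e, w) makes the slopes converge too.
  obtain ⟨w, -, κ, hκ, hκ'⟩ := tendsto_subseq_of_bounded (Metric.isBounded_closedBall (x := (0 : W))
    (r := M)) (x := fun k : ℕ => ℓ (y (ε / (k + 2)), v (ε / (k + 2))))
    (fun k => by simpa using hM _ (hs k))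
  have hlim' := hlim.comp hκ.tendsto_atTop
  have h1 : Tendsto (fun k => v (ε / (κ k + 2))) atTop (𝓝 (ψ (e, w))) := by
    refine Tendsto.congr (fun k => ?_) ((hψ' w).tendsto.comp ((hy.comp hlim').prodMk_nhds hκ'))
    have hε' : (0 : ℝ) < ε := hε
    exact (hw ⟨(hs (κ k)).1, (hs (κ k)).2.trans_lt (half_lt_self hε')⟩).2.2
  -- Convergent slopes applied to r → 0 tend to 0, while the same sequence tends to f. So f = 0,
  -- which contradicts the assumption on T e (0, f).
  have h2 : Tendsto (fun k => v (ε / (κ k + 2)) (r (ε / (κ k + 2)))) atTop (𝓝 (ψ (e, w) 0)) :=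
    ((isBoundedBilinearMap_apply (𝕜 := ℝ)).continuous.tendsto (ψ (e, w), (0 : B))).comp
      (h1.prodMk_nhds (hr.comp hlim'))
  have h3 := tendsto_nhds_unique h2 (hv.comp hlim')
  rw [map_zero] at h3
  apply hf
  rw [← h3]
  exact congrArg Prod.fst (map_zero (T e))

end Escape

section Continuity

variable {E E' : Type*} [NormedAddCommGroup E] [NormedSpace ℝ E] [NormedAddCommGroup E']
  [NormedSpace ℝ E'] {k : ℕ}

lemma continuousAt_fderivComp {T : E' → E →L[ℝ] E} {e : E'} (hT : ContinuousAt T e)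
    (w : E [⋀^Fin (k + 1)]→L[ℝ] ℝ) :
    ContinuousAt (fun x : E' × E [⋀^Fin (k + 1)]→L[ℝ] ℝ =>
      x.2.fderivCompContinuousLinearMap (ContinuousLinearMap.id ℝ E) (T x.1)) (e, w) := by
  have h1 : ContinuousAt (fun x : E' × E [⋀^Fin (k + 1)]→L[ℝ] ℝ => (x.2, T x.1)) (e, w) :=
    continuousAt_snd.prodMk (ContinuousAt.comp (f := Prod.fst) (x := (e, w)) hT continuousAt_fst)
  exact ContinuousAt.comp (f := fun x : E' × E [⋀^Fin (k + 1)]→L[ℝ] ℝ => (x.2, T x.1))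
    (x := (e, w)) (contDiff_fderivComp (k := k) (ContinuousLinearMap.id ℝ E)).continuous.continuousAt
    h1

lemma fderivComp_smul_left (t : ℝ) (w : E [⋀^Fin (k + 1)]→L[ℝ] ℝ) (T : E →L[ℝ] E) :
    (t • w).fderivCompContinuousLinearMap (ContinuousLinearMap.id ℝ E) T =
      t • w.fderivCompContinuousLinearMap (ContinuousLinearMap.id ℝ E) T := by
  ext u
  simp [ContinuousAlternatingMap.fderivCompContinuousLinearMap_apply, Finset.mul_sum]

lemma continuousAt_snd_comp {W W' G G' : Type*} [TopologicalSpace W] [TopologicalSpace W']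
    [TopologicalSpace G] [TopologicalSpace G'] {f : W → W'} (hf : Continuous f)
    {g : E × W' → G × G'} {e : E} {w : W} (hg : ContinuousAt g (e, f w)) :
    ContinuousAt (fun x : E × W => (g (x.1, f x.2)).2) (e, w) :=
  continuousAt_snd.comp (ContinuousAt.comp (f := fun x : E × W => (x.1, f x.2)) (x := (e, w)) hg
    (continuousAt_fst.prodMk (hf.continuousAt.comp continuousAt_snd)))

lemma continuous_mkL_comp {EX F : Type*} [NormedAddCommGroup EX] [NormedSpace ℝ EX]
    [NormedAddCommGroup F] [NormedSpace ℝ F] [FiniteDimensional ℝ EX] [FiniteDimensional ℝ F]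
    (P : (EX × F) [⋀^Fin k]→L[ℝ] ℝ →L[ℝ] LamModel EX F ℝ k) :
    Continuous fun w => mkL EX F k (P w) :=
  (mkL EX F k).continuous.comp P.continuous

end Continuity

/-! ### Projectability of Noether symmetries to the base. -/

section Projectability

variable {n m : ℕ} {HX : Type*} [TopologicalSpace HX]
  {IX : ModelWithCorners ℝ (BaseModel n) HX}
  {X Y : Type*} [TopologicalSpace X] [ChartedSpace HX X] [IsManifold IX ∞ X]
  [TopologicalSpace Y] [ChartedSpace (ModelProd HX (FibreModel m)) Y]
  [IsManifold (modelY IX m) ∞ Y] [IsManifold (modelY IX m) 1 Y]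
  {p : Y → X} [IsFibred (FibreModel m) IX p]
  (c : FibredChart (F := FibreModel m) IX p)
  {η : DForm IX X (n + 1)} {L : JetBundle IX p m → ℝ}
  {ξ : VField (modelY IX m) Y} {α : DForm (modelY IX m) Y n}

lemma exists_jet_extend {y : Y} (hy : y ∈ c.chart.source) (v : BaseModel n →L[ℝ] FibreModel m) :
    ∃ z : JetBundle IX p m, z.proj ∈ c.chart.source ∧
      (jetChart c).chart.extend (modelJet IX m) z = (c.chart.extend (modelY IX m) y, v) := by
  have h : (c.chart y, v) ∈ (jetChart c).chart.target := c.chart.map_source hy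
  refine ⟨(jetChart c).chart.symm (c.chart y, v), (jetChart c).chart.map_target h, ?_⟩
  exact congrArg (modelJet IX m) ((jetChart c).chart.right_inv h)

lemma exists_dual_extend {y : Y} (hy : y ∈ c.chart.source)
    (v : DualModel (BaseModel n) (FibreModel m) ℝ (n + 1)) :
    ∃ z : DualJetBundle IX p m, z.proj ∈ c.chart.source ∧
      (dualChart c).chart.extend (modelDual IX m) z = (c.chart.extend (modelY IX m) y, v) := by
  have h : (c.chart y, v) ∈ (dualChart (k := n + 1) c).chart.target := c.chart.map_source hy
  refine ⟨(dualChart c).chart.symm (c.chart y, v), (dualChart c).chart.map_target h, ?_⟩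
  exact congrArg (modelDual IX m) ((dualChart c).chart.right_inv h)

lemma range_prod_mem_nhds {E V H : Type*} [NormedAddCommGroup E] [NormedSpace ℝ E]
    [NormedAddCommGroup V] [NormedSpace ℝ V] [TopologicalSpace H] {I : ModelWithCorners ℝ E H}
    {e : E} (he : range I ∈ 𝓝 e) (v : V) : range (I.prod 𝓘(ℝ, V)) ∈ 𝓝 (e, v) := by
  rw [ModelWithCorners.range_prod]
  exact prod_mem_nhds he (by simp)

-- Along the prolongation, Leg_L in coordinates satisfies the lifting equation, which is affine in
-- its value. Since leg_L is a diffeomorphism onto the whole dual bundle, its inverse recovers the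
-- slopes and is continuous at every possible limit of the lifted curve; this excludes escape.
-- Interior points are needed to solve the differential equation in the chart.
set_option maxHeartbeats 400000 in
lemma fst_fieldDeriv_eq_zero_of_interior (hη : η.Smooth)
    (hL : ContMDiff (modelJet IX m) 𝓘(ℝ, ℝ) ∞ L)
    (Φ : JetBundle IX p m ≃ₘ^∞⟮modelJet IX m, modelDual IX m⟯ DualJetBundle IX p m)
    (hΦ : ∀ z, Φ z = leg η L z) (hξ : IsSmoothVF ξ) (hα : α.Smooth)
    {ξ₁ : VField (modelJet IX m) (JetBundle IX p m)} (hξ₁ : IsProlongation ξ ξ₁)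
    (h : ∀ z, LiftsAt (V := BaseModel n →L[ℝ] FibreModel m) (M := JetBundle IX p m)
      (legAlong η L) ξ α z (ξ₁ z))
    {y : Y} (hy : y ∈ c.chart.source)
    (hi : range (modelY IX m) ∈ 𝓝 (c.chart.extend (modelY IX m) y)) (f : FibreModel m) :
    (fieldDeriv c ξ (c.chart.extend (modelY IX m) y) (0, f)).1 = 0 := by
  obtain ⟨P, hP⟩ := exists_projL (BaseModel n) (FibreModel m) (n + 1)
  have hev : ∀ᶠ x in 𝓝 (c.chart.extend (modelY IX m) y), range (modelY IX m) ∈ 𝓝 x ∧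
      ∃ y' ∈ c.chart.source, c.chart.extend (modelY IX m) y' = x := by
    refine (eventually_mem_nhds_iff.2 hi).and ?_
    have h1 : ∀ᶠ x in 𝓝[range (modelY IX m)] (c.chart.extend (modelY IX m) y),
        ∃ y' ∈ c.chart.source, c.chart.extend (modelY IX m) y' = x := by
      refine eventually_extend (e := c.chart) hy ?_
      filter_upwards [c.chart.open_source.mem_nhds hy] with y' hy'
      exact ⟨y', hy', rfl⟩
    rwa [nhdsWithin_eq_nhds.2 hi] at h1
  have hΦp : ∀ d : DualJetBundle IX p m, (Φ.symm d).proj = d.proj := by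
    intro d
    have h1 : (leg η L (Φ.symm d)).proj = d.proj := by rw [← hΦ, Φ.apply_symm_apply]
    exact h1
  have hξY := ((VField.contDiffWithinAt_rep c.chart_mem hy hξ).contDiffAt hi).of_le
    (m := 1) (by simp)
  have hT := (contDiffWithinAt_fieldDeriv c hξ hy).contDiffAt hi
  refine fst_apply_eq_zero_of_affine (B := BaseModel n) (F := FibreModel m)
    (W := (BaseModel n × FibreModel m) [⋀^Fin (n + 1)]→L[ℝ] ℝ)
    (ξ := VField.rep ξ c.chart) (T := fieldDeriv c ξ) (ℓ := (legAlong η L).rep (jetChart c))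
    -- The velocity component of leg_L⁻¹. Arbitrary forms are first retracted by P to the model
    -- fibre, so that ψ is defined for every form w.
    (ψ := fun x => (mapRep (modelDual IX m) (dualChart c).chart (modelJet IX m)
      (jetChart c).chart Φ.symm
      (x.1, mkL (BaseModel n) (FibreModel m) (n + 1) (P x.2))).2)
    (R₀ := extRep c α) (R := fun x w => w.fderivCompContinuousLinearMap
      (ContinuousLinearMap.id ℝ _) (fieldDeriv c ξ x)) hξY (hT.of_le (by simp))
    ((contDiffWithinAt_extRep c hα hy).contDiffAt hi).continuousAt
    (continuousAt_fderivComp hT.continuousAt 0)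
    (fun x t w => fderivComp_smul_left t w _) ?_ ?_ ?_ f
  · filter_upwards [hev] with x hx v
    obtain ⟨hx, y', hy', rfl⟩ := hx
    obtain ⟨z, hz, hzv⟩ := exists_jet_extend c hy' v
    have hn := range_prod_mem_nhds hx v
    have h1 := contDiffWithinAt_rep_legAlong c hη hL hz
    rw [hzv] at h1
    have h2 : dChart (modelJet IX m) (jetChart c).chart z (ξ₁ z) =
        (VField.rep ξ c.chart (c.chart.extend (modelY IX m) y'),
          prolongRep (fieldDeriv c ξ (c.chart.extend (modelY IX m) y')) v) := by
      have h3 := (eventually_rep_related c hξ₁.related hz).self_of_nhdsWithin (mem_range_self _)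
      rw [VField.rep_extend ξ₁ hz, hzv] at h3
      have h4 := ((isProlongation_iff hξ).1 hξ₁).2.2 c z hz
      have h5 : c.chart.extend (modelY IX m) z.proj = c.chart.extend (modelY IX m) y' :=
        congrArg Prod.fst hzv
      rw [h5, hzv] at h4
      exact Prod.ext h3 h4
    have h6 := (liftsAt_legAlong_iff c hη hL hξ hα hz (h z).1).1 (h z)
    have h5 : c.chart.extend (modelY IX m) z.proj = c.chart.extend (modelY IX m) y' :=
        congrArg Prod.fst hzv
    rw [h2, h5, hzv, fderivWithin_of_mem_nhds hn] at h6
    exact ⟨(h1.contDiffAt hn).differentiableAt (by simp), h6⟩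
  · filter_upwards [hev] with x hx v
    obtain ⟨hx, y', hy', rfl⟩ := hx
    obtain ⟨z, hz, hzv⟩ := exists_jet_extend c hy' v
    have h1 := valL_lamChart_Leg (η := η) (L := L) c hz
    have h2 := dualChart_extend_toDual c (w := Leg η L z) hz
    have h3 : ((dualChart c).chart.extend (modelDual IX m) (Φ z)) =
        (c.chart.extend (modelY IX m) y', mkL (BaseModel n) (FibreModel m) (n + 1)
          (P ((legAlong η L).rep (jetChart c) (c.chart.extend (modelY IX m) y', v)))) := by
      rw [← hzv, ← h1, hP, hΦ]
      have h5 : c.chart.extend (modelY IX m) z.proj = c.chart.extend (modelY IX m) y' :=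
        congrArg Prod.fst hzv
      exact h2.trans (Prod.ext h5 rfl)
    change (mapRep (modelDual IX m) (dualChart c).chart (modelJet IX m)
      (jetChart c).chart Φ.symm (c.chart.extend (modelY IX m) y',
        mkL (BaseModel n) (FibreModel m) (n + 1)
          (P ((legAlong η L).rep (jetChart c) (c.chart.extend (modelY IX m) y', v))))).2 = v
    rw [← h3, mapRep_extend (e := (dualChart (k := n + 1) c).chart) (by
      rw [hΦ]
      exact hz), Φ.symm_apply_apply, hzv]
  · intro w
    obtain ⟨d, hd, hdv⟩ := exists_dual_extend (n := n) c hy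
      (mkL (BaseModel n) (FibreModel m) (n + 1) (P w))
    have h1 := contDiffWithinAt_mapRep (dualChart c).chart_mem (jetChart c).chart_mem (x := d) hd
      (f := Φ.symm) (by
        change (Φ.symm d).proj ∈ c.chart.source
        rw [hΦp]
        exact hd) (Φ.symm.contMDiff d)
    rw [hdv] at h1
    have h2 := (h1.contDiffAt (range_prod_mem_nhds hi _)).continuousAt
    exact continuousAt_snd_comp (continuous_mkL_comp P) h2

/-- Hyperregularity forces a Noether symmetry to be projectable to the base. -/
lemma fst_fieldDeriv_eq_zero (hη : η.Smooth)
    (hL : ContMDiff (modelJet IX m) 𝓘(ℝ, ℝ) ∞ L)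
    (Φ : JetBundle IX p m ≃ₘ^∞⟮modelJet IX m, modelDual IX m⟯ DualJetBundle IX p m)
    (hΦ : ∀ z, Φ z = leg η L z) (hξ : IsSmoothVF ξ) (hα : α.Smooth)
    {ξ₁ : VField (modelJet IX m) (JetBundle IX p m)} (hξ₁ : IsProlongation ξ ξ₁)
    (h : ∀ z, LiftsAt (V := BaseModel n →L[ℝ] FibreModel m) (M := JetBundle IX p m)
      (legAlong η L) ξ α z (ξ₁ z))
    {y : Y} (hy : y ∈ c.chart.source) (f : FibreModel m) :
    (fieldDeriv c ξ (c.chart.extend (modelY IX m) y) (0, f)).1 = 0 := by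
  have h1 : ∀ᶠ x in 𝓝[range (modelY IX m)] (c.chart.extend (modelY IX m) y),
      range (modelY IX m) ∈ 𝓝 x → (fieldDeriv c ξ x (0, f)).1 = 0 := by
    refine eventually_extend (e := c.chart) hy ?_
    filter_upwards [c.chart.open_source.mem_nhds hy] with y' hy' hi
    exact fst_fieldDeriv_eq_zero_of_interior c hη hL Φ hΦ hξ hα hξ₁ h hy' hi f
  have h2 : ContinuousWithinAt (fun x => (fieldDeriv c ξ x (0, f)).1) (range (modelY IX m))
      (c.chart.extend (modelY IX m) y) :=
    continuousWithinAt_fst.comp_of_eq (t := univ) ((contDiffWithinAt_fieldDeriv c hξ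
      hy).continuousWithinAt.clm_apply continuousWithinAt_const) (mapsTo_univ _ _) rfl
  -- At a boundary point the component is the limit of its values at interior points, where it
  -- vanishes.
  have : (𝓝[interior (range (modelY IX m))] (c.chart.extend (modelY IX m) y)).NeBot :=
    mem_closure_iff_nhdsWithin_neBot.1 (mem_closure_interior_range y)
  have h3 := h2.tendsto.mono_left (nhdsWithin_mono (c.chart.extend (modelY IX m) y)
    interior_subset)
  refine tendsto_nhds_unique (h3.congr' ?_) tendsto_const_nhds
  filter_upwards [nhdsWithin_mono _ interior_subset h1, self_mem_nhdsWithin] with x hx hx'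
  exact hx (mem_interior_iff_mem_nhds.1 hx')

end Projectability

section Related

variable {E E' E'' H H' H'' M M' M'' : Type*} [NormedAddCommGroup E] [NormedSpace ℝ E]
  [NormedAddCommGroup E'] [NormedSpace ℝ E'] [NormedAddCommGroup E''] [NormedSpace ℝ E'']
  [TopologicalSpace H] [TopologicalSpace H'] [TopologicalSpace H'']
  {I : ModelWithCorners ℝ E H} {I' : ModelWithCorners ℝ E' H'} {I'' : ModelWithCorners ℝ E'' H''}
  [TopologicalSpace M] [ChartedSpace H M] [TopologicalSpace M'] [ChartedSpace H' M']
  [TopologicalSpace M''] [ChartedSpace H'' M'']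
  {f : M → M'} {g : M' → M''} {ξ : VField I M} {ξ' : VField I' M'} {ξ'' : VField I'' M''}

lemma IsRelated.comp (hf : MDifferentiable I I' f) (hg : MDifferentiable I' I'' g)
    (h : IsRelated f ξ ξ') (h' : IsRelated g ξ' ξ'') : IsRelated (g ∘ f) ξ ξ'' := by
  intro x
  have h1 := DFunLike.congr_fun (mfderiv_comp x (hg (f x)) (hf x)) (ξ x)
  refine h1.trans (Eq.trans ?_ (h' (f x)))
  exact congrArg (mfderiv I' I'' g (f x)) (h x)

lemma IsRelated.of_comp (hf : MDifferentiable I I' f) (hg : MDifferentiable I' I'' g)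
    (hs : Function.Surjective f) (h : IsRelated f ξ ξ') (h' : IsRelated (g ∘ f) ξ ξ'') :
    IsRelated g ξ' ξ'' := by
  intro y
  obtain ⟨x, rfl⟩ := hs y
  have h1 := DFunLike.congr_fun (mfderiv_comp x (hg (f x)) (hf x)) (ξ x)
  refine Eq.trans ?_ (h1.symm.trans (h' x))
  exact congrArg (mfderiv I' I'' g (f x)) (h x).symm

end Related

/-! ### Relations between the forms and lifts on the two sides. -/

section Transport

variable {n m : ℕ} {HX : Type*} [TopologicalSpace HX]
  {IX : ModelWithCorners ℝ (BaseModel n) HX}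
  {X Y : Type*} [TopologicalSpace X] [ChartedSpace HX X] [IsManifold IX ∞ X]
  [TopologicalSpace Y] [ChartedSpace (ModelProd HX (FibreModel m)) Y]
  [IsManifold (modelY IX m) ∞ Y] [IsManifold (modelY IX m) 1 Y]
  {p : Y → X} [IsFibred (FibreModel m) IX p]
  {η : DForm IX X (n + 1)} {L : JetBundle IX p m → ℝ}
  {Φ : JetBundle IX p m ≃ₘ^∞⟮modelJet IX m, modelDual IX m⟯ DualJetBundle IX p m}
  {ξ : VField (modelY IX m) Y} {α : DForm (modelY IX m) Y n}

lemma contMDiff_dualProj :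
    ContMDiff (modelDual IX m) (modelY IX m) ∞ (DualJet.proj : DualJetBundle IX p m → Y) :=
  (isFibred_dual (F := FibreModel m) (IX := IX) (p := p) (k := n + 1)).contMDiff

lemma toDual_surjective : Function.Surjective (Lam.toDual : LamBundle IX p m → _) := by
  rintro ⟨y, q⟩
  obtain ⟨w, rfl⟩ := Submodule.Quotient.mk_surjective _ q
  exact ⟨⟨y, w⟩, rfl⟩

/-- Both forms evaluate Leg_L(z) on projections to Y, and Leg_L covers the identity of Y. -/
lemma pullback_Leg_liouville (hη : η.Smooth) (hL : ContMDiff (modelJet IX m) 𝓘(ℝ, ℝ) ∞ L) :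
    (DForm.pullback (Leg η L) (liouville IX p) : DForm (modelJet IX m) (JetBundle IX p m) _) =
      poincareCartan η L := by
  funext z
  ext v
  exact congrArg (fun u : Fin (n + 1) → TangentSpace (modelY IX m) z.proj => (Leg η L z).form u)
    (funext fun i => tangentProj_mfderiv_Leg hη hL z (v i))

/-- Since leg_L is onto, h must be Leg_L ∘ Φ⁻¹, and pullbacks compose. -/
lemma hamiltonForm_eq (hη : η.Smooth) (hL : ContMDiff (modelJet IX m) 𝓘(ℝ, ℝ) ∞ L)
    (hΦ : ∀ z, Φ z = leg η L z) {h : DualJetBundle IX p m → LamBundle IX p m}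
    (hh : ∀ z, h (leg η L z) = Leg η L z) :
    hamiltonForm h = DForm.pullback Φ.symm (poincareCartan η L) := by
  have h1 : h = Leg η L ∘ Φ.symm := by
    funext d
    have h2 := hh (Φ.symm d)
    rwa [← hΦ, Φ.apply_symm_apply] at h2
  rw [hamiltonForm, h1, ← pullback_Leg_liouville hη hL,
    DForm.pullback_comp (Φ.symm.contMDiff.mdifferentiable (by simp))
      ((contMDiff_Leg hη hL).mdifferentiable (by simp))]

/-- At points of the image of Leg_L the relation is the chain rule for leg_L. Every other point
shares its fibre of μ with such a point, and projectability of ξ makes the projected velocity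
constant along the fibre. -/
lemma isRelated_toDual_pushforward (hη : η.Smooth) (hL : ContMDiff (modelJet IX m) 𝓘(ℝ, ℝ) ∞ L)
    (hΦ : ∀ z, Φ z = leg η L z) (hξ : IsSmoothVF ξ) (hα : α.Smooth)
    {ξ₁ : VField (modelJet IX m) (JetBundle IX p m)} (hξ₁ : IsProlongation ξ ξ₁)
    (h : ∀ z, LiftsAt (V := BaseModel n →L[ℝ] FibreModel m) (M := JetBundle IX p m)
      (legAlong η L) ξ α z (ξ₁ z))
    {Ξ : VField (modelLam IX m) (LamBundle IX p m)} (hΞ : IsAlphaLift ξ α Ξ)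
    (hr : IsRelated (Leg η L) ξ₁ Ξ) : IsRelated Lam.toDual Ξ (pushforward Φ ξ₁) := by
  have hr' : IsRelated (leg η L) ξ₁ (pushforward Φ ξ₁) := by
    have h1 := isRelated_pushforward Φ ξ₁
    rwa [show (Φ : JetBundle IX p m → _) = leg η L from funext hΦ] at h1
  have hlift := (isAlphaLift_iff hξ hα).1 hΞ
  intro w
  obtain ⟨z, hz⟩ : ∃ z, leg η L z = w.toDual :=
    ⟨Φ.symm w.toDual, by rw [← hΦ, Φ.apply_symm_apply]⟩
  set c := fibredIndex (FibreModel m) IX p w.proj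
  have hw : w.proj ∈ c.chart.source := mem_fibredIndex w.proj
  have hp : w.proj = (Leg η L z).proj := (congrArg DualJet.proj hz).symm
  have hw' : (Leg η L z).proj ∈ c.chart.source := by rw [← hp]; exact hw
  have h1 := dChart_toDual_eq c hξ hα (w := w) (w' := Leg η L z) hz.symm hw hw'
    (fst_fieldDeriv_eq_zero c hη hL Φ hΦ hξ hα hξ₁ h hw') (hlift w) (hlift (Leg η L z))
  have h2 : mfderiv (modelLam IX m) (modelDual IX m) Lam.toDual (Leg η L z) (Ξ (Leg η L z)) =
      pushforward Φ ξ₁ (leg η L z) := by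
    refine Eq.trans ?_ (hr' z)
    have h3 := mfderiv_comp (I := modelJet IX m) (I' := modelLam IX m) (I'' := modelDual IX m) z
      ((contMDiff_toDual (Leg η L z)).mdifferentiableAt (by simp))
      ((contMDiff_Leg hη hL z).mdifferentiableAt (by simp))
    refine Eq.trans ?_ (DFunLike.congr_fun h3 (ξ₁ z)).symm
    exact congrArg (mfderiv (modelLam IX m) (modelDual IX m) Lam.toDual (Leg η L z)) (hr z).symm
  apply dChart_injective (dualChart (k := n + 1) c).chart_mem (x := w.toDual) hw
  refine h1.trans ((congrArg (dChart (modelDual IX m) (dualChart c).chart (leg η L z)) h2).trans ?_)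
  have h4 := congrArg (fun d => VField.rep (pushforward Φ ξ₁) (dualChart c).chart
    ((dualChart c).chart.extend (modelDual IX m) d)) hz
  have h5 := VField.rep_extend (pushforward Φ ξ₁) (e := (dualChart (k := n + 1) c).chart)
    (x := leg η L z) hw'
  have h6 := VField.rep_extend (pushforward Φ ξ₁) (e := (dualChart (k := n + 1) c).chart)
    (x := w.toDual) hw
  exact h5.symm.trans (h4.trans h6)

variable {b : ℕ} {B : Type*} [TopologicalSpace B] [ChartedSpace (EuclideanSpace ℝ (Fin b)) B]
  [IsManifold (𝓡 b) ∞ B] {j : B → JetBundle IX p m} {P : DForm (𝓡 b) B n}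
  {B' : Type*} [TopologicalSpace B'] [ChartedSpace (EuclideanSpace ℝ (Fin b)) B']
  [IsManifold (𝓡 b) ∞ B'] {j' : B' → DualJetBundle IX p m} {P' : DForm (𝓡 b) B' n}
  {β : B ≃ₘ^∞⟮𝓡 b, 𝓡 b⟯ B'}

lemma proj_comp_eq (hΦ : ∀ z, Φ z = leg η L z) :
    DualJet.proj ∘ Φ = (Jet.proj : JetBundle IX p m → Y) :=
  funext fun z => congrArg DualJet.proj (hΦ z)

lemma pullback_pullback_proj (hΦ : ∀ z, Φ z = leg η L z) :
    (DForm.pullback Φ (DForm.pullback DualJet.proj α :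
      DForm (modelDual IX m) (DualJetBundle IX p m) n) :
      DForm (modelJet IX m) (JetBundle IX p m) n) = DForm.pullback Jet.proj α := by
  rw [DForm.pullback_comp (Φ.contMDiff.mdifferentiable (by simp))
    (contMDiff_dualProj.mdifferentiable (by simp)), proj_comp_eq hΦ]

lemma pullback_boundary_eq (hΦ : ∀ z, Φ z = leg η L z) (hj : ContMDiff (𝓡 b) (modelJet IX m) ∞ j)
    (hj' : ContMDiff (𝓡 b) (modelDual IX m) ∞ j') (hβ : ∀ x, j' (β x) = Φ (j x)) :
    (DForm.pullback β (DForm.pullback j' (DForm.pullback DualJet.proj α :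
      DForm (modelDual IX m) (DualJetBundle IX p m) n) : DForm (𝓡 b) B' n) : DForm (𝓡 b) B n) =
    DForm.pullback j (DForm.pullback Jet.proj α : DForm (modelJet IX m) (JetBundle IX p m) n) := by
  have hβ' : j' ∘ β = Φ ∘ j := funext hβ
  rw [← pullback_pullback_proj hΦ, DForm.pullback_comp (β.contMDiff.mdifferentiable (by simp))
    (hj'.mdifferentiable (by simp)), DForm.pullback_comp (hj.mdifferentiable (by simp))
    (Φ.contMDiff.mdifferentiable (by simp)), hβ']

lemma contMDiff_boundary (hj : ContMDiff (𝓡 b) (modelJet IX m) ∞ j)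
    (hβ : ∀ x, j' (β x) = Φ (j x)) : ContMDiff (𝓡 b) (modelDual IX m) ∞ j' := by
  have h1 : j' = Φ ∘ j ∘ β.symm := by
    funext x
    have h2 := hβ (β.symm x)
    rwa [β.apply_symm_apply] at h2
  rw [h1]
  exact Φ.contMDiff.comp (hj.comp β.symm.contMDiff)

end Transport

/-! ### Comparison of the two kinds of Noether symmetries. -/

section Noether

variable {n m : ℕ} {HX : Type*} [TopologicalSpace HX]
  {IX : ModelWithCorners ℝ (BaseModel n) HX}
  {X Y : Type*} [TopologicalSpace X] [ChartedSpace HX X] [IsManifold IX ∞ X]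
  [TopologicalSpace Y] [ChartedSpace (ModelProd HX (FibreModel m)) Y]
  [IsManifold (modelY IX m) ∞ Y] [IsManifold (modelY IX m) 1 Y]
  {p : Y → X} [IsFibred (FibreModel m) IX p]
  {η : DForm IX X (n + 1)} {L : JetBundle IX p m → ℝ}
  {Φ : JetBundle IX p m ≃ₘ^∞⟮modelJet IX m, modelDual IX m⟯ DualJetBundle IX p m}
  {ξ : VField (modelY IX m) Y} {α : DForm (modelY IX m) Y n}

lemma isProlongation_unique (hξ : IsSmoothVF ξ)
    {ξ₁ ξ₁' : VField (modelJet IX m) (JetBundle IX p m)} (h : IsProlongation ξ ξ₁)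
    (h' : IsProlongation ξ ξ₁') : ξ₁ = ξ₁' := by
  funext z
  set c := fibredIndex (FibreModel m) IX p z.proj
  have hz : z.proj ∈ c.chart.source := mem_fibredIndex z.proj
  apply dChart_injective (jetChart c).chart_mem (x := z) hz
  refine Prod.ext ?_ ?_
  · refine (fst_dChart_apply (jetChart c) hz (ξ₁ z)).trans
      (Eq.trans ?_ (fst_dChart_apply (jetChart c) hz (ξ₁' z)).symm)
    exact congrArg (dChart (modelY IX m) c.chart z.proj) ((h.related z).trans (h'.related z).symm)
  · exact (((isProlongation_iff hξ).1 h).2.2 c z hz).trans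
      (((isProlongation_iff hξ).1 h').2.2 c z hz).symm

variable {b : ℕ} {B : Type*} [TopologicalSpace B] [ChartedSpace (EuclideanSpace ℝ (Fin b)) B]
  [IsManifold (𝓡 b) ∞ B] {j : B → JetBundle IX p m} {P : DForm (𝓡 b) B n}
  {B' : Type*} [TopologicalSpace B'] [ChartedSpace (EuclideanSpace ℝ (Fin b)) B']
  [IsManifold (𝓡 b) ∞ B'] {j' : B' → DualJetBundle IX p m} {P' : DForm (𝓡 b) B' n}
  {β : B ≃ₘ^∞⟮𝓡 b, 𝓡 b⟯ B'}

/-- The `α`-lift of a Noether symmetry for the De Donder equations. -/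
lemma IsNoetherDeDonder.exists_isAlphaLift (hη : η.Smooth)
    (hL : ContMDiff (modelJet IX m) 𝓘(ℝ, ℝ) ∞ L) (hΦ : ∀ z, Φ z = leg η L z)
    (h : IsNoetherDeDonder η L j P ξ α) {ξ₁ : VField (modelJet IX m) (JetBundle IX p m)}
    (hξ₁ : IsProlongation ξ ξ₁) :
    ∃ Ξ : VField (modelLam IX m) (LamBundle IX p m), IsAlphaLift ξ α Ξ ∧
      IsRelated (Leg η L) ξ₁ Ξ ∧ IsRelated Lam.toDual Ξ (pushforward Φ ξ₁) := by
  obtain ⟨ξ₂, h1, h2, -⟩ := h.symmetry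
  obtain rfl := isProlongation_unique h.smooth_field hξ₁ h1
  have hl : ∀ z, LiftsAt (V := BaseModel n →L[ℝ] FibreModel m) (M := JetBundle IX p m)
      (legAlong η L) ξ α z (ξ₁ z) := lie_basicForm_iff.1 ⟨h1.related, h2⟩
  have hs : Function.Surjective (leg η L) := by
    intro d
    exact ⟨Φ.symm d, by rw [← hΦ, Φ.apply_symm_apply]⟩
  obtain ⟨Ξ, h3, h4⟩ := FieldTheory.exists_isAlphaLift hη hL h.smooth_field h.smooth_form hs hl
  exact ⟨Ξ, h3, h4, isRelated_toDual_pushforward hη hL hΦ h.smooth_field h.smooth_form h1 hl h3 h4⟩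

/-- The lift constructed from the prolongation projects onto the pushforward of the prolongation;
the remaining conditions are transported by Φ and β. -/
lemma IsNoetherDeDonder.isNoetherHamilton (hη : η.Smooth)
    (hL : ContMDiff (modelJet IX m) 𝓘(ℝ, ℝ) ∞ L) (hΦ : ∀ z, Φ z = leg η L z)
    {h : DualJetBundle IX p m → LamBundle IX p m} (hh : ∀ z, h (leg η L z) = Leg η L z)
    (hj : ContMDiff (𝓡 b) (modelJet IX m) ∞ j) (hP : P.Smooth)
    (hβ : ∀ x, j' (β x) = Φ (j x)) (hP' : P' = DForm.pullback β.symm P)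
    (hN : IsNoetherDeDonder η L j P ξ α) : IsNoetherHamilton (hamiltonForm h) j' P' ξ α := by
  obtain ⟨ξ₁, h1, h2, h3⟩ := hN.symmetry
  obtain ⟨Ξ, h4, -, h5⟩ := hN.exists_isAlphaLift hη hL hΦ h1
  have hj' := contMDiff_boundary hj hβ
  refine ⟨hN.smooth_field, hN.smooth_form, hN.semibasic, ?_, Ξ, pushforward Φ ξ₁, h4,
    isSmoothVF_pushforward Φ h1.smooth, h5, ?_, h3.transport Φ β hj hβ hP hP'⟩
  · have h6 := DForm.IsExact.pullback β.symm.contMDiff hN.exact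
    rwa [← pullback_boundary_eq (α := α) hΦ hj hj' hβ, DForm.pullback_symm_pullback] at h6
  · rw [hamiltonForm_eq hη hL hΦ hh, ← DForm.pullback_lie Φ.symm.contMDiff h1.smooth
      (isRelated_symm_pushforward Φ ξ₁) (smooth_poincareCartan hη hL), h2,
      ← pullback_pullback_proj (α := α) hΦ,
      DForm.Smooth.d_pullback (w := DForm.pullback DualJet.proj α) Φ.contMDiff
        (fun d => (hN.smooth_form d.proj).pullback (contMDiff_dualProj d)),
      DForm.pullback_symm_pullback]

/-- The field pulled back to Z lies over ξ, because the α-lift does and μ is onto. It satisfies the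
lifting equation for Θ_L by naturality, and `isProlongation_of_liftsAt` identifies it with the
prolongation. -/
lemma IsNoetherHamilton.isNoetherDeDonder (hη : η.Smooth) (hη0 : ∀ x, η x ≠ 0)
    (hL : ContMDiff (modelJet IX m) 𝓘(ℝ, ℝ) ∞ L) (hΦ : ∀ z, Φ z = leg η L z)
    {h : DualJetBundle IX p m → LamBundle IX p m} (hh : ∀ z, h (leg η L z) = Leg η L z)
    (hj : ContMDiff (𝓡 b) (modelJet IX m) ∞ j)
    (hβ : ∀ x, j' (β x) = Φ (j x)) (hP' : P'.Smooth) (hβP : DForm.pullback β P' = P)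
    (hN : IsNoetherHamilton (hamiltonForm h) j' P' ξ α) : IsNoetherDeDonder η L j P ξ α := by
  obtain ⟨Ξ, ξ₁, h1, h2, h3, h4, h5⟩ := hN.symmetry
  have hj' := contMDiff_boundary hj hβ
  have hsymm : IsRelated Φ (pushforward Φ.symm ξ₁) ξ₁ := isRelated_symm_pushforward Φ.symm ξ₁
  have hs : IsSmoothVF (pushforward Φ.symm ξ₁) := isSmoothVF_pushforward Φ.symm h2
  have hΘ : (hamiltonForm h).Smooth := by
    rw [hamiltonForm_eq hη hL hΦ hh]
    exact fun d => (smooth_poincareCartan hη hL _).pullback (Φ.symm.contMDiff d)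
  have hΘ' : (DForm.pullback Φ (hamiltonForm h) : DForm (modelJet IX m) (JetBundle IX p m) _) =
      poincareCartan η L := by
    rw [hamiltonForm_eq hη hL hΦ hh]
    exact DForm.pullback_symm_pullback Φ.symm (poincareCartan η L)
  have hlie : DForm.lie (pushforward Φ.symm ξ₁) (poincareCartan η L) =
      (DForm.pullback Jet.proj α).d := by
    rw [← hΘ', ← DForm.pullback_lie Φ.contMDiff h2 hsymm hΘ, h4,
      ← DForm.Smooth.d_pullback (w := DForm.pullback DualJet.proj α) Φ.contMDiff
        (fun d => (hN.smooth_form d.proj).pullback (contMDiff_dualProj d)),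
      pullback_pullback_proj hΦ]
  have hr : IsRelated Jet.proj (pushforward Φ.symm ξ₁) ξ := by
    have h6 : IsRelated DualJet.proj ξ₁ ξ :=
      IsRelated.of_comp (contMDiff_toDual.mdifferentiable (by simp))
        (contMDiff_dualProj.mdifferentiable (by simp)) toDual_surjective h3 h1.related
    have h7 := hsymm.comp (Φ.contMDiff.mdifferentiable (by simp))
      (contMDiff_dualProj.mdifferentiable (by simp)) h6
    rwa [proj_comp_eq hΦ] at h7
  have himm : ∀ z u, mfderiv (modelJet IX m) (modelDual IX m) (leg η L) z u = 0 → u = 0 := by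
    intro z u hu
    rw [← show (Φ : JetBundle IX p m → _) = leg η L from funext hΦ] at hu
    rw [← Φ.mfderiv_symm_apply z u, hu]
    exact map_zero _
  refine ⟨hN.smooth_field, hN.smooth_form, hN.semibasic, ?_, pushforward Φ.symm ξ₁,
    isProlongation_of_liftsAt hη hη0 hL himm hN.smooth_field hN.smooth_form hs hr
      (lie_basicForm_iff.1 ⟨hr, hlie⟩), hlie, ?_⟩
  · have h6 := DForm.IsExact.pullback β.contMDiff hN.exact
    rwa [pullback_boundary_eq (α := α) hΦ hj hj' hβ] at h6
  · refine h5.transport Φ.symm β.symm hj' (fun y => ?_) hP' hβP.symm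
    obtain ⟨x, rfl⟩ : ∃ x, β x = y := ⟨β.symm y, β.apply_symm_apply y⟩
    rw [β.symm_apply_apply, hβ, Φ.symm_apply_apply]

end Noether

end FieldTheory

end

theorem mainTheorem11 {n m : ℕ} {HX : Type*} [TopologicalSpace HX]
    (IX : ModelWithCorners ℝ (EuclideanSpace ℝ (Fin (n + 1))) HX)
    {X : Type*} [TopologicalSpace X] [T2Space X] [SecondCountableTopology X] [ChartedSpace HX X]
    [IsManifold IX ∞ X]
    {Y : Type*} [TopologicalSpace Y] [T2Space Y] [SecondCountableTopology Y]
    [ChartedSpace (ModelProd HX (EuclideanSpace ℝ (Fin m))) Y] [IsManifold (modelY IX m) ∞ Y]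
    (p : Y → X) [IsFibred (EuclideanSpace ℝ (Fin m)) IX p]
    (η : DForm IX X (n + 1)) (hη : η.Smooth) (hη0 : ∀ x, η x ≠ 0)
    (L : JetBundle IX p m → ℝ) (hL : ContMDiff (modelJet IX m) 𝓘(ℝ, ℝ) ∞ L)
    (Φ : JetBundle IX p m ≃ₘ^∞⟮modelJet IX m, modelDual IX m⟯ DualJetBundle IX p m)
    (hΦ : ∀ z, Φ z = leg η L z)
    (h : DualJetBundle IX p m → LamBundle IX p m) (hh : ∀ z, h (leg η L z) = Leg η L z)
    {b : ℕ} {B : Type*} [TopologicalSpace B] [ChartedSpace (EuclideanSpace ℝ (Fin b)) B]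
    [IsManifold (𝓡 b) ∞ B] (j : B → JetBundle IX p m) (P : DForm (𝓡 b) B n)
    (hB : IsBoundaryCondition η L j P)
    {B' : Type*} [TopologicalSpace B'] [ChartedSpace (EuclideanSpace ℝ (Fin b)) B']
    [IsManifold (𝓡 b) ∞ B'] (j' : B' → DualJetBundle IX p m) (P' : DForm (𝓡 b) B' n)
    (hP' : P'.Smooth)
    (β : B ≃ₘ^∞⟮𝓡 b, 𝓡 b⟯ B') (hβ : ∀ x, j' (β x) = Φ (j x)) (hβP : DForm.pullback β P' = P) :
    (∀ ξ : VField (modelJet IX m) (JetBundle IX p m),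
      IsCartanSymmetry (poincareCartan η L) j P ξ ↔
        IsCartanSymmetry (hamiltonForm h) j' P' (pushforward Φ ξ)) ∧
    Set.BijOn (pushforward Φ) {ξ | IsCartanSymmetry (poincareCartan η L) j P ξ}
      {ξ | IsCartanSymmetry (hamiltonForm h) j' P' ξ} ∧
    (∀ (ξ : VField (modelY IX m) Y) (α : DForm (modelY IX m) Y n),
      IsNoetherDeDonder η L j P ξ α → ∀ ξ₁ : VField (modelJet IX m) (JetBundle IX p m),
        IsProlongation ξ ξ₁ →
        ∃ Ξ : VField (modelLam IX m) (LamBundle IX p m), IsAlphaLift ξ α Ξ ∧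
          (∀ Ξ', IsAlphaLift ξ α Ξ' → Ξ' = Ξ) ∧
          IsRelated (Leg η L) ξ₁ Ξ ∧ IsRelated Lam.toDual Ξ (pushforward Φ ξ₁)) ∧
    (∀ (ξ : VField (modelY IX m) Y) (α : DForm (modelY IX m) Y n),
      IsNoetherDeDonder η L j P ξ α ↔ IsNoetherHamilton (hamiltonForm h) j' P' ξ α) ∧
    (∀ ξ : VField (modelY IX m) Y,
      (∃ α, IsNoetherDeDonder η L j P ξ α) ↔ ∃ α, IsNoetherHamilton (hamiltonForm h) j' P' ξ α) := by
  have : IsManifold (modelY IX m) 1 Y := IsManifold.of_le (n := ∞) (by simp)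
  have hj := hB.embedded.contMDiff
  have hP'' : P' = DForm.pullback β.symm P := by
    rw [← hβP, DForm.pullback_symm_pullback]
  have hβ' : ∀ y, j (β.symm y) = Φ.symm (j' y) := by
    intro y
    obtain ⟨x, rfl⟩ : ∃ x, β x = y := ⟨β.symm y, β.apply_symm_apply y⟩
    rw [β.symm_apply_apply, hβ, Φ.symm_apply_apply]
  have hΘ := smooth_poincareCartan hη hL
  have hΘh := hamiltonForm_eq hη hL hΦ hh
  have hΘ' : (hamiltonForm h).Smooth := by
    rw [hΘh]
    exact fun d => (hΘ _).pullback (Φ.symm.contMDiff d)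
  have hΘL : poincareCartan η L = DForm.pullback Φ (hamiltonForm h) := by
    rw [hΘh]
    exact (DForm.pullback_symm_pullback Φ.symm (poincareCartan η L)).symm
  have hto : ∀ ξ : VField (modelJet IX m) (JetBundle IX p m),
      IsCartanSymmetry (poincareCartan η L) j P ξ →
        IsCartanSymmetry (hamiltonForm h) j' P' (pushforward Φ ξ) := fun ξ hξ =>
    hξ.transport Φ β hj hβ hB.smooth hP'' hΘ hΘh
  have hfrom : ∀ ξ : VField (modelDual IX m) (DualJetBundle IX p m),
      IsCartanSymmetry (hamiltonForm h) j' P' ξ →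
        IsCartanSymmetry (poincareCartan η L) j P (pushforward Φ.symm ξ) := fun ξ hξ =>
    hξ.transport Φ.symm β.symm (contMDiff_boundary hj hβ) hβ' hP' hβP.symm hΘ' hΘL
  have hN : ∀ (ξ : VField (modelY IX m) Y) (α : DForm (modelY IX m) Y n),
      IsNoetherDeDonder η L j P ξ α ↔ IsNoetherHamilton (hamiltonForm h) j' P' ξ α := fun ξ α =>
    ⟨fun hξ => hξ.isNoetherHamilton hη hL hΦ hh hj hB.smooth hβ hP'',
      fun hξ => hξ.isNoetherDeDonder hη hη0 hL hΦ hh hj hβ hP' hβP⟩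
  refine ⟨fun ξ => ⟨hto ξ, fun hξ => ?_⟩, ⟨hto, ?_, ?_⟩, ?_, hN,
    fun ξ => exists_congr fun α => hN ξ α⟩
  · have h1 := hfrom _ hξ
    rwa [pushforward_symm_pushforward] at h1
  · intro ξ _ ξ' _ hξ
    rw [← pushforward_symm_pushforward Φ ξ, hξ, pushforward_symm_pushforward]
  · exact fun ξ hξ => ⟨_, hfrom ξ hξ, pushforward_symm_pushforward Φ.symm ξ⟩
  · intro ξ α hξ ξ₁ hξ₁
    obtain ⟨Ξ, h1, h2, h3⟩ := hξ.exists_isAlphaLift hη hL hΦ hξ₁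
    exact ⟨Ξ, h1, fun Ξ' h' => isAlphaLift_unique hξ.smooth_field hξ.smooth_form h1 h', h2, h3⟩
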